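/- **Notation.** For a function $\varphi$ on the unit circle with Fourier coefficients $\varphi_k=\frac1{2\pi}\int_0^{2\pi}\varphi(e^{i\theta})e^{-ik\theta}\,d\theta$, let $T(\varphi)=(\varphi_{j-k})_{j,k\ge0}$ and $H(\varphi)=(\varphi_{j+k+1})_{j,k\ge0}$ act on $\ell^2(\mathbb Z_+)$, let $T_n(\varphi)+H_n(\varphi)=(\varphi_{j-k}+\varphi_{j+k+1})_{0\le j,k<n}$, and let $Q_n=I-P_n$, where $P_n$ is the orthogonal projection onto $\operatorname{span}\{e_0,\dots,e_{n-1}\}$. For a function $\sigma$ on $\mathbb R$ let $k(x)=\frac1{2\pi}\int_{-\infty}^\infty(\sigma(\xi)-1)e^{-ix\xi}\,d\xi$ (in the sense of Plancherel if $\sigma-1$ is in $L^2$ but not in $L^1$), let $(W(\sigma)f)(x)=f(x)+\int_0^\infty k(x-y)f(y)\,dy$ and $(H(\sigma)f)(x)=\int_0^\infty k(x+y)f(y)\,dy$ on $L^2(0,\infty)$, let $(W_R(\sigma)+H_R(\sigma))f(x)=f(x)+\int_0^R\big(k(x-y)+k(x+y)\big)f(y)\,dy$ on $L^2(0,R)$,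 and let $Q_R$ be the projection of $L^2(0,\infty)$ onto $L^2(R,\infty)$. Determinants of operators are Fredholm determinants of operators of the form identity $+$ trace class. **Symbols.** Let $\varphi=e^{b}$ be even, $\varphi(z^{-1})=\varphi(z)$, where $b=\log\varphi$ is a $C^2$ function on the unit circle. Let $\sigma=e^{f}$ be even, $\sigma(-\xi)=\sigma(\xi)$, where $f=\log\sigma$ is a $C^2$ function on $\mathbb R$ with $f,f',f''\in L^1(\mathbb R)$. Put $$G[\varphi]=\exp\Big(\frac1{2\pi}\int_0^{2\pi}b(e^{i\theta})\,d\theta\Big),\qquad G[\sigma]^R=\exp\Big(\frac R{2\pi}\int_{-\infty}^\infty f(\xi)\,d\xi\Big).$$ A factorization of $\varphi$ is $\varphi=\varphi_+\varphi_-$ on the unit circle, where $\varphi_+$ is continuous and nonzero on the closed unit disc and analytic inside, and $\varphi_-(z)=\varphi_+(z^{-1})$ for $|z|\ge1$. A factorization of $\sigma$ is $\sigma=\sigma_+\sigma_-$ on $\mathbb R$, where $\sigma_+$ is continuous, bounded and bounded away from $0$ on the closed upper half-plane and analytic above the real line, and $\sigma_-(\zeta)=\sigma_+(-\zeta)$ on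 the closed lower half-plane. **Statement.** (a) A factorization of $\varphi$ exists, all the operators below are bounded, the operator $T(\varphi^{-1})(T(\varphi)+H(\varphi))-I$ is of trace class, and for every factorization and every $n\ge0$ the operator $Q_nH(\varphi_- /\varphi_+)Q_n$ is of trace class and $$\det(T_n(\varphi)+H_n(\varphi))=G[\varphi]^n\,\det\big[T(\varphi^{-1})(T(\varphi)+H(\varphi))\big]\,\det\big(I+Q_nH(\varphi_- /\varphi_+)Q_n\big).$$ (b) A factorization of $\sigma$ exists, $\sigma-1$ and $\sigma^{-1}-1$ belong to $L^1(\mathbb R)$, all the operators below are bounded, the operator $W(\sigma^{-1})(W(\sigma)+H(\sigma))-I$ is of trace class, and for every factorization one has $\sigma_- /\sigma_+-1\in L^2(\mathbb R)$ and, for every $R>0$, the operators $W_R(\sigma)+H_R(\sigma)-I$ and $Q_RH(\sigma_- /\sigma_+)Q_R$ are of trace class and $$\det(W_R(\sigma)+H_R(\sigma))=G[\sigma]^R\,\det\big[W(\sigma^{-1})(W(\sigma)+H(\sigma))\big]\,\det\big(I+Q_RH(\sigma_- /\sigma_+)Q_R\big).$$ (c) Suppose that, for some constant $c$, $\sigma(\xi)=c\,\varphi\big(\frac{1+i\xi}{1-i\xi}\big)$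 for all $\xi\in\mathbb R$. Then $$\det\big[W(\sigma^{-1})(W(\sigma)+H(\sigma))\big]=\det\big[T(\varphi^{-1})(T(\varphi)+H(\varphi))\big],$$ and for all factorizations of $\varphi$ and $\sigma$, all $n\ge0$ and all $R>0$ with $\det(T_n(\varphi)+H_n(\varphi))\ne0$, one has $\det(I+Q_nH(\varphi_- /\varphi_+)Q_n)\ne0$ and $$\frac{\det(W_R(\sigma)+H_R(\sigma))}{\det(T_n(\varphi)+H_n(\varphi))}=\frac{G[\sigma]^R}{G[\varphi]^n}\;\frac{\det(I+Q_RH(\sigma_- /\sigma_+)Q_R)}{\det(I+Q_nH(\varphi_- /\varphi_+)Q_n)}.$$ -/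

import Mathlib

open MeasureTheory Filter Set Complex
open scoped Topology ENNReal FourierTransform InnerProductSpace

noncomputable section

namespace BorodinOkounkov

/-! ### Trace class operators and Fredholm determinants on a Hilbert space -/

section Hilbert

variable {E : Type*} [NormedAddCommGroup E] [InnerProductSpace ℂ E]

/-- `K` is of trace class: `K x = ∑ ⟪u i, x⟫ v i` with `∑ ‖u i‖ ‖v i‖ < ∞`. -/
def IsTraceClass (K : E →L[ℂ] E) : Prop :=
  ∃ u v : ℕ → E, Summable (fun i => ‖u i‖ * ‖v i‖) ∧
    ∀ x : E, HasSum (fun i => ⟪u i, x⟫_ℂ • v i) (K x)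

/-- The compression `P_V A |_V` of `A` to a finite-dimensional subspace `V`, where `P_V` is the
orthogonal projection onto `V`. -/
def compression (A : E →L[ℂ] E) (V : {V : Submodule ℂ E // FiniteDimensional ℂ V}) :
    V.1 →ₗ[ℂ] V.1 :=
  haveI := V.2
  ((V.1.orthogonalProjectionOnto).comp (A.comp V.1.subtypeL)).toLinearMap

/-- The Fredholm determinant of `A = I + K` with `K` of trace class: the limit of the determinants
of the compressions of `A` to finite-dimensional subspaces `V`, along the directed set of all such
subspaces. -/
def fredholmDet (A : E →L[ℂ] E) : ℂ :=
  limUnder (atTop : Filter {V : Submodule ℂ E // FiniteDimensional ℂ V})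
    (fun V => LinearMap.det (compression A V))

end Hilbert

/-! ### Toeplitz and Hankel operators on `ℓ²(ℤ₊)` -/

/-- The Hilbert space `ℓ²(ℤ₊)`. -/
abbrev Ell2 : Type := lp (fun _ : ℕ => ℂ) 2

/-- The standard basis vector `e_j` of `ℓ²(ℤ₊)`. -/
def stdVec (j : ℕ) : Ell2 := lp.single 2 j (1 : ℂ)

/-- The bounded operator `A` on `ℓ²(ℤ₊)` has the matrix `a`. -/
def HasMatrix (A : Ell2 →L[ℂ] Ell2) (a : ℕ → ℕ → ℂ) : Prop :=
  ∀ j k, ⟪stdVec j, A (stdVec k)⟫_ℂ = a j k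

/-- The matrix `a` defines a bounded operator on `ℓ²(ℤ₊)`. -/
def IsBoundedMatrix (a : ℕ → ℕ → ℂ) : Prop := ∃ A : Ell2 →L[ℂ] Ell2, HasMatrix A a

open Classical in
/-- The (unique) bounded operator on `ℓ²(ℤ₊)` with matrix `a`; it is only meaningful if
`IsBoundedMatrix a`. -/
def matrixOp (a : ℕ → ℕ → ℂ) : Ell2 →L[ℂ] Ell2 :=
  if h : IsBoundedMatrix a then h.choose else 0

/-- The Fourier coefficient `φ_k = (1/2π) ∫_0^{2π} φ(e^{iθ}) e^{-ikθ} dθ`. -/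
def coeff (φ : Circle → ℂ) (k : ℤ) : ℂ :=
  (1 / (2 * Real.pi)) *
    ∫ θ in (0 : ℝ)..(2 * Real.pi), φ (Circle.exp θ) * Complex.exp (-I * k * θ)

/-- The infinite Toeplitz matrix `(φ_{j-k})`. -/
def toeplitzMatrix (φ : Circle → ℂ) (j k : ℕ) : ℂ := coeff φ ((j : ℤ) - (k : ℤ))

/-- The infinite Hankel matrix `(φ_{j+k+1})`. -/
def hankelMatrix (φ : Circle → ℂ) (j k : ℕ) : ℂ := coeff φ ((j : ℤ) + (k : ℤ) + 1)

/-- The Toeplitz operator `T(φ)`. -/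
def T (φ : Circle → ℂ) : Ell2 →L[ℂ] Ell2 := matrixOp (toeplitzMatrix φ)

/-- The Hankel operator `H(φ)` on `ℓ²(ℤ₊)`. -/
def H (φ : Circle → ℂ) : Ell2 →L[ℂ] Ell2 := matrixOp (hankelMatrix φ)

/-- The finite matrix `T_n(φ) + H_n(φ)`. -/
def finiteTH (φ : Circle → ℂ) (n : ℕ) : Matrix (Fin n) (Fin n) ℂ :=
  Matrix.of fun j k => toeplitzMatrix φ j k + hankelMatrix φ j k

/-- `Q_n = I - P_n`, where `P_n` is the orthogonal projection of `ℓ²(ℤ₊)` onto the span of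
`e_0, …, e_{n-1}`. -/
def Q (n : ℕ) : Ell2 →L[ℂ] Ell2 :=
  haveI : FiniteDimensional ℂ (Submodule.span ℂ (Set.range fun j : Fin n => stdVec j)) :=
    FiniteDimensional.span_of_finite ℂ (Set.finite_range _)
  ContinuousLinearMap.id ℂ Ell2 -
    (Submodule.span ℂ (Set.range fun j : Fin n => stdVec j)).starProjection

/-- `φ = e^b` is an even function on the unit circle with a `C²` logarithm `b`. -/
structure IsCircleSymbol (φ b : Circle → ℂ) : Prop where
  smooth : ContDiff ℝ 2 (fun θ : ℝ => b (Circle.exp θ))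
  exp_eq : ∀ z, φ z = Complex.exp (b z)
  even : ∀ z, φ z⁻¹ = φ z

/-- The constant `G[φ] = exp((1/2π) ∫_0^{2π} b(e^{iθ}) dθ)`, where `b = log φ`. -/
def circleG (b : Circle → ℂ) : ℂ :=
  Complex.exp ((1 / (2 * Real.pi)) * ∫ θ in (0 : ℝ)..(2 * Real.pi), b (Circle.exp θ))

/-- A factorization `φ = φ⁺ φ⁻` on the unit circle, with `φ⁺` continuous and nonzero on the closed
unit disc and analytic inside, and `φ⁻(z) = φ⁺(1/z)` for `|z| ≥ 1` (so that `φ⁻` is nonzero,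
continuous, and analytic outside the disc, with a finite nonzero limit at infinity). -/
structure IsCircleFactorization (φ : Circle → ℂ) (φp φm : ℂ → ℂ) : Prop where
  analytic : DiffContOnCl ℂ φp (Metric.ball 0 1)
  ne_zero : ∀ z ∈ Metric.closedBall (0 : ℂ) 1, φp z ≠ 0
  symm : ∀ z : ℂ, 1 ≤ ‖z‖ → φm z = φp z⁻¹
  mul_eq : ∀ z : Circle, φ z = φp z * φm z

/-! ### Wiener-Hopf and Hankel operators on `L²(0,∞)` and `L²(0,R)` -/

section Kernels

/-- `A` is the integral operator `f(x) ↦ ∫ κ(x,y) f(y) dμ(y)` on `L²(μ)`. -/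
def IsIntegralOp (μ : Measure ℝ) (A : Lp ℂ 2 μ →L[ℂ] Lp ℂ 2 μ) (κ : ℝ → ℝ → ℂ) : Prop :=
  ∀ f : Lp ℂ 2 μ, ∀ᵐ x ∂μ,
    Integrable (fun y => κ x y * f y) μ ∧ (A f) x = ∫ y, κ x y * f y ∂μ

/-- The kernel `κ` defines a bounded integral operator on `L²(μ)`. -/
def IsBoundedKernel (μ : Measure ℝ) (κ : ℝ → ℝ → ℂ) : Prop :=
  ∃ A : Lp ℂ 2 μ →L[ℂ] Lp ℂ 2 μ, IsIntegralOp μ A κ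

open Classical in
/-- The (unique) bounded integral operator on `L²(μ)` with kernel `κ`; it is only meaningful if
`IsBoundedKernel μ κ`. -/
def integralOp (μ : Measure ℝ) (κ : ℝ → ℝ → ℂ) : Lp ℂ 2 μ →L[ℂ] Lp ℂ 2 μ :=
  if h : IsBoundedKernel μ κ then h.choose else 0

/-- The restriction operator `f ↦ 1_s f` on `L²(μ)`. -/
def restrictOp (μ : Measure ℝ) (s : Set ℝ) (hs : MeasurableSet s) : Lp ℂ 2 μ →L[ℂ] Lp ℂ 2 μ :=
  LinearMap.mkContinuous
    { toFun := fun f => ((Lp.memLp f).indicator hs).toLp (s.indicator f)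
      map_add' := by
        intro f g
        rw [← MemLp.toLp_add]
        apply MemLp.toLp_congr
        filter_upwards [Lp.coeFn_add f g] with x hx
        by_cases h : x ∈ s
        · simpa [h] using hx
        · simp [h]
      map_smul' := by
        intro c f
        rw [RingHom.id_apply, ← MemLp.toLp_const_smul]
        apply MemLp.toLp_congr
        filter_upwards [Lp.coeFn_smul c f] with x hx
        by_cases h : x ∈ s
        · simpa [h] using hx
        · simp [h] }
    1 (by
      intro f
      rw [one_mul]
      simp only [LinearMap.coe_mk, AddHom.coe_mk]
      rw [Lp.norm_toLp, Lp.norm_def]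
      exact ENNReal.toReal_mono (Lp.eLpNorm_ne_top f) (eLpNorm_indicator_le _))

end Kernels

open Classical in
/-- The kernel function `k(x) = (1/2π) ∫_{-∞}^{∞} (a(ξ) - 1) e^{-ixξ} dξ` of the symbol `a`.
If `a - 1` is square integrable without being integrable, then the integral is taken in the sense
of Plancherel; in terms of the normalization `(𝓕 h)(w) = ∫ h(ξ) e^{-2πiξw} dξ` it is
`k(x) = (1/2π) (𝓕 (a - 1))(x/2π)`. -/
def kernel (a : ℝ → ℂ) (x : ℝ) : ℂ :=
  if Integrable (fun ξ => a ξ - 1) then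
    (1 / (2 * Real.pi)) * ∫ ξ : ℝ, (a ξ - 1) * Complex.exp (-I * x * ξ)
  else if h : MemLp (fun ξ => a ξ - 1) 2 then
    (1 / (2 * Real.pi)) * (𝓕 (h.toLp (fun ξ => a ξ - 1)) : Lp ℂ 2 (volume : Measure ℝ))
      (x / (2 * Real.pi))
  else 0

/-- Lebesgue measure on `(0,∞)`. -/
abbrev halfLine : Measure ℝ := volume.restrict (Ioi 0)

/-- Lebesgue measure on `(0,R)`. -/
abbrev interval (R : ℝ) : Measure ℝ := volume.restrict (Ioo 0 R)

/-- The kernel `k(x - y)`. -/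
def diffKernel (a : ℝ → ℂ) (x y : ℝ) : ℂ := kernel a (x - y)

/-- The kernel `k(x + y)`. -/
def sumKernel (a : ℝ → ℂ) (x y : ℝ) : ℂ := kernel a (x + y)

/-- The Wiener-Hopf operator `W(a)` on `L²(0,∞)`. -/
def W (a : ℝ → ℂ) : Lp ℂ 2 halfLine →L[ℂ] Lp ℂ 2 halfLine :=
  ContinuousLinearMap.id ℂ _ + integralOp halfLine (diffKernel a)

/-- The Hankel operator `H(a)` on `L²(0,∞)`. -/
def HL (a : ℝ → ℂ) : Lp ℂ 2 halfLine →L[ℂ] Lp ℂ 2 halfLine :=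
  integralOp halfLine (sumKernel a)

/-- The truncated operator `W_R(a) + H_R(a)` on `L²(0,R)`. -/
def truncWH (a : ℝ → ℂ) (R : ℝ) : Lp ℂ 2 (interval R) →L[ℂ] Lp ℂ 2 (interval R) :=
  ContinuousLinearMap.id ℂ _ + integralOp (interval R) (diffKernel a) +
    integralOp (interval R) (sumKernel a)

/-- `Q_R`, the projection of `L²(0,∞)` onto `L²(R,∞)`. -/
def QL (R : ℝ) : Lp ℂ 2 halfLine →L[ℂ] Lp ℂ 2 halfLine :=
  restrictOp halfLine (Ioi R) measurableSet_Ioi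

/-- `σ = e^f` is an even function on the real line with a `C²` logarithm `f` such that `f`, `f'`
and `f''` are integrable. -/
structure IsLineSymbol (σ f : ℝ → ℂ) : Prop where
  smooth : ContDiff ℝ 2 f
  integrable : ∀ i ≤ 2, Integrable (iteratedDeriv i f)
  exp_eq : ∀ ξ, σ ξ = Complex.exp (f ξ)
  even : ∀ ξ, σ (-ξ) = σ ξ

/-- The power `G[σ]^R = exp(R · (1/2π) ∫ f(ξ) dξ)`, where `f = log σ`. -/
def lineGPow (f : ℝ → ℂ) (R : ℝ) : ℂ :=
  Complex.exp (R * ((1 / (2 * Real.pi)) * ∫ ξ : ℝ, f ξ))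

/-- A factorization `σ = σ⁺ σ⁻` on the real line, with `σ⁺` continuous on the closed upper
half-plane, analytic above the real line, bounded and bounded away from zero, and
`σ⁻(ζ) = σ⁺(-ζ)` on the closed lower half-plane (so that `σ⁻` has the corresponding properties
there). -/
structure IsLineFactorization (σ : ℝ → ℂ) (σp σm : ℂ → ℂ) : Prop where
  analytic : DiffContOnCl ℂ σp {ζ : ℂ | 0 < ζ.im}
  bounded : ∃ m M : ℝ, 0 < m ∧ ∀ ζ : ℂ, 0 ≤ ζ.im → m ≤ ‖σp ζ‖ ∧ ‖σp ζ‖ ≤ M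
  symm : ∀ ζ : ℂ, ζ.im ≤ 0 → σm ζ = σp (-ζ)
  mul_eq : ∀ ξ : ℝ, σ ξ = σp ξ * σm ξ

/-- The point `z(ξ) = (1 + iξ)/(1 - iξ)` of the unit circle. -/
def cayley (ξ : ℝ) : Circle :=
  ⟨(1 + I * ξ) / (1 - I * ξ), by
    have h : (1 + I * (ξ : ℂ)) = (starRingEnd ℂ) (1 - I * ξ) := by simp
    have h0 : (1 - I * (ξ : ℂ)) ≠ 0 := by
      intro h
      simpa using congrArg Complex.re h
    rw [Submonoid.unitSphere, Submonoid.mem_mk, Subsemigroup.mem_mk, mem_sphere_zero_iff_norm,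
      norm_div, h, RCLike.norm_conj, div_self (norm_ne_zero_iff.2 h0)]⟩

end BorodinOkounkov

end

noncomputable section

namespace BorodinOkounkov

/-! ### Gram determinants -/

section Gram

variable {n : Type*} [Fintype n] [DecidableEq n]
variable {E : Type*} [NormedAddCommGroup E] [InnerProductSpace ℂ E]

/-! Write `M(φ) = T(φ) + H(φ)`. The discrete and the continuous problem are both set in a Hardy
space inside L²(ℝ): an inclusion `i` with left inverse `r` and an involution `J` satisfy `i r + J i
r J = 1`, and the operators are `T(m) = r m i` and `H(m) = r m J i` (`HardySetup`). Inserting the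
decomposition between two multipliers gives `T(ab) = T(a)T(b) + H(a)H(b~)` and `H(ab) = T(a)H(b) +
H(a)T(b~)`, where `b~ = J b J`. If `b` is even, adding the two yields `M(ab) = M(a)M(b)`, so `M(φ)`
is inverted by `M(φ⁻¹)`.

Let `φ = φ₊φ₋`. The Hankel operators of `φ₋` and `1/φ₋` vanish, and it follows that `A = T(1/φ₊)
M(φ) T(1/φ₋)` has the inverse `1 + H(φ₋/φ₊)` (`middle_mul`), while `A` is similar to `T(φ⁻¹)M(φ)`
(`tc_middle`). Since `T(φ₊)` and `T(φ₋)` are triangular with respect to the initial segment, the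
truncation of `M(φ)` is the product of the truncations of `T(φ₊)`, `A` and `T(φ₋)`
(`compression_det`). Jacobi's identity for complementary compressions (`fredholmDet_jacobi`) turns
the determinant of the truncated `A` into `det A · det(1 + Q H(φ₋/φ₊) Q)`.

The outer factors produce the power of `G`. On the circle they are triangular matrices with constant
diagonal `φ₊(0)`, and `φ₊(0)² = G[φ]`. On the line they are `e^ℓ` and `e^u` with `ℓ` and `u`
Hilbert–Schmidt, so they are only treated together: `u + ℓ` is convolution with the transform of `f`
on `(0,R)`, which is of trace class with trace `(R/2π) ∫ f`, and `det(e^u e^ℓ) = exp tr(u + ℓ)`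
(`fredholmDet_exp_mul_exp`, `HardyFactor.exp_compression_det`).

Fredholm determinants are computed from representations `K = ∑ ⟪u_i, ·⟫ v_i` with square summable
families: `det(1 + K)` is the limit of the finite Gram determinants `det(1 + ⟪u_i, v_j⟫)`
(`IsRep.fredholmDet_eq`). A dimension-free bound and the Schwarz lemma make these continuous in the
vectors, which gives multiplicativity, `det(1 + XY) = det(1 + YX)`, and approximation by
compressions. Trace class on the circle comes from `∑ |k| |φ_k| < ∞`; on the line the kernels are
written as inner products of square integrable fields of vectors (`exists_isRep_kernel`).

For corresponding symbols, the functions `√2 zᵏ/(1 - 2πiξ)`, with `z` the Cayley transform, form an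
orthonormal basis of L²(ℝ) which reflection permutes by `k ↦ -k-1`. Those with `k ≥ 0` span exactly
the Hardy space of the half-line (`circ_proj_eq`), so the discrete and continuous operators are
conjugate and the constant `c` cancels. The ratio formula is the quotient of the two identities. -/

open scoped ComplexOrder in
lemma norm_det_sq_le (A : Matrix n n ℂ) :
    ‖A.det‖ ^ 2 ≤ Real.exp ((∑ i, ∑ j, ‖A i j‖ ^ 2) - Fintype.card n) := by
  have hP : (A.conjTranspose * A).PosSemidef := Matrix.posSemidef_conjTranspose_mul_self A
  have hH := hP.1
  have h1 : ((‖A.det‖ ^ 2 : ℝ) : ℂ) = ∏ i, ((hH.eigenvalues i : ℝ) : ℂ) := by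
    have := hH.det_eq_prod_eigenvalues
    rw [Matrix.det_mul, Matrix.det_conjTranspose] at this
    rw [← Complex.normSq_eq_norm_sq, Complex.normSq_eq_conj_mul_self]
    exact this
  have h2 : ((∑ i, ∑ j, ‖A i j‖ ^ 2 : ℝ) : ℂ) = ∑ i, ((hH.eigenvalues i : ℝ) : ℂ) := by
    have := hH.trace_eq_sum_eigenvalues
    rw [← RCLike.ofReal_eq_complex_ofReal, ← this, Matrix.trace]
    simp only [Matrix.diag_apply, Matrix.mul_apply, Matrix.conjTranspose_apply]
    rw [Finset.sum_comm]
    push_cast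
    refine Finset.sum_congr rfl fun i _ => Finset.sum_congr rfl fun j _ => ?_
    have := Complex.normSq_eq_conj_mul_self (z := A j i)
    rw [Complex.normSq_eq_norm_sq] at this
    simpa using this
  have h1' : ‖A.det‖ ^ 2 = ∏ i, hH.eigenvalues i := by exact_mod_cast h1
  have h2' : (∑ i, ∑ j, ‖A i j‖ ^ 2) = ∑ i, hH.eigenvalues i := by exact_mod_cast h2
  rw [h1', h2']
  have h3 : (∑ i, hH.eigenvalues i) - Fintype.card n = ∑ i, (hH.eigenvalues i - 1) := by
    simp
  rw [h3, Real.exp_sum]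
  -- For the eigenvalues `λ` of `A*A`, whose product is `|det A|²` and whose sum is the squared
  -- Hilbert–Schmidt norm, use `λ ≤ e^(λ-1)`. This is sharp at the identity, which is what makes the
  -- bound survive growing matrices.
  refine Finset.prod_le_prod (fun i _ => hP.eigenvalues_nonneg i) fun i _ => ?_
  have := Real.add_one_le_exp (hH.eigenvalues i - 1)
  linarith

/-- The Gram determinant `det (1 + ⟪u i, v j⟫)`. -/
def gramDet (u v : n → E) : ℂ := (1 + Matrix.of fun i j => ⟪u i, v j⟫_ℂ).det

/-- The bound for Gram determinants with `∑ ‖u i‖² ≤ S` and `∑ ‖v i‖² ≤ S`. -/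
def gramBound (S : ℝ) : ℝ := Real.exp ((S + S + S * S) / 2)

/-- The squared Hilbert–Schmidt norm of `1 + G` is the size of the matrix plus `2 Re tr G + ‖G‖²`.
The size cancels in `norm_det_sq_le`, so the bound does not depend on the number of vectors. -/
lemma norm_gramDet_le (u v : n → E) {S : ℝ} (hu : ∑ i, ‖u i‖ ^ 2 ≤ S) (hv : ∑ i, ‖v i‖ ^ 2 ≤ S) :
    ‖gramDet u v‖ ≤ gramBound S := by
  have hu0 : 0 ≤ ∑ i, ‖u i‖ ^ 2 := Finset.sum_nonneg fun i _ => sq_nonneg _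
  have hv0 : 0 ≤ ∑ i, ‖v i‖ ^ 2 := Finset.sum_nonneg fun i _ => sq_nonneg _
  set G : Matrix n n ℂ := Matrix.of fun i j => ⟪u i, v j⟫_ℂ with hG
  have hent : ∀ i j, ‖(1 + G) i j‖ ^ 2 =
      (if i = j then 1 + 2 * (G i j).re else 0) + ‖G i j‖ ^ 2 := by
    intro i j
    rw [Matrix.add_apply, Matrix.one_apply]
    split_ifs with h
    · rw [← Complex.normSq_eq_norm_sq, ← Complex.normSq_eq_norm_sq, Complex.normSq_add]
      simp; ring
    · simp
  have h1 : (∑ i, ∑ j, ‖(1 + G) i j‖ ^ 2) - Fintype.card n ≤ S + S + S * S := by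
    simp_rw [hent, Finset.sum_add_distrib]
    simp only [Finset.sum_ite_eq, Finset.mem_univ, if_true, Finset.sum_add_distrib]
    have a1 : ∑ i, 2 * (G i i).re ≤ S + S := by
      calc ∑ i, 2 * (G i i).re ≤ ∑ i, (‖u i‖ ^ 2 + ‖v i‖ ^ 2) := by
            refine Finset.sum_le_sum fun i _ => ?_
            have h1 : (G i i).re ≤ ‖u i‖ * ‖v i‖ :=
              (Complex.re_le_norm _).trans (norm_inner_le_norm _ _)
            nlinarith [sq_nonneg (‖u i‖ - ‖v i‖)]
        _ ≤ S + S := by rw [Finset.sum_add_distrib]; linarith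
    have a2 : ∑ i, ∑ j, ‖G i j‖ ^ 2 ≤ S * S := by
      calc ∑ i, ∑ j, ‖G i j‖ ^ 2 ≤ ∑ i, ∑ j, ‖u i‖ ^ 2 * ‖v j‖ ^ 2 := by
            refine Finset.sum_le_sum fun i _ => Finset.sum_le_sum fun j _ => ?_
            rw [← mul_pow]
            exact pow_le_pow_left₀ (norm_nonneg _) (norm_inner_le_norm _ _) 2
        _ = (∑ i, ‖u i‖ ^ 2) * ∑ j, ‖v j‖ ^ 2 := by rw [Finset.sum_mul_sum]
        _ ≤ S * S := mul_le_mul hu hv hv0 (hu0.trans hu)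
    simp
    linarith
  have h2 := (norm_det_sq_le (1 + G)).trans (Real.exp_le_exp.2 h1)
  have h3 : Real.exp (S + S + S * S) = gramBound S ^ 2 := by
    rw [gramBound, sq, ← Real.exp_add]; ring_nf
  rw [h3] at h2
  exact le_of_sq_le_sq h2 (Real.exp_nonneg _)

lemma gramDet_comm (u v : n → E) : gramDet v u = starRingEnd ℂ (gramDet u v) := by
  rw [gramDet, gramDet, ← Complex.star_def, ← Matrix.det_conjTranspose]
  congr 1
  ext i j
  simp [Matrix.conjTranspose_apply, Matrix.one_apply, eq_comm]

/-- On the complex line through `u` and `u'` the determinant is a polynomial, bounded on the disc of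
radius `1/δ` because the displacement has norm at most `δ`. The Schwarz lemma between `0` and `1`
then gains the factor `δ`. -/
lemma norm_gramDet_sub_le_left (u u' v : n → E) {S δ : ℝ} (hδ0 : 0 ≤ δ) (hδ : δ < 1)
    (hu : ∑ i, ‖u i‖ ^ 2 ≤ S) (hv : ∑ i, ‖v i‖ ^ 2 ≤ S)
    (hd : ∑ i, ‖u' i - u i‖ ^ 2 ≤ δ ^ 2) :
    ‖gramDet u' v - gramDet u v‖ ≤ 3 * gramBound (2 * S + 2) * δ := by
  have hS : 0 ≤ S := (Finset.sum_nonneg fun i _ => sq_nonneg _).trans hu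
  set M := gramBound (2 * S + 2) with hM
  have hMpos : 0 < M := Real.exp_pos _
  rcases hδ0.eq_or_lt with h0 | h0
  · subst h0
    have : u' = u := by
      ext i
      have h1 : ∑ i, ‖u' i - u i‖ ^ 2 = 0 :=
        le_antisymm (by simpa using hd) (Finset.sum_nonneg fun i _ => sq_nonneg _)
      have := (Finset.sum_eq_zero_iff_of_nonneg (fun i _ => sq_nonneg _)).1 h1 i (Finset.mem_univ _)
      rw [sq_eq_zero_iff, norm_eq_zero, sub_eq_zero] at this
      exact this
    simp [this]
  -- The inner product is conjugate linear in the first slot, so the parameter is conjugated to make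
  -- `p` holomorphic.
  set p : ℂ → ℂ := fun z => gramDet (fun i => u i + (starRingEnd ℂ z) • (u' i - u i)) v with hp
  have hpd : Differentiable ℂ p := by
    have : p = fun z => (Matrix.of fun i j =>
        (1 : Matrix n n ℂ) i j + (⟪u i, v j⟫_ℂ + z * ⟪u' i - u i, v j⟫_ℂ)).det := by
      ext z
      simp only [hp, gramDet]
      congr 1
      ext i j
      simp only [Matrix.add_apply, Matrix.of_apply, inner_add_left, inner_smul_left,
        RCLike.conj_conj]
    rw [this]
    simp only [Matrix.det_apply, Matrix.of_apply]
    fun_prop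
  have hb : ∀ z ∈ Metric.ball (0 : ℂ) (1 / δ), ‖p z‖ ≤ M := by
    intro z hz
    rw [mem_ball_zero_iff] at hz
    refine norm_gramDet_le _ _ ?_ (by linarith)
    have hz2 : ‖z‖ ^ 2 * δ ^ 2 ≤ 1 := by
      have : ‖z‖ * δ ≤ 1 := by
        rw [lt_div_iff₀ h0] at hz; exact hz.le
      rw [← mul_pow]
      exact pow_le_one₀ (by positivity) this
    calc ∑ i, ‖u i + (starRingEnd ℂ z) • (u' i - u i)‖ ^ 2
        ≤ ∑ i, (2 * ‖u i‖ ^ 2 + 2 * (‖z‖ ^ 2 * ‖u' i - u i‖ ^ 2)) := by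
          refine Finset.sum_le_sum fun i _ => ?_
          have h1 : ‖u i + (starRingEnd ℂ z) • (u' i - u i)‖ ≤ ‖u i‖ + ‖z‖ * ‖u' i - u i‖ := by
            refine (norm_add_le _ _).trans ?_
            rw [norm_smul, RCLike.norm_conj]
          have h2 := pow_le_pow_left₀ (norm_nonneg _) h1 2
          nlinarith [sq_nonneg (‖u i‖ - ‖z‖ * ‖u' i - u i‖)]
      _ = 2 * (∑ i, ‖u i‖ ^ 2) + 2 * (‖z‖ ^ 2 * ∑ i, ‖u' i - u i‖ ^ 2) := by
          rw [Finset.sum_add_distrib, ← Finset.mul_sum, ← Finset.mul_sum, ← Finset.mul_sum]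
      _ ≤ 2 * S + 2 := by
          have := mul_le_mul_of_nonneg_left hd (sq_nonneg ‖z‖)
          linarith
  have h1 : (1 : ℂ) ∈ Metric.ball (0 : ℂ) (1 / δ) := by
    rw [mem_ball_zero_iff, norm_one, lt_div_iff₀ h0]; linarith
  have h00 : (0 : ℂ) ∈ Metric.ball (0 : ℂ) (1 / δ) := by
    rw [mem_ball_zero_iff, norm_zero]; positivity
  have := Complex.dist_le_div_mul_dist_of_mapsTo_ball (f := p) (c := 0) (R₁ := 1 / δ)
    (R₂ := 3 * M) (z := 1) hpd.differentiableOn (fun z hz => by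
      rw [Metric.mem_closedBall, dist_eq_norm]
      refine (norm_sub_le _ _).trans ?_
      linarith [hb z hz, hb 0 h00]) h1
  rw [dist_eq_norm] at this
  simp only [hp, map_one, one_smul, map_zero, zero_smul, add_zero, add_sub_cancel] at this
  rw [dist_zero_right, norm_one, mul_one] at this
  rwa [div_div_eq_mul_div, div_one] at this

lemma norm_gramDet_sub_le (u u' v v' : n → E) {S δ : ℝ} (hδ0 : 0 ≤ δ) (hδ : δ < 1)
    (hu : ∑ i, ‖u i‖ ^ 2 ≤ S) (hv : ∑ i, ‖v i‖ ^ 2 ≤ S) (hu' : ∑ i, ‖u' i‖ ^ 2 ≤ S)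
    (hdu : ∑ i, ‖u' i - u i‖ ^ 2 ≤ δ ^ 2) (hdv : ∑ i, ‖v' i - v i‖ ^ 2 ≤ δ ^ 2) :
    ‖gramDet u' v' - gramDet u v‖ ≤ 6 * gramBound (2 * S + 2) * δ := by
  have h1 := norm_gramDet_sub_le_left u u' v hδ0 hδ hu hv hdu
  have h2 := norm_gramDet_sub_le_left v v' u' hδ0 hδ hv hu' hdv
  rw [gramDet_comm u' v', gramDet_comm u' v, ← map_sub, RCLike.norm_conj] at h2
  calc ‖gramDet u' v' - gramDet u v‖
      = ‖(gramDet u' v' - gramDet u' v) + (gramDet u' v - gramDet u v)‖ := by congr 1; ring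
    _ ≤ _ := (norm_add_le _ _).trans (by linarith)

end Gram

/-! ### Determinants of square summable families and their link to Fredholm determinants. -/

section Reps

variable {ι κ : Type*}
variable {E F : Type*} [NormedAddCommGroup E] [InnerProductSpace ℂ E]
  [NormedAddCommGroup F] [InnerProductSpace ℂ F]

/-- A zero vector contributes a row of the identity matrix. Sylvester's identity, applied to the
inclusion of `s` in `t`, removes these rows; determinants over different finite sets can thus be
compared at the same size. -/
lemma gramDet_restrict [DecidableEq ι] (u v : ι → E) {s t : Finset ι} (hst : s ⊆ t) :
    gramDet (fun i : t => if (i : ι) ∈ s then u i else 0) (fun i : t => v i) =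
      gramDet (fun i : s => u i) (fun i : s => v i) := by
  have h := Matrix.det_one_add_mul_comm
    (Matrix.of fun (i : t) (k : s) => if (i : ι) = k then (1 : ℂ) else 0)
    (Matrix.of fun (k : s) (j : t) => ⟪u k, v j⟫_ℂ)
  convert h using 1
  · rw [gramDet]
    congr 2
    ext i j
    simp only [Matrix.of_apply, Matrix.mul_apply, ite_mul, one_mul, zero_mul]
    by_cases hi : (i : ι) ∈ s
    · rw [Finset.sum_eq_single ⟨i, hi⟩]
      · simp [hi]
      · intro b _ hb
        rw [if_neg]
        intro h
        exact hb (Subtype.ext h.symm)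
      · simp
    · rw [Finset.sum_eq_zero]
      · simp [hi]
      · intro b _
        rw [if_neg]
        intro h
        exact hi (h ▸ b.2)
  · rw [gramDet]
    congr 2
    ext i j
    simp only [Matrix.of_apply, Matrix.mul_apply, mul_ite, mul_one, mul_zero]
    rw [Finset.sum_eq_single ⟨j, hst j.2⟩]
    · simp
    · intro b _ hb
      rw [if_neg]
      intro h
      exact hb (Subtype.ext h)
    · simp

/-- The Gram determinant along the finite set `s`. -/
def partialDet (u v : ι → E) (s : Finset ι) : ℂ :=
  haveI := Classical.decEq ι
  gramDet (fun i : s => u i) (fun i : s => v i)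

/-- The determinant `det (1 + ⟪u i, v j⟫)` over an arbitrary index type. -/
def fdet (u v : ι → E) : ℂ := limUnder (atTop : Filter (Finset ι)) (partialDet u v)

lemma fdet_congr {u v : ι → E} {u' v' : ι → F} (h : ∀ i j, ⟪u i, v j⟫_ℂ = ⟪u' i, v' j⟫_ℂ) :
    fdet u v = fdet u' v' := by
  simp only [fdet]
  congr 1
  ext s
  simp [partialDet, gramDet, h]

lemma sum_coe_sq_le {u : ι → E} (hu : Summable fun i => ‖u i‖ ^ 2) (s : Finset ι) :
    ∑ i : s, ‖u i‖ ^ 2 ≤ ∑' i, ‖u i‖ ^ 2 := by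
  rw [Finset.sum_coe_sort s (fun i => ‖u i‖ ^ 2)]
  exact hu.sum_le_tsum s fun i _ => sq_nonneg _

/-- Passing from `t` to `s` means replacing `u i` by zero outside `s`, so a small tail of `u` alone
is enough. -/
lemma norm_partialDet_sub_le {u v : ι → E} (hu : Summable fun i => ‖u i‖ ^ 2)
    (hv : Summable fun i => ‖v i‖ ^ 2) {S δ : ℝ} (hS : ∑' i, ‖u i‖ ^ 2 ≤ S)
    (hS' : ∑' i, ‖v i‖ ^ 2 ≤ S) (hδ0 : 0 ≤ δ) (hδ : δ < 1) {s t : Finset ι} (hst : s ⊆ t)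
    (h : ∑ i ∈ (have := Classical.decEq ι; t \ s), ‖u i‖ ^ 2 ≤ δ ^ 2) :
    ‖partialDet u v t - partialDet u v s‖ ≤ 3 * gramBound (2 * S + 2) * δ := by
  classical
  have h1 : partialDet u v s =
      gramDet (fun i : t => if (i : ι) ∈ s then u i else 0) (fun i : t => v i) := by
    rw [gramDet_restrict u v hst, partialDet]
  have h2 : partialDet u v t = gramDet (fun i : t => u i) (fun i : t => v i) := by
    rw [partialDet]
  rw [h1, h2]
  refine norm_gramDet_sub_le_left _ _ _ hδ0 hδ ?_ ((sum_coe_sq_le hv t).trans hS') ?_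
  · refine le_trans (Finset.sum_le_sum fun i _ => ?_) ((sum_coe_sq_le hu t).trans hS)
    split_ifs
    · exact le_rfl
    · simp
  · refine le_trans (le_of_eq ?_) h
    rw [Finset.sum_coe_sort t (fun i => ‖u i - if i ∈ s then u i else 0‖ ^ 2)]
    rw [← Finset.sum_sdiff hst]
    have : ∑ i ∈ s, ‖u i - if i ∈ s then u i else 0‖ ^ 2 = 0 :=
      Finset.sum_eq_zero fun i hi => by simp [hi]
    rw [this, add_zero]
    refine Finset.sum_congr (by congr!) fun i hi => ?_
    rw [Finset.mem_sdiff] at hi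
    simp [hi.2]

lemma gramBound_pos (S : ℝ) : 0 < gramBound S := Real.exp_pos _

lemma tendsto_partialDet {u v : ι → E} (hu : Summable fun i => ‖u i‖ ^ 2)
    (hv : Summable fun i => ‖v i‖ ^ 2) :
    Tendsto (partialDet u v) atTop (𝓝 (fdet u v)) := by
  classical
  apply tendsto_nhds_limUnder
  apply cauchySeq_tendsto_of_complete
  rw [Metric.cauchySeq_iff']
  intro ε hε
  set S := max (∑' i, ‖u i‖ ^ 2) (∑' i, ‖v i‖ ^ 2)
  set C := 3 * gramBound (2 * S + 2) with hC
  have hC0 : 0 < C := by have := gramBound_pos (2 * S + 2); positivity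
  set δ := min (1 / 2) (ε / (2 * C)) with hδ
  have hδ0 : 0 < δ := by positivity
  obtain ⟨s, hs⟩ := summable_iff_vanishing_norm.1 hu (δ ^ 2) (by positivity)
  refine ⟨s, fun t hst => ?_⟩
  rw [dist_eq_norm]
  refine lt_of_le_of_lt (norm_partialDet_sub_le hu hv (le_max_left _ _) (le_max_right _ _) hδ0.le
    (lt_of_le_of_lt (min_le_left _ _) (by norm_num)) hst ?_) ?_
  · have := hs (t \ s) Finset.sdiff_disjoint
    refine (Real.le_norm_self _).trans (le_of_lt ?_)
    convert this using 3
  · have : δ ≤ ε / (2 * C) := min_le_right _ _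
    have h2 : C * δ ≤ C * (ε / (2 * C)) := mul_le_mul_of_nonneg_left this hC0.le
    have h3 : C * (ε / (2 * C)) = ε / 2 := by field_simp
    linarith

/-- Convergence of families of vectors in the sense of square sums. -/
structure SqTendsto {α : Type*} (U : α → ι → E) (l : Filter α) (u : ι → E) : Prop where
  summable : ∀ a, Summable fun i => ‖U a i - u i‖ ^ 2
  tendsto : Tendsto (fun a => ∑' i, ‖U a i - u i‖ ^ 2) l (𝓝 0)

lemma norm_sq_le_two (x y : E) : ‖x‖ ^ 2 ≤ 2 * ‖x - y‖ ^ 2 + 2 * ‖y‖ ^ 2 := by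
  have h : ‖x‖ ≤ ‖x - y‖ + ‖y‖ := by simpa using norm_add_le (x - y) y
  have := pow_le_pow_left₀ (norm_nonneg _) h 2
  nlinarith [sq_nonneg (‖x - y‖ - ‖y‖)]

lemma SqTendsto.summable_sq {α : Type*} {U : α → ι → E} {l : Filter α} {u : ι → E}
    (h : SqTendsto U l u) (hu : Summable fun i => ‖u i‖ ^ 2) (a : α) :
    Summable fun i => ‖U a i‖ ^ 2 :=
  Summable.of_nonneg_of_le (fun _ => sq_nonneg _) (fun i => norm_sq_le_two (U a i) (u i))
    (((h.summable a).mul_left 2).add (hu.mul_left 2))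

/-- The Lipschitz estimate for Gram determinants is uniform over finite index sets and therefore
passes to the limit. -/
lemma tendsto_fdet {α : Type*} {l : Filter α} {U V : α → ι → E} {u v : ι → E}
    (hu : Summable fun i => ‖u i‖ ^ 2) (hv : Summable fun i => ‖v i‖ ^ 2)
    (hU : SqTendsto U l u) (hV : SqTendsto V l v) :
    Tendsto (fun a => fdet (U a) (V a)) l (𝓝 (fdet u v)) := by
  classical
  rw [Metric.tendsto_nhds]
  intro ε hε
  -- Families within square distance `1` of `u` and `v` have square sums below this `S`, so one
  -- constant serves all nearby families.
  set S := 2 * max (∑' i, ‖u i‖ ^ 2) (∑' i, ‖v i‖ ^ 2) + 2 with hS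
  have hu0 : 0 ≤ ∑' i, ‖u i‖ ^ 2 := tsum_nonneg fun _ => sq_nonneg _
  have hm1 := le_max_left (∑' i, ‖u i‖ ^ 2) (∑' i, ‖v i‖ ^ 2)
  have hm2 := le_max_right (∑' i, ‖u i‖ ^ 2) (∑' i, ‖v i‖ ^ 2)
  set C := 6 * gramBound (2 * S + 2) with hC
  have hC0 : 0 < C := by have := gramBound_pos (2 * S + 2); positivity
  set δ := min (1 / 2) (ε / (2 * C)) with hδ
  have hδ0 : 0 < δ := by positivity
  have hδ1 : δ < 1 := lt_of_le_of_lt (min_le_left _ _) (by norm_num)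
  have e1 := hU.tendsto.eventually (gt_mem_nhds (show (0 : ℝ) < δ ^ 2 by positivity))
  have e2 := hV.tendsto.eventually (gt_mem_nhds (show (0 : ℝ) < δ ^ 2 by positivity))
  filter_upwards [e1, e2] with a h1 h2
  have hUa := hU.summable_sq hu a
  have hVa := hV.summable_sq hv a
  have hUS : ∑' i, ‖U a i‖ ^ 2 ≤ S := by
    have := hUa.tsum_le_tsum (fun i => norm_sq_le_two (U a i) (u i))
      (((hU.summable a).mul_left 2).add (hu.mul_left 2))
    rw [((hU.summable a).mul_left 2).tsum_add (hu.mul_left 2), tsum_mul_left, tsum_mul_left] at this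
    have : δ ^ 2 ≤ 1 := pow_le_one₀ hδ0.le hδ1.le
    linarith
  have key : ∀ s : Finset ι, ‖partialDet (U a) (V a) s - partialDet u v s‖ ≤ C * δ := by
    intro s
    refine norm_gramDet_sub_le _ _ _ _ hδ0.le hδ1 ((sum_coe_sq_le hu s).trans (by linarith))
      ((sum_coe_sq_le hv s).trans (by linarith)) ((sum_coe_sq_le hUa s).trans hUS) ?_ ?_
    · rw [Finset.sum_coe_sort s (fun i => ‖U a i - u i‖ ^ 2)]
      exact ((hU.summable a).sum_le_tsum s fun i _ => sq_nonneg _).trans h1.le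
    · rw [Finset.sum_coe_sort s (fun i => ‖V a i - v i‖ ^ 2)]
      exact ((hV.summable a).sum_le_tsum s fun i _ => sq_nonneg _).trans h2.le
  have := le_of_tendsto ((tendsto_partialDet hUa hVa).sub (tendsto_partialDet hu hv)).norm
    (Eventually.of_forall key)
  rw [dist_eq_norm]
  refine lt_of_le_of_lt this ?_
  have : δ ≤ ε / (2 * C) := min_le_right _ _
  have h2 : C * δ ≤ C * (ε / (2 * C)) := mul_le_mul_of_nonneg_left this hC0.le
  have h3 : C * (ε / (2 * C)) = ε / 2 := by field_simp
  linarith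

lemma SqTendsto.of_dominated {α : Type*} {l : Filter α} {U : α → ι → E} {u : ι → E} {c : ι → ℝ}
    (hc : Summable fun i => c i ^ 2) (hb : ∀ a i, ‖U a i - u i‖ ≤ c i)
    (h : ∀ i, Tendsto (fun a => U a i) l (𝓝 (u i))) : SqTendsto U l u := by
  have hle : ∀ a i, ‖U a i - u i‖ ^ 2 ≤ c i ^ 2 := fun a i =>
    pow_le_pow_left₀ (norm_nonneg _) (hb a i) 2
  refine ⟨fun a => Summable.of_nonneg_of_le (fun _ => sq_nonneg _) (hle a) hc, ?_⟩
  have : Tendsto (fun a => ∑' i, ‖U a i - u i‖ ^ 2) l (𝓝 (∑' _ : ι, (0 : ℝ))) := by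
    refine tendsto_tsum_of_dominated_convergence hc (fun i => ?_) (Eventually.of_forall fun a i => ?_)
    · have := ((h i).sub_const (u i)).norm.pow 2
      simpa using this
    · rw [Real.norm_of_nonneg (sq_nonneg _)]
      exact hle a i
  simpa using this

/-- In an orthonormal basis `K` is the product of the matrix with columns `v i` and the matrix with
rows `u i`. By Parseval the product in the other order is the Gram matrix, and Sylvester's identity
applies. -/
lemma det_one_add_finiteRank [FiniteDimensional ℂ E] (u v : ι → E) (s : Finset ι)
    (K : E →ₗ[ℂ] E) (hK : ∀ x, K x = ∑ i ∈ s, ⟪u i, x⟫_ℂ • v i) :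
    LinearMap.det (1 + K) = partialDet u v s := by
  classical
  set e := stdOrthonormalBasis ℂ E
  rw [← LinearMap.det_toMatrix e.toBasis, partialDet, gramDet]
  have h := Matrix.det_one_add_mul_comm
    (Matrix.of fun (a : Fin (Module.finrank ℂ E)) (i : s) => ⟪e a, v i⟫_ℂ)
    (Matrix.of fun (i : s) (b : Fin (Module.finrank ℂ E)) => ⟪u i, e b⟫_ℂ)
  convert h using 1
  · congr 1
    rw [map_add, LinearMap.toMatrix_one]
    congr 1
    ext a b
    rw [LinearMap.toMatrix_apply, OrthonormalBasis.coe_toBasis, hK,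
      OrthonormalBasis.coe_toBasis_repr_apply, OrthonormalBasis.repr_apply_apply, inner_sum,
      Matrix.mul_apply, ← Finset.sum_coe_sort s]
    refine Finset.sum_congr rfl fun i _ => ?_
    simp [inner_smul_right, mul_comm]
  · congr! 2
    ext i j
    rw [Matrix.mul_apply]
    simp [OrthonormalBasis.sum_inner_mul_inner]

lemma det_one_add_eq_fdet [FiniteDimensional ℂ E] {u v : ι → E}
    (hu : Summable fun i => ‖u i‖ ^ 2) (hv : Summable fun i => ‖v i‖ ^ 2)
    (K : E →ₗ[ℂ] E) (hK : ∀ x, HasSum (fun i => ⟪u i, x⟫_ℂ • v i) (K x)) :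
    LinearMap.det (1 + K) = fdet u v := by
  classical
  set Ks : Finset ι → E →ₗ[ℂ] E := fun s => ∑ i ∈ s, (innerₛₗ ℂ (u i)).smulRight (v i)
  have hKs : ∀ s x, Ks s x = ∑ i ∈ s, ⟪u i, x⟫_ℂ • v i := by
    intro s x
    simp [Ks, LinearMap.sum_apply]
  refine tendsto_nhds_unique ?_ (tendsto_partialDet hu hv)
  have h1 : partialDet u v = fun s => LinearMap.det (1 + Ks s) := by
    ext s
    rw [det_one_add_finiteRank u v s (Ks s) (hKs s)]
  rw [h1]
  set e := stdOrthonormalBasis ℂ E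
  simp_rw [← LinearMap.det_toMatrix e.toBasis]
  refine ((continuous_id.matrix_det).tendsto _).comp ?_
  refine tendsto_pi_nhds.2 fun a => tendsto_pi_nhds.2 fun b => ?_
  simp only [LinearMap.toMatrix_apply, OrthonormalBasis.coe_toBasis,
    OrthonormalBasis.coe_toBasis_repr_apply, OrthonormalBasis.repr_apply_apply,
    LinearMap.add_apply, hKs]
  exact tendsto_const_nhds.inner (tendsto_const_nhds.add (hK (e b)))

/-- `K x = ∑ ⟪u i, x⟫ v i` with square summable families `u` and `v`. -/
structure IsRep (K : E →L[ℂ] F) (u : ι → E) (v : ι → F) : Prop where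
  left : Summable fun i => ‖u i‖ ^ 2
  right : Summable fun i => ‖v i‖ ^ 2
  hasSum : ∀ x, HasSum (fun i => ⟪u i, x⟫_ℂ • v i) (K x)

instance : Nonempty {V : Submodule ℂ E // FiniteDimensional ℂ V} := ⟨⟨⊥, inferInstance⟩⟩

instance : IsDirectedOrder {V : Submodule ℂ E // FiniteDimensional ℂ V} :=
  ⟨fun V W => by
    have := V.2
    have := W.2
    exact ⟨⟨V.1 ⊔ W.1, inferInstance⟩, le_sup_left (a := V.1), le_sup_right (a := V.1)⟩⟩

/-- The orthogonal projection onto a finite-dimensional subspace, as an operator. -/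
def proj (V : {V : Submodule ℂ E // FiniteDimensional ℂ V}) : E →L[ℂ] V.1 :=
  have := V.2
  V.1.orthogonalProjectionOnto

lemma norm_proj_le (V : {V : Submodule ℂ E // FiniteDimensional ℂ V}) (x : E) :
    ‖proj V x‖ ≤ ‖x‖ := by
  have := V.2
  exact V.1.norm_orthogonalProjectionOnto_apply_le x

lemma inner_proj_left (V : {V : Submodule ℂ E // FiniteDimensional ℂ V}) (x : E) (y : V.1) :
    ⟪proj V x, y⟫_ℂ = ⟪x, (y : E)⟫_ℂ := by
  have := V.2
  exact Submodule.inner_orthogonalProjectionOnto_eq_of_mem_right y x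

lemma eventually_proj_eq (x : E) :
    ∀ᶠ V in (atTop : Filter {V : Submodule ℂ E // FiniteDimensional ℂ V}),
      (proj V x : E) = x := by
  filter_upwards [eventually_ge_atTop ⟨Submodule.span ℂ {x}, inferInstance⟩] with V hV
  have := V.2
  have hx : x ∈ V.1 := hV (Submodule.mem_span_singleton_self x)
  exact Submodule.starProjection_eq_self_iff.2 hx

lemma compression_one_add_apply (K : E →L[ℂ] E)
    (V : {V : Submodule ℂ E // FiniteDimensional ℂ V}) :
    compression (1 + K) V = 1 + compression K V := by
  have := V.2
  ext x
  simp [compression]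

lemma compression_apply (K : E →L[ℂ] E)
    (V : {V : Submodule ℂ E // FiniteDimensional ℂ V}) (x : V.1) :
    compression K V x = proj V (K x) := rfl

/-- The compression to `V` is represented by the projected vectors. Each projection is exact as soon
as `V` contains the vector, so the projected families converge in square sum by dominated
convergence. -/
lemma IsRep.tendsto_det {K : E →L[ℂ] E} {u v : ι → E} (h : IsRep K u v) :
    Tendsto (fun V => LinearMap.det (compression (1 + K) V)) atTop (𝓝 (fdet u v)) := by
  have h1 : ∀ V, LinearMap.det (compression (1 + K) V) =
      fdet (fun i => (proj V (u i) : E)) (fun i => (proj V (v i) : E)) := by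
    intro V
    have := V.2
    have hb : ∀ w : ι → E, Summable (fun i => ‖w i‖ ^ 2) →
        Summable fun i => ‖proj V (w i)‖ ^ 2 := fun w hw =>
      Summable.of_nonneg_of_le (fun _ => sq_nonneg _)
        (fun i => pow_le_pow_left₀ (norm_nonneg _) (norm_proj_le V _) 2) hw
    rw [compression_one_add_apply, det_one_add_eq_fdet (hb u h.left) (hb v h.right)]
    · exact fdet_congr fun i j => by rw [Submodule.coe_inner]
    · intro x
      have := (proj V).hasSum (h.hasSum x)
      simpa only [inner_proj_left, compression_apply, map_smul, Function.comp_def] using this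
  simp_rw [h1]
  have ht : ∀ w : ι → E, Summable (fun i => ‖w i‖ ^ 2) →
      SqTendsto (fun (V : {V : Submodule ℂ E // FiniteDimensional ℂ V}) i => (proj V (w i) : E))
        atTop w := fun w hw => by
    refine SqTendsto.of_dominated (c := fun i => 2 * ‖w i‖) ?_ ?_ ?_
    · simp_rw [mul_pow]
      exact hw.mul_left _
    · intro V i
      refine (norm_sub_le _ _).trans ?_
      have := norm_proj_le V (w i)
      rw [Submodule.coe_norm] at this
      linarith
    · intro i
      exact tendsto_const_nhds.congr' ((eventually_proj_eq (w i)).mono fun V hV => hV.symm)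
  exact tendsto_fdet h.left h.right (ht u h.left) (ht v h.right)

/-- This makes `fdet` independent of the representation and of its index type. Determinant
identities can then be checked by comparing Gram matrices of suitably chosen representations. -/
theorem IsRep.fredholmDet_eq {K : E →L[ℂ] E} {u v : ι → E} (h : IsRep K u v) :
    fredholmDet (1 + K) = fdet u v :=
  h.tendsto_det.limUnder_eq

end Reps

/-! ### Trace class operators between Hilbert spaces -/

section TraceClass

variable {ι κ : Type*} {E F G : Type*}
  [NormedAddCommGroup E] [InnerProductSpace ℂ E]
  [NormedAddCommGroup F] [InnerProductSpace ℂ F]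
  [NormedAddCommGroup G] [InnerProductSpace ℂ G]

lemma inner_proj_right (V : {V : Submodule ℂ E // FiniteDimensional ℂ V}) (x : E) (y : V.1) :
    ⟪y, proj V x⟫_ℂ = ⟪(y : E), x⟫_ℂ := by
  have := V.2
  exact Submodule.inner_orthogonalProjectionOnto_eq_of_mem_left y x

lemma IsRep.comp_left {K : E →L[ℂ] F} {u : ι → E} {v : ι → F} (h : IsRep K u v)
    (X : F →L[ℂ] G) : IsRep (X ∘L K) u (fun i => X (v i)) := by
  refine ⟨h.left, ?_, fun x => ?_⟩
  · refine Summable.of_nonneg_of_le (fun _ => sq_nonneg _) (fun i => ?_) (h.right.mul_left (‖X‖ ^ 2))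
    rw [← mul_pow]
    exact pow_le_pow_left₀ (norm_nonneg _) (X.le_opNorm _) 2
  · simpa [Function.comp_def] using X.hasSum (h.hasSum x)

lemma summable_norm_sq_map {u : ι → E} (hu : Summable fun i => ‖u i‖ ^ 2) (X : E →L[ℂ] F) :
    Summable fun i => ‖X (u i)‖ ^ 2 := by
  refine Summable.of_nonneg_of_le (fun _ => sq_nonneg _) (fun i => ?_) (hu.mul_left (‖X‖ ^ 2))
  rw [← mul_pow]
  exact pow_le_pow_left₀ (norm_nonneg _) (X.le_opNorm _) 2

lemma IsRep.comp_right [CompleteSpace E] [CompleteSpace G] {K : E →L[ℂ] F} {u : ι → E} {v : ι → F}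
    (h : IsRep K u v) (X : G →L[ℂ] E) :
    IsRep (K ∘L X) (fun i => ContinuousLinearMap.adjoint X (u i)) v :=
  ⟨summable_norm_sq_map h.left _, h.right, fun x => by
    simpa [ContinuousLinearMap.adjoint_inner_left] using h.hasSum (X x)⟩

lemma IsRep.add {K L : E →L[ℂ] F} {u : ι → E} {v : ι → F} {u' : κ → E} {v' : κ → F}
    (h : IsRep K u v) (h' : IsRep L u' v') :
    IsRep (K + L) (Sum.elim u u') (Sum.elim v v') :=
  ⟨Summable.sum _ h.left h'.left, Summable.sum _ h.right h'.right,
    fun x => HasSum.sum (h.hasSum x) (h'.hasSum x)⟩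

lemma IsRep.smul {K : E →L[ℂ] F} {u : ι → E} {v : ι → F} (h : IsRep K u v) (c : ℂ) :
    IsRep (c • K) u (fun i => c • v i) := by
  have := h.comp_left (c • ContinuousLinearMap.id ℂ F)
  convert this using 1
  · ext x
    simp
  · ext i
    simp

lemma norm_sq_extend {f : ι → ℕ} (hf : Function.Injective f) (w : ι → E) :
    (fun n => ‖Function.extend f w 0 n‖ ^ 2) = Function.extend f (fun i => ‖w i‖ ^ 2) 0 := by
  ext n
  by_cases hn : ∃ i, f i = n
  · obtain ⟨i, rfl⟩ := hn
    simp [hf.extend_apply]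
  · simp [Function.extend_apply' _ _ _ hn]

lemma IsRep.exists_nat [Countable ι] {K : E →L[ℂ] F} {u : ι → E} {v : ι → F} (h : IsRep K u v) :
    ∃ (u' : ℕ → E) (v' : ℕ → F), IsRep K u' v' := by
  obtain ⟨f, hf⟩ := Countable.exists_injective_nat ι
  refine ⟨Function.extend f u 0, Function.extend f v 0, ?_, ?_, fun x => ?_⟩
  · rw [norm_sq_extend hf u]
    exact ((hasSum_extend_zero hf).2 h.left.hasSum).summable
  · rw [norm_sq_extend hf v]
    exact ((hasSum_extend_zero hf).2 h.right.hasSum).summable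
  · have : (fun n => ⟪Function.extend f u 0 n, x⟫_ℂ • Function.extend f v 0 n) =
        Function.extend f (fun i => ⟪u i, x⟫_ℂ • v i) 0 := by
      ext n
      by_cases hn : ∃ i, f i = n
      · obtain ⟨i, rfl⟩ := hn
        simp [hf.extend_apply]
      · simp [Function.extend_apply' _ _ _ hn]
    rw [this]
    exact (hasSum_extend_zero hf).2 (h.hasSum x)

/-- Trace class operators between two Hilbert spaces. -/
def TC (K : E →L[ℂ] F) : Prop := ∃ (u : ℕ → E) (v : ℕ → F), IsRep K u v

lemma IsRep.tc [Countable ι] {K : E →L[ℂ] F} {u : ι → E} {v : ι → F} (h : IsRep K u v) : TC K :=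
  h.exists_nat

lemma TC.comp_left {K : E →L[ℂ] F} (h : TC K) (X : F →L[ℂ] G) : TC (X ∘L K) := by
  obtain ⟨u, v, h⟩ := h
  exact (h.comp_left X).tc

lemma TC.comp_right [CompleteSpace E] [CompleteSpace G] {K : E →L[ℂ] F} (h : TC K)
    (X : G →L[ℂ] E) : TC (K ∘L X) := by
  obtain ⟨u, v, h⟩ := h
  exact (h.comp_right X).tc

lemma TC.mul_left {K : E →L[ℂ] E} (h : TC K) (X : E →L[ℂ] E) : TC (X * K) := h.comp_left X

lemma TC.mul_right [CompleteSpace E] {K : E →L[ℂ] E} (h : TC K) (X : E →L[ℂ] E) : TC (K * X) :=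
  h.comp_right X

lemma TC.add {K L : E →L[ℂ] F} (h : TC K) (h' : TC L) : TC (K + L) := by
  obtain ⟨u, v, h⟩ := h
  obtain ⟨u', v', h'⟩ := h'
  exact (h.add h').tc

lemma TC.neg {K : E →L[ℂ] F} (h : TC K) : TC (-K) := by
  obtain ⟨u, v, h⟩ := h
  have := (h.smul (-1)).tc
  rwa [neg_one_smul] at this

/-- Balancing does it: scaling `u i` and `v i` by reciprocal factors gives both the squared norm `‖u
i‖ ‖v i‖`. The converse is the inequality of arithmetic and geometric means. -/
lemma isTraceClass_iff_tc {K : E →L[ℂ] E} : IsTraceClass K ↔ TC K := by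
  constructor
  · rintro ⟨u, v, hs, hK⟩
    -- If `u i` or `v i` is zero this factor and its inverse are both zero by convention, which is
    -- harmless because the corresponding term vanishes.
    set c : ℕ → ℂ := fun i => ((Real.sqrt (‖v i‖ / ‖u i‖) : ℝ) : ℂ) with hc
    have key : ∀ a b : ℝ, 0 ≤ a → 0 ≤ b → (a = 0 ∨ b = 0 → Real.sqrt (b / a) = 0) := by
      rintro a b _ _ (rfl | rfl) <;> simp
    have hnorm : ∀ i, ‖c i • u i‖ ^ 2 = ‖u i‖ * ‖v i‖ := by
      intro i
      rw [norm_smul, mul_pow, hc]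
      simp only [Complex.norm_real, Real.norm_eq_abs, sq_abs]
      rw [Real.sq_sqrt (by positivity)]
      rcases eq_or_ne ‖u i‖ 0 with h | h
      · simp [h]
      · field_simp
    have hnorm' : ∀ i, ‖(c i)⁻¹ • v i‖ ^ 2 = ‖u i‖ * ‖v i‖ := by
      intro i
      rw [norm_smul, mul_pow, hc]
      simp only [norm_inv, Complex.norm_real, Real.norm_eq_abs, inv_pow, sq_abs]
      rw [Real.sq_sqrt (by positivity)]
      rcases eq_or_ne ‖v i‖ 0 with h | h
      · simp [h]
      · rcases eq_or_ne ‖u i‖ 0 with h' | h'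
        · simp [h']
        · field_simp
    refine ⟨fun i => c i • u i, fun i => (c i)⁻¹ • v i, ?_, ?_, fun x => ?_⟩
    · simpa only [hnorm] using hs
    · simpa only [hnorm'] using hs
    · convert hK x using 2 with i
      rw [inner_smul_left, smul_smul, hc]
      simp only [Complex.conj_ofReal]
      rcases eq_or_ne (Real.sqrt (‖v i‖ / ‖u i‖)) 0 with h | h
      · rw [Real.sqrt_eq_zero (by positivity), div_eq_zero_iff] at h
        rcases h with h | h <;> simp [norm_eq_zero.1 h]
      · have h' : ((Real.sqrt (‖v i‖ / ‖u i‖) : ℝ) : ℂ) ≠ 0 := by exact_mod_cast h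
        congr 1
        field_simp
  · rintro ⟨u, v, h⟩
    refine ⟨u, v, Summable.of_nonneg_of_le (fun i => by positivity) (fun i => ?_)
      ((h.left.add h.right).div_const 2), h.hasSum⟩
    nlinarith [sq_nonneg (‖u i‖ - ‖v i‖)]

/-- If `Y` is represented by `(u, v)`, then `XY` is represented by `(u, Xv)` and `YX` by `(X*u, v)`:
the Gram matrices are equal. -/
theorem fredholmDet_one_add_comm [CompleteSpace E] [CompleteSpace F] (X : F →L[ℂ] E)
    {Y : E →L[ℂ] F} (hY : TC Y) :
    fredholmDet (1 + X ∘L Y) = fredholmDet (1 + Y ∘L X) := by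
  obtain ⟨u, v, h⟩ := hY
  rw [(h.comp_left X).fredholmDet_eq, (h.comp_right X).fredholmDet_eq]
  exact fdet_congr fun i j => (ContinuousLinearMap.adjoint_inner_left _ _ _).symm

/-- Multiplicativity holds for the compressions in finite dimension, but the product of compressions
is not the compression of the product. Both have explicit representations with the same limit in
square sum. -/
theorem fredholmDet_mul [CompleteSpace E] {K L : E →L[ℂ] E} (hK : TC K) (hL : TC L) :
    fredholmDet ((1 + K) * (1 + L)) = fredholmDet (1 + K) * fredholmDet (1 + L) := by
  obtain ⟨u, v, hK⟩ := hK
  obtain ⟨u', v', hL⟩ := hL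
  have hrep := (hK.comp_right (1 + L)).add hL
  have h1 : (1 + K) * (1 + L) = 1 + (K ∘L (1 + L) + L) := by
    ext x; simp; abel
  rw [h1, hrep.fredholmDet_eq, hK.fredholmDet_eq, hL.fredholmDet_eq]
  refine tendsto_nhds_unique ?_ (hK.tendsto_det.mul hL.tendsto_det)
  -- These are the left vectors of `K_V (1 + L_V)`, where the subscript denotes compression to `V`.
  -- They converge to `(1 + L)* u i`, which belongs to `K (1 + L)`.
  set U : {V : Submodule ℂ E // FiniteDimensional ℂ V} → ℕ → E := fun V i =>
    proj V (u i) + proj V (ContinuousLinearMap.adjoint L (proj V (u i))) with hU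
  have hdet : ∀ V, LinearMap.det (compression (1 + K) V) * LinearMap.det (compression (1 + L) V) =
      fdet (Sum.elim (U V) fun i => (proj V (u' i) : E))
        (Sum.elim (fun i => (proj V (v i) : E)) fun i => (proj V (v' i) : E)) := by
    intro V
    have := V.2
    rw [← map_mul, compression_one_add_apply, compression_one_add_apply]
    have h2 : (1 + compression K V) * (1 + compression L V) =
        1 + (compression K V * (1 + compression L V) + compression L V) := by noncomm_ring
    have hb : ∀ w : ℕ → E, Summable (fun i => ‖w i‖ ^ 2) →
        Summable fun i => ‖proj V (w i)‖ ^ 2 := fun w hw => summable_norm_sq_map hw (proj V)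
    set w : ℕ → V.1 := fun i => proj V (u i) + proj V (ContinuousLinearMap.adjoint L (proj V (u i)))
    have hw : Summable fun i => ‖w i‖ ^ 2 :=
      summable_norm_sq_map hK.left
        (proj V + (proj V ∘L (ContinuousLinearMap.adjoint L)) ∘L (V.1.subtypeL ∘L proj V))
    rw [h2, det_one_add_eq_fdet (u := Sum.elim w fun i => proj V (u' i))
      (v := Sum.elim (fun i => proj V (v i)) fun i => proj V (v' i))]
    · refine fdet_congr fun i j => ?_
      rcases i with i | i <;> rcases j with j | j <;> simp [w, hU]
    · exact Summable.sum _ hw (hb _ hL.left)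
    · exact Summable.sum _ (hb _ hK.right) (hb _ hL.right)
    · intro x
      refine HasSum.sum (f := fun i : ℕ ⊕ ℕ => ⟪Sum.elim w (fun i => proj V (u' i)) i, x⟫_ℂ •
        Sum.elim (fun i => proj V (v i)) (fun i => proj V (v' i)) i) ?_ ?_
      · have := (proj V).hasSum (hK.hasSum (x + proj V (L x)))
        have e : ∀ i, ⟪w i, x⟫_ℂ = ⟪u i, (x : E) + proj V (L x)⟫_ℂ := by
          intro i
          simp only [w, inner_add_left, inner_proj_left, inner_add_right]
          rw [ContinuousLinearMap.adjoint_inner_left, ← inner_proj_left V (u i) (proj V (L x)),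
            inner_proj_right]
        simp only [Function.comp_def, Sum.elim_inl, e]
        simpa only [Function.comp_def, map_smul, Module.End.mul_apply, LinearMap.add_apply,
          Module.End.one_apply, compression_apply, Submodule.coe_add] using this
      · have := (proj V).hasSum (hL.hasSum x)
        simpa only [Function.comp_def, inner_proj_left, compression_apply, map_smul,
          Sum.elim_inr] using this
  simp_rw [hdet]
  have hP : ∀ w : ℕ → E, ∀ i, Tendsto (fun V : {V : Submodule ℂ E // FiniteDimensional ℂ V} =>
      (proj V (w i) : E)) atTop (𝓝 (w i)) := fun w i =>
    tendsto_const_nhds.congr' ((eventually_proj_eq (w i)).mono fun V hV => hV.symm)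
  have hn : ∀ (V : {V : Submodule ℂ E // FiniteDimensional ℂ V}) (x : E),
      ‖(proj V x : E)‖ ≤ ‖x‖ := fun V x => norm_proj_le V x
  have hd : ∀ (V : {V : Submodule ℂ E // FiniteDimensional ℂ V}) (x : E),
      ‖(proj V x : E) - x‖ ≤ 2 * ‖x‖ := fun V x => by
    refine (norm_sub_le _ _).trans ?_
    linarith [hn V x]
  refine tendsto_fdet hrep.left hrep.right ?_ ?_
  · refine SqTendsto.of_dominated
      (c := Sum.elim (fun i => (2 + 2 * ‖ContinuousLinearMap.adjoint L‖) * ‖u i‖)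
        fun i => 2 * ‖u' i‖) ?_ ?_ ?_
    · refine Summable.sum _ ?_ ?_
      · simp only [Function.comp_def, Sum.elim_inl, mul_pow]
        exact hK.left.mul_left _
      · simp only [Function.comp_def, Sum.elim_inr, mul_pow]
        exact hL.left.mul_left _
    · rintro V (i | i)
      · simp only [Sum.elim_inl, hU, map_add, ContinuousLinearMap.add_apply]
        have h1 := hd V (u i)
        have h2 := hn V (ContinuousLinearMap.adjoint L (proj V (u i)))
        have h3 := ((ContinuousLinearMap.adjoint L).le_opNorm (proj V (u i))).trans
          (mul_le_mul_of_nonneg_left (hn V (u i)) (norm_nonneg _))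
        have h4 := (ContinuousLinearMap.adjoint L).le_opNorm (u i)
        have e : ContinuousLinearMap.adjoint (1 : E →L[ℂ] E) = 1 :=
          ContinuousLinearMap.adjoint_id
        rw [e, ContinuousLinearMap.one_apply, add_sub_add_comm]
        refine (norm_add_le _ _).trans ?_
        have h5 := norm_sub_le ((proj V (ContinuousLinearMap.adjoint L (proj V (u i))) : E))
          (ContinuousLinearMap.adjoint L (u i))
        linarith
      · exact hd V (u' i)
    · rintro (i | i)
      · refine tendsto_const_nhds.congr' ?_
        filter_upwards [eventually_proj_eq (u i),
          eventually_proj_eq (ContinuousLinearMap.adjoint L (u i))] with V h1 h2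
        simp only [Sum.elim_inl, hU, h1, h2, map_add, ContinuousLinearMap.add_apply]
        congr 1
        exact congrArg (fun T : E →L[ℂ] E => T (u i)) ContinuousLinearMap.adjoint_id
      · exact hP u' i
  · refine SqTendsto.of_dominated
      (c := Sum.elim (fun i => 2 * ‖v i‖) fun i => 2 * ‖v' i‖) ?_ ?_ ?_
    · refine Summable.sum _ ?_ ?_
      · simp only [Function.comp_def, Sum.elim_inl, mul_pow]
        exact hK.right.mul_left _
      · simp only [Function.comp_def, Sum.elim_inr, mul_pow]
        exact hL.right.mul_left _
    · rintro V (i | i)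
      · exact hd V (v i)
      · exact hd V (v' i)
    · rintro (i | i)
      · exact hP v i
      · exact hP v' i

/-- Moving `S` to the other side leaves `K S' S = K`; only a one-sided inverse is needed. -/
theorem fredholmDet_conj [CompleteSpace E] [CompleteSpace F] {K : E →L[ℂ] E} (hK : TC K)
    (S : E →L[ℂ] F) (S' : F →L[ℂ] E) (h : S' ∘L S = 1) :
    fredholmDet (1 + S ∘L K ∘L S') = fredholmDet (1 + K) := by
  rw [fredholmDet_one_add_comm S (hK.comp_right S'), ContinuousLinearMap.comp_assoc, h]
  rfl

/-- Jacobi's identity for complementary compressions. -/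
theorem fredholmDet_jacobi [CompleteSpace E] {A B P Q : E →L[ℂ] E} (hA : TC (A - 1))
    (hAB : A * B = 1) (hBA : B * A = 1) (hPQ : P + Q = 1) (hP : P * P = P) :
    TC (B - 1) ∧ fredholmDet (1 + P * (A - 1) * P) =
      fredholmDet A * fredholmDet (1 + Q * (B - 1) * Q) := by
  have hQ : Q = 1 - P := by rw [← hPQ]; abel
  have hQQ : Q * Q = Q := by rw [hQ]; noncomm_ring; rw [← sq, sq, hP]; abel
  have hB : B - 1 = -(B * (A - 1)) := by rw [mul_sub, hBA]; noncomm_ring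
  have hBt : TC (B - 1) := by
    rw [hB]; exact (hA.mul_left B).neg
  refine ⟨hBt, ?_⟩
  -- Cyclicity and `P² = P` replace the two-sided compression by a one-sided one, which behaves well
  -- under products.
  have e1 : fredholmDet (1 + P * ((A - 1) * P)) = fredholmDet (1 + (A - 1) * P) := by
    have := fredholmDet_one_add_comm P (hA.mul_right P)
    rw [← ContinuousLinearMap.mul_def, ← ContinuousLinearMap.mul_def] at this
    rw [this, mul_assoc, hP]
  have e2 : fredholmDet (1 + Q * ((B - 1) * Q)) = fredholmDet (1 + (B - 1) * Q) := by
    have := fredholmDet_one_add_comm Q (hBt.mul_right Q)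
    rw [← ContinuousLinearMap.mul_def, ← ContinuousLinearMap.mul_def] at this
    rw [this, mul_assoc, hQQ]
  rw [mul_assoc, e1, mul_assoc, e2]
  have e3 : A = 1 + (A - 1) := by abel
  rw [show fredholmDet A = fredholmDet (1 + (A - 1)) by rw [← e3],
    ← fredholmDet_mul hA (hBt.mul_right Q)]
  congr 1
  -- The heart of Jacobi's identity: since `AB = 1`, this product is `A + (1 - A) Q = 1 + (A - 1)
  -- P`.
  have e4 : (1 + (A - 1)) * (1 + (B - 1) * Q) = A + (A * B - A) * Q := by noncomm_ring
  rw [e4, hAB, hQ]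
  noncomm_ring

lemma isRep_orthonormalBasis {n : Type*} [Fintype n] (e : OrthonormalBasis n ℂ E)
    (K : E →L[ℂ] F) : IsRep K (fun i => e i) (fun i => K (e i)) :=
  ⟨Summable.of_finite, Summable.of_finite, fun x => by
    have : K x = ∑ i, ⟪e i, x⟫_ℂ • K (e i) := by
      conv_lhs => rw [← e.sum_repr' x]
      simp
    rw [this]
    exact hasSum_fintype _⟩

lemma TC.of_finiteDimensional [FiniteDimensional ℂ E] (K : E →L[ℂ] F) : TC K :=
  (isRep_orthonormalBasis (stdOrthonormalBasis ℂ E) K).tc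

/-- In finite dimensions the Fredholm determinant is the determinant. -/
theorem fredholmDet_eq_det [FiniteDimensional ℂ E] (A : E →L[ℂ] E) :
    fredholmDet A = LinearMap.det (A : E →ₗ[ℂ] E) := by
  have h := isRep_orthonormalBasis (stdOrthonormalBasis ℂ E) (A - 1)
  have h1 : A = 1 + (A - 1) := by abel
  rw [h1, h.fredholmDet_eq, ← det_one_add_eq_fdet h.left h.right ((A - 1 : E →L[ℂ] E) : E →ₗ[ℂ] E)
    h.hasSum]
  congr 1

lemma IsRep.hasSum_trace [FiniteDimensional ℂ E] {K : E →L[ℂ] E} {u v : ι → E} (h : IsRep K u v) :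
    HasSum (fun i => ⟪u i, v i⟫_ℂ) (LinearMap.trace ℂ E (K : E →ₗ[ℂ] E)) := by
  set e := stdOrthonormalBasis ℂ E
  rw [LinearMap.trace_eq_sum_inner _ e]
  have : (fun i => ⟪u i, v i⟫_ℂ) = fun i => ∑ k, ⟪e k, ⟪u i, e k⟫_ℂ • v i⟫_ℂ := by
    ext i
    simp_rw [inner_smul_right]
    rw [← e.sum_inner_mul_inner]
  rw [this]
  exact hasSum_sum fun k _ => (innerSL ℂ (e k)).hasSum (h.hasSum (e k))

end TraceClass

/-! ### Exponentials of Hilbert-Schmidt operators -/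

section ExpTail

variable {E F : Type*} [NormedAddCommGroup E] [NormedSpace ℂ E] [CompleteSpace E]
  [NormedAddCommGroup F] [NormedSpace ℂ F] [CompleteSpace F]

/-- The entire function `∑ xⁿ / (n + m)!` of a bounded operator. -/
def expTail (m : ℕ) (x : E →L[ℂ] E) : E →L[ℂ] E := ∑' n : ℕ, ((n + m).factorial : ℂ)⁻¹ • x ^ n

omit [CompleteSpace E] in
lemma norm_clm_pow_le (x : E →L[ℂ] E) (n : ℕ) : ‖x ^ n‖ ≤ ‖x‖ ^ n := by
  rcases n.eq_zero_or_pos with rfl | hn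
  · rw [pow_zero, pow_zero]
    exact ContinuousLinearMap.norm_id_le
  · exact norm_pow_le' x hn

omit [CompleteSpace E] in
lemma norm_expTail_term_le {C : ℝ} (m : ℕ) (x : E →L[ℂ] E) (hx : ‖x‖ ≤ C) (n : ℕ) :
    ‖((n + m).factorial : ℂ)⁻¹ • x ^ n‖ ≤ C ^ n / n.factorial := by
  rw [norm_smul, norm_inv, Complex.norm_natCast, div_eq_inv_mul]
  refine mul_le_mul ?_ ((norm_clm_pow_le x n).trans (pow_le_pow_left₀ (norm_nonneg _) hx n))
    (norm_nonneg _) (by positivity)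
  apply inv_anti₀ (by positivity)
  exact_mod_cast Nat.factorial_le (Nat.le_add_right n m)

lemma summable_expTail (m : ℕ) (x : E →L[ℂ] E) :
    Summable fun n : ℕ => ((n + m).factorial : ℂ)⁻¹ • x ^ n :=
  Summable.of_norm_bounded (Real.summable_pow_div_factorial ‖x‖) (norm_expTail_term_le m x le_rfl)

lemma expTail_eq (m : ℕ) (x : E →L[ℂ] E) :
    expTail m x = (m.factorial : ℂ)⁻¹ • 1 + x * expTail (m + 1) x := by
  rw [expTail, (summable_expTail m x).tsum_eq_zero_add, expTail,
    ← (summable_expTail (m + 1) x).tsum_mul_left]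
  simp only [zero_add, pow_zero]
  congr 1
  refine tsum_congr fun n => ?_
  rw [mul_smul_comm, ← pow_succ', add_right_comm, add_assoc]

lemma exp_eq_expTail (x : E →L[ℂ] E) : NormedSpace.exp x = expTail 0 x := by
  rw [NormedSpace.exp_eq_tsum ℂ]
  rfl

lemma commute_expTail (m : ℕ) (x : E →L[ℂ] E) : x * expTail m x = expTail m x * x := by
  rw [expTail, ← (summable_expTail m x).tsum_mul_left, ← (summable_expTail m x).tsum_mul_right]
  refine tsum_congr fun n => ?_
  rw [mul_smul_comm, smul_mul_assoc, ← pow_succ, ← pow_succ']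

lemma exp_eq_one_add (x : E →L[ℂ] E) : NormedSpace.exp x = 1 + expTail 1 x * x := by
  rw [exp_eq_expTail, expTail_eq, ← commute_expTail]
  simp

lemma expTail_one_eq (x : E →L[ℂ] E) : expTail 1 x = 1 + expTail 2 x * x := by
  rw [expTail_eq, ← commute_expTail]
  simp

lemma tendsto_expTail {α : Type*} {l : Filter α} (m : ℕ) {X : α → E →L[ℂ] E} {x : E →L[ℂ] E}
    (h : Tendsto X l (𝓝 x)) : Tendsto (fun a => expTail m (X a)) l (𝓝 (expTail m x)) := by
  have hb : ∀ᶠ a in l, ‖X a‖ ≤ ‖x‖ + 1 :=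
    (h.norm.eventually (gt_mem_nhds (lt_add_one ‖x‖))).mono fun a ha => le_of_lt ha
  refine tendsto_tsum_of_dominated_convergence (Real.summable_pow_div_factorial (‖x‖ + 1))
    (fun n => (h.pow n).const_smul _) ?_
  filter_upwards [hb] with a ha n using norm_expTail_term_le m _ ha n

/-- Intertwining passes to exponentials. -/
lemma exp_comp_eq {x : E →L[ℂ] E} {y : F →L[ℂ] F} {A : E →L[ℂ] F} (h : A ∘L x = y ∘L A) :
    A ∘L NormedSpace.exp x = NormedSpace.exp y ∘L A := by
  have hn : ∀ n : ℕ, A ∘L (x ^ n) = (y ^ n) ∘L A := by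
    intro n
    induction n with
    | zero => rfl
    | succ n ih =>
      rw [pow_succ, pow_succ, ContinuousLinearMap.mul_def, ContinuousLinearMap.mul_def,
        ← ContinuousLinearMap.comp_assoc, ih, ContinuousLinearMap.comp_assoc, h,
        ContinuousLinearMap.comp_assoc]
  rw [exp_eq_expTail, exp_eq_expTail]
  have h1 := (ContinuousLinearMap.compL ℂ E E F A).hasSum (summable_expTail 0 x).hasSum
  have h2 := ((ContinuousLinearMap.compL ℂ E F F).flip A).hasSum (summable_expTail 0 y).hasSum
  refine h1.unique ?_
  have e : (fun n : ℕ => (ContinuousLinearMap.compL ℂ E E F A) (((n + 0).factorial : ℂ)⁻¹ • x ^ n)) =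
      fun n => (ContinuousLinearMap.compL ℂ E F F).flip A (((n + 0).factorial : ℂ)⁻¹ • y ^ n) := by
    ext1 n
    simp only [map_smul, ContinuousLinearMap.compL_apply, ContinuousLinearMap.flip_apply, hn]
  rw [e]
  exact h2

end ExpTail

/-! ### The determinant of the exponential in finite dimension. -/

section DetExp

attribute [local instance] Matrix.linftyOpNormedRing Matrix.linftyOpNormedAlgebra

variable {n : Type*} [Fintype n] [DecidableEq n]

/-- The curves `1 + tA` and `exp(tA)` have the same velocity at `0`, so by the chain rule the
determinant has the same derivative along both; along the first it is known to be the trace. -/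
lemma hasDerivAt_det_exp_zero (A : Matrix n n ℂ) :
    HasDerivAt (fun t : ℂ => (NormedSpace.exp (t • A)).det) A.trace 0 := by
  have hd : DifferentiableAt ℂ (fun M : Matrix n n ℂ => M.det) 1 := by
    have he : ∀ i j, Differentiable ℂ (fun M : Matrix n n ℂ => M i j) := fun i j =>
      (LinearMap.toContinuousLinearMap (Matrix.entryLinearMap ℂ ℂ i j)).differentiable
    simp only [Matrix.det_apply]
    fun_prop
  have h0 : HasDerivAt (fun t : ℂ => (1 : Matrix n n ℂ) + t • A) A 0 := by
    have := ((hasDerivAt_id (0 : ℂ)).smul_const A).const_add (1 : Matrix n n ℂ)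
    rwa [one_smul] at this
  have h1 : HasDerivAt (fun t : ℂ => (1 + t • A).det) A.trace 0 := by
    have hp : (fun t : ℂ => (1 + t • A).det) =
        fun t => Polynomial.eval t (1 + (Polynomial.X : Polynomial ℂ) • A.map Polynomial.C).det := by
      ext t
      rw [← Polynomial.coe_evalRingHom, RingHom.map_det]
      congr 1
      ext i j
      by_cases hij : i = j <;> simp [hij] <;> ring
    rw [hp, ← Matrix.derivative_det_one_add_X_smul]
    exact Polynomial.hasDerivAt _ _
  have h2 : HasDerivAt (fun t : ℂ => NormedSpace.exp (t • A)) A 0 := by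
    have := hasDerivAt_exp_smul_const A (0 : ℂ)
    rw [zero_smul, NormedSpace.exp_zero, one_mul] at this
    exact this
  have hfd := hd.hasFDerivAt
  have h3 := HasFDerivAt.comp_hasDerivAt_of_eq (0 : ℂ) hfd h0 (by simp)
  have h4 := HasFDerivAt.comp_hasDerivAt_of_eq (0 : ℂ) hfd h2 (by simp)
  rw [← h3.unique h1]
  exact h4

/-- The function `t ↦ det exp(tA)` is multiplicative, which carries the derivative at `0` to every
`t` and gives `g' = (tr A) g`. Hence `g(t) exp(-t tr A)` is constant. -/
lemma det_exp_matrix (A : Matrix n n ℂ) : (NormedSpace.exp A).det = Complex.exp A.trace := by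
  set g : ℂ → ℂ := fun t => (NormedSpace.exp (t • A)).det with hg
  have hmul : ∀ s t, g (s + t) = g s * g t := by
    intro s t
    simp only [hg, add_smul]
    rw [Matrix.exp_add_of_commute, Matrix.det_mul]
    exact (Commute.refl A).smul_left s |>.smul_right t
  have hder : ∀ t, HasDerivAt g (A.trace * g t) t := by
    intro t
    have h := (hasDerivAt_det_exp_zero A).mul_const (g t)
    have h' : HasDerivAt (fun s => g (s - t) * g t) (A.trace * g t) t := by
      have : HasDerivAt (fun s : ℂ => (NormedSpace.exp (s • A)).det * g t) (A.trace * g t) (t - t) := by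
        simpa using h
      exact this.comp_sub_const t t
    refine h'.congr_of_eventuallyEq (Eventually.of_forall fun s => ?_)
    change g s = g (s - t) * g t
    rw [← hmul, sub_add_cancel]
  have hconst : ∀ t, HasDerivAt (fun t => g t * Complex.exp (-(t * A.trace))) 0 t := by
    intro t
    have h2 : HasDerivAt (fun t : ℂ => Complex.exp (-(t * A.trace)))
        (Complex.exp (-(t * A.trace)) * -(1 * A.trace)) t :=
      (((hasDerivAt_id t).mul_const _).neg).cexp
    have h3 := (hder t).mul h2
    rwa [show A.trace * g t * Complex.exp (-(t * A.trace)) +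
      g t * (Complex.exp (-(t * A.trace)) * -(1 * A.trace)) = 0 by ring] at h3
  have := is_const_of_deriv_eq_zero (fun t => (hconst t).differentiableAt)
    (fun t => (hconst t).deriv) 1 0
  have hg0 : g 0 = 1 := by simp [hg]
  simp only [hg0, zero_mul, neg_zero, Complex.exp_zero, one_mul, mul_one] at this
  have hg1 : g 1 = (NormedSpace.exp A).det := by simp [hg]
  rw [← hg1]
  rw [Complex.exp_neg, mul_inv_eq_one₀ (Complex.exp_ne_zero _)] at this
  exact this

variable {E : Type*} [NormedAddCommGroup E] [InnerProductSpace ℂ E] [FiniteDimensional ℂ E]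

lemma det_exp_clm (x : E →L[ℂ] E) :
    LinearMap.det (NormedSpace.exp x : E →L[ℂ] E).toLinearMap =
      Complex.exp (LinearMap.trace ℂ E x.toLinearMap) := by
  have hc : CompleteSpace E := FiniteDimensional.complete ℂ E
  set e := stdOrthonormalBasis ℂ E
  rw [← LinearMap.det_toMatrix e.toBasis, LinearMap.trace_eq_matrix_trace ℂ e.toBasis,
    ← det_exp_matrix]
  congr 1
  set f : (E →L[ℂ] E) →+* Matrix (Fin (Module.finrank ℂ E)) (Fin (Module.finrank ℂ E)) ℂ :=
    (LinearMap.toMatrixAlgEquiv e.toBasis).toRingEquiv.toRingHom.comp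
      (ContinuousLinearMap.toLinearMapRingHom) with hf
  have hfc : Continuous f :=
    ((LinearMap.toMatrix e.toBasis e.toBasis).toLinearMap ∘ₗ
      (ContinuousLinearMap.coeLM ℂ : (E →L[ℂ] E) →ₗ[ℂ] (E →ₗ[ℂ] E))).continuous_of_finiteDimensional
  letI : NormedAlgebra ℚ (E →L[ℂ] E) := NormedAlgebra.restrictScalars ℚ ℂ _
  exact NormedSpace.map_exp f hfc x

end DetExp

/-! ### Products of exponentials of Hilbert–Schmidt operators. -/

section ExpDet

variable {ι κ : Type*} {E F G : Type*}
  [NormedAddCommGroup E] [InnerProductSpace ℂ E] [CompleteSpace E]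
  [NormedAddCommGroup F] [InnerProductSpace ℂ F] [CompleteSpace F]
  [NormedAddCommGroup G] [InnerProductSpace ℂ G] [CompleteSpace G]

omit [CompleteSpace E] [CompleteSpace F] in
lemma norm_le_sqrt_tsum (g : HilbertBasis κ ℂ E) {X : E →L[ℂ] F}
    (h : Summable fun i => ‖X (g i)‖ ^ 2) : ‖X‖ ≤ Real.sqrt (∑' i, ‖X (g i)‖ ^ 2) := by
  refine X.opNorm_le_bound (Real.sqrt_nonneg _) fun f => ?_
  have h1 := X.hasSum (g.hasSum_repr f)
  refine le_of_tendsto h1.norm (Eventually.of_forall fun s => ?_)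
  calc ‖∑ i ∈ s, X (g.repr f i • g i)‖ ≤ ∑ i ∈ s, ‖⟪g i, f⟫_ℂ‖ * ‖X (g i)‖ := by
        refine (norm_sum_le _ _).trans (le_of_eq ?_)
        refine Finset.sum_congr rfl fun i _ => ?_
        rw [map_smul, norm_smul, g.repr_apply_apply]
    _ ≤ Real.sqrt (∑ i ∈ s, ‖⟪g i, f⟫_ℂ‖ ^ 2) * Real.sqrt (∑ i ∈ s, ‖X (g i)‖ ^ 2) :=
        Real.sum_mul_le_sqrt_mul_sqrt _ _ _
    _ ≤ ‖f‖ * Real.sqrt (∑' i, ‖X (g i)‖ ^ 2) := by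
        refine mul_le_mul ?_ (Real.sqrt_le_sqrt (h.sum_le_tsum s fun _ _ => sq_nonneg _))
          (Real.sqrt_nonneg _) (norm_nonneg _)
        rw [← Real.sqrt_sq (norm_nonneg f)]
        exact Real.sqrt_le_sqrt (g.orthonormal.sum_inner_products_le f)
    _ = _ := mul_comm _ _

/-- The product of two Hilbert-Schmidt operators. -/
lemma isRep_comp (g : HilbertBasis κ ℂ F) {S : F →L[ℂ] G} {T : E →L[ℂ] F}
    (hS : Summable fun i => ‖S (g i)‖ ^ 2)
    (hT : Summable fun i => ‖ContinuousLinearMap.adjoint T (g i)‖ ^ 2) :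
    IsRep (S ∘L T) (fun i => ContinuousLinearMap.adjoint T (g i)) (fun i => S (g i)) :=
  ⟨hT, hS, fun x => by
    have := S.hasSum (g.hasSum_repr (T x))
    simpa [Function.comp_def, g.repr_apply_apply, ContinuousLinearMap.adjoint_inner_left] using this⟩

omit [InnerProductSpace ℂ E] [CompleteSpace E] in
lemma SqTendsto.sum {α : Type*} {l : Filter α} {U : α → ι → E} {u : ι → E}
    {V : α → κ → E} {v : κ → E} (h : SqTendsto U l u) (h' : SqTendsto V l v) :
    SqTendsto (fun a => Sum.elim (U a) (V a)) l (Sum.elim u v) := by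
  have hs : ∀ a, Summable fun i => ‖Sum.elim (U a) (V a) i - Sum.elim u v i‖ ^ 2 := fun a =>
    Summable.sum _ (h.summable a) (h'.summable a)
  refine ⟨hs, ?_⟩
  have := h.tendsto.add h'.tendsto
  rw [add_zero] at this
  refine this.congr fun a => ?_
  exact (HasSum.sum (f := fun i => ‖Sum.elim (U a) (V a) i - Sum.elim u v i‖ ^ 2)
    (h.summable a).hasSum (h'.summable a).hasSum).tsum_eq.symm

omit [CompleteSpace E] [CompleteSpace F] in
lemma SqTendsto.map {α : Type*} {l : Filter α} {U : α → ι → E} {u : ι → E}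
    (h : SqTendsto U l u) (hu : Summable fun i => ‖u i‖ ^ 2) {A : α → E →L[ℂ] F} {A₀ : E →L[ℂ] F}
    (hA : Tendsto A l (𝓝 A₀)) :
    SqTendsto (fun a i => A a (U a i)) l (fun i => A₀ (u i)) := by
  have hle : ∀ a i, ‖A a (U a i) - A₀ (u i)‖ ^ 2 ≤
      2 * ‖A a‖ ^ 2 * ‖U a i - u i‖ ^ 2 + 2 * ‖A a - A₀‖ ^ 2 * ‖u i‖ ^ 2 := by
    intro a i
    have h1 : A a (U a i) - A₀ (u i) = A a (U a i - u i) + (A a - A₀) (u i) := by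
      simp
    have h2 : ‖A a (U a i) - A₀ (u i)‖ ≤ ‖A a‖ * ‖U a i - u i‖ + ‖A a - A₀‖ * ‖u i‖ := by
      rw [h1]
      exact (norm_add_le _ _).trans (add_le_add ((A a).le_opNorm _) ((A a - A₀).le_opNorm _))
    have h3 := pow_le_pow_left₀ (norm_nonneg _) h2 2
    nlinarith [sq_nonneg (‖A a‖ * ‖U a i - u i‖ - ‖A a - A₀‖ * ‖u i‖)]
  have hs : ∀ a, Summable fun i =>
      2 * ‖A a‖ ^ 2 * ‖U a i - u i‖ ^ 2 + 2 * ‖A a - A₀‖ ^ 2 * ‖u i‖ ^ 2 := fun a =>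
    ((h.summable a).mul_left _).add (hu.mul_left _)
  refine ⟨fun a => Summable.of_nonneg_of_le (fun _ => sq_nonneg _) (hle a) (hs a), ?_⟩
  have ht : Tendsto (fun a => 2 * ‖A a‖ ^ 2 * (∑' i, ‖U a i - u i‖ ^ 2) +
      2 * ‖A a - A₀‖ ^ 2 * ∑' i, ‖u i‖ ^ 2) l (𝓝 (2 * ‖A₀‖ ^ 2 * 0 +
      2 * ‖A₀ - A₀‖ ^ 2 * ∑' i, ‖u i‖ ^ 2)) :=
    (((hA.norm.pow 2).const_mul 2).mul h.tendsto).add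
      ((((hA.sub_const A₀).norm.pow 2).const_mul 2).mul_const _)
  rw [sub_self, norm_zero] at ht
  simp only [ne_eq, OfNat.ofNat_ne_zero, not_false_eq_true, zero_pow, mul_zero, zero_mul,
    add_zero] at ht
  refine squeeze_zero (fun a => tsum_nonneg fun _ => sq_nonneg _) (fun a => ?_) ht
  rw [← tsum_mul_left, ← tsum_mul_left,
    ← ((h.summable a).mul_left _).tsum_add (hu.mul_left _)]
  exact (Summable.of_nonneg_of_le (fun _ => sq_nonneg _) (hle a) (hs a)).tsum_le_tsum (hle a) (hs a)

/-- On the range of the idempotent `j r` the exponential is that of the compressed operator, and on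
the complementary range it is the identity. -/
lemma exp_compress {j : E →L[ℂ] F} {r : F →L[ℂ] E} (hj : r ∘L j = 1) (x : F →L[ℂ] F) :
    NormedSpace.exp (j ∘L r * x * j ∘L r) =
      1 + j ∘L ((NormedSpace.exp (r ∘L x ∘L j) - 1) ∘L r) := by
  set P := j ∘L r with hP
  set X := r ∘L x ∘L j
  have hrj : ∀ v, r (j v) = v := fun v => congrArg (fun T : E →L[ℂ] E => T v) hj
  have hPP : P * P = P := by ext v; simp [hP, hrj]
  have h1 := exp_comp_eq (x := X) (y := P * x * P) (A := j) (by
    ext v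
    simp [X, hP, hrj])
  have h2 : NormedSpace.exp (P * x * P) * P = j ∘L NormedSpace.exp X ∘L r := by
    rw [← ContinuousLinearMap.comp_assoc, h1]
    rfl
  have h3 : NormedSpace.exp (P * x * P) * (1 - P) = 1 - P := by
    rw [exp_eq_one_add, add_mul, one_mul, mul_assoc, mul_assoc (P * x), mul_sub, mul_one, hPP,
      sub_self, mul_zero, mul_zero, add_zero]
  calc NormedSpace.exp (P * x * P)
      = NormedSpace.exp (P * x * P) * P + NormedSpace.exp (P * x * P) * (1 - P) := by
        rw [← mul_add]; simp
    _ = _ := by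
        rw [h2, h3]
        ext v
        simp [hP]
        abel

/-- For finite-rank truncations the determinant is `exp(tr X) exp(tr Y) = exp(tr(X + Y))`. The trace
is read off from a representation of the sum, since only the sum has a trace in the limit. -/
lemma fredholmDet_exp_compress [FiniteDimensional ℂ E] {j : E →L[ℂ] F} {r : F →L[ℂ] E}
    (hj : r ∘L j = 1) (hr : ∀ w v, ⟪r w, v⟫_ℂ = ⟪w, j v⟫_ℂ) (x y : F →L[ℂ] F)
    {a b : ι → F} (h : IsRep (x + y) a b) :
    fredholmDet (NormedSpace.exp (j ∘L r * x * j ∘L r) *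
      NormedSpace.exp (j ∘L r * y * j ∘L r)) = Complex.exp (∑' i, ⟪r (a i), r (b i)⟫_ℂ) := by
  set X := r ∘L x ∘L j with hX
  set Y := r ∘L y ∘L j with hY
  have hrj : ∀ v, r (j v) = v := fun v => congrArg (fun T : E →L[ℂ] E => T v) hj
  have h1 : NormedSpace.exp (j ∘L r * x * j ∘L r) * NormedSpace.exp (j ∘L r * y * j ∘L r) =
      1 + j ∘L ((NormedSpace.exp X * NormedSpace.exp Y - 1) ∘L r) := by
    rw [exp_compress hj, exp_compress hj]
    ext v
    simp [← hX, ← hY, hrj]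
    abel
  rw [h1, fredholmDet_one_add_comm _ (TC.comp_right (TC.of_finiteDimensional _) _),
    ContinuousLinearMap.comp_assoc, hj]
  have h2 : (1 : E →L[ℂ] E) + (NormedSpace.exp X * NormedSpace.exp Y - 1) ∘L 1 =
      NormedSpace.exp X * NormedSpace.exp Y := by
    ext v; simp
  have h3 : (NormedSpace.exp X * NormedSpace.exp Y : E →L[ℂ] E).toLinearMap =
      (NormedSpace.exp X : E →L[ℂ] E).toLinearMap * (NormedSpace.exp Y : E →L[ℂ] E).toLinearMap := rfl
  rw [h2, fredholmDet_eq_det, h3, map_mul, det_exp_clm, det_exp_clm, ← Complex.exp_add, ← map_add]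
  congr 1
  have h4 : IsRep (X + Y) (fun i => r (a i)) (fun i => r (b i)) := by
    refine ⟨summable_norm_sq_map h.left _, summable_norm_sq_map h.right _, fun v => ?_⟩
    have := r.hasSum (h.hasSum (j v))
    simp only [hr]
    simpa only [Function.comp_def, map_smul, ContinuousLinearMap.add_apply, map_add, hX, hY,
      ContinuousLinearMap.comp_apply] using this
  exact h4.hasSum_trace.tsum_eq.symm

/-- The determinant of `e^x e^y` for Hilbert-Schmidt operators `x` and `y` with `x + y` of trace
class. -/
theorem fredholmDet_exp_mul_exp [Countable κ] [Countable ι] (g : HilbertBasis κ ℂ F)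
    {x y : F →L[ℂ] F} (hx : Summable fun i => ‖x (g i)‖ ^ 2)
    (hx' : Summable fun i => ‖ContinuousLinearMap.adjoint x (g i)‖ ^ 2)
    (hy : Summable fun i => ‖y (g i)‖ ^ 2)
    (hy' : Summable fun i => ‖ContinuousLinearMap.adjoint y (g i)‖ ^ 2)
    {a b : ι → F} (h : IsRep (x + y) a b) :
    TC (NormedSpace.exp x * NormedSpace.exp y - 1) ∧
    fredholmDet (NormedSpace.exp x * NormedSpace.exp y) = Complex.exp (∑' i, ⟪a i, b i⟫_ℂ) := by
  classical
  -- the general representation of `e^X e^Y - 1`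
  have hrep : ∀ (X Y : F →L[ℂ] F) (a b : ι → F), (Summable fun i => ‖X (g i)‖ ^ 2) →
      (Summable fun i => ‖ContinuousLinearMap.adjoint X (g i)‖ ^ 2) →
      (Summable fun i => ‖Y (g i)‖ ^ 2) →
      (Summable fun i => ‖ContinuousLinearMap.adjoint Y (g i)‖ ^ 2) → IsRep (X + Y) a b →
      IsRep (NormedSpace.exp X * NormedSpace.exp Y - 1)
        (Sum.elim a (Sum.elim (fun i => ContinuousLinearMap.adjoint X (g i))
          (Sum.elim (fun i => ContinuousLinearMap.adjoint Y (g i))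
            (fun i => ContinuousLinearMap.adjoint (expTail 1 Y)
              (ContinuousLinearMap.adjoint Y (g i))))))
        (Sum.elim b (Sum.elim (fun i => expTail 2 X (X (g i)))
          (Sum.elim (fun i => expTail 2 Y (Y (g i))) (fun i => expTail 1 X (X (g i)))))) := by
    intro X Y a b h1 h2 h3 h4 h5
    have := h5.add (((isRep_comp g h1 h2).comp_left (expTail 2 X)).add
      (((isRep_comp g h3 h4).comp_left (expTail 2 Y)).add
        (((isRep_comp g h1 h4).comp_right (expTail 1 Y)).comp_left (expTail 1 X))))
    convert this using 1
    simp only [← ContinuousLinearMap.mul_def]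
    -- After the linear terms, which combine to `X + Y`, every remaining term contains a product of
    -- two Hilbert–Schmidt operators and is therefore represented by square summable families.
    have e1 : NormedSpace.exp X = 1 + X + expTail 2 X * (X * X) := by
      rw [exp_eq_one_add, expTail_one_eq]; noncomm_ring
    have e2 : NormedSpace.exp Y = 1 + Y + expTail 2 Y * (Y * Y) := by
      rw [exp_eq_one_add, expTail_one_eq]; noncomm_ring
    have e3 : NormedSpace.exp X * NormedSpace.exp Y - 1 = (NormedSpace.exp X - 1) +
        (NormedSpace.exp Y - 1) + (NormedSpace.exp X - 1) * (NormedSpace.exp Y - 1) := by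
      noncomm_ring
    have e4 : (NormedSpace.exp X - 1) * (NormedSpace.exp Y - 1) =
        expTail 1 X * (X * Y * expTail 1 Y) := by
      rw [exp_eq_one_add, exp_eq_one_add, ← commute_expTail 1 Y]; noncomm_ring
    rw [e3, e4, e1, e2]
    abel
  have H := hrep x y a b hx hx' hy hy' h
  refine ⟨H.tc, ?_⟩
  set V : Finset κ → Submodule ℂ F := fun s => Submodule.span ℂ (s.image (g : κ → F) : Set F) with hV
  have hVf : ∀ s, FiniteDimensional ℂ (V s) := fun s => FiniteDimensional.span_finset ℂ _
  set P : Finset κ → F →L[ℂ] F := fun s => (V s).starProjection with hP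
  have hPg : ∀ s i, P s (g i) = if i ∈ s then g i else 0 := by
    intro s i
    split_ifs with hi
    · refine Submodule.starProjection_eq_self_iff.2 (Submodule.subset_span ?_)
      simpa using ⟨i, hi, rfl⟩
    · refine (Submodule.starProjection_apply_eq_zero_iff _).2 ?_
      intro u hu
      refine Submodule.span_induction (p := fun u _ => ⟪u, g i⟫_ℂ = 0) ?_ (by simp) ?_ ?_ hu
      · intro w hw
        simp only [Finset.coe_image, Set.mem_image, Finset.mem_coe] at hw
        obtain ⟨k, hk, rfl⟩ := hw
        exact g.orthonormal.2 (fun e => hi (e ▸ hk))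
      · intro _ _ _ _ e1 e2
        rw [inner_add_left, e1, e2, add_zero]
      · intro c _ _ e1
        rw [inner_smul_left, e1, mul_zero]
  have hPt : ∀ f, Tendsto (fun s => P s f) atTop (𝓝 f) := by
    intro f
    refine Submodule.starProjection_tendsto_self V ?_ f ?_
    · intro s t hst
      exact Submodule.span_mono (by
        intro w hw
        simp only [Finset.coe_image, Set.mem_image, Finset.mem_coe] at hw ⊢
        obtain ⟨k, hk, rfl⟩ := hw
        exact ⟨k, hst hk, rfl⟩)
    · exact g.finite_spans_dense.ge
  have hPn : ∀ s f, ‖P s f‖ ≤ ‖f‖ := fun s f => (V s).norm_starProjection_apply_le f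
  have hPadj : ∀ s, ContinuousLinearMap.adjoint (P s) = P s := fun s =>
    (ContinuousLinearMap.isSelfAdjoint_iff'.1 (isSelfAdjoint_starProjection (V s)))
  -- convergence of the compressions
  have hconv : ∀ X : F →L[ℂ] F, (Summable fun i => ‖X (g i)‖ ^ 2) →
      SqTendsto (fun s i => (P s * X * P s) (g i)) atTop (fun i => X (g i)) := by
    intro X hX
    refine SqTendsto.of_dominated (c := fun i => 2 * ‖X (g i)‖) ?_ ?_ ?_
    · simpa only [mul_pow] using hX.mul_left (2 ^ 2)
    · intro s i
      change ‖P s (X (P s (g i))) - X (g i)‖ ≤ 2 * ‖X (g i)‖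
      rw [hPg]
      split_ifs
      · refine (norm_sub_le _ _).trans ?_
        linarith [hPn s (X (g i))]
      · simp only [map_zero, zero_sub, norm_neg]
        linarith [norm_nonneg (X (g i))]
    · intro i
      refine (hPt (X (g i))).congr' ?_
      filter_upwards [eventually_ge_atTop {i}] with s hs
      have : i ∈ s := hs (Finset.mem_singleton_self i)
      simp [hPg, this]
  -- The operator norm is dominated by the Hilbert–Schmidt norm, so the truncations converge in
  -- operator norm and the exponential tails converge with them.
  have hop : ∀ X : F →L[ℂ] F, (Summable fun i => ‖X (g i)‖ ^ 2) →
      Tendsto (fun s => P s * X * P s) atTop (𝓝 X) := by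
    intro X hX
    have h1 := hconv X hX
    rw [tendsto_iff_norm_sub_tendsto_zero]
    have h2 := h1.tendsto.sqrt
    rw [Real.sqrt_zero] at h2
    refine squeeze_zero (fun _ => norm_nonneg _) (fun s => ?_) h2
    exact norm_le_sqrt_tsum g (X := P s * X * P s - X) (h1.summable s)
  have hadj : ∀ (X : F →L[ℂ] F) s, ContinuousLinearMap.adjoint (P s * X * P s) =
      P s * ContinuousLinearMap.adjoint X * P s := by
    intro X s
    rw [ContinuousLinearMap.mul_def, ContinuousLinearMap.mul_def, ContinuousLinearMap.adjoint_comp,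
      ContinuousLinearMap.adjoint_comp, hPadj]
    rfl
  have hsq : ∀ w : ι → F, (Summable fun i => ‖w i‖ ^ 2) →
      SqTendsto (fun s i => P s (w i)) atTop w := fun w hw => by
    refine SqTendsto.of_dominated (c := fun i => 2 * ‖w i‖) ?_ ?_ fun i => hPt (w i)
    · simp_rw [mul_pow]
      exact hw.mul_left _
    · intro s i
      refine (norm_sub_le _ _).trans ?_
      linarith [hPn s (w i)]
  have hreps : ∀ s, IsRep (P s * x * P s + P s * y * P s) (fun i => P s (a i))
      (fun i => P s (b i)) := by
    intro s
    have := (h.comp_right (P s)).comp_left (P s)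
    rw [hPadj] at this
    convert this using 1
    ext f; simp
  have hcx := hconv x hx
  have hcx' := hconv _ hx'
  have hcy := hconv y hy
  have hcy' := hconv _ hy'
  have hcxs := fun s => hcx.summable_sq hx s
  have hcys := fun s => hcy.summable_sq hy s
  have hcxs' := fun s => hcx'.summable_sq hx' s
  have hcys' := fun s => hcy'.summable_sq hy' s
  have Hs := fun s => hrep (P s * x * P s) (P s * y * P s) _ _ (hcxs s)
    (by simpa only [hadj] using hcxs' s) (hcys s) (by simpa only [hadj] using hcys' s) (hreps s)
  have lim1 : Tendsto (fun s => fredholmDet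
      (NormedSpace.exp (P s * x * P s) * NormedSpace.exp (P s * y * P s))) atTop
      (𝓝 (fredholmDet (NormedSpace.exp x * NormedSpace.exp y))) := by
    have e : ∀ T : F →L[ℂ] F, fredholmDet T = fredholmDet (1 + (T - 1)) := fun T => by
      congr 1; abel
    rw [e, H.fredholmDet_eq]
    simp_rw [e (NormedSpace.exp (P _ * x * P _) * NormedSpace.exp (P _ * y * P _)),
      fun s => (Hs s).fredholmDet_eq, hadj]
    refine tendsto_fdet H.left H.right ?_ ?_
    · refine (hsq a h.left).sum (hcx'.sum (hcy'.sum (hcy'.map hy' ?_)))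
      exact (ContinuousLinearMap.adjoint.continuous.tendsto _).comp
        (tendsto_expTail 1 (hop y hy))
    · exact (hsq b h.right).sum ((hcx.map hx (tendsto_expTail 2 (hop x hx))).sum
        ((hcy.map hy (tendsto_expTail 2 (hop y hy))).sum
          (hcx.map hx (tendsto_expTail 1 (hop x hx)))))
  -- The traces converge by dominated convergence, as `|⟪P a, P b⟫| ≤ ‖a‖ ‖b‖ ≤ ‖a‖² + ‖b‖²`.
  have lim2 : Tendsto (fun s => Complex.exp (∑' i, ⟪P s (a i), P s (b i)⟫_ℂ)) atTop
      (𝓝 (Complex.exp (∑' i, ⟪a i, b i⟫_ℂ))) := by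
    refine (Complex.continuous_exp.tendsto _).comp ?_
    refine tendsto_tsum_of_dominated_convergence (h.left.add h.right)
      (fun i => (hPt (a i)).inner (hPt (b i))) (Eventually.of_forall fun s i => ?_)
    refine (norm_inner_le_norm _ _).trans ?_
    have := mul_le_mul (hPn s (a i)) (hPn s (b i)) (norm_nonneg _) (norm_nonneg _)
    nlinarith [sq_nonneg (‖a i‖ - ‖b i‖), sq_nonneg ‖a i‖, sq_nonneg ‖b i‖]
  refine tendsto_nhds_unique lim1 (lim2.congr fun s => ?_)
  have := fredholmDet_exp_compress (j := (V s).subtypeL) (r := (V s).orthogonalProjectionOnto)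
    (by ext v; simp) (fun w v => Submodule.inner_orthogonalProjectionOnto_eq_of_mem_right v w) x y h
  refine Eq.trans ?_ this.symm
  congr 1

end ExpDet

/-! ### Toeplitz and Hankel operators over an abstract Hardy space -/

section Hardy

variable {E L F : Type*}
  [NormedAddCommGroup E] [InnerProductSpace ℂ E] [CompleteSpace E]
  [NormedAddCommGroup L] [InnerProductSpace ℂ L]
  [NormedAddCommGroup F] [InnerProductSpace ℂ F] [CompleteSpace F]

/-- An inclusion `i : E → L` with left inverse `r` such that `L` is the direct sum of the range of
`i` and its image under the involution `J`. -/
structure HardySetup (i : E →L[ℂ] L) (r : L →L[ℂ] E) (J : L →L[ℂ] L) : Prop where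
  retract : r ∘L i = 1
  invol : J * J = 1
  decomp : i ∘L r + J * (i ∘L r) * J = 1

/-- The compression of `m` to the Hardy space. -/
def toep (i : E →L[ℂ] L) (r : L →L[ℂ] E) (m : L →L[ℂ] L) : E →L[ℂ] E := r ∘L m ∘L i

/-- The Hankel operator of `m`. -/
def hank (i : E →L[ℂ] L) (r : L →L[ℂ] E) (J m : L →L[ℂ] L) : E →L[ℂ] E := r ∘L m ∘L J ∘L i

variable {i : E →L[ℂ] L} {r : L →L[ℂ] E} {J : L →L[ℂ] L}

namespace HardySetup

omit [CompleteSpace E] in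
lemma apply_decomp (h : HardySetup i r J) (x : L) : i (r x) + J (i (r (J x))) = x :=
  congrArg (fun T : L →L[ℂ] L => T x) h.decomp

omit [CompleteSpace E] in
lemma apply_invol (h : HardySetup i r J) (x : L) : J (J x) = x :=
  congrArg (fun T : L →L[ℂ] L => T x) h.invol

omit [CompleteSpace E] in
lemma apply_retract (h : HardySetup i r J) (x : E) : r (i x) = x :=
  congrArg (fun T : E →L[ℂ] E => T x) h.retract

-- Insert `i r + J i r J = 1` between `a` and `b`. The first summand gives the Toeplitz product and
-- the second, with `J² = 1`, the Hankel product.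
omit [CompleteSpace E] in
lemma toep_mul (h : HardySetup i r J) (a b : L →L[ℂ] L) :
    toep i r (a * b) = toep i r a * toep i r b + hank i r J a * hank i r J (J * b * J) := by
  ext x
  have e := h.apply_decomp (b (i x))
  simp only [toep, hank, ContinuousLinearMap.comp_apply, ContinuousLinearMap.mul_def,
    ContinuousLinearMap.add_apply, h.apply_invol]
  rw [← map_add, ← map_add, e]

omit [CompleteSpace E] in
lemma hank_mul (h : HardySetup i r J) (a b : L →L[ℂ] L) :
    hank i r J (a * b) = toep i r a * hank i r J b + hank i r J a * toep i r (J * b * J) := by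
  ext x
  have e := h.apply_decomp (b (J (i x)))
  simp only [toep, hank, ContinuousLinearMap.comp_apply, ContinuousLinearMap.mul_def,
    ContinuousLinearMap.add_apply]
  rw [← map_add, ← map_add, e]

omit [CompleteSpace E] in
lemma toep_one (h : HardySetup i r J) : toep i r 1 = 1 := by
  ext x
  exact h.apply_retract x

-- A vector of the Hardy space has no component in the reflected space, by the decomposition;
-- reflecting this shows that `J` maps the Hardy space into the kernel of `r`.
omit [CompleteSpace E] in
lemma hank_one (h : HardySetup i r J) : hank i r J 1 = 0 := by
  ext x
  have e := h.apply_decomp (i x)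
  rw [h.apply_retract, add_eq_left] at e
  have e2 := congrArg (fun y => r (J y)) e
  have e3 : r (J (i x)) = 0 := by simpa [h.apply_invol, h.apply_retract] using e2
  exact e3

end HardySetup

/-- A factorization of an even multiplier `p p'` into a plus factor `p` and a minus factor `p'`,
with inverses `q` and `q'`. -/
structure HardyFactor (i : E →L[ℂ] L) (r : L →L[ℂ] E) (J p p' q q' : L →L[ℂ] L) : Prop where
  setup : HardySetup i r J
  refl_p : J * p * J = p'
  refl_q : J * q * J = q'
  mul_inv : p * q = 1
  inv_mul : q * p = 1
  comm : p * p' = p' * p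
  hank_p : hank i r J p' = 0
  hank_q : hank i r J q' = 0

namespace HardyFactor

variable {p p' q q' : L →L[ℂ] L}

omit [CompleteSpace E] in
lemma refl_p' (h : HardyFactor i r J p p' q q') : J * p' * J = p := by
  rw [← h.refl_p, mul_assoc, mul_assoc, mul_assoc, h.setup.invol, mul_one, ← mul_assoc,
    h.setup.invol, one_mul]

omit [CompleteSpace E] in
lemma refl_q' (h : HardyFactor i r J p p' q q') : J * q' * J = q := by
  rw [← h.refl_q, mul_assoc, mul_assoc, mul_assoc, h.setup.invol, mul_one, ← mul_assoc,
    h.setup.invol, one_mul]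

omit [CompleteSpace E] in
lemma refl_mul (h : HardyFactor i r J p p' q q') (a b : L →L[ℂ] L) :
    J * (a * b) * J = (J * a * J) * (J * b * J) := by
  have : (J * a * J) * (J * b * J) = J * a * (J * J) * b * J := by noncomm_ring
  rw [this, h.setup.invol]
  noncomm_ring

omit [CompleteSpace E] in
lemma mul_inv' (h : HardyFactor i r J p p' q q') : p' * q' = 1 := by
  rw [← h.refl_p, ← h.refl_q, ← h.refl_mul, h.mul_inv, mul_one, h.setup.invol]

omit [CompleteSpace E] in
lemma inv_mul' (h : HardyFactor i r J p p' q q') : q' * p' = 1 := by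
  rw [← h.refl_p, ← h.refl_q, ← h.refl_mul, h.inv_mul, mul_one, h.setup.invol]

omit [CompleteSpace E] in
lemma comm_q (h : HardyFactor i r J p p' q q') : q * p' = p' * q := by
  calc q * p' = q * p' * (p * q) := by rw [h.mul_inv, mul_one]
    _ = q * (p' * p) * q := by noncomm_ring
    _ = (q * p) * p' * q := by rw [← h.comm]; noncomm_ring
    _ = p' * q := by rw [h.inv_mul, one_mul]

omit [CompleteSpace E] in
lemma comm_qq (h : HardyFactor i r J p p' q q') : q * q' = q' * q := by
  calc q * q' = (q' * p') * q * q' := by rw [h.inv_mul', one_mul]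
    _ = q' * (p' * q) * q' := by noncomm_ring
    _ = q' * q * (p' * q') := by rw [← h.comm_q]; noncomm_ring
    _ = q' * q := by rw [h.mul_inv', mul_one]

omit [CompleteSpace E] in
lemma symm_mul (h : HardyFactor i r J p p' q q') : J * (p * p') * J = p * p' := by
  rw [h.refl_mul, h.refl_p, h.refl_p', h.comm]

omit [CompleteSpace E] in
lemma symm_inv (h : HardyFactor i r J p p' q q') : J * (q * q') * J = q * q' := by
  rw [h.refl_mul, h.refl_q, h.refl_q', h.comm_qq]

omit [CompleteSpace E] in
lemma inv_mul_symbol (h : HardyFactor i r J p p' q q') : q * q' * (p * p') = 1 := by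
  rw [h.comm]
  calc q * q' * (p' * p) = q * (q' * p') * p := by noncomm_ring
    _ = 1 := by rw [h.inv_mul', mul_one, h.inv_mul]

omit [CompleteSpace E] in
lemma symbol_mul_inv (h : HardyFactor i r J p p' q q') : p * p' * (q * q') = 1 := by
  rw [h.comm_qq]
  calc p * p' * (q' * q) = p * (p' * q') * q := by noncomm_ring
    _ = 1 := by rw [h.mul_inv', mul_one, h.mul_inv]

omit [CompleteSpace E] in
lemma toep_minus_mul (h : HardyFactor i r J p p' q q') (b : L →L[ℂ] L) :
    toep i r (p' * b) = toep i r p' * toep i r b := by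
  rw [h.setup.toep_mul, h.hank_p, zero_mul, add_zero]

omit [CompleteSpace E] in
lemma toep_minus_mul' (h : HardyFactor i r J p p' q q') (b : L →L[ℂ] L) :
    toep i r (q' * b) = toep i r q' * toep i r b := by
  rw [h.setup.toep_mul, h.hank_q, zero_mul, add_zero]

omit [CompleteSpace E] in
lemma toep_mul_plus (h : HardyFactor i r J p p' q q') (a : L →L[ℂ] L) :
    toep i r (a * p) = toep i r a * toep i r p := by
  rw [h.setup.toep_mul, h.refl_p, h.hank_p, mul_zero, add_zero]

omit [CompleteSpace E] in
lemma toep_mul_plus' (h : HardyFactor i r J p p' q q') (a : L →L[ℂ] L) :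
    toep i r (a * q) = toep i r a * toep i r q := by
  rw [h.setup.toep_mul, h.refl_q, h.hank_q, mul_zero, add_zero]

omit [CompleteSpace E] in
lemma toep_p_q (h : HardyFactor i r J p p' q q') : toep i r p * toep i r q = 1 := by
  rw [← h.toep_mul_plus', h.mul_inv, h.setup.toep_one]

omit [CompleteSpace E] in
lemma toep_q_p (h : HardyFactor i r J p p' q q') : toep i r q * toep i r p = 1 := by
  rw [← h.toep_mul_plus, h.inv_mul, h.setup.toep_one]

omit [CompleteSpace E] in
lemma toep_p_q' (h : HardyFactor i r J p p' q q') : toep i r p' * toep i r q' = 1 := by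
  rw [← h.toep_minus_mul, h.mul_inv', h.setup.toep_one]

omit [CompleteSpace E] in
lemma toep_q_p' (h : HardyFactor i r J p p' q q') : toep i r q' * toep i r p' = 1 := by
  rw [← h.toep_minus_mul', h.inv_mul', h.setup.toep_one]

/-- The sum of the Toeplitz and the Hankel operator. -/
def sumOp (i : E →L[ℂ] L) (r : L →L[ℂ] E) (J m : L →L[ℂ] L) : E →L[ℂ] E :=
  toep i r m + hank i r J m

/-- The operator `T(q) (T(φ) + H(φ)) T(q')`. -/
def middle (i : E →L[ℂ] L) (r : L →L[ℂ] E) (J p p' q q' : L →L[ℂ] L) : E →L[ℂ] E :=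
  toep i r q * sumOp i r J (p * p') * toep i r q'

omit [CompleteSpace E] in
lemma sumOp_eq (h : HardyFactor i r J p p' q q') :
    sumOp i r J (p * p') = toep i r p * middle i r J p p' q q' * toep i r p' := by
  have : toep i r p * middle i r J p p' q q' * toep i r p' =
      (toep i r p * toep i r q) * sumOp i r J (p * p') * (toep i r q' * toep i r p') := by
    rw [middle]; noncomm_ring
  rw [this, h.toep_p_q, h.toep_q_p', one_mul, mul_one]

-- For even symbols the Toeplitz and Hankel product formulas add up to multiplicativity of `T + H`.
-- The product of the symbol and its inverse is `1`, whose Toeplitz operator is the identity and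
-- whose Hankel operator is zero.
omit [CompleteSpace E] in
lemma sumOp_mul_sumOp (h : HardyFactor i r J p p' q q') :
    sumOp i r J (p * p') * sumOp i r J (q * q') = 1 ∧
      sumOp i r J (q * q') * sumOp i r J (p * p') = 1 := by
  constructor
  · have h1 := h.setup.toep_mul (p * p') (q * q')
    have h2 := h.setup.hank_mul (p * p') (q * q')
    rw [h.symbol_mul_inv, h.symm_inv] at h1 h2
    rw [h.setup.toep_one] at h1
    rw [h.setup.hank_one] at h2
    calc _ = (toep i r (p * p') * toep i r (q * q') + hank i r J (p * p') * hank i r J (q * q')) +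
          (toep i r (p * p') * hank i r J (q * q') + hank i r J (p * p') * toep i r (q * q')) := by
          rw [sumOp, sumOp]; noncomm_ring
      _ = 1 := by rw [← h1, ← h2, add_zero]
  · have h1 := h.setup.toep_mul (q * q') (p * p')
    have h2 := h.setup.hank_mul (q * q') (p * p')
    rw [h.inv_mul_symbol, h.symm_mul] at h1 h2
    rw [h.setup.toep_one] at h1
    rw [h.setup.hank_one] at h2
    calc _ = (toep i r (q * q') * toep i r (p * p') + hank i r J (q * q') * hank i r J (p * p')) +
          (toep i r (q * q') * hank i r J (p * p') + hank i r J (q * q') * toep i r (p * p')) := by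
          rw [sumOp, sumOp]; noncomm_ring
      _ = 1 := by rw [← h1, ← h2, add_zero]

-- A minus factor can be moved inside from the left and a plus factor from the right: `T(p')` turns
-- the symbol `q q'` into `q`, and then `T(p)` turns `T(q)` into `1` and `H(q)` into `H(p' q)`. This
-- is the origin of the symbol `φ₋/φ₊`.
omit [CompleteSpace E] in
lemma inverse_eq (h : HardyFactor i r J p p' q q') :
    toep i r p' * sumOp i r J (q * q') * toep i r p = 1 + hank i r J (p' * q) := by
  have e : p' * (q * q') = q := by
    rw [h.comm_qq, ← mul_assoc, h.mul_inv', one_mul]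
  have h1 : toep i r p' * toep i r (q * q') = toep i r q := by
    rw [← h.toep_minus_mul, e]
  have h2 : toep i r p' * hank i r J (q * q') = hank i r J q := by
    have := h.setup.hank_mul p' (q * q')
    rw [e, h.hank_p, zero_mul, add_zero] at this
    exact this.symm
  have h3 : hank i r J q * toep i r p = hank i r J (p' * q) := by
    have := h.setup.hank_mul q p'
    rw [h.hank_p, mul_zero, zero_add, h.refl_p', h.comm_q] at this
    exact this.symm
  rw [sumOp, mul_add, h1, h2, add_mul, h.toep_q_p, h3]

omit [CompleteSpace E] in
lemma middle_mul (h : HardyFactor i r J p p' q q') :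
    middle i r J p p' q q' * (1 + hank i r J (p' * q)) = 1 ∧
      (1 + hank i r J (p' * q)) * middle i r J p p' q q' = 1 := by
  rw [← h.inverse_eq, middle]
  constructor
  · calc _ = toep i r q * (sumOp i r J (p * p') * ((toep i r q' * toep i r p') *
          sumOp i r J (q * q'))) * toep i r p := by noncomm_ring
      _ = 1 := by rw [h.toep_q_p', one_mul, h.sumOp_mul_sumOp.1, mul_one, h.toep_q_p]
  · calc _ = toep i r p' * (sumOp i r J (q * q') * ((toep i r p * toep i r q) *
          sumOp i r J (p * p'))) * toep i r q' := by noncomm_ring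
      _ = 1 := by rw [h.toep_p_q, one_mul, h.sumOp_mul_sumOp.2, mul_one, h.toep_p_q']

/-- With `a = q q'` and `φ = p p'`, the product formula gives `T(a)T(φ) - 1 = -H(a)H(φ)`. Hence
`H(φ)` splits off on the right of the whole difference. -/
lemma tc_first (h : HardyFactor i r J p p' q q') (ht : TC (hank i r J (p * p'))) :
    TC (toep i r (q * q') * sumOp i r J (p * p') - 1) := by
  have h1 := h.setup.toep_mul (q * q') (p * p')
  rw [h.inv_mul_symbol, h.symm_mul, h.setup.toep_one] at h1
  have : toep i r (q * q') * sumOp i r J (p * p') - 1 =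
      (toep i r (q * q') - hank i r J (q * q')) * hank i r J (p * p') := by
    rw [sumOp, h1]; noncomm_ring
  rw [this]
  exact ht.mul_left _

-- Exhibits `middle` as a similarity transform of `T(φ⁻¹) M(φ)`, because `T(p')` and `T(q')` are
-- mutually inverse.
omit [CompleteSpace E] in
lemma middle_eq (h : HardyFactor i r J p p' q q') :
    middle i r J p p' q q' =
      toep i r p' * (toep i r (q * q') * sumOp i r J (p * p')) * toep i r q' := by
  rw [h.comm_qq, h.toep_minus_mul', middle]
  calc _ = 1 * toep i r q * sumOp i r J (p * p') * toep i r q' := by rw [one_mul]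
    _ = _ := by rw [← h.toep_p_q']; noncomm_ring

lemma tc_middle (h : HardyFactor i r J p p' q q') (ht : TC (hank i r J (p * p'))) :
    TC (middle i r J p p' q q' - 1) ∧ fredholmDet (middle i r J p p' q q') =
      fredholmDet (toep i r (q * q') * sumOp i r J (p * p')) := by
  have hB := h.tc_first ht
  set B := toep i r (q * q') * sumOp i r J (p * p')
  have e : middle i r J p p' q q' = 1 + toep i r p' ∘L (B - 1) ∘L toep i r q' := by
    rw [h.middle_eq, ← ContinuousLinearMap.mul_def, ← ContinuousLinearMap.mul_def]
    calc _ = toep i r p' * toep i r q' + toep i r p' * ((B - 1) * toep i r q') := by noncomm_ring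
      _ = _ := by rw [h.toep_p_q']
  constructor
  · rw [e, add_sub_cancel_left]
    exact (hB.comp_right _).comp_left _
  · rw [e, fredholmDet_conj hB _ _ h.toep_q_p', add_sub_cancel]

/-- The determinant of a compression of `T(φ) + H(φ)`. -/
theorem compression_det (h : HardyFactor i r J p p' q q') (ht : TC (hank i r J (p * p')))
    {j : F →L[ℂ] E} {s : E →L[ℂ] F} (hsj : s ∘L j = 1)
    (hp : s ∘L toep i r p = s ∘L toep i r p ∘L j ∘L s)
    (hp' : toep i r p' ∘L j = j ∘L s ∘L toep i r p' ∘L j) :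
    TC (hank i r J (p' * q)) ∧
    s ∘L sumOp i r J (p * p') ∘L j =
      (s ∘L toep i r p ∘L j) * (1 + s ∘L (middle i r J p p' q q' - 1) ∘L j) *
        (s ∘L toep i r p' ∘L j) ∧
    fredholmDet (1 + s ∘L (middle i r J p p' q q' - 1) ∘L j) =
      fredholmDet (toep i r (q * q') * sumOp i r J (p * p')) *
        fredholmDet (1 + (1 - j ∘L s) * hank i r J (p' * q) * (1 - j ∘L s)) := by
  -- Jacobi's identity is applied to `middle` and its inverse `1 + H(p' q)`, with the complementary
  -- projections `j s` and `1 - j s`.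
  obtain ⟨hA, hdet⟩ := h.tc_middle ht
  set A := middle i r J p p' q q' with hAdef
  have hsj' : ∀ x, s (j x) = x := fun x => congrArg (fun T : F →L[ℂ] F => T x) hsj
  have hPP : (j ∘L s) * (j ∘L s) = j ∘L s := by ext x; simp [hsj']
  obtain ⟨hK, hjac⟩ := fredholmDet_jacobi (P := j ∘L s) (Q := 1 - j ∘L s) hA h.middle_mul.1
    h.middle_mul.2 (by abel) hPP
  rw [add_sub_cancel_left] at hK hjac
  refine ⟨hK, ?_, ?_⟩
  · have hp1 : ∀ x, s (toep i r p x) = s (toep i r p (j (s x))) := fun x =>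
      congrArg (fun T : E →L[ℂ] F => T x) hp
    have hp2 : ∀ x, toep i r p' (j x) = j (s (toep i r p' (j x))) := fun x =>
      congrArg (fun T : F →L[ℂ] E => T x) hp'
    rw [h.sumOp_eq]
    ext x
    have e : ∀ y, (1 + s ∘L (A - 1) ∘L j) y = s (A (j y)) := by
      intro y; simp [hsj']
    simp only [ContinuousLinearMap.comp_apply, ContinuousLinearMap.mul_def, e]
    -- Triangularity of the outer factors is exactly what permits inserting `j s` on both sides of
    -- the middle operator.
    rw [← hp2, hp1]
  · rw [← hdet, ← hjac]
    have := fredholmDet_one_add_comm s ((hA.comp_right j).comp_left 1)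
    have e1 : s ∘L (1 ∘L (A - 1) ∘L j) = s ∘L (A - 1) ∘L j := rfl
    have := fredholmDet_one_add_comm (E := E) (F := F) j (Y := s ∘L (A - 1) ∘L (j ∘L s))
      ((hA.comp_right _).comp_left _)
    have e2 : (s ∘L (A - 1) ∘L j ∘L s) ∘L j = s ∘L (A - 1) ∘L j := by
      ext x; simp [hsj']
    rw [e2] at this
    rw [← this]
    rfl

end HardyFactor

end Hardy

/-! ### Hilbert–Schmidt operators given by square integrable fields of vectors -/

section Rows

instance fact_two_ne_top : Fact ((2 : ℝ≥0∞) ≠ ⊤) := ⟨by norm_num⟩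

section Basis

variable {H : Type*} [NormedAddCommGroup H] [InnerProductSpace ℂ H] [CompleteSpace H]

/-- Orthonormal vectors lie at mutual distance `√2`, so the balls of radius `1/2` around them are
disjoint; a separable space contains only countably many disjoint nonempty open sets. -/
lemma exists_countable_hilbertBasis [TopologicalSpace.SeparableSpace H] :
    ∃ (w : Set H) (_ : Countable w), Nonempty (HilbertBasis w ℂ H) := by
  obtain ⟨w, b, hb⟩ := exists_hilbertBasis ℂ H
  have ho : Orthonormal ℂ ((↑) : w → H) := hb ▸ b.orthonormal
  refine ⟨w, ?_, ⟨b⟩⟩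
  have : w.Countable := by
    refine Set.PairwiseDisjoint.countable_of_isOpen (s := fun x => Metric.ball x (1 / 2)) ?_
      (fun _ _ => Metric.isOpen_ball) (fun x _ => ⟨x, Metric.mem_ball_self (by norm_num)⟩)
    intro x hx y hy hxy
    refine Metric.ball_disjoint_ball ?_
    have h1 : ⟪x, y⟫_ℂ = 0 := ho.2 (i := ⟨x, hx⟩) (j := ⟨y, hy⟩) (by simpa using hxy)
    have h2 : ‖x - y‖ ^ 2 = 2 := by
      rw [@norm_sub_sq ℂ, h1, ho.1 ⟨x, hx⟩, ho.1 ⟨y, hy⟩]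
      norm_num
    rw [dist_eq_norm]
    nlinarith [norm_nonneg (x - y)]
  exact this

/-- Bessel's inequality in the target space, after expanding the adjoint in the first basis and
exchanging the two sums. -/
lemma summable_norm_sq_adjoint {G : Type*} [NormedAddCommGroup G] [InnerProductSpace ℂ G]
    [CompleteSpace G] {ι κ : Type*} (g : HilbertBasis ι ℂ H) (g' : HilbertBasis κ ℂ G)
    {A : H →L[ℂ] G} (hA : Summable fun i => ‖A (g i)‖ ^ 2) :
    Summable fun j => ‖ContinuousLinearMap.adjoint A (g' j)‖ ^ 2 := by
  refine summable_of_sum_le (c := ∑' i, ‖A (g i)‖ ^ 2) (fun _ => sq_nonneg _) fun s => ?_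
  have h1 : ∀ j, HasSum (fun i => ‖⟪g' j, A (g i)⟫_ℂ‖ ^ 2)
      (‖ContinuousLinearMap.adjoint A (g' j)‖ ^ 2) := by
    intro j
    have := g.hasSum_inner_mul_inner (ContinuousLinearMap.adjoint A (g' j))
      (ContinuousLinearMap.adjoint A (g' j))
    have h2 := (Complex.hasSum_re this)
    rw [inner_self_eq_norm_sq_to_K] at h2
    convert h2 using 1
    · ext i
      rw [ContinuousLinearMap.adjoint_inner_left, ContinuousLinearMap.adjoint_inner_right,
        ← inner_conj_symm (A (g i)), Complex.mul_conj, Complex.normSq_eq_norm_sq]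
      norm_cast
    · norm_cast
  have h3 := hasSum_sum (s := s) fun j _ => h1 j
  rw [← h3.tsum_eq]
  refine h3.summable.tsum_le_tsum (fun i => ?_) hA
  exact g'.orthonormal.sum_inner_products_le _

end Basis

variable {X : Type*} [MeasurableSpace X] {μ : Measure X}
  {H : Type*} [NormedAddCommGroup H] [InnerProductSpace ℂ H] [CompleteSpace H]

/-- The operator `h ↦ (x ↦ ⟪v x, h⟫)`. -/
def rowOp {v : X → H} (hv : MemLp v 2 μ) : H →L[ℂ] Lp ℂ 2 μ :=
  LinearMap.mkContinuous
    { toFun := fun h => (hv.inner_const (𝕜 := ℂ) h).toLp _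
      map_add' := by
        intro f g
        rw [← MemLp.toLp_add]
        refine MemLp.toLp_congr _ _ (Eventually.of_forall fun x => ?_)
        simp [inner_add_right]
      map_smul' := by
        intro c f
        rw [RingHom.id_apply, ← MemLp.toLp_const_smul]
        refine MemLp.toLp_congr _ _ (Eventually.of_forall fun x => ?_)
        simp [inner_smul_right] }
    (eLpNorm v 2 μ).toReal (by
      intro h
      simp only [LinearMap.coe_mk, AddHom.coe_mk]
      rw [Lp.norm_toLp]
      have h1 := eLpNorm_le_mul_eLpNorm_of_ae_le_mul (μ := μ) (p := 2)
        (f := fun x => ⟪v x, h⟫_ℂ) (g := v) (c := ‖h‖)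
        (Eventually.of_forall fun x => by rw [mul_comm]; exact norm_inner_le_norm _ _)
      calc _ ≤ (ENNReal.ofReal ‖h‖ * eLpNorm v 2 μ).toReal :=
            ENNReal.toReal_mono (ENNReal.mul_ne_top ENNReal.ofReal_ne_top hv.2.ne) h1
        _ = _ := by
            rw [ENNReal.toReal_mul, ENNReal.toReal_ofReal (norm_nonneg _), mul_comm])

lemma coeFn_rowOp {v : X → H} (hv : MemLp v 2 μ) (h : H) :
    rowOp hv h =ᵐ[μ] fun x => ⟪v x, h⟫_ℂ :=
  (hv.inner_const h).coeFn_toLp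

lemma MemLp.integrable_inner {G : Type*} [NormedAddCommGroup G] [InnerProductSpace ℂ G]
    {v w : X → G} (hv : MemLp v 2 μ) (hw : MemLp w 2 μ) :
    Integrable (fun x => ⟪v x, w x⟫_ℂ) μ := by
  refine (hv.norm.integrable_mul hw.norm).mono' (hv.1.inner hw.1)
    (Eventually.of_forall fun x => ?_)
  exact norm_inner_le_norm _ _

lemma norm_sq_Lp (f : Lp ℂ 2 μ) : ‖f‖ ^ 2 = ∫ x, ‖f x‖ ^ 2 ∂μ := by
  have h : ((‖f‖ ^ 2 : ℝ) : ℂ) = ((∫ x, ‖f x‖ ^ 2 ∂μ : ℝ) : ℂ) := by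
    have := inner_self_eq_norm_sq_to_K (𝕜 := ℂ) f
    rw [L2.inner_def] at this
    rw [← integral_complex_ofReal]
    push_cast
    rw [← Complex.coe_algebraMap] at *
    refine this.symm.trans (integral_congr_ae (Eventually.of_forall fun x => ?_))
    simpa using inner_self_eq_norm_sq_to_K (𝕜 := ℂ) (f x)
  exact_mod_cast h

lemma norm_sq_rowOp {v : X → H} (hv : MemLp v 2 μ) (h : H) :
    ‖rowOp hv h‖ ^ 2 = ∫ x, ‖⟪v x, h⟫_ℂ‖ ^ 2 ∂μ := by
  rw [norm_sq_Lp]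
  refine integral_congr_ae ?_
  filter_upwards [coeFn_rowOp hv h] with x hx
  rw [hx]

/-- Bessel's inequality for `v x`, integrated over `x`: an operator given by a square integrable
field of vectors is Hilbert–Schmidt. -/
lemma summable_rowOp {ι : Type*} {v : X → H} (hv : MemLp v 2 μ) {g : ι → H}
    (hg : Orthonormal ℂ g) : Summable fun i => ‖rowOp hv (g i)‖ ^ 2 := by
  refine summable_of_sum_le (c := ∫ x, ‖v x‖ ^ 2 ∂μ) (fun _ => sq_nonneg _) fun s => ?_
  simp_rw [norm_sq_rowOp]
  rw [← integral_finsetSum _ fun i _ => (hv.inner_const (g i)).norm.integrable_sq]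
  refine integral_mono (integrable_finsetSum _ fun i _ =>
    (hv.inner_const (g i)).norm.integrable_sq) hv.norm.integrable_sq fun x => ?_
  have := hg.sum_inner_products_le (x := v x) (s := s)
  refine le_trans (le_of_eq (Finset.sum_congr rfl fun i _ => ?_)) this
  rw [norm_inner_symm]

/-- The operator with kernel `⟪v x, w y⟫`. -/
lemma isIntegral_rowOp_comp {v w : X → H} (hv : MemLp v 2 μ) (hw : MemLp w 2 μ) (f : Lp ℂ 2 μ) :
    ∀ᵐ x ∂μ, Integrable (fun y => ⟪v x, w y⟫_ℂ * f y) μ ∧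
      (rowOp hv ∘L ContinuousLinearMap.adjoint (rowOp hw)) f x = ∫ y, ⟪v x, w y⟫_ℂ * f y ∂μ := by
  filter_upwards [coeFn_rowOp hv (ContinuousLinearMap.adjoint (rowOp hw) f)] with x hx
  refine ⟨(hw.const_inner (𝕜 := ℂ) (v x)).integrable_mul (Lp.memLp f), ?_⟩
  rw [ContinuousLinearMap.comp_apply, hx, ContinuousLinearMap.adjoint_inner_right, L2.inner_def]
  refine integral_congr_ae ?_
  filter_upwards [coeFn_rowOp hw (v x)] with y hy
  rw [hy, RCLike.inner_apply, inner_conj_symm, mul_comm]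

/-- Expanding `⟪v x, w x⟫` in the basis and integrating term by term; the integrability of the sum
follows from the Hilbert–Schmidt bounds of both fields. -/
lemma hasSum_inner_rowOp {ι : Type*} [Countable ι] {v w : X → H} (hv : MemLp v 2 μ)
    (hw : MemLp w 2 μ) (g : HilbertBasis ι ℂ H) :
    HasSum (fun i => ⟪rowOp hw (g i), rowOp hv (g i)⟫_ℂ) (∫ x, ⟪v x, w x⟫_ℂ ∂μ) := by
  have key := hasSum_integral_of_summable_integral_norm (μ := μ)
    (F := fun i x => ⟪⟪w x, g i⟫_ℂ, ⟪v x, g i⟫_ℂ⟫_ℂ)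
    (fun i => MemLp.integrable_inner (hw.inner_const (g i)) (hv.inner_const (g i))) ?_
  · have e1 : ∀ i, ⟪rowOp hw (g i), rowOp hv (g i)⟫_ℂ =
        ∫ x, ⟪⟪w x, g i⟫_ℂ, ⟪v x, g i⟫_ℂ⟫_ℂ ∂μ := by
      intro i
      rw [L2.inner_def]
      refine integral_congr_ae ?_
      filter_upwards [coeFn_rowOp hw (g i), coeFn_rowOp hv (g i)] with x h1 h2
      rw [h1, h2]
    have e2 : ∀ x, ∑' i, ⟪⟪w x, g i⟫_ℂ, ⟪v x, g i⟫_ℂ⟫_ℂ = ⟪v x, w x⟫_ℂ := by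
      intro x
      rw [← (g.hasSum_inner_mul_inner (v x) (w x)).tsum_eq]
      refine tsum_congr fun i => ?_
      rw [RCLike.inner_apply, inner_conj_symm]
    simp only [e2] at key
    simpa only [e1] using key
  · refine Summable.of_nonneg_of_le (fun i => integral_nonneg fun x => norm_nonneg _) (fun i => ?_)
      (((summable_rowOp hw g.orthonormal).add (summable_rowOp hv g.orthonormal)))
    rw [norm_sq_rowOp, norm_sq_rowOp, ← integral_add (hw.inner_const (g i)).norm.integrable_sq
      (hv.inner_const (g i)).norm.integrable_sq]
    refine integral_mono_of_nonneg (Eventually.of_forall fun x => norm_nonneg _)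
      ((hw.inner_const (g i)).norm.integrable_sq.add
      (hv.inner_const (g i)).norm.integrable_sq) (Eventually.of_forall fun x => ?_)
    have := norm_inner_le_norm (𝕜 := ℂ) ⟪w x, g i⟫_ℂ ⟪v x, g i⟫_ℂ
    simp only
    nlinarith [sq_nonneg (‖⟪w x, g i⟫_ℂ‖ - ‖⟪v x, g i⟫_ℂ‖), norm_nonneg ⟪w x, g i⟫_ℂ,
      norm_nonneg ⟪v x, g i⟫_ℂ]

/-- A kernel that factors as `⟪v x, w y⟫` is a product of two Hilbert–Schmidt operators, and its
trace is the integral over the diagonal. -/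
lemma exists_isRep_rowOp_comp [TopologicalSpace.SeparableSpace H] {v w : X → H}
    (hv : MemLp v 2 μ) (hw : MemLp w 2 μ) :
    ∃ (ι : Set H) (_ : Countable ι) (a b : ι → Lp ℂ 2 μ),
      IsRep (rowOp hv ∘L ContinuousLinearMap.adjoint (rowOp hw)) a b ∧
      ∑' i, ⟪a i, b i⟫_ℂ = ∫ x, ⟪v x, w x⟫_ℂ ∂μ := by
  obtain ⟨ι, hι, ⟨g⟩⟩ := exists_countable_hilbertBasis (H := H)
  have h := isRep_comp g (S := rowOp hv) (T := ContinuousLinearMap.adjoint (rowOp hw))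
    (summable_rowOp hv g.orthonormal)
    (by simpa using summable_rowOp hw g.orthonormal)
  simp only [ContinuousLinearMap.adjoint_adjoint] at h
  exact ⟨ι, hι, _, _, h, (hasSum_inner_rowOp hv hw g).tsum_eq⟩

end Rows

/-! ### Uniqueness of operators with a given kernel or matrix. -/

section Unique

variable {μ : Measure ℝ}

lemma IsIntegralOp.unique {A B : Lp ℂ 2 μ →L[ℂ] Lp ℂ 2 μ} {κ : ℝ → ℝ → ℂ}
    (hA : IsIntegralOp μ A κ) (hB : IsIntegralOp μ B κ) : A = B := by
  ext f
  filter_upwards [hA f, hB f] with x h1 h2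
  rw [h1.2, h2.2]

lemma IsIntegralOp.integralOp_eq {A : Lp ℂ 2 μ →L[ℂ] Lp ℂ 2 μ} {κ : ℝ → ℝ → ℂ}
    (hA : IsIntegralOp μ A κ) : integralOp μ κ = A := by
  have h : IsBoundedKernel μ κ := ⟨A, hA⟩
  rw [integralOp, dif_pos h]
  exact h.choose_spec.unique hA

/-- The standard basis of `ℓ²(ℤ₊)`. -/
def stdBasis : HilbertBasis ℕ ℂ Ell2 := HilbertBasis.ofRepr (LinearIsometryEquiv.refl ℂ Ell2)

lemma stdBasis_apply (j : ℕ) : stdBasis j = stdVec j := by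
  rw [← HilbertBasis.repr_symm_single]
  rfl

lemma hasMatrix_ext {A B : Ell2 →L[ℂ] Ell2} {a : ℕ → ℕ → ℂ} (hA : HasMatrix A a)
    (hB : HasMatrix B a) : A = B := by
  have h1 : ∀ k, A (stdBasis k) = B (stdBasis k) := by
    intro k
    refine stdBasis.repr.injective ?_
    ext j
    rw [stdBasis.repr_apply_apply, stdBasis.repr_apply_apply, stdBasis_apply, stdBasis_apply]
    exact (hA j k).trans (hB j k).symm
  ext x : 1
  have h2 := A.hasSum (stdBasis.hasSum_repr x)
  have h3 := B.hasSum (stdBasis.hasSum_repr x)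
  simp only [map_smul, h1] at h2 h3
  exact h2.unique h3

lemma HasMatrix.matrixOp_eq {A : Ell2 →L[ℂ] Ell2} {a : ℕ → ℕ → ℂ} (hA : HasMatrix A a) :
    matrixOp a = A := by
  have h : IsBoundedMatrix a := ⟨A, hA⟩
  rw [matrixOp, dif_pos h]
  exact hasMatrix_ext h.choose_spec hA

end Unique

/-! ### Multiplication operators, the reflection and the Fourier transform on `L²(ℝ)` -/

section Model

open scoped BoundedContinuousFunction

/-- The space `L²(ℝ)`. -/
abbrev LR : Type := Lp ℂ 2 (volume : Measure ℝ)

lemma memLp_bcf_mul (a : ℝ →ᵇ ℂ) {f : ℝ → ℂ} (hf : MemLp f 2) : MemLp (fun x => a x * f x) 2 :=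
  hf.of_le_mul (c := ‖a‖) (a.continuous.aestronglyMeasurable.mul hf.1)
    (Eventually.of_forall fun x => by
      rw [norm_mul]
      exact mul_le_mul_of_nonneg_right (a.norm_coe_le_norm x) (norm_nonneg _))

/-- Multiplication by a bounded continuous function. -/
def mulOp (a : ℝ →ᵇ ℂ) : LR →L[ℂ] LR :=
  LinearMap.mkContinuous
    { toFun := fun f => (memLp_bcf_mul a (Lp.memLp f)).toLp _
      map_add' := by
        intro f g
        rw [← MemLp.toLp_add]
        refine MemLp.toLp_congr _ _ ?_
        filter_upwards [Lp.coeFn_add f g] with x hx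
        simp only [hx, Pi.add_apply, mul_add]
      map_smul' := by
        intro c f
        rw [RingHom.id_apply, ← MemLp.toLp_const_smul]
        refine MemLp.toLp_congr _ _ ?_
        filter_upwards [Lp.coeFn_smul c f] with x hx
        simp only [hx, Pi.smul_apply, smul_eq_mul, mul_left_comm] }
    ‖a‖ (by
      intro f
      simp only [LinearMap.coe_mk, AddHom.coe_mk]
      rw [Lp.norm_toLp, Lp.norm_def]
      have h1 := eLpNorm_le_mul_eLpNorm_of_ae_le_mul (μ := volume) (p := 2)
        (f := fun x => a x * f x) (g := f) (c := ‖a‖)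
        (Eventually.of_forall fun x => by
          rw [norm_mul]
          exact mul_le_mul_of_nonneg_right (a.norm_coe_le_norm x) (norm_nonneg _))
      calc _ ≤ (ENNReal.ofReal ‖a‖ * eLpNorm f 2 volume).toReal :=
            ENNReal.toReal_mono (ENNReal.mul_ne_top ENNReal.ofReal_ne_top (Lp.eLpNorm_ne_top f)) h1
        _ = _ := by rw [ENNReal.toReal_mul, ENNReal.toReal_ofReal (norm_nonneg _)])

lemma coeFn_mulOp (a : ℝ →ᵇ ℂ) (f : LR) : mulOp a f =ᵐ[volume] fun x => a x * f x :=
  (memLp_bcf_mul a (Lp.memLp f)).coeFn_toLp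

lemma norm_mulOp_le (a : ℝ →ᵇ ℂ) : ‖mulOp a‖ ≤ ‖a‖ :=
  LinearMap.mkContinuous_norm_le _ (norm_nonneg _) _

lemma mulOp_mul (a b : ℝ →ᵇ ℂ) : mulOp (a * b) = mulOp a * mulOp b := by
  ext f
  rw [ContinuousLinearMap.mul_def, ContinuousLinearMap.comp_apply]
  filter_upwards [coeFn_mulOp (a * b) f, coeFn_mulOp a (mulOp b f), coeFn_mulOp b f]
    with x h1 h2 h3
  rw [h1, h2, h3, BoundedContinuousFunction.mul_apply, mul_assoc]

lemma mulOp_add (a b : ℝ →ᵇ ℂ) : mulOp (a + b) = mulOp a + mulOp b := by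
  ext f
  rw [ContinuousLinearMap.add_apply]
  filter_upwards [coeFn_mulOp (a + b) f, coeFn_mulOp a f, coeFn_mulOp b f,
    Lp.coeFn_add (mulOp a f) (mulOp b f)] with x h1 h2 h3 h4
  rw [h1, h4, Pi.add_apply, h2, h3, BoundedContinuousFunction.add_apply, add_mul]

lemma mulOp_algebraMap (c : ℂ) : mulOp (algebraMap ℂ (ℝ →ᵇ ℂ) c) = c • 1 := by
  ext f
  filter_upwards [coeFn_mulOp (algebraMap ℂ (ℝ →ᵇ ℂ) c) f, Lp.coeFn_smul c f] with x h1 h2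
  rw [h1]
  change _ = (c • f : LR) x
  rw [h2]
  rfl

/-- Multiplication by bounded continuous functions as a homomorphism of algebras. -/
def mulHom : (ℝ →ᵇ ℂ) →ₐ[ℂ] (LR →L[ℂ] LR) where
  toFun := mulOp
  map_one' := by simpa using mulOp_algebraMap 1
  map_mul' := mulOp_mul
  map_zero' := by simpa using mulOp_algebraMap 0
  map_add' := mulOp_add
  commutes' c := by
    rw [mulOp_algebraMap, Algebra.algebraMap_eq_smul_one]

lemma mulOp_one : mulOp 1 = 1 := map_one mulHom

lemma mulOp_smul (c : ℂ) (a : ℝ →ᵇ ℂ) : mulOp (c • a) = c • mulOp a := map_smul mulHom c a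

lemma continuous_mulHom : Continuous mulHom := by
  refine AddMonoidHomClass.continuous_of_bound mulHom 1 fun a => ?_
  rw [one_mul]
  exact norm_mulOp_le a

lemma mulOp_exp (a : ℝ →ᵇ ℂ) : mulOp (NormedSpace.exp a) = NormedSpace.exp (mulOp a) :=
  NormedSpace.map_exp mulHom continuous_mulHom a

/-- Evaluation of bounded continuous functions as a homomorphism of rings. -/
def evalHom (x : ℝ) : (ℝ →ᵇ ℂ) →+* ℂ where
  toFun a := a x
  map_one' := rfl
  map_mul' _ _ := rfl
  map_zero' := rfl
  map_add' _ _ := rfl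

lemma bcf_exp_apply (a : ℝ →ᵇ ℂ) (x : ℝ) : (NormedSpace.exp a) x = Complex.exp (a x) := by
  have hc : Continuous (evalHom x) := (BoundedContinuousFunction.lipschitz_eval_const x).continuous
  rw [Complex.exp_eq_exp_ℂ]
  exact NormedSpace.map_exp (evalHom x) hc a

/-- The reflection `f ↦ f(-x)`. -/
def reflOp : LR →L[ℂ] LR :=
  (Lp.compMeasurePreservingₗᵢ ℂ (fun x : ℝ => -x)
    (Measure.measurePreserving_neg volume)).toContinuousLinearMap

lemma coeFn_reflOp (f : LR) : reflOp f =ᵐ[volume] fun x => f (-x) :=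
  Lp.coeFn_compMeasurePreserving f (Measure.measurePreserving_neg volume)

lemma ae_neg {p : ℝ → Prop} (h : ∀ᵐ x, p x) : ∀ᵐ x, p (-x) :=
  (Measure.measurePreserving_neg (volume : Measure ℝ)).quasiMeasurePreserving.ae h

lemma reflOp_reflOp (f : LR) : reflOp (reflOp f) = f := by
  ext
  filter_upwards [coeFn_reflOp (reflOp f), ae_neg (coeFn_reflOp f)] with x h1 h2
  rw [h1, h2, neg_neg]

lemma reflOp_mul_reflOp : reflOp * reflOp = 1 := by
  ext1 f
  exact reflOp_reflOp f

lemma inner_reflOp (f g : LR) : ⟪reflOp f, reflOp g⟫_ℂ = ⟪f, g⟫_ℂ :=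
  LinearIsometry.inner_map_map _ f g

/-- The reflection of a bounded continuous function. -/
def reflFun (a : ℝ →ᵇ ℂ) : ℝ →ᵇ ℂ := a.compContinuous ⟨fun x => -x, continuous_neg⟩

lemma reflFun_apply (a : ℝ →ᵇ ℂ) (x : ℝ) : reflFun a x = a (-x) := rfl

lemma reflOp_mulOp (a : ℝ →ᵇ ℂ) : reflOp * mulOp a * reflOp = mulOp (reflFun a) := by
  ext f
  change reflOp (mulOp a (reflOp f)) =ᵐ[volume] _
  filter_upwards [coeFn_reflOp (mulOp a (reflOp f)), ae_neg (coeFn_mulOp a (reflOp f)),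
    ae_neg (coeFn_reflOp f), coeFn_mulOp (reflFun a) f] with x h1 h2 h3 h4
  rw [h1, h2, h3, h4, neg_neg, reflFun_apply]

lemma conj_fourierInv (f : ℝ → ℂ) (x : ℝ) :
    (starRingEnd ℂ) ((𝓕⁻ f : ℝ → ℂ) x) = (𝓕 (fun y => (starRingEnd ℂ) (f y)) : ℝ → ℂ) x := by
  rw [Real.fourierInv_eq', Real.fourier_eq', ← integral_conj]
  refine integral_congr_ae (Eventually.of_forall fun y => ?_)
  simp only [smul_eq_mul, map_mul, ← Complex.exp_conj, Complex.conj_ofReal, Complex.conj_I]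
  push_cast
  ring_nf

/-- The two Fourier transforms agree on integrable square integrable functions. -/
lemma fourier_toLp_ae {g : ℝ → ℂ} (h1 : Integrable g) (h2 : MemLp g 2) :
    (𝓕 (h2.toLp g) : LR) =ᵐ[volume] (𝓕 g : ℝ → ℂ) := by
  have hc : Continuous (𝓕 g : ℝ → ℂ) :=
    VectorFourier.fourierIntegral_continuous Real.continuous_fourierChar
      (by exact continuous_inner) h1
  -- Both transforms are tested against compactly supported smooth functions. For the L² transform
  -- the pairing is moved by unitarity, for the integral transform by Fubini.
  have key := ae_eq_zero_of_integral_contDiff_smul_eq_zero (μ := (volume : Measure ℝ))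
    (f := fun x => (𝓕 (h2.toLp g) : LR) x - (𝓕 g : ℝ → ℂ) x)
    (((Lp.memLp _).locallyIntegrable one_le_two).sub hc.locallyIntegrable) ?_
  · filter_upwards [key] with x hx
    exact sub_eq_zero.1 hx
  intro ψ hψ hψs
  have hs : HasCompactSupport (fun x => (ψ x : ℂ)) := hψs.comp_left (g := ((↑) : ℝ → ℂ)) rfl
  set Ψ : SchwartzMap ℝ ℂ := hs.toSchwartzMap (Complex.ofRealCLM.contDiff.comp hψ) with hΨ
  have hΨa : ∀ x, Ψ x = ψ x := fun x => rfl
  have e1 : ∫ x, ψ x • (𝓕 (h2.toLp g) : LR) x = ⟪Ψ.toLp 2, (𝓕 (h2.toLp g) : LR)⟫_ℂ := by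
    rw [L2.inner_def]
    refine integral_congr_ae ?_
    filter_upwards [Ψ.coeFn_toLp 2 volume] with x hx
    rw [hx, RCLike.inner_apply, hΨa, Complex.conj_ofReal, Complex.real_smul, mul_comm]
  have e2 : Ψ.toLp 2 = 𝓕 ((𝓕⁻ Ψ).toLp 2 : LR) := by
    rw [SchwartzMap.toLp_fourier_eq, FourierTransform.fourier_fourierInv_eq]
  have e3 : ⟪(𝓕⁻ Ψ).toLp 2, h2.toLp g⟫_ℂ = ∫ x, (𝓕 (fun x => (ψ x : ℂ)) : ℝ → ℂ) x • g x := by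
    rw [L2.inner_def]
    refine integral_congr_ae ?_
    filter_upwards [(𝓕⁻ Ψ).coeFn_toLp 2 volume, h2.coeFn_toLp] with x h3 h4
    rw [h3, h4, RCLike.inner_apply, SchwartzMap.fourierInv_coe, conj_fourierInv, smul_eq_mul,
      mul_comm]
    have e : (fun y => (starRingEnd ℂ) (Ψ y)) = fun y => (ψ y : ℂ) :=
      funext fun y => Complex.conj_ofReal _
    rw [e]
  have e4 : ∫ x, (𝓕 (fun x => (ψ x : ℂ)) : ℝ → ℂ) x • g x =
      ∫ x, (ψ x : ℂ) • (𝓕 g : ℝ → ℂ) x := by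
    simpa using! VectorFourier.integral_fourierIntegral_smul_eq_flip (L := innerₗ ℝ)
      (μ := volume) (ν := volume) (f := fun x => (ψ x : ℂ))
      Real.continuous_fourierChar continuous_inner Ψ.integrable h1
  simp only [smul_sub]
  have hi1 : Integrable fun x => ψ x • (𝓕 (h2.toLp g) : LR) x := by
    have := ((Ψ.memLp 2 volume).integrable_mul (Lp.memLp (𝓕 (h2.toLp g) : LR)))
    refine this.congr (Eventually.of_forall fun x => ?_)
    simp [hΨa]
  have hi2 : Integrable fun x => ψ x • (𝓕 g : ℝ → ℂ) x :=
    (hψ.continuous.smul hc).integrable_of_hasCompactSupport hψs.smul_right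
  rw [integral_sub hi1 hi2, e1, e2, Lp.inner_fourier_eq, e3, e4, sub_eq_zero]
  rfl

lemma conj_fourier (f : ℝ → ℂ) (x : ℝ) :
    (starRingEnd ℂ) ((𝓕 f : ℝ → ℂ) x) = (𝓕 (fun y => (starRingEnd ℂ) (f y)) : ℝ → ℂ) (-x) := by
  rw [← conj_fourierInv, Real.fourierInv_eq_fourier_neg, neg_neg]

lemma fourier_modulate (f : ℝ → ℂ) (x y : ℝ) :
    (𝓕 (fun ξ : ℝ => Complex.exp (2 * Real.pi * x * ξ * I) * f ξ) : ℝ → ℂ) y = (𝓕 f : ℝ → ℂ) (y - x) := by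
  rw [Real.fourier_real_eq_integral_exp_smul, Real.fourier_real_eq_integral_exp_smul]
  refine integral_congr_ae (Eventually.of_forall fun v => ?_)
  simp only [smul_eq_mul]
  rw [← mul_assoc, ← Complex.exp_add]
  congr 2
  push_cast
  ring

lemma norm_exp_real_mul_I (x ξ : ℝ) : ‖Complex.exp (2 * Real.pi * x * ξ * I)‖ = 1 := by
  have := Complex.norm_exp_ofReal_mul_I (2 * Real.pi * x * ξ)
  push_cast at this
  exact this

lemma memLp_modulate {p : ℝ≥0∞} {f : ℝ → ℂ} (hf : MemLp f p) (x : ℝ) :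
    MemLp (fun ξ : ℝ => Complex.exp (2 * Real.pi * x * ξ * I) * f ξ) p := by
  refine hf.of_le (by
    have : Continuous fun ξ : ℝ => Complex.exp (2 * Real.pi * x * ξ * I) := by fun_prop
    exact this.aestronglyMeasurable.mul hf.1) (Eventually.of_forall fun ξ => ?_)
  rw [norm_mul, norm_exp_real_mul_I, one_mul]

lemma MemLp.conj {p : ℝ≥0∞} {f : ℝ → ℂ} {μ : Measure ℝ} (hf : MemLp f p μ) :
    MemLp (fun ξ : ℝ => (starRingEnd ℂ) (f ξ)) p μ :=
  hf.star

lemma memLp_sub_left {p : ℝ≥0∞} {f : ℝ → ℂ} (hf : MemLp f p) (x : ℝ) :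
    MemLp (fun y : ℝ => f (x - y)) p :=
  hf.comp_measurePreserving (Measure.measurePreserving_sub_left volume x)

lemma schwartz_ext {f g : LR →L[ℂ] ℂ}
    (h : ∀ ψ : SchwartzMap ℝ ℂ, f (ψ.toLp 2) = g (ψ.toLp 2)) : f = g := by
  have hd := SchwartzMap.denseRange_toLpCLM (E := ℝ) (F := ℂ) (p := 2) (μ := volume) (by norm_num)
  ext u
  exact congrFun (hd.equalizer f.continuous g.continuous (funext h)) u

/-- The convolution theorem for square integrable functions. -/
lemma integral_fourier_conv (u w : LR) (x : ℝ) :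
    ∫ y, (𝓕 u : LR) (x - y) * (𝓕 w : LR) y =
      ∫ ξ : ℝ, Complex.exp (-(2 * Real.pi * x * ξ * I)) * (u ξ * w ξ) := by
  have m1 : MemLp (fun y => (starRingEnd ℂ) ((𝓕 u : LR) (x - y))) 2 :=
    MemLp.conj (memLp_sub_left (Lp.memLp (𝓕 u : LR)) x)
  have m2 : MemLp (fun ξ : ℝ => Complex.exp (2 * Real.pi * x * ξ * I) * (starRingEnd ℂ) (u ξ)) 2 :=
    memLp_modulate (MemLp.conj (Lp.memLp u)) x
  have r1 : ∀ w : LR, ⟪m1.toLp _, w⟫_ℂ = ∫ y, (𝓕 u : LR) (x - y) * w y := by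
    intro w
    rw [L2.inner_def]
    refine integral_congr_ae ?_
    filter_upwards [m1.coeFn_toLp] with y hy
    rw [hy, RCLike.inner_apply, RCLike.conj_conj, mul_comm]
  have r2 : ∀ w : LR, ⟪m2.toLp _, w⟫_ℂ =
      ∫ ξ : ℝ, Complex.exp (-(2 * Real.pi * x * ξ * I)) * (u ξ * w ξ) := by
    intro w
    rw [L2.inner_def]
    refine integral_congr_ae ?_
    filter_upwards [m2.coeFn_toLp] with y hy
    rw [hy, RCLike.inner_apply, map_mul, RCLike.conj_conj, ← Complex.exp_conj]
    simp only [map_mul, Complex.conj_I, Complex.conj_ofReal, map_ofNat]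
    rw [mul_neg]
    ring
  rw [← r1, ← r2]
  -- For fixed `u` and `x` both sides are continuous linear functionals of `w`, so Schwartz
  -- functions suffice; there everything is an absolutely convergent integral.
  have key := schwartz_ext (f := (innerSL ℂ (m1.toLp _)) ∘L
      (Lp.fourierTransformₗᵢ ℝ ℂ).toLinearIsometry.toContinuousLinearMap)
    (g := innerSL ℂ (m2.toLp _)) ?_
  · exact congrArg (fun T : LR →L[ℂ] ℂ => T w) key
  intro ψ
  change ⟪m1.toLp _, 𝓕 (ψ.toLp 2)⟫_ℂ = ⟪m2.toLp _, ψ.toLp 2⟫_ℂ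
  rw [r1, r2, SchwartzMap.toLp_fourier_eq]
  have m3 : ∀ p : ℝ≥0∞, MemLp (fun ξ : ℝ => Complex.exp (2 * Real.pi * x * ξ * I) *
      (starRingEnd ℂ) (ψ ξ)) p := fun p => memLp_modulate (MemLp.conj (ψ.memLp p volume)) x
  have e1 : ∫ ξ : ℝ, Complex.exp (-(2 * Real.pi * x * ξ * I)) * (u ξ * (ψ.toLp 2 : LR) ξ) =
      ⟪(m3 2).toLp _, u⟫_ℂ := by
    rw [L2.inner_def]
    refine integral_congr_ae ?_
    filter_upwards [(m3 2).coeFn_toLp, ψ.coeFn_toLp 2 volume] with y hy h2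
    rw [hy, h2, RCLike.inner_apply, map_mul, RCLike.conj_conj, ← Complex.exp_conj]
    simp only [map_mul, Complex.conj_I, Complex.conj_ofReal, map_ofNat]
    rw [mul_neg]
    ring
  rw [e1, ← Lp.inner_fourier_eq, L2.inner_def, ← integral_sub_left_eq_self _ volume x]
  refine integral_congr_ae ?_
  filter_upwards [fourier_toLp_ae (memLp_one_iff_integrable.1 (m3 1)) (m3 2),
    (Measure.measurePreserving_sub_left (volume : Measure ℝ) x).quasiMeasurePreserving.ae
      ((𝓕 ψ).coeFn_toLp 2 volume)] with y h1 h2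
  rw [h1, h2, sub_sub_cancel, fourier_modulate, RCLike.inner_apply, conj_fourier]
  simp only [Complex.conj_conj, neg_sub]
  rfl

lemma fourier_reflOp (u : LR) : 𝓕 (reflOp u) = reflOp (𝓕 u : LR) := by
  have hd := SchwartzMap.denseRange_toLpCLM (E := ℝ) (F := ℂ) (p := 2) (μ := volume) (by norm_num)
  have hF : Continuous fun u : LR => (𝓕 u : LR) := (Lp.fourierTransformₗᵢ ℝ ℂ).continuous
  refine congrFun (hd.equalizer (hF.comp reflOp.continuous) (reflOp.continuous.comp hF)
    (funext fun ψ => ?_)) u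
  change 𝓕 (reflOp (ψ.toLp 2)) = reflOp (𝓕 (ψ.toLp 2 : LR))
  have m : ∀ p : ℝ≥0∞, MemLp (fun ξ : ℝ => ψ (-ξ)) p := fun p =>
    (ψ.memLp p volume).comp_measurePreserving (Measure.measurePreserving_neg volume)
  have e : reflOp (ψ.toLp 2) = (m 2).toLp _ := by
    ext
    filter_upwards [coeFn_reflOp (ψ.toLp 2), ae_neg (ψ.coeFn_toLp 2 volume), (m 2).coeFn_toLp]
      with x h1 h2 h3
    rw [h1, h2, h3]
  rw [e, SchwartzMap.toLp_fourier_eq]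
  ext
  filter_upwards [fourier_toLp_ae (memLp_one_iff_integrable.1 (m 1)) (m 2),
    coeFn_reflOp ((𝓕 ψ).toLp 2), ae_neg ((𝓕 ψ).coeFn_toLp 2 volume)] with x h1 h2 h3
  rw [h1, h2, h3, ← Real.fourierInv_eq_fourier_comp_neg (ψ : ℝ → ℂ), Real.fourierInv_eq_fourier_neg]
  rfl

/-- The convolution operator with the Fourier transform of `c` on the Fourier side. -/
lemma fourier_mulOp_ae (c : ℝ →ᵇ ℂ) (hc : MemLp c 2) (u : LR) :
    (𝓕 (mulOp c (𝓕⁻ u)) : LR) =ᵐ[volume] fun x => ∫ y, (𝓕 (hc.toLp c) : LR) (x - y) * u y := by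
  set w : LR := 𝓕⁻ u
  have hu : u = 𝓕 w := (FourierTransform.fourier_fourierInv_eq u).symm
  have m2 : MemLp (fun x => c x * w x) 2 := memLp_bcf_mul c (Lp.memLp w)
  have m1 : Integrable (fun x => c x * w x) := hc.integrable_mul (Lp.memLp w)
  have e : mulOp c w = m2.toLp _ := rfl
  rw [e]
  filter_upwards [fourier_toLp_ae m1 m2] with x hx
  rw [hx, hu, integral_fourier_conv, Real.fourier_real_eq_integral_exp_smul]
  refine integral_congr_ae ?_
  filter_upwards [hc.coeFn_toLp] with ξ hξ
  rw [hξ, smul_eq_mul]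
  congr 2
  push_cast
  ring

end Model

/-! ### Extension by zero and restriction -/

section Restriction

variable {μ ν : Measure ℝ} {s : Set ℝ}

lemma memLp_extend (hs : MeasurableSet s) (h : ν = μ.restrict s) (f : Lp ℂ 2 ν) :
    MemLp (s.indicator f) 2 μ := by
  subst h
  exact (memLp_indicator_iff_restrict hs).2 (Lp.memLp f)

/-- Extension by zero. -/
def extOp (hs : MeasurableSet s) (h : ν = μ.restrict s) : Lp ℂ 2 ν →L[ℂ] Lp ℂ 2 μ :=
  LinearMap.mkContinuous
    { toFun := fun f => (memLp_extend hs h f).toLp (s.indicator f)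
      map_add' := by
        subst h
        intro f g
        rw [← MemLp.toLp_add]
        refine MemLp.toLp_congr _ _ ?_
        filter_upwards [(ae_restrict_iff' hs).1 (Lp.coeFn_add f g)] with x hx
        by_cases h : x ∈ s
        · simpa [h] using hx h
        · simp [h]
      map_smul' := by
        subst h
        intro c f
        rw [RingHom.id_apply, ← MemLp.toLp_const_smul]
        refine MemLp.toLp_congr _ _ ?_
        filter_upwards [(ae_restrict_iff' hs).1 (Lp.coeFn_smul c f)] with x hx
        by_cases h : x ∈ s
        · simpa [h] using hx h
        · simp [h] }
    1 (by
      subst h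
      intro f
      rw [one_mul]
      simp only [LinearMap.coe_mk, AddHom.coe_mk]
      rw [Lp.norm_toLp, Lp.norm_def, eLpNorm_indicator_eq_eLpNorm_restrict hs])

lemma coeFn_extOp (hs : MeasurableSet s) (h : ν = μ.restrict s) (f : Lp ℂ 2 ν) :
    extOp hs h f =ᵐ[μ] s.indicator f :=
  (memLp_extend hs h f).coeFn_toLp

lemma restrict_le_of_eq (h : ν = μ.restrict s) : ν ≤ μ := h ▸ Measure.restrict_le_self

/-- Restriction to a subset. -/
def restOp (h : ν = μ.restrict s) : Lp ℂ 2 μ →L[ℂ] Lp ℂ 2 ν :=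
  LinearMap.mkContinuous
    { toFun := fun f => ((Lp.memLp f).mono_measure (restrict_le_of_eq h)).toLp f
      map_add' := by
        intro f g
        rw [← MemLp.toLp_add]
        exact MemLp.toLp_congr _ _
          ((restrict_le_of_eq h).absolutelyContinuous.ae_eq (Lp.coeFn_add f g))
      map_smul' := by
        intro c f
        rw [RingHom.id_apply, ← MemLp.toLp_const_smul]
        exact MemLp.toLp_congr _ _
          ((restrict_le_of_eq h).absolutelyContinuous.ae_eq (Lp.coeFn_smul c f)) }
    1 (by
      intro f
      rw [one_mul]
      simp only [LinearMap.coe_mk, AddHom.coe_mk]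
      rw [Lp.norm_toLp, Lp.norm_def]
      exact ENNReal.toReal_mono (Lp.eLpNorm_ne_top f)
        (eLpNorm_mono_measure _ (restrict_le_of_eq h)))

lemma coeFn_restOp (h : ν = μ.restrict s) (f : Lp ℂ 2 μ) : restOp h f =ᵐ[ν] f :=
  ((Lp.memLp f).mono_measure (restrict_le_of_eq h)).coeFn_toLp

lemma ae_of_ae_eq_restrict (h : ν = μ.restrict s) {p : ℝ → Prop} (hp : ∀ᵐ x ∂μ, p x) :
    ∀ᵐ x ∂ν, p x :=
  (restrict_le_of_eq h).absolutelyContinuous hp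

lemma ae_mem_of_eq_restrict (hs : MeasurableSet s) (h : ν = μ.restrict s) : ∀ᵐ x ∂ν, x ∈ s := by
  subst h
  exact ae_restrict_mem hs

lemma restOp_extOp (hs : MeasurableSet s) (h : ν = μ.restrict s) :
    restOp h ∘L extOp hs h = 1 := by
  ext f
  change restOp h (extOp hs h f) =ᵐ[ν] f
  filter_upwards [coeFn_restOp h (extOp hs h f), ae_of_ae_eq_restrict h (coeFn_extOp hs h f),
    ae_mem_of_eq_restrict hs h] with x h1 h2 h3
  rw [h1, h2, indicator_of_mem h3]

lemma extOp_restOp_ae (hs : MeasurableSet s) (h : ν = μ.restrict s) (f : Lp ℂ 2 μ) :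
    extOp hs h (restOp h f) =ᵐ[μ] s.indicator f := by
  have h1 := coeFn_restOp h f
  subst h
  filter_upwards [coeFn_extOp hs rfl (restOp rfl f), (ae_restrict_iff' hs).1 h1] with x h2 h3
  rw [h2]
  by_cases hx : x ∈ s
  · rw [indicator_of_mem hx, indicator_of_mem hx, h3 hx]
  · rw [indicator_of_notMem hx, indicator_of_notMem hx]

lemma integral_mul_extOp (hs : MeasurableSet s) (h : ν = μ.restrict s) (κ : ℝ → ℂ)
    (f : Lp ℂ 2 ν) : ∫ y, κ y * extOp hs h f y ∂μ = ∫ y, κ y * f y ∂ν := by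
  have h1 := coeFn_extOp hs h f
  subst h
  rw [← integral_indicator hs]
  refine integral_congr_ae ?_
  filter_upwards [h1] with x hx
  rw [hx]
  by_cases hx : x ∈ s
  · rw [indicator_of_mem hx, indicator_of_mem hx]
  · rw [indicator_of_notMem hx, indicator_of_notMem hx, mul_zero]

end Restriction

/-! ### The Hardy space of the half-line -/

section Line

open scoped BoundedContinuousFunction

/-- Extension by zero from the half-line. -/
def extH : Lp ℂ 2 halfLine →L[ℂ] LR := extOp measurableSet_Ioi rfl

/-- Restriction to the half-line. -/
def restH : LR →L[ℂ] Lp ℂ 2 halfLine := restOp rfl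

/-- The Fourier transform as a bounded operator. -/
def fourL : LR →L[ℂ] LR := (Lp.fourierTransformₗᵢ ℝ ℂ).toLinearIsometry.toContinuousLinearMap

/-- The inverse Fourier transform as a bounded operator. -/
def fourInvL : LR →L[ℂ] LR :=
  (Lp.fourierTransformₗᵢ ℝ ℂ).symm.toLinearIsometry.toContinuousLinearMap

lemma fourL_apply (u : LR) : fourL u = 𝓕 u := rfl

lemma fourInvL_apply (u : LR) : fourInvL u = 𝓕⁻ u := rfl

lemma fourL_fourInvL (u : LR) : fourL (fourInvL u) = u :=
  (Lp.fourierTransformₗᵢ ℝ ℂ).apply_symm_apply u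

lemma fourInvL_fourL (u : LR) : fourInvL (fourL u) = u :=
  (Lp.fourierTransformₗᵢ ℝ ℂ).symm_apply_apply u

lemma fourL_reflOp (u : LR) : fourL (reflOp u) = reflOp (fourL u) := fourier_reflOp u

lemma fourInvL_reflOp (u : LR) : fourInvL (reflOp u) = reflOp (fourInvL u) := by
  rw [← fourInvL_fourL (reflOp (fourInvL u)), fourL_reflOp, fourL_fourInvL]

/-- The inclusion of the Hardy space of the half-line. -/
def lineIncl : Lp ℂ 2 halfLine →L[ℂ] LR := fourInvL ∘L extH

/-- The projection onto the Hardy space of the half-line. -/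
def lineProj : LR →L[ℂ] Lp ℂ 2 halfLine := restH ∘L fourL

/-- On the Fourier side the Hardy space consists of functions supported on `(0,∞)`, and reflection
exchanges the two half-lines, which fill the line up to the null set `{0}`. -/
lemma lineSetup : HardySetup lineIncl lineProj reflOp where
  retract := by
    ext1 f
    change restH (fourL (fourInvL (extH f))) = f
    rw [fourL_fourInvL]
    exact congrArg (fun T : Lp ℂ 2 halfLine →L[ℂ] Lp ℂ 2 halfLine => T f)
      (restOp_extOp measurableSet_Ioi rfl)
  invol := reflOp_mul_reflOp
  decomp := by
    ext1 u
    change fourInvL (extH (restH (fourL u))) +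
      reflOp (fourInvL (extH (restH (fourL (reflOp u))))) = u
    rw [← fourInvL_reflOp, fourL_reflOp, ← map_add]
    conv_rhs => rw [← fourInvL_fourL u]
    congr 1
    set v := fourL u
    ext
    have h0 : ∀ᵐ x : ℝ, x ≠ 0 := by simp [ae_iff]
    filter_upwards [Lp.coeFn_add (extH (restH v)) (reflOp (extH (restH (reflOp v)))),
      extOp_restOp_ae measurableSet_Ioi rfl v,
      coeFn_reflOp (extH (restH (reflOp v))),
      ae_neg (extOp_restOp_ae measurableSet_Ioi rfl (reflOp v)), ae_neg (coeFn_reflOp v), h0]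
      with x h1 h2 h3 h4 h5 h6
    rw [h1, Pi.add_apply, h3]
    change extOp _ _ (restOp _ v) x + extOp _ _ (restOp _ (reflOp v)) (-x) = v x
    rw [h2, h4]
    rcases lt_or_gt_of_ne h6 with h | h
    · rw [indicator_of_notMem (by simpa using h.le), indicator_of_mem (by simpa using h), h5,
        neg_neg, zero_add]
    · rw [indicator_of_mem (by simpa using h), indicator_of_notMem (by simpa using h.le), add_zero]

lemma isIntegralOp_toep {c : ℝ →ᵇ ℂ} (hc : MemLp c 2) {κ : ℝ → ℂ}
    (hκ : κ =ᵐ[volume] (𝓕 (hc.toLp c) : LR)) :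
    IsIntegralOp halfLine (toep lineIncl lineProj (mulOp c)) (fun x y => κ (x - y)) := by
  intro f
  have hm : MemLp κ 2 := (memLp_congr_ae hκ).2 (Lp.memLp _)
  change ∀ᵐ x ∂halfLine, _ ∧ (restH (𝓕 (mulOp c (𝓕⁻ (extH f))))) x = _
  filter_upwards [coeFn_restOp (rfl : halfLine = _) (𝓕 (mulOp c (𝓕⁻ (extH f)))),
    ae_restrict_of_ae (fourier_mulOp_ae c hc (extH f))] with x h1 h2
  refine ⟨((memLp_sub_left hm x).mono_measure Measure.restrict_le_self).integrable_mul
    (Lp.memLp f), ?_⟩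
  change restOp _ _ x = _
  rw [h1, h2, ← integral_mul_extOp measurableSet_Ioi rfl]
  refine integral_congr_ae ?_
  filter_upwards [(Measure.measurePreserving_sub_left (volume : Measure ℝ)
    x).quasiMeasurePreserving.ae hκ] with y hy
  rw [hy]
  rfl

lemma isIntegralOp_hank {c : ℝ →ᵇ ℂ} (hc : MemLp c 2) {κ : ℝ → ℂ}
    (hκ : κ =ᵐ[volume] (𝓕 (hc.toLp c) : LR)) :
    IsIntegralOp halfLine (hank lineIncl lineProj reflOp (mulOp c)) (fun x y => κ (x + y)) := by
  intro f
  have hm : MemLp κ 2 := (memLp_congr_ae hκ).2 (Lp.memLp _)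
  change ∀ᵐ x ∂halfLine, _ ∧ (restH (𝓕 (mulOp c (reflOp (fourInvL (extH f)))))) x = _
  rw [← fourInvL_reflOp, fourInvL_apply]
  filter_upwards [coeFn_restOp (rfl : halfLine = _) (𝓕 (mulOp c (𝓕⁻ (reflOp (extH f))))),
    ae_restrict_of_ae (fourier_mulOp_ae c hc (reflOp (extH f)))] with x h1 h2
  refine ⟨((hm.comp_measurePreserving (measurePreserving_add_left volume x)).mono_measure
    Measure.restrict_le_self).integrable_mul (Lp.memLp f), ?_⟩
  change restOp _ _ x = _
  -- The substitution `y ↦ -y` undoes the reflection of the function and turns the convolution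
  -- kernel `κ(x - y)` into `κ(x + y)`.
  rw [h1, h2, ← integral_mul_extOp measurableSet_Ioi rfl, ← integral_neg_eq_self]
  refine integral_congr_ae ?_
  filter_upwards [(measurePreserving_add_left (volume : Measure ℝ)
    x).quasiMeasurePreserving.ae hκ, ae_neg (coeFn_reflOp (extH f))] with y hy h3
  rw [hy, h3, sub_neg_eq_add, neg_neg]
  rfl

end Line

/-! ### Dilations and the kernel of a symbol -/

section Dilation

open scoped BoundedContinuousFunction

lemma memLp_comp_mul_left {p : ℝ≥0∞} {f : ℝ → ℂ} (hf : MemLp f p) {r : ℝ} (hr : r ≠ 0) :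
    MemLp (fun x => f (r * x)) p := by
  have h : MemLp f p (Measure.map (fun x : ℝ => r * x) volume) := by
    rw [Real.map_volume_mul_left hr]
    exact hf.smul_measure ENNReal.ofReal_ne_top
  exact h.comp_of_map (by fun_prop)

lemma fourier_comp_mul_left (g : ℝ → ℂ) {r : ℝ} (hr : 0 < r) (x : ℝ) :
    (𝓕 (fun ξ => g (r * ξ)) : ℝ → ℂ) x = (r⁻¹ : ℝ) * (𝓕 g : ℝ → ℂ) (x / r) := by
  rw [Real.fourier_real_eq_integral_exp_smul, Real.fourier_real_eq_integral_exp_smul]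
  have := Measure.integral_comp_mul_left
    (fun v : ℝ => Complex.exp ((-2 * Real.pi * v * (x / r) : ℝ) * I) • g v) r
  rw [abs_of_pos (inv_pos.2 hr), Complex.real_smul] at this
  rw [← this]
  refine integral_congr_ae (Eventually.of_forall fun v => ?_)
  simp only
  congr 4
  field_simp

/-- The Fourier transform of a dilation, for square integrable functions. -/
lemma fourier_dilate_ae {g : ℝ → ℂ} (hg : MemLp g 2) {r : ℝ} (hr : 0 < r)
    (hg' : MemLp (fun ξ => g (r * ξ)) 2) :
    (𝓕 (hg'.toLp _) : LR) =ᵐ[volume] fun x => (r⁻¹ : ℝ) * (𝓕 (hg.toLp g) : LR) (x / r) := by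
  have m : MemLp (fun x => ((r⁻¹ : ℝ) : ℂ) * (𝓕 (hg.toLp g) : LR) (x / r)) 2 := by
    have := (memLp_comp_mul_left (Lp.memLp (𝓕 (hg.toLp g) : LR)) (inv_ne_zero hr.ne')).const_mul
      ((r⁻¹ : ℝ) : ℂ)
    simpa [div_eq_inv_mul] using this
  suffices h : (𝓕 (hg'.toLp _) : LR) = m.toLp _ by
    rw [h]; exact m.coeFn_toLp
  suffices h : innerSL ℂ (𝓕 (hg'.toLp _) : LR) = innerSL ℂ (m.toLp _) from
    ext_inner_right ℂ fun w => congrArg (fun T : LR →L[ℂ] ℂ => T w) h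
  refine schwartz_ext fun ψ => ?_
  change ⟪(𝓕 (hg'.toLp _) : LR), ψ.toLp 2⟫_ℂ = ⟪m.toLp _, ψ.toLp 2⟫_ℂ
  have e2 : ψ.toLp 2 = 𝓕 ((𝓕⁻ ψ).toLp 2 : LR) := by
    rw [SchwartzMap.toLp_fourier_eq, FourierTransform.fourier_fourierInv_eq]
  set η := 𝓕⁻ ψ with hη
  have hηψ : (𝓕 (η : ℝ → ℂ) : ℝ → ℂ) = ψ := by
    rw [← SchwartzMap.fourier_coe, hη, FourierTransform.fourier_fourierInv_eq]
  have mη : ∀ p : ℝ≥0∞, MemLp (fun ξ => η (r⁻¹ * ξ)) p := fun p =>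
    memLp_comp_mul_left (η.memLp p volume) (inv_ne_zero hr.ne')
  have s1 : ⟪(𝓕 (hg'.toLp _) : LR), ψ.toLp 2⟫_ℂ = (r⁻¹ : ℝ) * ⟪hg.toLp g, (mη 2).toLp _⟫_ℂ := by
    rw [e2, Lp.inner_fourier_eq, L2.inner_def, L2.inner_def]
    have h1 : ∫ ξ, ⟪(hg'.toLp _ : LR) ξ, (η.toLp 2 : LR) ξ⟫_ℂ =
        ∫ ξ, ⟪g (r * ξ), η (r⁻¹ * (r * ξ))⟫_ℂ := by
      refine integral_congr_ae ?_
      filter_upwards [hg'.coeFn_toLp, η.coeFn_toLp 2 volume] with x h1 h2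
      rw [h1, h2, inv_mul_cancel_left₀ hr.ne']
    rw [h1, Measure.integral_comp_mul_left (fun ξ => ⟪g ξ, η (r⁻¹ * ξ)⟫_ℂ) r,
      abs_of_pos (inv_pos.2 hr), Complex.real_smul]
    congr 1
    refine integral_congr_ae ?_
    filter_upwards [hg.coeFn_toLp, (mη 2).coeFn_toLp] with x h1 h2
    rw [h1, h2]
  rw [s1, ← Lp.inner_fourier_eq, L2.inner_def, L2.inner_def]
  have h2 : ∫ ξ, ⟪(m.toLp _ : LR) ξ, (ψ.toLp 2 : LR) ξ⟫_ℂ =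
      ∫ x, ⟪((r⁻¹ : ℝ) : ℂ) * (𝓕 (hg.toLp g) : LR) (r⁻¹ * x), ψ (r * (r⁻¹ * x))⟫_ℂ := by
    refine integral_congr_ae ?_
    filter_upwards [m.coeFn_toLp, ψ.coeFn_toLp 2 volume] with x h1 h2
    rw [h1, h2, mul_inv_cancel_left₀ hr.ne', div_eq_inv_mul]
  rw [h2, Measure.integral_comp_mul_left (fun x => ⟪((r⁻¹ : ℝ) : ℂ) * (𝓕 (hg.toLp g) : LR) x,
    ψ (r * x)⟫_ℂ) r⁻¹, inv_inv, abs_of_pos hr, Complex.real_smul, ← integral_const_mul,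
    ← integral_const_mul]
  refine integral_congr_ae ?_
  filter_upwards [fourier_toLp_ae (memLp_one_iff_integrable.1 (mη 1)) (mη 2)] with x h1
  rw [h1, fourier_comp_mul_left (η : ℝ → ℂ) (inv_pos.2 hr), hηψ, inv_inv, div_inv_eq_mul]
  simp only [RCLike.inner_apply, map_mul, Complex.conj_ofReal]
  push_cast
  rw [mul_comm x r]
  ring

/-- The dilation of the symbol by `2π` absorbs both the factor `1/2π` and the difference in the
exponents. This is why all multipliers below are symbols evaluated at `2πξ`. -/
lemma kernel_eq_fourier {a : ℝ → ℂ} (h : Integrable fun ξ => a ξ - 1) (x : ℝ) :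
    kernel a x = (𝓕 (fun ξ => a (2 * Real.pi * ξ) - 1) : ℝ → ℂ) x := by
  rw [kernel, if_pos h, fourier_comp_mul_left (fun ξ => a ξ - 1) Real.two_pi_pos,
    Real.fourier_real_eq_integral_exp_smul]
  congr 1
  · push_cast; rw [one_div]
  · refine integral_congr_ae (Eventually.of_forall fun ξ => ?_)
    simp only [smul_eq_mul]
    rw [mul_comm]
    congr 2
    have : (Real.pi : ℂ) ≠ 0 := by exact_mod_cast Real.pi_ne_zero
    push_cast
    field_simp

lemma kernel_ae_eq {a : ℝ → ℂ} (h : MemLp (fun ξ => a ξ - 1) 2) {c : ℝ → ℂ}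
    (hc : ∀ ξ, c ξ = a (2 * Real.pi * ξ) - 1) (hc2 : MemLp c 2) :
    kernel a =ᵐ[volume] (𝓕 (hc2.toLp c) : LR) := by
  obtain rfl : c = fun ξ => a (2 * Real.pi * ξ) - 1 := funext hc
  by_cases hi : Integrable fun ξ => a ξ - 1
  · have hi' : Integrable fun ξ => a (2 * Real.pi * ξ) - 1 :=
      memLp_one_iff_integrable.1 (memLp_comp_mul_left (memLp_one_iff_integrable.2 hi)
        Real.two_pi_pos.ne')
    filter_upwards [fourier_toLp_ae hi' hc2] with x hx
    rw [hx, kernel_eq_fourier hi]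
  · filter_upwards [fourier_dilate_ae h Real.two_pi_pos hc2] with x hx
    rw [hx, kernel, if_neg hi, dif_pos h]
    push_cast
    rw [one_div]

/-- The bounded continuous function `A` is the symbol `a` after a dilation. -/
structure IsDilated (A : ℝ →ᵇ ℂ) (a : ℝ → ℂ) : Prop where
  apply : ∀ ξ, A ξ = a (2 * Real.pi * ξ)
  memLp : MemLp (fun ξ => a ξ - 1) 2

namespace IsDilated

variable {A : ℝ →ᵇ ℂ} {a : ℝ → ℂ}

lemma memLp' (h : IsDilated A a) : MemLp ((A - 1 : ℝ →ᵇ ℂ) : ℝ → ℂ) 2 := by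
  have := memLp_comp_mul_left h.memLp Real.two_pi_pos.ne'
  refine this.ae_eq (Eventually.of_forall fun ξ => ?_)
  simp [h.apply]

lemma kernel_ae (h : IsDilated A a) : kernel a =ᵐ[volume] (𝓕 (h.memLp'.toLp _) : LR) :=
  kernel_ae_eq h.memLp (fun ξ => by simp [h.apply]) h.memLp'

lemma isIntegralOp_diff (h : IsDilated A a) :
    IsIntegralOp halfLine (toep lineIncl lineProj (mulOp (A - 1))) (diffKernel a) :=
  isIntegralOp_toep h.memLp' h.kernel_ae

lemma isIntegralOp_sum (h : IsDilated A a) :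
    IsIntegralOp halfLine (hank lineIncl lineProj reflOp (mulOp (A - 1))) (sumKernel a) :=
  isIntegralOp_hank h.memLp' h.kernel_ae

lemma mulOp_eq (A : ℝ →ᵇ ℂ) : mulOp A = 1 + mulOp (A - 1) := by
  rw [← mulOp_one, ← mulOp_add, add_sub_cancel]

lemma W_eq (h : IsDilated A a) : W a = toep lineIncl lineProj (mulOp A) := by
  rw [W, h.isIntegralOp_diff.integralOp_eq, mulOp_eq A]
  conv_lhs => rw [← ContinuousLinearMap.one_def, ← lineSetup.toep_one]
  simp only [toep]
  ext1 f
  simp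

lemma HL_eq (h : IsDilated A a) : HL a = hank lineIncl lineProj reflOp (mulOp A) := by
  rw [HL, h.isIntegralOp_sum.integralOp_eq, mulOp_eq A]
  rw [← zero_add (hank lineIncl lineProj reflOp (mulOp (A - 1))), ← lineSetup.hank_one]
  simp only [hank]
  ext1 f
  simp

end IsDilated

end Dilation

/-! ### Trace class integral operators with smooth symbols -/

section Fields

/-- Lebesgue measure on `ℝ × (0,∞)`. -/
abbrev stripMeasure : Measure (ℝ × ℝ) := volume.prod (volume.restrict (Ioi 0))

/-- The function `α(t) e^{iAt} √s e^{-ps}`. -/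
def field (α : ℝ → ℂ) (A p : ℝ) (z : ℝ × ℝ) : ℂ :=
  (α z.1 * Complex.exp (I * A * z.1)) * ((√z.2 * Real.exp (-(p * z.2)) : ℝ) : ℂ)

lemma norm_exp_I_mul (A t : ℝ) : ‖Complex.exp (I * A * t)‖ = 1 := by
  have := Complex.norm_exp_ofReal_mul_I (A * t)
  rw [← this]
  congr 2
  push_cast
  ring

lemma integrableOn_mul_exp {p : ℝ} (hp : 0 < p) :
    Integrable (fun s : ℝ => s * Real.exp (-(p * s))) (volume.restrict (Ioi 0)) := by
  have := integrableOn_rpow_mul_exp_neg_mul_rpow (s := 1) (p := 1) (b := p) (by norm_num)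
    one_pos hp
  simpa [IntegrableOn] using this

lemma integral_mul_exp {p : ℝ} (hp : 0 < p) :
    ∫ s in Ioi (0 : ℝ), s * Real.exp (-(p * s)) = 1 / p ^ 2 := by
  have := Real.integral_rpow_mul_exp_neg_mul_Ioi (a := 2) (r := p) (by norm_num) hp
  have h2 : Real.Gamma 2 = 1 := by
    simpa using Real.Gamma_nat_eq_factorial 1
  have h3 : (2 : ℝ) - 1 = 1 := by norm_num
  simpa [h2, h3] using this

lemma memLp_field {α : ℝ → ℂ} (hα : MemLp α 2) (A : ℝ) {p : ℝ} (hp : 0 < p) :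
    MemLp (field α A p) 2 stripMeasure := by
  have h1 : AEStronglyMeasurable (fun t : ℝ => α t * Complex.exp (I * A * t)) volume := by
    have : Continuous fun t : ℝ => Complex.exp (I * A * t) := by fun_prop
    exact hα.1.mul this.aestronglyMeasurable
  have h2 : Continuous (fun s : ℝ => ((√s * Real.exp (-(p * s)) : ℝ) : ℂ)) := by fun_prop
  have hm : AEStronglyMeasurable (field α A p) stripMeasure :=
    h1.comp_fst.mul (h2.aestronglyMeasurable (μ := volume.restrict (Ioi 0))).comp_snd
  rw [memLp_two_iff_integrable_sq_norm hm]
  have e : ∀ z : ℝ × ℝ, 0 < z.2 → ‖field α A p z‖ ^ 2 =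
      ‖α z.1‖ ^ 2 * (z.2 * Real.exp (-(2 * p * z.2))) := by
    intro z hz
    rw [field, norm_mul, norm_mul, norm_exp_I_mul, mul_one, mul_pow, Complex.norm_real,
      Real.norm_of_nonneg (by positivity), mul_pow, Real.sq_sqrt hz.le, ← Real.exp_nat_mul]
    congr 3
    push_cast
    ring
  have hi : Integrable (fun z : ℝ × ℝ => ‖α z.1‖ ^ 2 * (z.2 * Real.exp (-(2 * p * z.2))))
      stripMeasure :=
    (hα.norm.integrable_sq).mul_prod (integrableOn_mul_exp (p := 2 * p) (by positivity))
  refine hi.congr ?_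
  have hz : ∀ᵐ z ∂stripMeasure, 0 < z.2 :=
    Measure.quasiMeasurePreserving_snd.ae (ae_restrict_mem measurableSet_Ioi)
  filter_upwards [hz] with z hz
  exact (e z hz).symm

/-- The integral over `t` is a Fourier transform at `B - A`, and the integral over `s` is the
Laplace integral `∫ s e^(-(p+q)s) ds = (p+q)⁻²`. A kernel depending on sums thereby becomes an inner
product of a vector depending on `x` and one depending on `y`. -/
lemma inner_field {α β : ℝ → ℂ} (hα : MemLp α 2) (hβ : MemLp β 2) (A B : ℝ) {p q : ℝ}
    (hp : 0 < p) (hq : 0 < q) :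
    ⟪(memLp_field hα A hp).toLp _, (memLp_field hβ B hq).toLp _⟫_ℂ =
      (∫ t : ℝ, (starRingEnd ℂ) (α t) * β t * Complex.exp (I * (B - A : ℝ) * t)) *
        ((1 / (p + q) ^ 2 : ℝ) : ℂ) := by
  rw [L2.inner_def, ← integral_mul_exp (add_pos hp hq), ← integral_complex_ofReal,
    ← integral_prod_mul]
  refine integral_congr_ae ?_
  have hz : ∀ᵐ z ∂stripMeasure, 0 < z.2 :=
    Measure.quasiMeasurePreserving_snd.ae (ae_restrict_mem measurableSet_Ioi)
  filter_upwards [(memLp_field hα A hp).coeFn_toLp, (memLp_field hβ B hq).coeFn_toLp, hz]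
    with z h1 h2 h3
  rw [h1, h2, RCLike.inner_apply, field, field]
  simp only [map_mul, Complex.conj_ofReal, ← Complex.exp_conj, Complex.conj_I]
  have e1 : Complex.exp (I * (B - A : ℝ) * z.1) =
      Complex.exp (I * B * z.1) * Complex.exp (-I * A * z.1) := by
    rw [← Complex.exp_add]; congr 1; push_cast; ring
  have e2 : ((z.2 * Real.exp (-((p + q) * z.2)) : ℝ) : ℂ) =
      ((√z.2 * Real.exp (-(q * z.2)) : ℝ) : ℂ) * ((√z.2 * Real.exp (-(p * z.2)) : ℝ) : ℂ) := by
    rw [← Complex.ofReal_mul]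
    congr 1
    have : Real.exp (-((p + q) * z.2)) = Real.exp (-(q * z.2)) * Real.exp (-(p * z.2)) := by
      rw [← Real.exp_add]; congr 1; ring
    rw [this]
    nth_rw 1 [← Real.mul_self_sqrt h3.le]
    ring
  rw [e1, e2]
  ring

/-- The squared distance of two values is a combination of inner products. It spares any direct
estimate in the space of fields and yields measurability. -/
lemma continuous_of_inner {X H : Type*} [TopologicalSpace X] [NormedAddCommGroup H]
    [InnerProductSpace ℂ H] {V : X → H} (h : Continuous fun z : X × X => ⟪V z.1, V z.2⟫_ℂ) :
    Continuous V := by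
  rw [continuous_iff_continuousAt]
  intro x₀
  rw [ContinuousAt, tendsto_iff_norm_sub_tendsto_zero]
  have h1 : ∀ x, ‖V x - V x₀‖ = √(RCLike.re (⟪V x, V x⟫_ℂ - ⟪V x, V x₀⟫_ℂ - ⟪V x₀, V x⟫_ℂ +
      ⟪V x₀, V x₀⟫_ℂ)) := by
    intro x
    rw [norm_eq_sqrt_re_inner (𝕜 := ℂ), inner_sub_sub_self]
  simp_rw [h1]
  have hc : Continuous fun x => √(RCLike.re (⟪V x, V x⟫_ℂ - ⟪V x, V x₀⟫_ℂ - ⟪V x₀, V x⟫_ℂ +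
      ⟪V x₀, V x₀⟫_ℂ)) := by
    have a1 : Continuous fun x => ⟪V x, V x⟫_ℂ := h.comp (continuous_id.prodMk continuous_id)
    have a2 : Continuous fun x => ⟪V x, V x₀⟫_ℂ := h.comp (continuous_id.prodMk continuous_const)
    have a3 : Continuous fun x => ⟪V x₀, V x⟫_ℂ := h.comp (continuous_const.prodMk continuous_id)
    exact Real.continuous_sqrt.comp
      (RCLike.continuous_re.comp (((a1.sub a2).sub a3).add continuous_const))
  have := hc.tendsto x₀
  simpa using this

lemma continuous_expIntegral {h : ℝ → ℂ} (hh : Integrable h) :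
    Continuous fun A : ℝ => ∫ t : ℝ, h t * Complex.exp (I * A * t) := by
  refine continuous_of_dominated (bound := fun t => ‖h t‖) (fun A => ?_) (fun A => ?_) hh.norm ?_
  · have : Continuous fun t : ℝ => Complex.exp (I * A * t) := by fun_prop
    exact hh.1.mul this.aestronglyMeasurable
  · refine Eventually.of_forall fun t => ?_
    rw [norm_mul, norm_exp_I_mul, mul_one]
  · exact Eventually.of_forall fun t => by fun_prop

lemma memLp_toLp_field {μ : Measure ℝ} {α : ℝ → ℂ} (hα : MemLp α 2) {A p : ℝ → ℝ}
    (hA : Continuous A) (hp : Continuous p) (hp0 : ∀ x, 0 < p x)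
    (hi : Integrable (fun x => 1 / p x ^ 2) μ) :
    MemLp (fun x => (memLp_field hα (A x) (hp0 x)).toLp _) 2 μ := by
  have hint : Integrable fun t => (starRingEnd ℂ) (α t) * α t := by
    exact (MemLp.conj hα).integrable_mul hα
  have hc : Continuous (fun x => (memLp_field hα (A x) (hp0 x)).toLp _) := by
    refine continuous_of_inner (Continuous.congr ?_ fun z =>
      (inner_field hα hα (A z.1) (A z.2) (hp0 z.1) (hp0 z.2)).symm)
    refine Continuous.mul ?_ ?_
    · exact (continuous_expIntegral hint).comp
        (g := fun A : ℝ => ∫ t : ℝ, (starRingEnd ℂ) (α t) * α t * Complex.exp (I * A * t))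
        (f := fun z : ℝ × ℝ => A z.2 - A z.1) (by fun_prop)
    · refine Complex.continuous_ofReal.comp (continuous_const.div (by fun_prop) fun z => ?_)
      exact (pow_pos (add_pos (hp0 _) (hp0 _)) 2).ne'
  rw [memLp_two_iff_integrable_sq_norm hc.aestronglyMeasurable]
  have e : ∀ x, ‖(memLp_field hα (A x) (hp0 x)).toLp _‖ ^ 2 =
      ‖∫ t : ℝ, (starRingEnd ℂ) (α t) * α t‖ / 4 * (1 / p x ^ 2) := by
    intro x
    have h1 := inner_field hα hα (A x) (A x) (hp0 x) (hp0 x)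
    rw [inner_self_eq_norm_sq_to_K, sub_self] at h1
    have h2 := congrArg norm h1
    simp only [norm_mul, norm_pow, RCLike.norm_ofReal, abs_norm, Complex.norm_real,
      Complex.ofReal_zero, mul_zero, zero_mul, Complex.exp_zero, mul_one] at h2
    rw [h2, Real.norm_of_nonneg (by positivity)]
    have := (hp0 x).ne'
    field_simp
    ring
  simp_rw [e]
  exact hi.const_mul _

/-- The function `(2π)⁻¹ ∫ g(ξ) e^{-ixξ} dξ`. -/
def fk (g : ℝ → ℂ) (x : ℝ) : ℂ := (1 / (2 * Real.pi)) * ∫ ξ : ℝ, g ξ * Complex.exp (-I * x * ξ)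

/-- Operators with kernel `ĥ(A x + B y) / (p x + q y)²` are of trace class. -/
lemma exists_isRep_kernel {μ : Measure ℝ} {h : ℝ → ℂ} (hh : Integrable h) {A B p q : ℝ → ℝ}
    (hA : Continuous A) (hB : Continuous B) (hp : Continuous p) (hq : Continuous q)
    (hp0 : ∀ x, 0 < p x) (hq0 : ∀ x, 0 < q x) (hpi : Integrable (fun x => 1 / p x ^ 2) μ)
    (hqi : Integrable (fun x => 1 / q x ^ 2) μ) :
    ∃ (K : Lp ℂ 2 μ →L[ℂ] Lp ℂ 2 μ) (ι : Type) (_ : Countable ι) (a b : ι → Lp ℂ 2 μ),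
      IsIntegralOp μ K (fun x y => fk h (A x + B y) * ((1 / (p x + q y) ^ 2 : ℝ) : ℂ)) ∧
      IsRep K a b ∧
      ∑' i, ⟪a i, b i⟫_ℂ = ∫ x, fk h (A x + B x) * ((1 / (p x + q x) ^ 2 : ℝ) : ℂ) ∂μ := by
  -- The integrable `h` is split into two square integrable factors of modulus proportional to
  -- `√|h|`. Where `h` vanishes the inverse is zero by convention.
  set α : ℝ → ℂ := fun t => ((√‖h t‖ : ℝ) : ℂ) with hαdef
  set β : ℝ → ℂ := fun t => (1 / (2 * Real.pi)) * (h t * ((√‖h t‖ : ℝ) : ℂ)⁻¹) with hβdef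
  have mα : AEStronglyMeasurable α volume :=
    Complex.continuous_ofReal.comp_aestronglyMeasurable
      (Real.continuous_sqrt.comp_aestronglyMeasurable hh.1.norm)
  have hα : MemLp α 2 := by
    rw [memLp_two_iff_integrable_sq_norm mα]
    refine hh.norm.congr (Eventually.of_forall fun t => ?_)
    simp only [hαdef, Complex.norm_real, Real.norm_of_nonneg (Real.sqrt_nonneg _),
      Real.sq_sqrt (norm_nonneg (h t))]
  have hβ' : MemLp (fun t => h t * (α t)⁻¹) 2 := by
    refine hα.of_le (hh.1.mul mα.aemeasurable.inv.aestronglyMeasurable)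
      (Eventually.of_forall fun t => ?_)
    simp only [hαdef, norm_mul, norm_inv, Complex.norm_real,
      Real.norm_of_nonneg (Real.sqrt_nonneg _)]
    by_cases h0 : ‖h t‖ = 0
    · simp [h0]
    · rw [← div_eq_mul_inv, Real.div_sqrt]
  have hβ : MemLp β 2 := hβ'.const_mul _
  have hαβ : ∀ t, (starRingEnd ℂ) (α t) * β t = (1 / (2 * Real.pi)) * h t := by
    intro t
    simp only [hαdef, hβdef, Complex.conj_ofReal]
    by_cases h0 : h t = 0
    · simp [h0]
    · have : ((√‖h t‖ : ℝ) : ℂ) ≠ 0 := by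
        exact_mod_cast (Real.sqrt_pos.2 (norm_pos_iff.2 h0)).ne'
      field_simp
  have hv := memLp_toLp_field hα hA hp hp0 hpi
  -- The sign is needed because the inner product of two fields produces the difference of the
  -- frequencies, whereas the kernel contains `A x + B y`.
  have hw := memLp_toLp_field hβ hB.neg hq hq0 hqi
  have hin : ∀ x y, ⟪(memLp_field hα (A x) (hp0 x)).toLp _,
      (memLp_field hβ (-B y) (hq0 y)).toLp _⟫_ℂ =
      fk h (A x + B y) * ((1 / (p x + q y) ^ 2 : ℝ) : ℂ) := by
    intro x y
    rw [inner_field hα hβ (A x) (-B y) (hp0 x) (hq0 y), fk, ← integral_const_mul]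
    congr 2
    ext t
    rw [hαβ, mul_assoc]
    congr 3
    push_cast
    ring
  obtain ⟨ι, hι, a, b, hr, ht⟩ := exists_isRep_rowOp_comp hv hw
  refine ⟨_, ι, hι, a, b, fun f => ?_, hr, ?_⟩
  · simpa only [Pi.neg_apply, hin] using isIntegral_rowOp_comp hv hw f
  · rw [ht]
    simp only [Pi.neg_apply, hin]

lemma IsIntegralOp.congr {μ : Measure ℝ} {K : Lp ℂ 2 μ →L[ℂ] Lp ℂ 2 μ} {κ κ' : ℝ → ℝ → ℂ}
    (h : IsIntegralOp μ K κ) (hκ : ∀ᵐ x ∂μ, ∀ᵐ y ∂μ, κ x y = κ' x y) : IsIntegralOp μ K κ' := by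
  intro f
  filter_upwards [h f, hκ] with x h1 h2
  have e : (fun y => κ x y * f y) =ᵐ[μ] fun y => κ' x y * f y := by
    filter_upwards [h2] with y hy
    rw [hy]
  exact ⟨h1.1.congr e, h1.2.trans (integral_congr_ae e)⟩

/-- Twice continuously differentiable functions with integrable derivatives up to order two. -/
structure IsSmoothL1 (g : ℝ → ℂ) : Prop where
  smooth : ContDiff ℝ 2 g
  integrable : ∀ i ≤ 2, Integrable (iteratedDeriv i g)

namespace IsSmoothL1

variable {g : ℝ → ℂ}

lemma integrable_self (h : IsSmoothL1 g) : Integrable g := by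
  simpa using h.integrable 0 (by norm_num)

lemma fk_deriv (h : IsSmoothL1 g) {n : ℕ} (hn : n ≤ 2) (x : ℝ) :
    fk (iteratedDeriv n g) x = (I * x) ^ n * fk g x := by
  have e : ∀ f : ℝ → ℂ, fk f x = (1 / (2 * Real.pi)) * (𝓕 f : ℝ → ℂ) (x / (2 * Real.pi)) := by
    intro f
    rw [fk, Real.fourier_real_eq_integral_exp_smul]
    congr 1
    refine integral_congr_ae (Eventually.of_forall fun t => ?_)
    simp only [smul_eq_mul]
    rw [mul_comm]
    congr 2
    have : (Real.pi : ℂ) ≠ 0 := by exact_mod_cast Real.pi_ne_zero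
    push_cast
    field_simp
  have h2 := Real.fourier_iteratedDeriv (N := 2) (n := n) (f := g) (by exact_mod_cast h.smooth)
    (fun i hi => h.integrable i (by exact_mod_cast hi)) (by exact_mod_cast hn)
  rw [e, e, h2]
  simp only [smul_eq_mul]
  have : (2 * Real.pi * I * ((x / (2 * Real.pi) : ℝ) : ℂ)) = I * x := by
    have : (Real.pi : ℂ) ≠ 0 := by exact_mod_cast Real.pi_ne_zero
    push_cast
    field_simp
  rw [this]
  ring

/-- The function whose transform is `(c + z)² ĝ(z)`. -/
def shifted (c : ℝ) (g : ℝ → ℂ) (ξ : ℝ) : ℂ :=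
  c ^ 2 * g ξ + (-(2 * c * I)) * iteratedDeriv 1 g ξ + (-1) * iteratedDeriv 2 g ξ

lemma integrable_shifted (h : IsSmoothL1 g) (c : ℝ) : Integrable (shifted c g) :=
  ((h.integrable_self.const_mul _).add ((h.integrable 1 (by norm_num)).const_mul _)).add
    ((h.integrable 2 le_rfl).const_mul _)

/-- Each derivative multiplies the transform by `ix`; the coefficients of `shifted` are those of the
expansion of `(c + x)²`. -/
lemma fk_shifted (h : IsSmoothL1 g) (c x : ℝ) :
    fk (shifted c g) x = ((c + x : ℝ) : ℂ) ^ 2 * fk g x := by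
  have hI : ∀ f : ℝ → ℂ, Integrable f →
      Integrable fun ξ : ℝ => f ξ * Complex.exp (-I * x * ξ) := by
    intro f hf
    have hc : Continuous fun ξ : ℝ => Complex.exp (-I * x * ξ) := by fun_prop
    refine hf.mono (hf.1.mul hc.aestronglyMeasurable) (Eventually.of_forall fun ξ => ?_)
    have := norm_exp_I_mul (-x) ξ
    rw [norm_mul, show -I * (x : ℂ) * ξ = I * ((-x : ℝ) : ℂ) * ξ by push_cast; ring, this, mul_one]
  have e : fk (shifted c g) x = c ^ 2 * fk g x + (-(2 * c * I)) * fk (iteratedDeriv 1 g) x +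
      (-1) * fk (iteratedDeriv 2 g) x := by
    have i0 := (hI _ h.integrable_self).const_mul ((c : ℂ) ^ 2)
    have i1 := (hI _ (h.integrable 1 (by norm_num))).const_mul (-(2 * c * I))
    have i2 := (hI _ (h.integrable 2 le_rfl)).const_mul (-1)
    have i01 := i0.add i1
    simp only [fk, shifted, add_mul, mul_assoc, Pi.add_def] at *
    rw [integral_add i01 i2, integral_add i0 i1, integral_const_mul, integral_const_mul,
      integral_const_mul]
    ring
  rw [e, h.fk_deriv (n := 1) (by norm_num), h.fk_deriv le_rfl]
  push_cast
  linear_combination (-2 * c * x * fk g x - x ^ 2 * fk g x) * Complex.I_sq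

/-- Multiply and divide by `(1 + x + y)²`. The numerator is the transform of the integrable function
`shifted 1 g`, and `1 + x + y` splits as `(1/2 + x) + (1/2 + y)`, whose inverse squares are
integrable on the half-line. -/
lemma tc_hankel_halfLine (h : IsSmoothL1 g) :
    ∃ K, TC K ∧ IsIntegralOp halfLine K (fun x y => fk g (x + y)) := by
  have hi : Integrable (fun x : ℝ => 1 / (1 / 2 + |x|) ^ 2) halfLine := by
    refine Integrable.mono' ((integrable_inv_one_add_sq.const_mul 4).mono_measure
      Measure.restrict_le_self) (by
        have : Measurable fun x : ℝ => 1 / (1 / 2 + |x|) ^ 2 := by fun_prop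
        exact this.aestronglyMeasurable) (Eventually.of_forall fun x => ?_)
    rw [Real.norm_of_nonneg (by positivity), ← div_eq_mul_inv,
      div_le_div_iff₀ (by positivity) (by positivity)]
    nlinarith [abs_nonneg x, sq_abs x]
  obtain ⟨K, ι, hι, a, b, h1, h2, -⟩ := exists_isRep_kernel (h.integrable_shifted 1)
    (A := id) (B := id) (p := fun x => 1 / 2 + |x|) (q := fun x => 1 / 2 + |x|) continuous_id
    continuous_id (by fun_prop) (by fun_prop) (fun x => by positivity) (fun x => by positivity)
    hi hi
  refine ⟨K, h2.tc, h1.congr ?_⟩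
  filter_upwards [ae_restrict_mem measurableSet_Ioi] with x hx
  filter_upwards [ae_restrict_mem measurableSet_Ioi] with y hy
  rw [mem_Ioi] at hx hy
  rw [h.fk_shifted, abs_of_pos hx, abs_of_pos hy]
  simp only [id]
  have e : (1 / 2 + x + (1 / 2 + y)) = 1 + (x + y) := by ring
  have e0 : ((1 + (x + y) : ℝ) : ℂ) ≠ 0 := by exact_mod_cast (by positivity)
  rw [e, Complex.ofReal_div, Complex.ofReal_pow]
  field_simp
  simp

instance isFiniteMeasure_interval (R : ℝ) : IsFiniteMeasure (interval R) :=
  ⟨by simp [interval]⟩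

lemma integrable_of_half_le {R : ℝ} {p : ℝ → ℝ} (hp : Continuous p) (h : ∀ x, 1 / 2 ≤ p x) :
    Integrable (fun x => 1 / p x ^ 2) (interval R) := by
  refine Integrable.of_bound (C := 4) ?_ (Eventually.of_forall fun x => ?_)
  · exact (measurable_const.div (hp.measurable.pow_const 2)).aestronglyMeasurable
  · have := h x
    rw [Real.norm_of_nonneg (by positivity), div_le_iff₀ (by positivity)]
    nlinarith

lemma tc_hankel_interval (h : IsSmoothL1 g) (R : ℝ) :
    ∃ K, TC K ∧ IsIntegralOp (interval R) K (fun x y => fk g (x + y)) := by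
  have hc : Continuous fun x : ℝ => 1 / 2 + |x| := by fun_prop
  have hi := integrable_of_half_le (R := R) hc fun x => by
    have := abs_nonneg x; linarith
  obtain ⟨K, ι, hι, a, b, h1, h2, -⟩ := exists_isRep_kernel (h.integrable_shifted 1)
    (A := id) (B := id) continuous_id continuous_id hc hc (fun x => by positivity)
    (fun x => by positivity) hi hi
  refine ⟨K, h2.tc, h1.congr ?_⟩
  filter_upwards [ae_restrict_mem measurableSet_Ioo] with x hx
  filter_upwards [ae_restrict_mem measurableSet_Ioo] with y hy
  have hx := hx.1
  have hy := hy.1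
  rw [h.fk_shifted, abs_of_pos hx, abs_of_pos hy]
  simp only [id]
  have e : (1 / 2 + x + (1 / 2 + y)) = 1 + (x + y) := by ring
  have e0 : ((1 + (x + y) : ℝ) : ℂ) ≠ 0 := by exact_mod_cast (by positivity)
  rw [e, Complex.ofReal_div, Complex.ofReal_pow]
  field_simp
  simp

/-- The kernel depends on `x - y`, so the denominator is `1 + R + x - y = (1/2 + x) + (1/2 + R -
y)`: adding `R` keeps both summands positive on the interval. On the diagonal the kernel is
constant, which gives the trace. -/
lemma isRep_conv_interval (h : IsSmoothL1 g) {R : ℝ} (hR : 0 < R) :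
    ∃ (K : Lp ℂ 2 (interval R) →L[ℂ] Lp ℂ 2 (interval R)) (ι : Type) (_ : Countable ι)
      (a b : ι → Lp ℂ 2 (interval R)),
      IsIntegralOp (interval R) K (fun x y => fk g (x - y)) ∧ IsRep K a b ∧
      ∑' i, ⟪a i, b i⟫_ℂ = R * fk g 0 := by
  have hc : Continuous fun x : ℝ => 1 / 2 + |x| := by fun_prop
  have hc' : Continuous fun x : ℝ => 1 / 2 + |R - x| := by fun_prop
  have hi := integrable_of_half_le (R := R) hc fun x => by
    have := abs_nonneg x; linarith
  have hi' := integrable_of_half_le (R := R) hc' fun x => by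
    have := abs_nonneg (R - x); linarith
  obtain ⟨K, ι, hι, a, b, h1, h2, h3⟩ := exists_isRep_kernel (h.integrable_shifted (1 + R))
    (A := id) (B := fun y => -y) continuous_id continuous_neg hc hc' (fun x => by positivity)
    (fun x => by positivity) hi hi'
  have e : ∀ x ∈ Ioo 0 R, ∀ y ∈ Ioo 0 R, fk (shifted (1 + R) g) (id x + -y) *
      ((1 / (1 / 2 + |x| + (1 / 2 + |R - y|)) ^ 2 : ℝ) : ℂ) = fk g (x - y) := by
    intro x hx y hy
    have hx := hx.1
    have hy1 := hy.1
    have hy := sub_pos.2 hy.2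
    rw [h.fk_shifted, abs_of_pos hx, abs_of_pos hy]
    simp only [id]
    have e : (1 / 2 + x + (1 / 2 + (R - y))) = 1 + R + (x + -y) := by ring
    have e0 : ((1 + R + (x + -y) : ℝ) : ℂ) ≠ 0 := by
      exact_mod_cast (by linarith : (0 : ℝ) < 1 + R + (x + -y)).ne'
    rw [e, Complex.ofReal_div, Complex.ofReal_pow, ← sub_eq_add_neg]
    rw [← sub_eq_add_neg] at e0
    field_simp
    simp
  refine ⟨K, ι, hι, a, b, h1.congr ?_, h2, ?_⟩
  · filter_upwards [ae_restrict_mem measurableSet_Ioo] with x hx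
    filter_upwards [ae_restrict_mem measurableSet_Ioo] with y hy
    exact e x hx y hy
  · rw [h3]
    have : ∀ᵐ x ∂interval R, fk (shifted (1 + R) g) (id x + -x) *
      ((1 / (1 / 2 + |x| + (1 / 2 + |R - x|)) ^ 2 : ℝ) : ℂ) = fk g 0 := by
      filter_upwards [ae_restrict_mem measurableSet_Ioo] with x hx
      rw [e x hx x hx, sub_self]
    rw [integral_congr_ae this]
    simp [hR.le]

end IsSmoothL1

end Fields

/-! ### Multipliers which preserve the Hardy space of the half-line -/

section Plus

open scoped BoundedContinuousFunction

lemma fourInvL_eq (u : LR) : fourInvL u = reflOp (fourL u) := by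
  have hd := SchwartzMap.denseRange_toLpCLM (E := ℝ) (F := ℂ) (p := 2) (μ := volume) (by norm_num)
  refine congrFun (hd.equalizer fourInvL.continuous (reflOp ∘L fourL).continuous
    (funext fun ψ => ?_)) u
  change (𝓕⁻ (ψ.toLp 2) : LR) = reflOp (𝓕 (ψ.toLp 2) : LR)
  rw [SchwartzMap.toLp_fourier_eq, SchwartzMap.toLp_fourierInv_eq]
  ext
  filter_upwards [coeFn_reflOp ((𝓕 ψ).toLp 2), ae_neg ((𝓕 ψ).coeFn_toLp 2 volume),
    (𝓕⁻ ψ).coeFn_toLp 2 volume] with x h1 h2 h3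
  rw [h1, h2, h3, SchwartzMap.fourierInv_coe, Real.fourierInv_eq_fourier_neg]
  rfl

lemma fourierInv_toLp_ae {g : ℝ → ℂ} (h1 : Integrable g) (h2 : MemLp g 2) :
    fourInvL (h2.toLp g) =ᵐ[volume] (𝓕⁻ g : ℝ → ℂ) := by
  rw [fourInvL_eq]
  filter_upwards [coeFn_reflOp (fourL (h2.toLp g)), ae_neg (fourier_toLp_ae h1 h2)] with x h3 h4
  rw [h3, Real.fourierInv_eq_fourier_neg]
  exact h4

/-- The Fourier transform of `c` is the function `κ`, which vanishes on the negative half-line. -/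
structure IsPlus (c : ℝ →ᵇ ℂ) (κ : ℝ → ℂ) : Prop where
  memLp : MemLp c 2
  fourier : κ =ᵐ[volume] (𝓕 (memLp.toLp c) : LR)
  support : ∀ x < 0, κ x = 0

lemma isPlus_of_fourierInv {c : ℝ →ᵇ ℂ} {κ : ℝ → ℂ} (h1 : Integrable κ) (h2 : MemLp κ 2)
    (h : ∀ ξ, c ξ = (𝓕⁻ κ : ℝ → ℂ) ξ) (h0 : ∀ x < 0, κ x = 0) : IsPlus c κ := by
  have hc : fourInvL (h2.toLp κ) =ᵐ[volume] c := by
    filter_upwards [fourierInv_toLp_ae h1 h2] with x hx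
    rw [hx, h]
  have hm : MemLp c 2 := (memLp_congr_ae hc).1 (Lp.memLp _)
  refine ⟨hm, ?_, h0⟩
  have e : hm.toLp c = fourInvL (h2.toLp κ) := by
    ext
    filter_upwards [hm.coeFn_toLp, hc] with x h3 h4
    rw [h3, h4]
  have e2 : (𝓕 (hm.toLp c) : LR) = h2.toLp κ := by
    rw [e]
    exact fourL_fourInvL _
  rw [e2]
  exact h2.coeFn_toLp.symm

lemma reflFun_memLp {c : ℝ →ᵇ ℂ} (h : MemLp c 2) : MemLp (reflFun c) 2 :=
  h.comp_measurePreserving (Measure.measurePreserving_neg volume)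

lemma fourier_reflFun {c : ℝ →ᵇ ℂ} {κ : ℝ → ℂ} (hm : MemLp c 2)
    (hf : κ =ᵐ[volume] (𝓕 (hm.toLp c) : LR)) :
    (fun x => κ (-x)) =ᵐ[volume] (𝓕 ((reflFun_memLp hm).toLp (reflFun c)) : LR) := by
  have e : (reflFun_memLp hm).toLp (reflFun c) = reflOp (hm.toLp c) := by
    ext
    filter_upwards [coeFn_reflOp (hm.toLp c), (reflFun_memLp hm).coeFn_toLp,
      ae_neg hm.coeFn_toLp] with x h1 h2 h3
    rw [h1, h2, h3, reflFun_apply]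
  rw [e, fourier_reflOp]
  filter_upwards [coeFn_reflOp (𝓕 (hm.toLp c) : LR), ae_neg hf] with x h1 h2
  rw [h1, h2]

lemma extH_restH {v : LR} (hv : ∀ᵐ x, x < 0 → v x = 0) : extH (restH v) = v := by
  ext
  have h0 : ∀ᵐ x : ℝ, x ≠ 0 := by simp [ae_iff]
  filter_upwards [extOp_restOp_ae measurableSet_Ioi rfl v, hv, h0] with x h1 h2 h3
  change extOp _ _ (restOp _ v) x = _
  rw [h1]
  rcases lt_or_gt_of_ne h3 with h | h
  · rw [indicator_of_notMem (by simpa using h.le), h2 h]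
  · rw [indicator_of_mem (by simpa using h)]

namespace IsPlus

variable {c : ℝ →ᵇ ℂ} {κ : ℝ → ℂ}

/-- Convolving two functions supported on the positive half-line gives a function supported there.
-/
lemma mulOp_lineIncl (h : IsPlus c κ) :
    mulOp c ∘L lineIncl = lineIncl ∘L toep lineIncl lineProj (mulOp c) := by
  ext1 f
  set v : LR := 𝓕 (mulOp c (𝓕⁻ (extH f))) with hv
  have hv0 : ∀ᵐ x, x < 0 → v x = 0 := by
    filter_upwards [fourier_mulOp_ae c h.memLp (extH f)] with x hx h0
    rw [hv, hx]
    have : ∫ y, (𝓕 (h.memLp.toLp c) : LR) (x - y) * extH f y = ∫ _ : ℝ, (0 : ℂ) := by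
      refine integral_congr_ae ?_
      filter_upwards [(Measure.measurePreserving_sub_left (volume : Measure ℝ)
        x).quasiMeasurePreserving.ae h.fourier, coeFn_extOp measurableSet_Ioi rfl f] with y hy h1
      change _ * extOp _ _ f y = 0
      rw [← hy, h1]
      by_cases h2 : y ∈ Ioi 0
      · rw [h.support _ (by rw [mem_Ioi] at h2; linarith), zero_mul]
      · rw [indicator_of_notMem h2, mul_zero]
    rw [this, integral_zero]
  have e : extH (restH v) = v := extH_restH hv0
  change mulOp c (fourInvL (extH f)) = fourInvL (extH (restH v))
  rw [e]
  exact (fourInvL_fourL _).symm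

end IsPlus

/-- Multipliers which preserve the Hardy space. -/
lemma hank_refl_eq_zero {E L : Type*} [NormedAddCommGroup E] [InnerProductSpace ℂ E]
    [NormedAddCommGroup L] [InnerProductSpace ℂ L] {i : E →L[ℂ] L} {r : L →L[ℂ] E}
    {J X Y : L →L[ℂ] L} (h : HardySetup i r J) (hX : X ∘L i = i ∘L toep i r X)
    (hY : J * X * J = Y) : hank i r J Y = 0 := by
  subst hY
  ext1 x
  change r (J (X (J (J (i x))))) = 0
  rw [h.apply_invol]
  have h1 := congrArg (fun T : E →L[ℂ] L => T x) hX
  simp only [ContinuousLinearMap.comp_apply] at h1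
  rw [h1]
  exact congrArg (fun T : E →L[ℂ] E => T (toep i r X x)) h.hank_one

section Exp

variable {E L : Type*} [NormedAddCommGroup E] [InnerProductSpace ℂ E] [CompleteSpace E]
    [NormedAddCommGroup L] [InnerProductSpace ℂ L] [CompleteSpace L] {i : E →L[ℂ] L}
    {r : L →L[ℂ] E} {J X Y : L →L[ℂ] L}

lemma exp_comp_incl (hX : X ∘L i = i ∘L toep i r X) :
    NormedSpace.exp X ∘L i = i ∘L NormedSpace.exp (toep i r X) :=
  (exp_comp_eq hX.symm).symm

lemma toep_exp_plus (h : HardySetup i r J) (hX : X ∘L i = i ∘L toep i r X) :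
    toep i r (NormedSpace.exp X) = NormedSpace.exp (toep i r X) := by
  rw [toep, exp_comp_incl hX, ← ContinuousLinearMap.comp_assoc, h.retract]
  rfl

lemma exp_plus (h : HardySetup i r J) (hX : X ∘L i = i ∘L toep i r X) :
    NormedSpace.exp X ∘L i = i ∘L toep i r (NormedSpace.exp X) := by
  rw [toep_exp_plus h hX, exp_comp_incl hX]

/-- A vanishing Hankel operator means that `Y` preserves the kernel of `r`. Hence `r` intertwines
`Y` with its compression, and this passes to exponentials. -/
lemma toep_exp_minus (h : HardySetup i r J) (hY : hank i r J Y = 0) :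
    toep i r (NormedSpace.exp Y) = NormedSpace.exp (toep i r Y) := by
  have h1 : r ∘L Y = toep i r Y ∘L r := by
    ext1 x
    change r (Y x) = r (Y (i (r x)))
    conv_lhs => rw [← h.apply_decomp x]
    rw [map_add, map_add]
    have : r (Y (J (i (r (J x))))) = 0 :=
      congrArg (fun T : E →L[ℂ] E => T (r (J x))) hY
    rw [this, add_zero]
  rw [toep, ← ContinuousLinearMap.comp_assoc, exp_comp_eq h1, ContinuousLinearMap.comp_assoc,
    h.retract]
  rfl

end Exp

end Plus

/-! ### Compressions to a finite interval -/

section Interval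

open scoped BoundedContinuousFunction

lemma inner_extOp {μ ν : Measure ℝ} {s : Set ℝ} (hs : MeasurableSet s) (h : ν = μ.restrict s)
    (f g : Lp ℂ 2 ν) : ⟪extOp hs h f, extOp hs h g⟫_ℂ = ⟪f, g⟫_ℂ := by
  rw [L2.inner_def, L2.inner_def]
  have h1 := coeFn_extOp hs h f
  have h2 := coeFn_extOp hs h g
  subst h
  rw [← integral_indicator hs]
  refine integral_congr_ae ?_
  filter_upwards [h1, h2] with x h3 h4
  rw [h3, h4]
  by_cases hx : x ∈ s
  · simp only [indicator_of_mem hx]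
  · simp only [indicator_of_notMem hx, inner_zero_left]

lemma interval_eq (R : ℝ) : interval R = halfLine.restrict (Ioo 0 R) := by
  rw [interval, halfLine, Measure.restrict_restrict measurableSet_Ioo,
    inter_eq_left.2 fun x hx => hx.1]

/-- Extension by zero from the interval to the half-line. -/
def extI (R : ℝ) : Lp ℂ 2 (interval R) →L[ℂ] Lp ℂ 2 halfLine :=
  extOp measurableSet_Ioo (interval_eq R)

/-- Restriction from the half-line to the interval. -/
def restI (R : ℝ) : Lp ℂ 2 halfLine →L[ℂ] Lp ℂ 2 (interval R) := restOp (interval_eq R)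

lemma restI_extI (R : ℝ) : restI R ∘L extI R = 1 := restOp_extOp _ _

lemma coeFn_restrictOp (μ : Measure ℝ) {s : Set ℝ} (hs : MeasurableSet s) (f : Lp ℂ 2 μ) :
    restrictOp μ s hs f =ᵐ[μ] s.indicator f :=
  ((Lp.memLp f).indicator hs).coeFn_toLp

lemma one_sub_extI_restI (R : ℝ) : 1 - extI R ∘L restI R = QL R := by
  ext f
  change (f - extI R (restI R f) : Lp ℂ 2 halfLine) =ᵐ[halfLine] _
  have h0 : ∀ᵐ x ∂halfLine, x ≠ R := ae_restrict_of_ae (by simp [ae_iff])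
  filter_upwards [Lp.coeFn_sub f (extI R (restI R f)),
    extOp_restOp_ae measurableSet_Ioo (interval_eq R) f,
    coeFn_restrictOp halfLine measurableSet_Ioi f, h0, ae_restrict_mem measurableSet_Ioi]
    with x h1 h2 h3 h4 h5
  change _ = restrictOp halfLine (Ioi R) measurableSet_Ioi f x
  rw [h1, Pi.sub_apply, h3]
  change f x - extOp _ _ (restOp _ f) x = _
  rw [h2]
  rcases lt_or_gt_of_ne h4 with h | h
  · rw [indicator_of_mem (show x ∈ Ioo 0 R from ⟨h5, h⟩), indicator_of_notMem (by simpa using h.le),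
      sub_self]
  · rw [indicator_of_notMem (fun hx => hx.2.not_ge h.le), indicator_of_mem (by simpa using h),
      sub_zero]

lemma IsIntegralOp.compress {K : Lp ℂ 2 halfLine →L[ℂ] Lp ℂ 2 halfLine} {κ : ℝ → ℝ → ℂ}
    (h : IsIntegralOp halfLine K κ) (R : ℝ) :
    IsIntegralOp (interval R) (restI R ∘L K ∘L extI R) κ := by
  intro f
  change ∀ᵐ x ∂interval R, _ ∧ restI R (K (extI R f)) x = _
  filter_upwards [coeFn_restOp (interval_eq R) (K (extI R f)),
    ae_of_ae_eq_restrict (interval_eq R) (h (extI R f))] with x h1 h2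
  refine ⟨?_, ?_⟩
  · have h3 := h2.1.mono_measure (restrict_le_of_eq (interval_eq R))
    refine h3.congr ?_
    filter_upwards [ae_of_ae_eq_restrict (interval_eq R)
      (coeFn_extOp measurableSet_Ioo (interval_eq R) f),
      ae_mem_of_eq_restrict measurableSet_Ioo (interval_eq R)] with y hy h4
    change _ * extOp _ _ f y = _
    rw [hy, indicator_of_mem h4]
  · change restOp _ _ x = _
    rw [h1, h2.2]
    exact integral_mul_extOp measurableSet_Ioo (interval_eq R) _ f

/-- The operator is causal: at a point `x < R` the kernel `κ(x - y)` vanishes for `y > x`, so only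
the values of the function on `(0,R)` enter. -/
lemma IsPlus.restI_toep {c : ℝ →ᵇ ℂ} {κ : ℝ → ℂ} (h : IsPlus c κ) (R : ℝ) :
    restI R ∘L toep lineIncl lineProj (mulOp c) =
      (restI R ∘L toep lineIncl lineProj (mulOp c) ∘L extI R) ∘L restI R := by
  ext1 f
  set T := toep lineIncl lineProj (mulOp c)
  change restI R (T f) = restI R (T (extI R (restI R f)))
  rw [← sub_eq_zero, ← map_sub, ← map_sub]
  set g := f - extI R (restI R f) with hg
  have hg0 : ∀ᵐ x ∂halfLine, x < R → g x = 0 := by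
    filter_upwards [Lp.coeFn_sub f (extI R (restI R f)), ae_restrict_mem measurableSet_Ioi,
      extOp_restOp_ae measurableSet_Ioo (interval_eq R) f] with x h1 h2 h3 h4
    rw [hg, h1, Pi.sub_apply]
    change f x - extOp _ _ (restOp _ f) x = _
    rw [h3, indicator_of_mem (show x ∈ Ioo 0 R from ⟨h2, h4⟩), sub_self]
  ext
  filter_upwards [coeFn_restOp (interval_eq R) (T g), ae_of_ae_eq_restrict (interval_eq R)
    (isIntegralOp_toep h.memLp h.fourier g), Lp.coeFn_zero ℂ 2 (interval R),
    ae_mem_of_eq_restrict measurableSet_Ioo (interval_eq R)] with x h1 h2 h3 h4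
  rw [h3]
  change restOp _ (T g) x = 0
  rw [h1, h2.2]
  rw [← integral_zero ℝ ℂ (μ := halfLine)]
  refine integral_congr_ae ?_
  filter_upwards [hg0] with y hy
  by_cases hyR : y < R
  · rw [hy hyR, mul_zero]
  · rw [h.support _ (by linarith [h4.2]), zero_mul]

/-- The reflected kernel vanishes for `x > y`, so functions supported in `(0,R)` are mapped to
functions supported there. -/
lemma IsPlus.toep_extI {c : ℝ →ᵇ ℂ} {κ : ℝ → ℂ} (h : IsPlus c κ) (R : ℝ) :
    toep lineIncl lineProj (mulOp (reflFun c)) ∘L extI R =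
      extI R ∘L (restI R ∘L toep lineIncl lineProj (mulOp (reflFun c)) ∘L extI R) := by
  ext1 f
  set T := toep lineIncl lineProj (mulOp (reflFun c))
  change T (extI R f) = extI R (restI R (T (extI R f)))
  ext
  filter_upwards [extOp_restOp_ae measurableSet_Ioo (interval_eq R) (T (extI R f)),
    isIntegralOp_toep (reflFun_memLp h.memLp) (fourier_reflFun h.memLp h.fourier) (extI R f),
    ae_restrict_mem measurableSet_Ioi] with x h1 h2 h3
  change _ = extOp _ _ (restOp _ (T (extI R f))) x
  rw [h1]
  by_cases hx : x < R
  · rw [indicator_of_mem (show x ∈ Ioo 0 R from ⟨h3, hx⟩)]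
  · rw [indicator_of_notMem fun h4 => hx h4.2, h2.2, ← integral_zero ℝ ℂ (μ := halfLine)]
    refine integral_congr_ae ?_
    filter_upwards [coeFn_extOp measurableSet_Ioo (interval_eq R) f] with y hy
    change _ * extOp _ _ f y = _
    rw [hy]
    by_cases h4 : y ∈ Ioo 0 R
    · rw [h.support _ (by linarith [h4.2]), zero_mul]
    · rw [indicator_of_notMem h4, mul_zero]

/-- The field of vectors representing the convolution with the Fourier transform of `c`. -/
lemma memLp_convField {c : ℝ → ℂ} (hc : MemLp c 2) (R : ℝ) :
    MemLp (fun x : ℝ => (memLp_modulate (MemLp.conj hc) x).toLp _) 2 (interval R) := by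
  have hin : ∀ x y : ℝ, ⟪(memLp_modulate (MemLp.conj hc) x).toLp _,
      (memLp_modulate (MemLp.conj hc) y).toLp _⟫_ℂ =
      ∫ t : ℝ, (c t * (starRingEnd ℂ) (c t)) * Complex.exp (I * (2 * Real.pi * (y - x) : ℝ) * t) := by
    intro x y
    rw [L2.inner_def]
    refine integral_congr_ae ?_
    filter_upwards [(memLp_modulate (MemLp.conj hc) x).coeFn_toLp,
      (memLp_modulate (MemLp.conj hc) y).coeFn_toLp] with t h1 h2
    rw [h1, h2, RCLike.inner_apply]
    simp only [map_mul, RCLike.conj_conj, ← Complex.exp_conj, Complex.conj_I, Complex.conj_ofReal,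
      map_ofNat]
    have : Complex.exp (I * (2 * Real.pi * (y - x) : ℝ) * t) =
        Complex.exp (2 * Real.pi * y * t * I) * Complex.exp (2 * Real.pi * x * t * -I) := by
      rw [← Complex.exp_add]
      congr 1
      push_cast
      ring
    rw [this]
    ring
  have hint : Integrable fun t => c t * (starRingEnd ℂ) (c t) :=
    hc.integrable_mul (MemLp.conj hc)
  have hcont : Continuous fun x : ℝ => (memLp_modulate (MemLp.conj hc) x).toLp _ := by
    refine continuous_of_inner (Continuous.congr ?_ fun z => (hin z.1 z.2).symm)
    exact (continuous_expIntegral hint).comp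
      (g := fun A : ℝ => ∫ t : ℝ, (c t * (starRingEnd ℂ) (c t)) * Complex.exp (I * A * t))
      (f := fun z : ℝ × ℝ => 2 * Real.pi * (z.2 - z.1)) (by fun_prop)
  refine MemLp.of_bound hcont.aestronglyMeasurable
    (C := ‖(memLp_modulate (MemLp.conj hc) 0).toLp _‖) (Eventually.of_forall fun x => ?_)
  refine le_of_eq ((sq_eq_sq₀ (norm_nonneg _) (norm_nonneg _)).1 ?_)
  have h1 := congrArg norm (hin x x)
  have h2 := congrArg norm (hin 0 0)
  rw [sub_self, inner_self_eq_norm_sq_to_K, norm_pow, RCLike.norm_ofReal, abs_norm] at h1 h2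
  rw [h1, h2]

/-- The value of the image at `x` is the inner product of a vector `v x` with the transform of the
function, and `‖v x‖` does not depend on `x`. On an interval of finite length such a field is square
integrable, so square integrability of `c` is enough for Hilbert–Schmidt. -/
lemma summable_restI_toep {c : ℝ →ᵇ ℂ} (hc : MemLp c 2) (R : ℝ) {ι : Type*}
    {g : ι → Lp ℂ 2 (interval R)} (hg : Orthonormal ℂ g) :
    Summable fun i => ‖(restI R ∘L toep lineIncl lineProj (mulOp c) ∘L extI R) (g i)‖ ^ 2 := by
  have hv := memLp_convField hc R
  have hiso : ∀ a b, ⟪lineIncl (extI R a), lineIncl (extI R b)⟫_ℂ = ⟪a, b⟫_ℂ := by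
    intro a b
    change ⟪fourInvL _, fourInvL _⟫_ℂ = _
    rw [← Lp.inner_fourier_eq, ← fourL_apply, ← fourL_apply, fourL_fourInvL, fourL_fourInvL]
    exact (inner_extOp _ _ _ _).trans (inner_extOp _ _ _ _)
  have ho : Orthonormal ℂ fun i => lineIncl (extI R (g i)) := by
    classical
    rw [orthonormal_iff_ite] at hg ⊢
    intro i j
    rw [hiso, hg]
  refine (summable_rowOp hv ho).congr fun i => ?_
  congr 2
  set w := lineIncl (extI R (g i))
  ext
  have m1 : Integrable fun ξ => c ξ * w ξ := hc.integrable_mul (Lp.memLp w)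
  have m2 : MemLp (fun ξ => c ξ * w ξ) 2 := memLp_bcf_mul c (Lp.memLp w)
  filter_upwards [coeFn_rowOp hv w, coeFn_restOp (interval_eq R)
    (toep lineIncl lineProj (mulOp c) (extI R (g i))),
    ae_of_ae_eq_restrict (interval_eq R) (coeFn_restOp (rfl : halfLine = _) (𝓕 (mulOp c w))),
    ae_restrict_of_ae (fourier_toLp_ae m1 m2)] with x h1 h2 h3 h4
  have h5 : (restI R ∘L toep lineIncl lineProj (mulOp c) ∘L extI R) (g i) x =
      (𝓕 (fun ξ => c ξ * w ξ) : ℝ → ℂ) x := h2.trans (h3.trans h4)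
  rw [h1, h5]
  rw [L2.inner_def, Real.fourier_real_eq_integral_exp_smul]
  refine integral_congr_ae ?_
  filter_upwards [(memLp_modulate (MemLp.conj hc) x).coeFn_toLp] with ξ hξ
  rw [hξ, RCLike.inner_apply]
  simp only [map_mul, RCLike.conj_conj, ← Complex.exp_conj, Complex.conj_I, Complex.conj_ofReal,
      map_ofNat, smul_eq_mul]
  have : Complex.exp ((-2 * Real.pi * ξ * x : ℝ) * I) =
      Complex.exp (2 * Real.pi * x * ξ * -I) := by
    congr 1
    push_cast
    ring
  rw [this]
  ring

end Interval

/-! ### Exponentials of smooth integrable functions -/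

section SmoothExp

lemma exists_bound_of_integrable_deriv {g : ℝ → ℂ} (hg : ContDiff ℝ 1 g)
    (hi : Integrable (deriv g)) : ∃ C, ∀ x, ‖g x‖ ≤ C := by
  refine ⟨‖g 0‖ + ∫ x, ‖deriv g x‖, fun x => ?_⟩
  have h1 : ∫ y in (0 : ℝ)..x, deriv g y = g x - g 0 :=
    intervalIntegral.integral_deriv_eq_sub
      (fun y _ => (hg.differentiable (by norm_num)).differentiableAt) hi.intervalIntegrable
  have h2 : g x = g 0 + ∫ y in (0 : ℝ)..x, deriv g y := by rw [h1]; ring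
  rw [h2]
  refine (norm_add_le _ _).trans (add_le_add_right ?_ _)
  refine (intervalIntegral.norm_integral_le_integral_norm_uIoc).trans ?_
  exact setIntegral_le_integral hi.norm (Eventually.of_forall fun _ => norm_nonneg _)

lemma norm_exp_sub_one_le_mul (w : ℂ) : ‖Complex.exp w - 1‖ ≤ ‖w‖ * Real.exp ‖w‖ := by
  simpa using Complex.norm_exp_sub_sum_le_norm_mul_exp w 1

namespace IsSmoothL1

variable {f : ℝ → ℂ}

lemma exists_bound (h : IsSmoothL1 f) : ∃ C, ∀ x, ‖f x‖ ≤ C :=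
  exists_bound_of_integrable_deriv (h.smooth.of_le (by norm_num))
    (by simpa using h.integrable 1 (by norm_num))

lemma memLp_two (h : IsSmoothL1 f) : MemLp f 2 := by
  obtain ⟨C, hC⟩ := h.exists_bound
  rw [memLp_two_iff_integrable_sq_norm h.integrable_self.1]
  refine (h.integrable_self.norm.const_mul C).mono'
    ((h.integrable_self.1.norm.pow 2)) (Eventually.of_forall fun x => ?_)
  rw [Real.norm_of_nonneg (by positivity), pow_two]
  exact mul_le_mul_of_nonneg_right (hC x) (norm_nonneg _)

lemma neg (h : IsSmoothL1 f) : IsSmoothL1 (-f) :=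
  ⟨h.smooth.neg, fun i hi => by
    have : iteratedDeriv i (-f) = -iteratedDeriv i f := by
      ext x; exact iteratedDeriv_neg i f x
    rw [this]
    exact (h.integrable i hi).neg⟩

/-- Integrability of `f'` and `f''` bounds `f` and `f'`. Then `|e^f - 1|` is at most a constant
times `|f|`, and the second derivative `e^f (f'² + f'')` is integrable. -/
lemma exp_sub_one (h : IsSmoothL1 f) : IsSmoothL1 (fun ξ => Complex.exp (f ξ) - 1) := by
  obtain ⟨C, hC⟩ := h.exists_bound
  have hC0 : 0 ≤ C := (norm_nonneg _).trans (hC 0)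
  have hd1 : ContDiff ℝ 1 (deriv f) := by
    have : ContDiff ℝ (1 + 1) f := by simpa [one_add_one_eq_two] using h.smooth
    exact (contDiff_succ_iff_deriv.1 this).2.2
  have i1 : Integrable (deriv f) := by simpa using h.integrable 1 (by norm_num)
  have i2 : Integrable (deriv (deriv f)) := by
    have := h.integrable 2 le_rfl
    rwa [iteratedDeriv_succ, iteratedDeriv_one] at this
  obtain ⟨D, hD⟩ := exists_bound_of_integrable_deriv hd1 i2
  have hf : ∀ x, HasDerivAt f (deriv f x) x := fun x =>
    ((h.smooth.differentiable (by norm_num)) x).hasDerivAt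
  have hf' : ∀ x, HasDerivAt (deriv f) (deriv (deriv f) x) x := fun x =>
    ((hd1.differentiable (by norm_num)) x).hasDerivAt
  have he : ∀ x, HasDerivAt (fun ξ => Complex.exp (f ξ) - 1) (Complex.exp (f x) * deriv f x) x :=
    fun x => ((hf x).cexp).sub_const 1
  have e1 : deriv (fun ξ => Complex.exp (f ξ) - 1) = fun x => Complex.exp (f x) * deriv f x :=
    funext fun x => (he x).deriv
  have e2 : deriv (fun x => Complex.exp (f x) * deriv f x) = fun x =>
      Complex.exp (f x) * deriv f x * deriv f x + Complex.exp (f x) * deriv (deriv f) x :=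
    funext fun x => (((hf x).cexp).mul (hf' x)).deriv
  have hb : ∀ x, ‖Complex.exp (f x)‖ ≤ Real.exp C := fun x => by
    rw [Complex.norm_exp]
    exact Real.exp_le_exp.2 ((Complex.re_le_norm _).trans (hC x))
  have hce : Continuous fun x => Complex.exp (f x) := h.smooth.continuous.cexp
  have j1 : Integrable fun x => Complex.exp (f x) * deriv f x :=
    i1.bdd_mul hce.aestronglyMeasurable (Eventually.of_forall hb)
  refine ⟨(h.smooth.cexp).sub contDiff_const, fun i hi => ?_⟩
  interval_cases i
  · rw [iteratedDeriv_zero]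
    refine (h.integrable_self.norm.const_mul (Real.exp C)).mono'
      (hce.sub continuous_const).aestronglyMeasurable (Eventually.of_forall fun x => ?_)
    refine (norm_exp_sub_one_le_mul _).trans ?_
    rw [mul_comm]
    exact mul_le_mul_of_nonneg_right (Real.exp_le_exp.2 (hC x)) (norm_nonneg _)
  · rw [iteratedDeriv_one, e1]
    exact j1
  · rw [iteratedDeriv_succ, iteratedDeriv_one, e1, e2]
    refine Integrable.add ?_ (i2.bdd_mul hce.aestronglyMeasurable (Eventually.of_forall hb))
    exact j1.mul_bdd (c := D) hd1.continuous.aestronglyMeasurable (Eventually.of_forall hD)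

end IsSmoothL1

lemma IsLineSymbol.isSmoothL1 {σ f : ℝ → ℂ} (h : IsLineSymbol σ f) : IsSmoothL1 f :=
  ⟨h.smooth, h.integrable⟩

lemma IsLineSymbol.sub_one {σ f : ℝ → ℂ} (h : IsLineSymbol σ f) :
    IsSmoothL1 (fun ξ => σ ξ - 1) := by
  simpa only [h.exp_eq] using h.isSmoothL1.exp_sub_one

lemma IsLineSymbol.inv_sub_one {σ f : ℝ → ℂ} (h : IsLineSymbol σ f) :
    IsSmoothL1 (fun ξ => (σ ξ)⁻¹ - 1) := by
  have := h.isSmoothL1.neg.exp_sub_one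
  simpa only [h.exp_eq, ← Complex.exp_neg, Pi.neg_apply] using this

/-- A continuous function whose exponential is one and which vanishes at a point is zero. -/
lemma eq_zero_of_exp_eq_one {d : ℝ → ℂ} (hd : Continuous d) (h : ∀ x, Complex.exp (d x) = 1)
    (h0 : d 0 = 0) (x : ℝ) : d x = 0 := by
  -- The function takes values in `2πiℤ`; being continuous on a connected space, it is constant.
  have hn : ∀ x, ∃ n : ℤ, d x = n * (2 * Real.pi * I) := fun x => Complex.exp_eq_one_iff.1 (h x)
  choose n hn using hn
  have hpi : (2 * Real.pi * I : ℂ) ≠ 0 := by simp [Real.pi_ne_zero]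
  have hc : Continuous n := by
    have h1 : Continuous fun x => ((n x : ℤ) : ℂ) := by
      have : (fun x => ((n x : ℤ) : ℂ)) = fun x => d x / (2 * Real.pi * I) := by
        ext x
        rw [hn x, mul_div_cancel_right₀ _ hpi]
      rw [this]
      exact hd.div_const _
    have h2 : Continuous fun x => ((n x : ℤ) : ℝ) := by
      have := Complex.continuous_re.comp h1
      simpa [Function.comp_def] using this
    exact Int.isClosedEmbedding_coe_real.isInducing.continuous_iff.2 h2
  have h3 : n x = n 0 := PreconnectedSpace.constant inferInstance hc
  have h4 : (n 0 : ℂ) = 0 := by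
    have := hn 0
    rw [h0] at this
    rcases mul_eq_zero.1 this.symm with h | h
    · exact h
    · exact absurd h hpi
  rw [hn x, h3, h4, zero_mul]

/-- The difference `f(-ξ) - f(ξ)` is a continuous logarithm of `1` which vanishes at `ξ = 0`. -/
lemma IsLineSymbol.even_log {σ f : ℝ → ℂ} (h : IsLineSymbol σ f) (ξ : ℝ) : f (-ξ) = f ξ := by
  have := eq_zero_of_exp_eq_one (d := fun ξ => f (-ξ) - f ξ)
    ((h.smooth.continuous.comp continuous_neg).sub h.smooth.continuous) (fun x => by
      rw [Complex.exp_sub, ← h.exp_eq, ← h.exp_eq, h.even, div_self]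
      rw [h.exp_eq]
      exact Complex.exp_ne_zero _) (by simp) ξ
  exact sub_eq_zero.1 this

end SmoothExp

/-! ### The determinant identity on the half-line for exponential factors -/

section LineDet

open scoped BoundedContinuousFunction

lemma exp_mul_exp_neg {E : Type*} [NormedAddCommGroup E] [NormedSpace ℂ E] [CompleteSpace E]
    (x : E →L[ℂ] E) : NormedSpace.exp x * NormedSpace.exp (-x) = 1 := by
  letI : NormedAlgebra ℚ (E →L[ℂ] E) := NormedAlgebra.restrictScalars ℚ ℂ _
  rw [← NormedSpace.exp_add_of_commute (Commute.neg_right (Commute.refl x)), add_neg_cancel,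
    NormedSpace.exp_zero]

lemma reflFun_exp (c : ℝ →ᵇ ℂ) :
    reflFun (NormedSpace.exp c) = NormedSpace.exp (reflFun c) := by
  ext x
  rw [reflFun_apply, bcf_exp_apply, bcf_exp_apply, reflFun_apply]

lemma bcf_exp_add (c d : ℝ →ᵇ ℂ) :
    NormedSpace.exp (c + d) = NormedSpace.exp c * NormedSpace.exp d := by
  ext x
  rw [BoundedContinuousFunction.mul_apply, bcf_exp_apply, bcf_exp_apply, bcf_exp_apply,
    BoundedContinuousFunction.add_apply, Complex.exp_add]

lemma bcf_exp_zero : NormedSpace.exp (0 : ℝ →ᵇ ℂ) = 1 := by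
  ext x
  rw [bcf_exp_apply]
  simp

/-- The determinant of a compression of `T(φ) + H(φ)` for exponential factors. -/
theorem HardyFactor.exp_compression_det {E L F : Type*}
    [NormedAddCommGroup E] [InnerProductSpace ℂ E] [CompleteSpace E]
    [NormedAddCommGroup L] [InnerProductSpace ℂ L]
    [NormedAddCommGroup F] [InnerProductSpace ℂ F] [CompleteSpace F]
    {i : E →L[ℂ] L} {r : L →L[ℂ] E} {J p p' q q' : L →L[ℂ] L}
    (h : HardyFactor i r J p p' q q') (ht : TC (hank i r J (p * p')))
    {j : F →L[ℂ] E} {s : E →L[ℂ] F} (hsj : s ∘L j = 1) {T T' : E →L[ℂ] E}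
    (hT : toep i r p = NormedSpace.exp T) (hT' : toep i r p' = NormedSpace.exp T')
    (hs : s ∘L T = (s ∘L T ∘L j) ∘L s) (hj : T' ∘L j = j ∘L (s ∘L T' ∘L j))
    {κ ι : Type*} [Countable κ] [Countable ι] (g : HilbertBasis κ ℂ F)
    (s1 : Summable fun i => ‖(s ∘L T ∘L j) (g i)‖ ^ 2)
    (s1' : Summable fun i => ‖ContinuousLinearMap.adjoint (s ∘L T ∘L j) (g i)‖ ^ 2)
    (s2 : Summable fun i => ‖(s ∘L T' ∘L j) (g i)‖ ^ 2)
    (s2' : Summable fun i => ‖ContinuousLinearMap.adjoint (s ∘L T' ∘L j) (g i)‖ ^ 2)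
    {a b : ι → F} (hrep : IsRep (s ∘L T' ∘L j + s ∘L T ∘L j) a b) :
    TC (hank i r J (p' * q)) ∧ fredholmDet (s ∘L sumOp i r J (p * p') ∘L j) =
      Complex.exp (∑' i, ⟪a i, b i⟫_ℂ) *
        fredholmDet (toep i r (q * q') * sumOp i r J (p * p')) *
        fredholmDet (1 + (1 - j ∘L s) * hank i r J (p' * q) * (1 - j ∘L s)) := by
  set ℓ := s ∘L T ∘L j with hℓ
  set u := s ∘L T' ∘L j with hu
  -- Triangularity says that `s` intertwines `T` with its truncation, and `j` that of `T'` with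
  -- `T'`. The truncations of the exponentials are therefore exponentials of the truncations.
  have c1 : s ∘L NormedSpace.exp T = NormedSpace.exp ℓ ∘L s := exp_comp_eq hs
  have c2 : j ∘L NormedSpace.exp u = NormedSpace.exp T' ∘L j := exp_comp_eq hj.symm
  have d1 : s ∘L NormedSpace.exp T ∘L j = NormedSpace.exp ℓ := by
    rw [← ContinuousLinearMap.comp_assoc, c1, ContinuousLinearMap.comp_assoc, hsj]
    rfl
  have d2 : s ∘L NormedSpace.exp T' ∘L j = NormedSpace.exp u := by
    rw [← c2, ← ContinuousLinearMap.comp_assoc, hsj]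
    rfl
  obtain ⟨g1, g2, g3⟩ := h.compression_det ht (j := j) (s := s) hsj
    (by
      rw [hT, c1]
      have : s ∘L NormedSpace.exp T ∘L j ∘L s = (s ∘L NormedSpace.exp T ∘L j) ∘L s := rfl
      rw [this, d1])
    (by rw [hT', d2, c2])
  refine ⟨g1, ?_⟩
  rw [hT, hT', d1, d2] at g2
  have hAK : TC (s ∘L (middle i r J p p' q q' - 1) ∘L j) :=
    ((h.tc_middle ht).1.comp_right _).comp_left _
  set K := s ∘L (middle i r J p p' q q' - 1) ∘L j
  obtain ⟨t1, t2⟩ := fredholmDet_exp_mul_exp g (x := u) (y := ℓ) s2 s2' s1 s1' hrep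
  have hinv : NormedSpace.exp (-ℓ) * NormedSpace.exp ℓ = 1 := by
    simpa using exp_mul_exp_neg (-ℓ)
  have hinv' : NormedSpace.exp ℓ * NormedSpace.exp (-ℓ) = 1 := exp_mul_exp_neg ℓ
  set X := NormedSpace.exp u * NormedSpace.exp ℓ with hX
  have hKE : TC ((1 + K) * X - 1) := by
    have : (1 + K) * X - 1 = K * X + (X - 1) := by noncomm_ring
    rw [this]
    exact (hAK.mul_right _).add t1
  -- The truncation is `e^ℓ (1 + K) e^u`, whose outer factors are not assumed to be identity plus
  -- trace class. Conjugation by `e^ℓ` brings it to `(1 + K) e^u e^ℓ`, a product of two operators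
  -- that are.
  have hconj := fredholmDet_conj hKE (NormedSpace.exp ℓ) (NormedSpace.exp (-ℓ)) hinv
  have e3 : 1 + NormedSpace.exp ℓ ∘L ((1 + K) * X - 1) ∘L NormedSpace.exp (-ℓ) =
      s ∘L sumOp i r J (p * p') ∘L j := by
    rw [g2]
    change 1 + NormedSpace.exp ℓ * (((1 + K) * X - 1) * NormedSpace.exp (-ℓ)) = _
    calc _ = 1 - NormedSpace.exp ℓ * NormedSpace.exp (-ℓ) + NormedSpace.exp ℓ * (1 + K) *
          NormedSpace.exp u * (NormedSpace.exp ℓ * NormedSpace.exp (-ℓ)) := by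
          rw [hX]; noncomm_ring
      _ = _ := by rw [hinv', sub_self, zero_add, mul_one]
  rw [e3, add_sub_cancel] at hconj
  have hmul := fredholmDet_mul hAK t1
  rw [add_sub_cancel] at hmul
  rw [hconj, hmul, g3, t2]
  ring

namespace IsPlus

variable {c : ℝ →ᵇ ℂ} {κ : ℝ → ℂ}

lemma mulOp_neg_lineIncl (h : IsPlus c κ) :
    mulOp (-c) ∘L lineIncl = lineIncl ∘L toep lineIncl lineProj (mulOp (-c)) := by
  have e : mulOp (-c) = -mulOp c := map_neg mulHom c
  have h1 := h.mulOp_lineIncl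
  simp only [toep] at h1 ⊢
  rw [e]
  ext1 x
  have h2 := congrArg (fun T : Lp ℂ 2 halfLine →L[ℂ] LR => T x) h1
  simp only [ContinuousLinearMap.comp_apply] at h2
  change -(mulOp c (lineIncl x)) = lineIncl (lineProj (-(mulOp c (lineIncl x))))
  rw [map_neg, map_neg]
  exact congrArg Neg.neg h2

lemma hardyFactor (h : IsPlus c κ) :
    HardyFactor lineIncl lineProj reflOp (mulOp (NormedSpace.exp c))
      (mulOp (NormedSpace.exp (reflFun c))) (mulOp (NormedSpace.exp (-c)))
      (mulOp (NormedSpace.exp (-reflFun c))) where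
  setup := lineSetup
  refl_p := by rw [reflOp_mulOp, reflFun_exp]
  refl_q := by rw [reflOp_mulOp, reflFun_exp]; rfl
  mul_inv := by rw [← mulOp_mul, ← bcf_exp_add, add_neg_cancel, bcf_exp_zero, mulOp_one]
  inv_mul := by rw [← mulOp_mul, ← bcf_exp_add, neg_add_cancel, bcf_exp_zero, mulOp_one]
  comm := by rw [← mulOp_mul, ← mulOp_mul, mul_comm]
  hank_p := by
    refine hank_refl_eq_zero lineSetup (X := mulOp (NormedSpace.exp c)) ?_ ?_
    · rw [mulOp_exp]
      exact exp_plus lineSetup h.mulOp_lineIncl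
    · rw [reflOp_mulOp, reflFun_exp]
  hank_q := by
    refine hank_refl_eq_zero lineSetup (X := mulOp (NormedSpace.exp (-c))) ?_ ?_
    · rw [mulOp_exp]
      exact exp_plus lineSetup h.mulOp_neg_lineIncl
    · rw [reflOp_mulOp, reflFun_exp]; rfl

lemma hank_reflFun (h : IsPlus c κ) :
    hank lineIncl lineProj reflOp (mulOp (reflFun c)) = 0 :=
  hank_refl_eq_zero lineSetup h.mulOp_lineIncl (reflOp_mulOp c)

end IsPlus

lemma truncWH_eq {σ : ℝ → ℂ} {A : ℝ →ᵇ ℂ} (h : IsDilated A σ) (R : ℝ) :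
    truncWH σ R = restI R ∘L HardyFactor.sumOp lineIncl lineProj reflOp (mulOp A) ∘L extI R := by
  have h1 := h.isIntegralOp_diff.compress R
  have h2 := h.isIntegralOp_sum.compress R
  have e1 := h.W_eq
  rw [W, h.isIntegralOp_diff.integralOp_eq] at e1
  have e2 := h.HL_eq
  rw [HL, h.isIntegralOp_sum.integralOp_eq] at e2
  rw [truncWH, h1.integralOp_eq, h2.integralOp_eq, HardyFactor.sumOp, ← e1, ← e2]
  ext1 f
  have h3 : restI R (extI R f) = f :=
    congrArg (fun T : Lp ℂ 2 (interval R) →L[ℂ] _ => T f) (restI_extI R)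
  simp [h3]

/-- A logarithmic plus factor of the symbol `e^f`. -/
structure IsLogFactor (σ f : ℝ → ℂ) (c : ℝ →ᵇ ℂ) (κ : ℝ → ℂ) : Prop where
  symbol : IsLineSymbol σ f
  plus : IsPlus c κ
  sum : ∀ ξ, c ξ + c (-ξ) = f (2 * Real.pi * ξ)

namespace IsLogFactor

variable {σ f : ℝ → ℂ} {c : ℝ →ᵇ ℂ} {κ : ℝ → ℂ}

lemma isDilated (h : IsLogFactor σ f c κ) :
    IsDilated (NormedSpace.exp c * NormedSpace.exp (reflFun c)) σ :=
  ⟨fun ξ => by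
    rw [BoundedContinuousFunction.mul_apply, bcf_exp_apply, bcf_exp_apply, reflFun_apply,
      ← Complex.exp_add, h.sum, h.symbol.exp_eq], h.symbol.sub_one.memLp_two⟩

lemma isDilated_inv (h : IsLogFactor σ f c κ) :
    IsDilated (NormedSpace.exp (-c) * NormedSpace.exp (-reflFun c)) σ⁻¹ :=
  ⟨fun ξ => by
    rw [BoundedContinuousFunction.mul_apply, bcf_exp_apply, bcf_exp_apply, Pi.inv_apply,
      BoundedContinuousFunction.neg_apply, BoundedContinuousFunction.neg_apply, reflFun_apply,
      ← Complex.exp_add, h.symbol.exp_eq, ← h.sum, ← Complex.exp_neg, neg_add],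
    h.symbol.inv_sub_one.memLp_two⟩

/-- The exponent `w = c(-ξ) - c(ξ)` is bounded and square integrable, and `|e^w - 1| ≤ |w| e^|w|`.
Integrability is not claimed, so the kernel of the ratio may only exist in the sense of Plancherel.
-/
lemma isDilated_ratio (h : IsLogFactor σ f c κ) {a : ℝ → ℂ}
    (ha : ∀ ξ, a (2 * Real.pi * ξ) = Complex.exp (c (-ξ) - c ξ)) :
    IsDilated (NormedSpace.exp (reflFun c) * NormedSpace.exp (-c)) a := by
  refine ⟨fun ξ => ?_, ?_⟩
  · rw [BoundedContinuousFunction.mul_apply, bcf_exp_apply, bcf_exp_apply,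
      BoundedContinuousFunction.neg_apply, reflFun_apply, ← Complex.exp_add, ha, sub_eq_add_neg]
  · set w : ℝ →ᵇ ℂ := reflFun c - c with hw
    have hw2 : MemLp w 2 := (reflFun_memLp h.plus.memLp).sub h.plus.memLp
    have h1 : MemLp (fun ξ => a (2 * Real.pi * ξ) - 1) 2 := by
      refine hw2.of_le_mul (c := Real.exp ‖w‖) ?_ (Eventually.of_forall fun ξ => ?_)
      · have : (fun ξ => a (2 * Real.pi * ξ) - 1) = fun ξ => Complex.exp (w ξ) - 1 := by
          ext ξ; rw [ha]; rfl
        rw [this]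
        exact (w.continuous.cexp.sub continuous_const).aestronglyMeasurable
      · rw [ha]
        refine (norm_exp_sub_one_le_mul (w ξ)).trans ?_
        rw [mul_comm]
        exact mul_le_mul_of_nonneg_right (Real.exp_le_exp.2 (w.norm_coe_le_norm ξ))
          (norm_nonneg _)
    have h2 := memLp_comp_mul_left h1 (inv_ne_zero Real.two_pi_pos.ne')
    refine h2.ae_eq (Eventually.of_forall fun ξ => ?_)
    simp only [mul_inv_cancel_left₀ Real.two_pi_pos.ne']

lemma tc_hank (h : IsLogFactor σ f c κ) :
    TC (hank lineIncl lineProj reflOp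
      (mulOp (NormedSpace.exp c) * mulOp (NormedSpace.exp (reflFun c)))) := by
  obtain ⟨K, hK, hi⟩ := h.symbol.sub_one.tc_hankel_halfLine
  rw [← mulOp_mul, ← h.isDilated.HL_eq, HL]
  have : IsIntegralOp halfLine K (sumKernel σ) := by
    have e : sumKernel σ = fun x y => fk (fun ξ => σ ξ - 1) (x + y) := by
      ext x y
      rw [sumKernel, kernel, if_pos h.symbol.sub_one.integrable_self, fk]
    rw [e]
    exact hi
  rw [this.integralOp_eq]
  exact hK

lemma tc_first (h : IsLogFactor σ f c κ) : TC (W σ⁻¹ * (W σ + HL σ) - 1) := by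
  have := h.plus.hardyFactor.tc_first h.tc_hank
  rwa [HardyFactor.sumOp, ← mulOp_mul, ← mulOp_mul, ← h.isDilated_inv.W_eq, ← h.isDilated.W_eq,
    ← h.isDilated.HL_eq] at this

lemma tc_truncWH (h : IsLogFactor σ f c κ) {R : ℝ} (hR : 0 < R) : TC (truncWH σ R - 1) := by
  obtain ⟨K, ι, hι, a, b, hK, hr, -⟩ := h.symbol.sub_one.isRep_conv_interval hR
  obtain ⟨K', hK', hi'⟩ := h.symbol.sub_one.tc_hankel_interval R
  have e1 : diffKernel σ = fun x y => fk (fun ξ => σ ξ - 1) (x - y) := by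
    ext x y
    rw [diffKernel, kernel, if_pos h.symbol.sub_one.integrable_self, fk]
  have e2 : sumKernel σ = fun x y => fk (fun ξ => σ ξ - 1) (x + y) := by
    ext x y
    rw [sumKernel, kernel, if_pos h.symbol.sub_one.integrable_self, fk]
  rw [← e1] at hK
  rw [← e2] at hi'
  rw [truncWH, hK.integralOp_eq, hi'.integralOp_eq, ← ContinuousLinearMap.one_def, add_assoc,
    add_sub_cancel_left]
  exact hr.tc.add hK'

/-- The two truncations add up to convolution with the transform of `f` itself, since the logarithms
of the factors sum to `f`. This smooth kernel supplies the trace. -/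
lemma isIntegralOp_add (h : IsLogFactor σ f c κ) (R : ℝ) :
    IsIntegralOp (interval R)
      (restI R ∘L toep lineIncl lineProj (mulOp (reflFun c)) ∘L extI R +
        restI R ∘L toep lineIncl lineProj (mulOp c) ∘L extI R) (fun x y => fk f (x - y)) := by
  set F : ℝ →ᵇ ℂ := reflFun c + c with hFdef
  have hF2 : MemLp F 2 := (reflFun_memLp h.plus.memLp).add h.plus.memLp
  -- The kernel of a symbol is defined by subtracting `1`, so `fk f` is the kernel of `f + 1`.
  have k1 : MemLp (fun ξ => (f ξ + 1) - 1) 2 := by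
    simpa using h.symbol.isSmoothL1.memLp_two
  have k2 : Integrable (fun ξ => (f ξ + 1) - 1) := by
    simpa using h.symbol.isSmoothL1.integrable_self
  have k3 : fk f = kernel (fun ξ => f ξ + 1) := by
    ext x
    simp only [kernel, if_pos k2, fk, add_sub_cancel_right]
  have e : IsIntegralOp halfLine (toep lineIncl lineProj (mulOp F))
      (fun x y => fk f (x - y)) := by
    refine isIntegralOp_toep hF2 (κ := fk f) ?_
    rw [k3]
    exact kernel_ae_eq (a := fun ξ => f ξ + 1) k1 (c := F) (fun ξ => by
      simp [hFdef, reflFun_apply, ← h.sum, add_comm]) hF2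
  have e2 := e.compress R
  have e3 : restI R ∘L toep lineIncl lineProj (mulOp F) ∘L extI R =
      restI R ∘L toep lineIncl lineProj (mulOp (reflFun c)) ∘L extI R +
        restI R ∘L toep lineIncl lineProj (mulOp c) ∘L extI R := by
    rw [hFdef, mulOp_add]
    simp only [toep, ContinuousLinearMap.comp_add, ContinuousLinearMap.add_comp]
  rwa [e3] at e2

/-- The determinant identity on the half-line. -/
theorem det_truncWH (h : IsLogFactor σ f c κ) {a : ℝ → ℂ}
    (ha : ∀ ξ, a (2 * Real.pi * ξ) = Complex.exp (c (-ξ) - c ξ)) {R : ℝ} (hR : 0 < R) :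
    TC (HL a) ∧ fredholmDet (truncWH σ R) =
      lineGPow f R * fredholmDet (W σ⁻¹ * (W σ + HL σ)) *
        fredholmDet (1 + QL R * HL a * QL R) := by
  have eT : toep lineIncl lineProj (mulOp (NormedSpace.exp c)) =
      NormedSpace.exp (toep lineIncl lineProj (mulOp c)) := by
    rw [mulOp_exp]
    exact toep_exp_plus lineSetup h.plus.mulOp_lineIncl
  have eT' : toep lineIncl lineProj (mulOp (NormedSpace.exp (reflFun c))) =
      NormedSpace.exp (toep lineIncl lineProj (mulOp (reflFun c))) := by
    rw [mulOp_exp]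
    exact toep_exp_minus lineSetup h.plus.hank_reflFun
  obtain ⟨D, ι, hι, α, β, hD, hrep, htr⟩ := h.symbol.isSmoothL1.isRep_conv_interval hR
  -- Uniqueness of integral operators transfers the trace-class representation of the convolution to
  -- the sum of the two truncated logarithms.
  rw [← (h.isIntegralOp_add R).unique hD] at hrep
  obtain ⟨ι', hι', ⟨g⟩⟩ := exists_countable_hilbertBasis (H := Lp ℂ 2 (interval R))
  have s1 := summable_restI_toep h.plus.memLp R g.orthonormal
  have s2 := summable_restI_toep (reflFun_memLp h.plus.memLp) R g.orthonormal
  have key := h.plus.hardyFactor.exp_compression_det h.tc_hank (restI_extI R) eT eT'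
    (h.plus.restI_toep R) (h.plus.toep_extI R) g s1 (summable_norm_sq_adjoint g g s1) s2
    (summable_norm_sq_adjoint g g s2) hrep
  have hG : Complex.exp (∑' i, ⟪α i, β i⟫_ℂ) = lineGPow f R := by
    rw [htr, lineGPow, fk]
    simp
  obtain ⟨g1, g2⟩ := key
  rw [← mulOp_mul, ← (h.isDilated_ratio ha).HL_eq] at g1
  rw [one_sub_extI_restI R, ← mulOp_mul, ← mulOp_mul, ← mulOp_mul, ← truncWH_eq h.isDilated,
    HardyFactor.sumOp, ← h.isDilated_inv.W_eq, ← h.isDilated.W_eq, ← h.isDilated.HL_eq,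
    ← (h.isDilated_ratio ha).HL_eq, hG] at g2
  exact ⟨g1, g2⟩

end IsLogFactor

end LineDet

/-! ### The canonical factorization on the line -/

section LineFactor

open scoped BoundedContinuousFunction

lemma norm_fk_le (g : ℝ → ℂ) (x : ℝ) : ‖fk g x‖ ≤ ∫ ξ, ‖g ξ‖ := by
  have h1 : ‖(1 / (2 * Real.pi) : ℂ)‖ ≤ 1 := by
    rw [norm_div, norm_one, norm_mul, Complex.norm_real, Real.norm_of_nonneg Real.pi_pos.le,
      div_le_one (by simp [Real.pi_pos])]
    have := Real.pi_gt_three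
    simp
    linarith
  have h2 : ‖∫ ξ : ℝ, g ξ * Complex.exp (-I * x * ξ)‖ ≤ ∫ ξ, ‖g ξ‖ := by
    refine (norm_integral_le_integral_norm _).trans (le_of_eq ?_)
    refine integral_congr_ae (Eventually.of_forall fun ξ => ?_)
    have := norm_exp_I_mul (-x) ξ
    simp only [norm_mul]
    rw [show -I * (x : ℂ) * ξ = I * ((-x : ℝ) : ℂ) * ξ by push_cast; ring, this, mul_one]
  rw [fk, norm_mul]
  exact (mul_le_mul h1 h2 (norm_nonneg _) zero_le_one).trans (one_mul _).le

lemma continuous_fk {g : ℝ → ℂ} (hg : Integrable g) : Continuous (fk g) := by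
  have := (continuous_expIntegral hg).comp continuous_neg
  refine ((continuous_const (y := (1 / (2 * Real.pi) : ℂ))).mul this).congr fun x => ?_
  change (1 / (2 * Real.pi) : ℂ) * (∫ t : ℝ, g t * Complex.exp (I * (-x : ℝ) * t)) = _
  rw [fk]
  push_cast
  ring_nf

namespace IsSmoothL1

variable {f : ℝ → ℂ}

/-- The transform of `f` is bounded by `∫ |f|`, and `x²` times it, up to sign the transform of
`f''`, by `∫ |f''|`. This decay makes the half-line integral of the transform absolutely convergent.
-/
lemma exists_fk_bound (h : IsSmoothL1 f) : ∃ C, ∀ x, ‖fk f x‖ ≤ C * (1 + x ^ 2)⁻¹ := by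
  refine ⟨(∫ ξ, ‖f ξ‖) + ∫ ξ, ‖iteratedDeriv 2 f ξ‖, fun x => ?_⟩
  rw [← div_eq_mul_inv, le_div_iff₀ (by positivity), mul_add, mul_one]
  refine add_le_add (norm_fk_le f x) ?_
  have h1 := h.fk_deriv (n := 2) le_rfl x
  have h2 := norm_fk_le (iteratedDeriv 2 f) x
  rw [h1, norm_mul, norm_pow, norm_mul, Complex.norm_I, one_mul, Complex.norm_real, Real.norm_eq_abs,
    sq_abs] at h2
  linarith

lemma integrable_fk (h : IsSmoothL1 f) : Integrable (fk f) := by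
  obtain ⟨C, hC⟩ := h.exists_fk_bound
  exact (integrable_inv_one_add_sq.const_mul C).mono'
    (continuous_fk h.integrable_self).aestronglyMeasurable (Eventually.of_forall hC)

lemma memLp_fk (h : IsSmoothL1 f) : MemLp (fk f) 2 := by
  rw [memLp_two_iff_integrable_sq_norm (continuous_fk h.integrable_self).aestronglyMeasurable]
  refine (h.integrable_fk.norm.const_mul (∫ ξ, ‖f ξ‖)).mono'
    ((continuous_fk h.integrable_self).norm.pow 2).aestronglyMeasurable
    (Eventually.of_forall fun x => ?_)
  rw [Real.norm_of_nonneg (by positivity), pow_two]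
  exact mul_le_mul_of_nonneg_right (norm_fk_le f x) (norm_nonneg _)

end IsSmoothL1

/-- The analytic part of `f` in the upper half-plane. -/
def linePlus (f : ℝ → ℂ) (ζ : ℂ) : ℂ := ∫ x in Ioi (0 : ℝ), fk f x * Complex.exp (I * ζ * x)

lemma norm_exp_I_mul_eq (ζ : ℂ) (x : ℝ) :
    ‖Complex.exp (I * ζ * x)‖ = Real.exp (-(ζ.im * x)) := by
  rw [Complex.norm_exp]
  congr 1
  simp

namespace IsSmoothL1

variable {f : ℝ → ℂ}

lemma aestronglyMeasurable_linePlus (h : IsSmoothL1 f) (ζ : ℂ) :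
    AEStronglyMeasurable (fun x : ℝ => fk f x * Complex.exp (I * ζ * x))
      (volume.restrict (Ioi 0)) := by
  have h1 := continuous_fk h.integrable_self
  exact (by fun_prop : Continuous fun x : ℝ => fk f x * Complex.exp (I * ζ * x)).aestronglyMeasurable

lemma norm_linePlus_integrand_le {ζ : ℂ} (hζ : 0 ≤ ζ.im) {x : ℝ} (hx : 0 < x) :
    ‖fk f x * Complex.exp (I * ζ * x)‖ ≤ ‖fk f x‖ := by
  rw [norm_mul, norm_exp_I_mul_eq]
  refine mul_le_of_le_one_right (norm_nonneg _) (Real.exp_le_one_iff.2 ?_)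
  nlinarith

lemma norm_linePlus_le (h : IsSmoothL1 f) {ζ : ℂ} (hζ : 0 ≤ ζ.im) :
    ‖linePlus f ζ‖ ≤ ∫ x in Ioi (0 : ℝ), ‖fk f x‖ := by
  refine norm_integral_le_of_norm_le h.integrable_fk.norm.integrableOn ?_
  filter_upwards [ae_restrict_mem measurableSet_Ioi] with x hx
  exact norm_linePlus_integrand_le hζ hx

/-- Differentiation under the integral works locally, where `Im ζ ≥ ε` and `x e^(-εx) ≤ 1/ε`.
Continuity up to the real line only uses `|e^(iζx)| ≤ 1`. -/
lemma diffContOnCl_linePlus (h : IsSmoothL1 f) :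
    DiffContOnCl ℂ (linePlus f) {ζ : ℂ | 0 < ζ.im} := by
  constructor
  · intro ζ₀ hζ₀
    have hζ₀ : 0 < ζ₀.im := hζ₀
    set ε := ζ₀.im / 2 with hε
    have hε0 : 0 < ε := by positivity
    have him : ∀ ζ ∈ Metric.ball ζ₀ ε, ε ≤ ζ.im := by
      intro ζ hζ
      have h1 : |(ζ - ζ₀).im| ≤ ‖ζ - ζ₀‖ := Complex.abs_im_le_norm _
      rw [Metric.mem_ball, dist_eq_norm] at hζ
      rw [Complex.sub_im] at h1
      have h2 := (abs_lt.1 (h1.trans_lt hζ)).1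
      linarith
    have key := hasDerivAt_integral_of_dominated_loc_of_deriv_le (𝕜 := ℂ)
      (μ := volume.restrict (Ioi (0 : ℝ))) (F := fun ζ x => fk f x * Complex.exp (I * ζ * x))
      (F' := fun ζ x => fk f x * (Complex.exp (I * ζ * x) * (I * x))) (x₀ := ζ₀)
      (s := Metric.ball ζ₀ ε) (bound := fun x => ‖fk f x‖ * (1 / ε))
      (Metric.ball_mem_nhds _ hε0)
      (Eventually.of_forall fun ζ => h.aestronglyMeasurable_linePlus ζ) ?_ ?_ ?_ ?_ ?_
    · exact key.2.differentiableAt.differentiableWithinAt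
    · refine h.integrable_fk.norm.integrableOn.mono' (h.aestronglyMeasurable_linePlus ζ₀) ?_
      filter_upwards [ae_restrict_mem measurableSet_Ioi] with x hx
      exact norm_linePlus_integrand_le hζ₀.le hx
    · have h1 := continuous_fk h.integrable_self
      exact (by fun_prop : Continuous fun x : ℝ =>
        fk f x * (Complex.exp (I * ζ₀ * x) * (I * x))).aestronglyMeasurable
    · filter_upwards [ae_restrict_mem measurableSet_Ioi] with x hx ζ hζ
      have hx : 0 < x := hx
      have h1 := him ζ hζ
      rw [norm_mul, norm_mul, norm_exp_I_mul_eq, norm_mul, Complex.norm_I,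
        one_mul, Complex.norm_real, Real.norm_of_nonneg hx.le]
      refine mul_le_mul_of_nonneg_left ?_ (norm_nonneg _)
      have h2 : Real.exp (-(ζ.im * x)) ≤ Real.exp (-(ε * x)) :=
        Real.exp_le_exp.2 (by nlinarith)
      have h3 : ε * x ≤ Real.exp (ε * x) := by
        have := Real.add_one_le_exp (ε * x); linarith
      calc _ ≤ Real.exp (-(ε * x)) * x := mul_le_mul_of_nonneg_right h2 hx.le
        _ ≤ 1 / ε := by
          rw [Real.exp_neg, le_div_iff₀ hε0, inv_mul_eq_div, div_mul_eq_mul_div,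
            div_le_one (Real.exp_pos _)]
          linarith
    · exact h.integrable_fk.norm.integrableOn.mul_const _
    · refine Eventually.of_forall fun x ζ _ => ?_
      have : HasDerivAt (fun ζ : ℂ => I * ζ * x) (I * x) ζ := by
        simpa using ((hasDerivAt_id ζ).const_mul I).mul_const (x : ℂ)
      exact this.cexp.const_mul _
  · rw [Complex.closure_setOfPred_lt_im]
    intro ζ₀ hζ₀
    refine tendsto_integral_filter_of_dominated_convergence (fun x => ‖fk f x‖)
      (Eventually.of_forall fun ζ => h.aestronglyMeasurable_linePlus ζ) ?_
      h.integrable_fk.norm.integrableOn ?_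
    · filter_upwards [self_mem_nhdsWithin] with ζ hζ
      filter_upwards [ae_restrict_mem measurableSet_Ioi] with x hx
      exact norm_linePlus_integrand_le hζ hx
    · refine Eventually.of_forall fun x => ?_
      exact ((by fun_prop : Continuous fun ζ : ℂ => fk f x * Complex.exp (I * ζ * x)).tendsto
        ζ₀).mono_left nhdsWithin_le_nhds

/-- The boundary values of the analytic part, after a dilation. -/
def lineB (h : IsSmoothL1 f) : ℝ →ᵇ ℂ :=
  BoundedContinuousFunction.ofNormedAddCommGroup (fun ξ : ℝ => linePlus f (2 * Real.pi * ξ : ℝ))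
    (by
      have h1 := h.diffContOnCl_linePlus.2
      rw [Complex.closure_setOfPred_lt_im] at h1
      exact h1.comp_continuous (by fun_prop) fun ξ => by simp)
    (∫ x in Ioi (0 : ℝ), ‖fk f x‖) (fun ξ => h.norm_linePlus_le (by simp))

lemma lineB_apply (h : IsSmoothL1 f) (ξ : ℝ) :
    h.lineB ξ = linePlus f (2 * Real.pi * ξ : ℝ) := rfl

lemma isPlus_lineB (h : IsSmoothL1 f) : IsPlus h.lineB ((Ioi 0).indicator (fk f)) := by
  refine isPlus_of_fourierInv (h.integrable_fk.indicator measurableSet_Ioi)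
    (h.memLp_fk.indicator measurableSet_Ioi) (fun ξ => ?_)
    (fun x hx => indicator_of_notMem (by simpa using hx.le) _)
  rw [lineB_apply, linePlus, ← integral_indicator measurableSet_Ioi, Real.fourierInv_eq']
  refine integral_congr_ae (Eventually.of_forall fun x => ?_)
  by_cases hx : x ∈ Ioi 0
  · simp only [indicator_of_mem hx, smul_eq_mul]
    rw [mul_comm]
    congr 2
    simp
    ring
  · simp only [indicator_of_notMem hx, smul_zero]

lemma integral_fk (h : IsSmoothL1 f) (ξ : ℝ) :
    ∫ x : ℝ, fk f x * Complex.exp (I * ξ * x) = f ξ := by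
  set g : ℝ → ℂ := fun η => f (2 * Real.pi * η) with hg
  have hgi : Integrable g :=
    memLp_one_iff_integrable.1 (memLp_comp_mul_left
      (memLp_one_iff_integrable.2 h.integrable_self) Real.two_pi_pos.ne')
  have hFg : (𝓕 g : ℝ → ℂ) = fk f := by
    ext x
    have k2 : Integrable (fun ξ => (f ξ + 1) - 1) := by simpa using h.integrable_self
    have := kernel_eq_fourier (a := fun ξ => f ξ + 1) k2 x
    simp only [kernel, if_pos k2, add_sub_cancel_right] at this
    exact this.symm
  have hinv := (show Continuous g from h.smooth.continuous.comp
    (by fun_prop)).fourierInv_fourier_eq hgi (by rw [hFg]; exact h.integrable_fk)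
  have h1 := congrFun hinv (ξ / (2 * Real.pi))
  rw [hFg, Real.fourierInv_eq'] at h1
  have h2 : g (ξ / (2 * Real.pi)) = f ξ := by
    simp only [hg]
    congr 1
    field_simp
  rw [← h2, ← h1]
  refine integral_congr_ae (Eventually.of_forall fun x => ?_)
  simp only [smul_eq_mul]
  rw [mul_comm]
  congr 2
  have : (Real.pi : ℂ) ≠ 0 := by exact_mod_cast Real.pi_ne_zero
  simp
  field_simp

lemma fk_neg (hf : ∀ ξ, f (-ξ) = f ξ) (x : ℝ) : fk f (-x) = fk f x := by
  rw [fk, fk, ← integral_neg_eq_self]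
  congr 2
  ext ξ
  rw [hf]
  push_cast
  ring_nf

/-- The transform of an even function is even, so the reflected half of the inversion integral is
the integral over the negative half-line. -/
lemma linePlus_add (h : IsSmoothL1 f) (hf : ∀ ξ, f (-ξ) = f ξ) (ξ : ℝ) :
    linePlus f ξ + linePlus f (-ξ : ℝ) = f ξ := by
  have hi : Integrable fun x : ℝ => fk f x * Complex.exp (I * ξ * x) := by
    have hc : Continuous fun x : ℝ => Complex.exp (I * ξ * x) := by fun_prop
    refine h.integrable_fk.mono (h.integrable_fk.1.mul hc.aestronglyMeasurable)
      (Eventually.of_forall fun x => ?_)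
    rw [norm_mul, norm_exp_I_mul, mul_one]
  rw [← h.integral_fk ξ, ← integral_add_compl measurableSet_Ioi hi, linePlus, linePlus]
  congr 1
  have h2 := integral_comp_neg_Ioi (0 : ℝ) fun x => fk f x * Complex.exp (I * ξ * x)
  rw [compl_Ioi, ← neg_zero, ← h2, neg_zero]
  refine integral_congr_ae (Eventually.of_forall fun x => ?_)
  simp only [fk_neg hf]
  push_cast
  ring_nf

lemma isLineFactorization {σ : ℝ → ℂ} (h : IsSmoothL1 f) (hf : ∀ ξ, f (-ξ) = f ξ)
    (hσ : ∀ ξ, σ ξ = Complex.exp (f ξ)) :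
    IsLineFactorization σ (fun ζ => Complex.exp (linePlus f ζ))
      (fun ζ => Complex.exp (linePlus f (-ζ))) := by
  set M := ∫ x in Ioi (0 : ℝ), ‖fk f x‖
  refine ⟨⟨h.diffContOnCl_linePlus.1.cexp, h.diffContOnCl_linePlus.2.cexp⟩,
    ⟨Real.exp (-M), Real.exp M, Real.exp_pos _, fun ζ hζ => ?_⟩, fun ζ _ => rfl, fun ξ => ?_⟩
  · have h1 := h.norm_linePlus_le hζ
    have h2 := abs_le.1 ((Complex.abs_re_le_norm _).trans h1)
    rw [Complex.norm_exp]
    exact ⟨Real.exp_le_exp.2 h2.1, Real.exp_le_exp.2 h2.2⟩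
  · rw [hσ, ← h.linePlus_add hf ξ, Complex.exp_add]
    push_cast
    rfl

end IsSmoothL1

lemma IsLineSymbol.isLogFactor {σ f : ℝ → ℂ} (h : IsLineSymbol σ f) :
    IsLogFactor σ f h.isSmoothL1.lineB ((Ioi 0).indicator (fk f)) where
  symbol := h
  plus := h.isSmoothL1.isPlus_lineB
  sum ξ := by
    rw [IsSmoothL1.lineB_apply, IsSmoothL1.lineB_apply, mul_neg]
    exact h.isSmoothL1.linePlus_add h.even_log _

end LineFactor

/-! ### The Cayley transform and an orthonormal basis of L²(ℝ) adapted to the circle. -/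

section CircleBasis

open scoped BoundedContinuousFunction

lemma one_sub_I_mul_ne_zero (x : ℝ) : 1 - I * (x : ℂ) ≠ 0 := by
  intro h
  simpa using congrArg Complex.re h

lemma one_add_I_mul_ne_zero (x : ℝ) : 1 + I * (x : ℂ) ≠ 0 := by
  intro h
  simpa using congrArg Complex.re h

lemma coe_cayley (x : ℝ) : (cayley x : ℂ) = (1 + I * x) / (1 - I * x) := rfl

lemma continuous_cayley : Continuous cayley := by
  refine Continuous.subtype_mk (Continuous.div ?_ ?_ one_sub_I_mul_ne_zero) _ <;> fun_prop

lemma cayley_neg (x : ℝ) : cayley (-x) = (cayley x)⁻¹ := by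
  ext
  rw [Circle.coe_inv, coe_cayley, coe_cayley, inv_div]
  push_cast
  ring_nf

lemma exp_two_arctan (x : ℝ) : Circle.exp (2 * Real.arctan x) = cayley x := by
  ext
  have h0 : (0 : ℝ) < 1 + x ^ 2 := by positivity
  have hs : ((Real.sqrt (1 + x ^ 2) : ℝ) : ℂ) ^ 2 = (1 + I * x) * (1 - I * x) := by
    rw [← ofReal_pow, Real.sq_sqrt h0.le]
    push_cast
    linear_combination (x : ℂ) ^ 2 * I_sq
  have hs0 : ((Real.sqrt (1 + x ^ 2) : ℝ) : ℂ) ≠ 0 := ofReal_ne_zero.2 (Real.sqrt_pos.2 h0).ne'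
  have h1 : Complex.exp (Real.arctan x * I) = (1 + I * x) / (Real.sqrt (1 + x ^ 2) : ℝ) := by
    rw [Complex.exp_mul_I, ← ofReal_cos, ← ofReal_sin, Real.cos_arctan, Real.sin_arctan]
    push_cast
    ring
  rw [Circle.coe_exp, ofReal_mul, ofReal_ofNat, mul_assoc, two_mul, Complex.exp_add, h1,
    coe_cayley, div_mul_div_comm, ← pow_two, ← pow_two, hs, pow_two,
    mul_div_mul_left _ _ (one_add_I_mul_ne_zero x)]

/-- The Cayley transform of the rescaled line. -/
def cay (ξ : ℝ) : Circle := cayley (2 * Real.pi * ξ)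

lemma continuous_cay : Continuous cay := continuous_cayley.comp (by fun_prop)

lemma cay_neg (ξ : ℝ) : cay (-ξ) = (cay ξ)⁻¹ := by
  rw [cay, mul_neg, cayley_neg, cay]

/-- The angle of the Cayley transform of the rescaled line. -/
def cayAngle (ξ : ℝ) : ℝ := 2 * Real.arctan (2 * Real.pi * ξ)

lemma exp_cayAngle (ξ : ℝ) : Circle.exp (cayAngle ξ) = cay ξ := exp_two_arctan _

/-- The density of the rescaled Cayley transform. -/
def cayDensity (ξ : ℝ) : ℝ := 4 * Real.pi / (1 + (2 * Real.pi * ξ) ^ 2)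

lemma cayDensity_pos (ξ : ℝ) : 0 < cayDensity ξ := by
  unfold cayDensity
  positivity

lemma hasDerivAt_cayAngle (ξ : ℝ) :
    HasDerivAt cayAngle (cayDensity ξ) ξ := by
  have h := (((hasDerivAt_id ξ).const_mul (2 * Real.pi)).arctan).const_mul 2
  refine h.congr_deriv ?_
  simp only [id, cayDensity]
  ring

lemma injective_cayAngle : Function.Injective cayAngle := by
  intro x y h
  have h1 := Real.arctan_injective (mul_left_cancel₀ two_ne_zero h)
  exact mul_left_cancel₀ (by positivity) h1

lemma image_cayAngle : cayAngle '' univ = Ioo (-Real.pi) Real.pi := by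
  ext θ
  constructor
  · rintro ⟨ξ, -, rfl⟩
    have := Real.arctan_mem_Ioo (2 * Real.pi * ξ)
    constructor <;> simp only [cayAngle] <;> linarith [this.1, this.2]
  · intro h
    refine ⟨Real.tan (θ / 2) / (2 * Real.pi), mem_univ _, ?_⟩
    rw [cayAngle, mul_div_cancel₀ _ (by positivity),
      Real.arctan_tan (by linarith [h.1]) (by linarith [h.2])]
    ring

lemma integral_comp_cayAngle (F : ℝ → ℂ) :
    ∫ θ in Ioo (-Real.pi) Real.pi, F θ = ∫ ξ, cayDensity ξ • F (cayAngle ξ) := by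
  rw [← image_cayAngle, integral_image_eq_integral_abs_deriv_smul MeasurableSet.univ
    (fun ξ _ => (hasDerivAt_cayAngle ξ).hasDerivWithinAt) injective_cayAngle.injOn,
    setIntegral_univ]
  refine integral_congr_ae (Eventually.of_forall fun ξ => ?_)
  simp only [abs_of_pos (cayDensity_pos ξ)]

lemma integral_comp_cayAngle_real (F : ℝ → ℝ) :
    ∫ θ in Ioo (-Real.pi) Real.pi, F θ = ∫ ξ, cayDensity ξ * F (cayAngle ξ) := by
  rw [← image_cayAngle, integral_image_eq_integral_abs_deriv_smul MeasurableSet.univ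
    (fun ξ _ => (hasDerivAt_cayAngle ξ).hasDerivWithinAt) injective_cayAngle.injOn,
    setIntegral_univ]
  refine integral_congr_ae (Eventually.of_forall fun ξ => ?_)
  simp only [abs_of_pos (cayDensity_pos ξ), smul_eq_mul]

lemma integrableOn_comp_cayAngle (F : ℝ → ℝ) :
    IntegrableOn F (Ioo (-Real.pi) Real.pi) ↔
      Integrable fun ξ => cayDensity ξ * F (cayAngle ξ) := by
  rw [← image_cayAngle, integrableOn_image_iff_integrableOn_abs_deriv_smul MeasurableSet.univ
    (fun ξ _ => (hasDerivAt_cayAngle ξ).hasDerivWithinAt) injective_cayAngle.injOn,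
    integrableOn_univ]
  simp only [abs_of_pos (cayDensity_pos _), smul_eq_mul]

/-- The period is shifted to `(-π, π)`, the range of `cayAngle`, and the angle is substituted. -/
lemma coeff_eq_integral (φ : Circle → ℂ) (k : ℤ) :
    coeff φ k = (1 / (2 * Real.pi)) *
      ∫ ξ, cayDensity ξ • (φ (cay ξ) * ((cay ξ : ℂ)) ^ (-k)) := by
  have hp : Function.Periodic
      (fun θ : ℝ => φ (Circle.exp θ) * Complex.exp (-I * k * θ)) (2 * Real.pi) := by
    intro θ
    have h1 : Complex.exp (-I * k * ((θ + 2 * Real.pi : ℝ) : ℂ)) =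
        Complex.exp (-I * k * θ) := by
      have : -I * k * ((θ + 2 * Real.pi : ℝ) : ℂ) = -I * k * θ - k * (2 * Real.pi * I) := by
        push_cast
        ring
      rw [this, Complex.exp_sub, Complex.exp_int_mul_two_pi_mul_I, div_one]
    simp only
    rw [h1, Circle.exp_add, Circle.exp_two_pi, mul_one]
  have h2 := hp.intervalIntegral_add_eq 0 (-Real.pi)
  rw [zero_add, show -Real.pi + 2 * Real.pi = Real.pi by ring] at h2
  rw [coeff, h2, intervalIntegral.integral_of_le (by linarith [Real.pi_pos]),
    integral_Ioc_eq_integral_Ioo, integral_comp_cayAngle]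
  congr 1
  refine integral_congr_ae (Eventually.of_forall fun ξ => ?_)
  simp only
  congr 2
  · rw [exp_cayAngle]
  · rw [← exp_cayAngle, Circle.coe_exp, ← Complex.exp_int_mul]
    congr 1
    push_cast
    ring

/-- The functions `√2 zᵏ / (1 - 2πiξ)`, where `z` is the rescaled Cayley transform. -/
def mobFun (k : ℤ) (ξ : ℝ) : ℂ :=
  Real.sqrt 2 * (cay ξ : ℂ) ^ k / (1 - I * (2 * Real.pi * ξ : ℝ))

lemma continuous_mobFun (k : ℤ) : Continuous (mobFun k) := by
  refine Continuous.div (continuous_const.mul ?_) ?_ fun ξ => one_sub_I_mul_ne_zero _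
  · exact (continuous_subtype_val.comp continuous_cay).zpow₀ k fun ξ => Or.inl (Circle.coe_ne_zero _)
  · fun_prop

lemma normSq_one_sub (x : ℝ) : ‖1 - I * (x : ℂ)‖ ^ 2 = 1 + x ^ 2 := by
  rw [← Complex.normSq_eq_norm_sq, Complex.normSq_apply]
  simp
  ring

lemma norm_mobFun_sq (k : ℤ) (ξ : ℝ) :
    ‖mobFun k ξ‖ ^ 2 = cayDensity ξ / (2 * Real.pi) := by
  rw [mobFun, norm_div, norm_mul, norm_zpow, Circle.norm_coe, one_zpow, mul_one, div_pow,
    normSq_one_sub, Complex.norm_real, Real.norm_of_nonneg (Real.sqrt_nonneg 2),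
    Real.sq_sqrt zero_le_two, cayDensity]
  field_simp
  norm_num

lemma conj_mobFun_mul (j k : ℤ) (ξ : ℝ) :
    (starRingEnd ℂ) (mobFun j ξ) * mobFun k ξ =
      (cayDensity ξ / (2 * Real.pi) : ℝ) * (cay ξ : ℂ) ^ (k - j) := by
  have h1 : ∀ j, mobFun j ξ = mobFun 0 ξ * (cay ξ : ℂ) ^ j := by
    intro j
    simp only [mobFun, zpow_zero]
    ring
  rw [h1 j, h1 k, map_mul, map_zpow₀, ← Circle.coe_inv_eq_conj, Circle.coe_inv, inv_zpow,
    ← norm_mobFun_sq 0, zpow_sub₀ (Circle.coe_ne_zero _)]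
  have := Complex.conj_mul' (mobFun 0 ξ)
  push_cast
  rw [← this]
  ring

lemma integrable_cayDensity : Integrable cayDensity := by
  have := (integrableOn_comp_cayAngle fun _ => 1).1 (by simp)
  simpa using this

lemma memLp_mobFun (k : ℤ) : MemLp (mobFun k) 2 := by
  rw [memLp_two_iff_integrable_sq_norm (continuous_mobFun k).aestronglyMeasurable]
  simp only [norm_mobFun_sq]
  exact integrable_cayDensity.div_const _

/-- The functions `√2 zᵏ / (1 - 2πiξ)` as vectors of `L²(ℝ)`. -/
def mobVec (k : ℤ) : LR := (memLp_mobFun k).toLp _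

lemma coeFn_mobVec (k : ℤ) : mobVec k =ᵐ[volume] mobFun k := (memLp_mobFun k).coeFn_toLp

lemma inner_mobVec (k : ℤ) (g : LR) :
    ⟪mobVec k, g⟫_ℂ = ∫ ξ, (starRingEnd ℂ) (mobFun k ξ) * g ξ := by
  rw [L2.inner_def]
  refine integral_congr_ae ?_
  filter_upwards [coeFn_mobVec k] with ξ h
  rw [h, RCLike.inner_apply, mul_comm]

lemma inner_mobVec_mulOp (a : ℝ →ᵇ ℂ) (j k : ℤ) :
    ⟪mobVec j, mulOp a (mobVec k)⟫_ℂ =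
      ∫ ξ, (cayDensity ξ / (2 * Real.pi) : ℝ) * (a ξ * (cay ξ : ℂ) ^ (k - j)) := by
  rw [inner_mobVec]
  refine integral_congr_ae ?_
  filter_upwards [coeFn_mobVec k, coeFn_mulOp a (mobVec k)] with ξ h1 h2
  rw [h2, h1, mul_left_comm, conj_mobFun_mul]
  ring

/-- A continuous function on the circle as a bounded continuous function on the line. -/
def circFun (φ : C(Circle, ℂ)) : ℝ →ᵇ ℂ :=
  (BoundedContinuousFunction.mkOfCompact φ).compContinuous ⟨cay, continuous_cay⟩

@[simp] lemma circFun_apply (φ : C(Circle, ℂ)) (ξ : ℝ) : circFun φ ξ = φ (cay ξ) := rfl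

/-- The weight `|mobFun|²` is the density of normalized arc length under the Cayley transform.
Multiplication by a function on the circle therefore has the doubly infinite Toeplitz matrix in this
system. -/
lemma inner_mobVec_circFun (φ : C(Circle, ℂ)) (j k : ℤ) :
    ⟪mobVec j, mulOp (circFun φ) (mobVec k)⟫_ℂ = coeff φ (j - k) := by
  rw [inner_mobVec_mulOp, coeff_eq_integral, ← integral_const_mul]
  refine integral_congr_ae (Eventually.of_forall fun ξ => ?_)
  simp only [circFun_apply, Complex.real_smul, neg_sub]
  push_cast
  ring

lemma coeff_one (k : ℤ) : coeff (1 : C(Circle, ℂ)) k = if k = 0 then 1 else 0 := by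
  have hpi : (2 * Real.pi : ℂ) ≠ 0 := by
    exact_mod_cast (by positivity : (2 * Real.pi : ℝ) ≠ 0)
  simp only [coeff, ContinuousMap.one_apply, one_mul]
  split_ifs with h
  · subst h
    simp only [Int.cast_zero, mul_zero, zero_mul, Complex.exp_zero, intervalIntegral.integral_const,
      sub_zero, Complex.real_smul, mul_one]
    push_cast
    exact one_div_mul_cancel hpi
  · have hc : -I * (k : ℂ) ≠ 0 := mul_ne_zero (neg_ne_zero.2 I_ne_zero) (Int.cast_ne_zero.2 h)
    rw [integral_exp_mul_complex hc]
    have : -I * (k : ℂ) * ((2 * Real.pi : ℝ) : ℂ) = (-k : ℤ) * (2 * Real.pi * I) := by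
      push_cast
      ring
    rw [this, Complex.exp_int_mul_two_pi_mul_I]
    simp

lemma orthonormal_mobVec : Orthonormal ℂ mobVec := by
  classical
  rw [orthonormal_iff_ite]
  intro j k
  have h := inner_mobVec_circFun 1 j k
  have h1 : circFun 1 = 1 := rfl
  rw [h1, mulOp_one] at h
  change ⟪mobVec j, mobVec k⟫_ℂ = _ at h
  rw [h, coeff_one]
  simp [sub_eq_zero]

/-- Dividing `g` by `mobFun 0` and passing to the angle gives a square integrable function all of
whose Fourier coefficients vanish; Parseval's identity, transported back to the line, gives `∫ |g|²
= 0`. -/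
lemma eq_zero_of_inner_mobVec {g : LR} (hg : ∀ k, ⟪mobVec k, g⟫_ℂ = 0) : g = 0 := by
  have hab : -Real.pi < Real.pi := by linarith [Real.pi_pos]
  have hmg : StronglyMeasurable (g : ℝ → ℂ) := Lp.stronglyMeasurable g
  set F : ℝ → ℂ := fun θ => g (Real.tan (θ / 2) / (2 * Real.pi)) /
    mobFun 0 (Real.tan (θ / 2) / (2 * Real.pi)) with hF
  have hFc : ∀ ξ, F (cayAngle ξ) = g ξ / mobFun 0 ξ := by
    intro ξ
    have : Real.tan (cayAngle ξ / 2) / (2 * Real.pi) = ξ := by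
      rw [cayAngle, mul_div_cancel_left₀ _ two_ne_zero, Real.tan_arctan,
        mul_div_cancel_left₀ _ (by positivity)]
    simp only [hF, this]
  have hw : ∀ k ξ, mobFun k ξ ≠ 0 := fun k ξ => by
    have h0 := cayDensity_pos ξ
    have h1 := norm_mobFun_sq k ξ
    intro h2
    rw [h2, norm_zero, zero_pow two_ne_zero] at h1
    have : 0 < cayDensity ξ / (2 * Real.pi) := by positivity
    linarith
  have hFm : Measurable F := by
    have ht : Measurable fun θ : ℝ => Real.tan (θ / 2) / (2 * Real.pi) := by
      simp only [Real.tan_eq_sin_div_cos]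
      fun_prop
    exact (hmg.measurable.comp ht).div ((continuous_mobFun 0).measurable.comp ht)
  have hdens : ∀ ξ, cayDensity ξ * ‖F (cayAngle ξ)‖ ^ 2 = 2 * Real.pi * ‖g ξ‖ ^ 2 := by
    intro ξ
    have h0 := cayDensity_pos ξ
    rw [hFc, norm_div, div_pow, norm_mobFun_sq]
    field_simp
  have hsq : Integrable fun ξ => ‖g ξ‖ ^ 2 :=
    (memLp_two_iff_integrable_sq_norm (Lp.aestronglyMeasurable g)).1 (Lp.memLp g)
  have hFL : MemLp F 2 (volume.restrict (Ioc (-Real.pi) Real.pi)) := by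
    rw [memLp_two_iff_integrable_sq_norm hFm.aestronglyMeasurable]
    have : IntegrableOn (fun θ => ‖F θ‖ ^ 2) (Ioo (-Real.pi) Real.pi) := by
      rw [integrableOn_comp_cayAngle]
      simp only [hdens]
      exact hsq.const_mul _
    exact (integrableOn_Ioc_iff_integrableOn_Ioo).2 this
  have hcoef : ∀ k : ℤ, fourierCoeffOn hab F k = 0 := by
    intro k
    rw [fourierCoeffOn_eq_integral, intervalIntegral.integral_of_le hab.le,
      integral_Ioc_eq_integral_Ioo, integral_comp_cayAngle]
    have h1 : ∀ ξ, cayDensity ξ • (fourier (-k) ((cayAngle ξ : ℝ) : AddCircle (Real.pi - -Real.pi)) •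
        F (cayAngle ξ)) = (2 * Real.pi : ℝ) * ((starRingEnd ℂ) (mobFun k ξ) * g ξ) := by
      intro ξ
      have h2 : fourier (-k) ((cayAngle ξ : ℝ) : AddCircle (Real.pi - -Real.pi)) =
          (cay ξ : ℂ) ^ (-k) := by
        rw [fourier_coe_apply, ← exp_cayAngle, Circle.coe_exp, ← Complex.exp_int_mul]
        congr 1
        have : (Real.pi : ℂ) ≠ 0 := ofReal_ne_zero.2 Real.pi_ne_zero
        push_cast
        field_simp
        ring
      have h3 := conj_mobFun_mul k 0 ξ
      rw [zero_sub] at h3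
      have hpi : (Real.pi : ℂ) ≠ 0 := ofReal_ne_zero.2 Real.pi_ne_zero
      rw [h2, hFc, Complex.real_smul, smul_eq_mul]
      have h4 : (starRingEnd ℂ) (mobFun k ξ) =
          (cayDensity ξ / (2 * Real.pi) : ℝ) * (cay ξ : ℂ) ^ (-k) / mobFun 0 ξ := by
        rw [← h3, mul_div_cancel_right₀ _ (hw 0 ξ)]
      rw [h4]
      push_cast
      field_simp
    rw [integral_congr_ae (Eventually.of_forall h1), integral_const_mul, ← inner_mobVec, hg]
    simp
  have hP := hasSum_sq_fourierCoeffOn hab hFL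
  simp only [hcoef, norm_zero, ne_eq, OfNat.ofNat_ne_zero, not_false_eq_true, zero_pow] at hP
  have h0 := hP.unique hasSum_zero
  rw [intervalIntegral.integral_of_le hab.le, integral_Ioc_eq_integral_Ioo,
    integral_comp_cayAngle_real] at h0
  simp only [hdens] at h0
  rw [integral_const_mul, smul_eq_mul] at h0
  have h5 : ∫ ξ, ‖g ξ‖ ^ 2 = 0 := by
    have h6 : (Real.pi - -Real.pi)⁻¹ ≠ 0 := inv_ne_zero (by linarith [Real.pi_pos])
    have h7 : 2 * Real.pi ≠ 0 := by positivity
    simpa [h6, h7, Real.pi_ne_zero] using h0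
  rw [integral_eq_zero_iff_of_nonneg (fun ξ => by positivity) hsq] at h5
  rw [Lp.eq_zero_iff_ae_eq_zero]
  filter_upwards [h5] with ξ h
  simpa using h

/-- The Hilbert basis `√2 zᵏ / (1 - 2πiξ)` of `L²(ℝ)`. -/
def mobBasis : HilbertBasis ℤ ℂ LR :=
  HilbertBasis.mkOfOrthogonalEqBot orthonormal_mobVec (by
    rw [Submodule.eq_bot_iff]
    intro g hg
    refine eq_zero_of_inner_mobVec fun k => ?_
    exact (Submodule.mem_orthogonal _ _).1 hg _ (Submodule.subset_span (mem_range_self k)))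

lemma mobBasis_apply (k : ℤ) : mobBasis k = mobVec k :=
  congrFun (HilbertBasis.coe_mkOfOrthogonalEqBot _ _) k

lemma ext_mobVec {F : Type*} [NormedAddCommGroup F] [NormedSpace ℂ F] {A B : LR →L[ℂ] F}
    (h : ∀ k, A (mobVec k) = B (mobVec k)) : A = B := by
  ext x : 1
  have h2 := A.hasSum (mobBasis.hasSum_repr x)
  have h3 := B.hasSum (mobBasis.hasSum_repr x)
  simp only [map_smul, mobBasis_apply, h] at h2 h3
  exact h2.unique h3

/-- Reflection inverts `z` and conjugates the denominator, and the quotient of the denominators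
contributes one more factor `z⁻¹`. This shift is the source of the index `j + k + 1` in the Hankel
matrix. -/
lemma reflOp_mobVec (k : ℤ) : reflOp (mobVec k) = mobVec (-k - 1) := by
  ext
  filter_upwards [coeFn_reflOp (mobVec k), ae_neg (coeFn_mobVec k),
    coeFn_mobVec (-k - 1)] with ξ h1 h2 h3
  rw [h1, h2, h3, mobFun, mobFun, cay_neg, Circle.coe_inv, inv_zpow, ← zpow_neg,
    zpow_sub_one₀ (Circle.coe_ne_zero _)]
  have e1 : (cay ξ : ℂ) = (1 + I * (2 * Real.pi * ξ : ℝ)) / (1 - I * (2 * Real.pi * ξ : ℝ)) := rfl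
  have e2 := one_sub_I_mul_ne_zero (2 * Real.pi * ξ)
  have e3 := one_add_I_mul_ne_zero (2 * Real.pi * ξ)
  have e4 : (1 : ℂ) - I * (2 * Real.pi * -ξ : ℝ) = 1 + I * (2 * Real.pi * ξ : ℝ) := by
    push_cast
    ring
  rw [e4]
  have e5 : ((cay ξ : ℂ))⁻¹ = (1 - I * (2 * Real.pi * ξ : ℝ)) / (1 + I * (2 * Real.pi * ξ : ℝ)) := by
    rw [e1, inv_div]
  rw [e5]
  field_simp

end CircleBasis

/-! ### The Hardy space of the circle inside L²(ℝ). -/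

section CircleSetup

open scoped BoundedContinuousFunction

/-- The inclusion of `ℓ²(ℤ₊)` in `L²(ℝ)` sending `e_k` to `√2 zᵏ / (1 - 2πiξ)`. -/
def circIncl : Ell2 →L[ℂ] LR :=
  ((orthonormal_mobVec.comp (fun k : ℕ => (k : ℤ)) Nat.cast_injective).orthogonalFamily.linearIsometry
    ).toContinuousLinearMap

lemma circIncl_stdVec (k : ℕ) : circIncl (stdVec k) = mobVec k := by
  have := (orthonormal_mobVec.comp (fun k : ℕ => (k : ℤ))
    Nat.cast_injective).orthogonalFamily.linearIsometry_apply_single (i := k) (1 : ℂ)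
  refine this.trans ?_
  simp

/-- The adjoint of the inclusion of `ℓ²(ℤ₊)` in `L²(ℝ)`. -/
def circProj : LR →L[ℂ] Ell2 := ContinuousLinearMap.adjoint circIncl

lemma inner_stdVec_circProj (j : ℕ) (g : LR) :
    ⟪stdVec j, circProj g⟫_ℂ = ⟪mobVec j, g⟫_ℂ := by
  rw [circProj, ContinuousLinearMap.adjoint_inner_right, circIncl_stdVec]

lemma eq_of_inner_stdVec {x y : Ell2} (h : ∀ j, ⟪stdVec j, x⟫_ℂ = ⟪stdVec j, y⟫_ℂ) : x = y := by
  refine stdBasis.repr.injective ?_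
  ext j
  rw [stdBasis.repr_apply_apply, stdBasis.repr_apply_apply, stdBasis_apply]
  exact h j

lemma inner_mobVec_mobVec (j k : ℤ) : ⟪mobVec j, mobVec k⟫_ℂ = if j = k then 1 else 0 :=
  orthonormal_iff_ite.1 orthonormal_mobVec j k

lemma inner_stdVec (j k : ℕ) : ⟪stdVec j, stdVec k⟫_ℂ = if j = k then (1 : ℂ) else 0 := by
  have := orthonormal_iff_ite.1 stdBasis.orthonormal j k
  rwa [stdBasis_apply, stdBasis_apply] at this

lemma circProj_mobVec_natCast (k : ℕ) : circProj (mobVec k) = stdVec k := by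
  refine eq_of_inner_stdVec fun j => ?_
  rw [inner_stdVec_circProj, inner_mobVec_mobVec, inner_stdVec]
  simp

lemma circProj_mobVec_of_neg {k : ℤ} (hk : k < 0) : circProj (mobVec k) = 0 := by
  refine eq_of_inner_stdVec fun j => ?_
  rw [inner_stdVec_circProj, inner_mobVec_mobVec, inner_zero_right, if_neg (by omega)]

/-- The map `k ↦ -k-1` exchanges the nonnegative and the negative integers, so the reflected space
is spanned by the basis vectors of negative index. -/
lemma circSetup : HardySetup circIncl circProj reflOp where
  retract := by
    refine hasMatrix_ext (a := fun j k => if j = k then 1 else 0) (fun j k => ?_) (fun j k => ?_)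
    · rw [ContinuousLinearMap.comp_apply, inner_stdVec_circProj, circIncl_stdVec,
        inner_mobVec_mobVec]
      simp
    · exact inner_stdVec j k
  invol := reflOp_mul_reflOp
  decomp := by
    refine ext_mobVec fun k => ?_
    simp only [ContinuousLinearMap.add_apply, ContinuousLinearMap.mul_def,
      ContinuousLinearMap.comp_apply, reflOp_mobVec, ContinuousLinearMap.one_apply]
    rcases le_or_gt 0 k with hk | hk
    · lift k to ℕ using hk
      rw [circProj_mobVec_natCast, circIncl_stdVec, circProj_mobVec_of_neg (by omega), map_zero,
        map_zero, add_zero]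
    · obtain ⟨m, hm⟩ : ∃ m : ℕ, -k - 1 = m := ⟨(-k - 1).toNat, by omega⟩
      rw [circProj_mobVec_of_neg hk, map_zero, zero_add, hm, circProj_mobVec_natCast,
        circIncl_stdVec, reflOp_mobVec]
      congr 1
      omega

lemma inner_toep (m : LR →L[ℂ] LR) (j k : ℕ) :
    ⟪stdVec j, toep circIncl circProj m (stdVec k)⟫_ℂ = ⟪mobVec j, m (mobVec k)⟫_ℂ := by
  rw [toep, ContinuousLinearMap.comp_apply, ContinuousLinearMap.comp_apply, inner_stdVec_circProj,
    circIncl_stdVec]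

lemma inner_hank (m : LR →L[ℂ] LR) (j k : ℕ) :
    ⟪stdVec j, hank circIncl circProj reflOp m (stdVec k)⟫_ℂ =
      ⟪mobVec j, m (mobVec (-k - 1))⟫_ℂ := by
  rw [hank, ContinuousLinearMap.comp_apply, ContinuousLinearMap.comp_apply,
    ContinuousLinearMap.comp_apply, inner_stdVec_circProj, circIncl_stdVec, reflOp_mobVec]

lemma hasMatrix_toep (φ : C(Circle, ℂ)) :
    HasMatrix (toep circIncl circProj (mulOp (circFun φ))) (toeplitzMatrix φ) := by
  intro j k
  rw [inner_toep, inner_mobVec_circFun, toeplitzMatrix]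

lemma hasMatrix_hank (φ : C(Circle, ℂ)) :
    HasMatrix (hank circIncl circProj reflOp (mulOp (circFun φ))) (hankelMatrix φ) := by
  intro j k
  rw [inner_hank, inner_mobVec_circFun, hankelMatrix]
  congr 1
  ring

lemma T_eq (φ : C(Circle, ℂ)) : T φ = toep circIncl circProj (mulOp (circFun φ)) :=
  (hasMatrix_toep φ).matrixOp_eq

lemma H_eq (φ : C(Circle, ℂ)) : H φ = hank circIncl circProj reflOp (mulOp (circFun φ)) :=
  (hasMatrix_hank φ).matrixOp_eq

lemma inner_mobVec_reflFun (a : ℝ →ᵇ ℂ) (j k : ℤ) :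
    ⟪mobVec j, mulOp (reflFun a) (mobVec k)⟫_ℂ =
      ⟪mobVec (-j - 1), mulOp a (mobVec (-k - 1))⟫_ℂ := by
  rw [← reflOp_mulOp, ContinuousLinearMap.mul_def, ContinuousLinearMap.mul_def,
    ContinuousLinearMap.comp_apply, ContinuousLinearMap.comp_apply,
    reflOp_mobVec, ← inner_reflOp, reflOp_mobVec, reflOp_reflOp]

end CircleSetup

/-! ### Boundary values of bounded analytic functions on the disc. -/

section Disc

open scoped BoundedContinuousFunction

/-- The bounded continuous function `a` on the line is the boundary value, along the rescaled
Cayley transform, of the bounded analytic function `F` on the disc. -/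
structure IsDiscPlus (a : ℝ →ᵇ ℂ) (F : ℂ → ℂ) : Prop where
  diff : DifferentiableOn ℂ F (Metric.ball 0 1)
  bounded : ∃ M, ∀ z ∈ Metric.ball (0 : ℂ) 1, ‖F z‖ ≤ M
  tendsto : ∀ ξ, Tendsto (fun r : ℝ => F (r * cay ξ)) (𝓝[<] 1) (𝓝 (a ξ))

lemma smul_mem_ball {r : ℝ} (h0 : 0 < r) (h1 : r < 1) (z : Circle) :
    (r * z : ℂ) ∈ Metric.ball (0 : ℂ) 1 := by
  rw [mem_ball_zero_iff, norm_mul, Circle.norm_coe, mul_one, Complex.norm_real,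
    Real.norm_of_nonneg h0.le]
  exact h1

/-- The mean value property for `F(rz) zᵐ`, which is analytic in a neighbourhood of the closed disc.
-/
lemma coeff_neg_of_differentiableOn {F : ℂ → ℂ} (hF : DifferentiableOn ℂ F (Metric.ball 0 1))
    {r : ℝ} (h0 : 0 < r) (h1 : r < 1) (m : ℕ) :
    coeff (fun z => F (r * z)) (-m) = if m = 0 then F 0 else 0 := by
  have hd : DiffContOnCl ℂ (fun z => F (r * z) * z ^ m) (Metric.ball 0 |1|) := by
    have hm : MapsTo (fun z : ℂ => (r : ℂ) * z) (Metric.closedBall 0 1) (Metric.ball 0 1) := by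
      intro z hz
      rw [mem_closedBall_zero_iff] at hz
      rw [mem_ball_zero_iff, norm_mul, Complex.norm_real, Real.norm_of_nonneg h0.le]
      calc r * ‖z‖ ≤ r * 1 := by gcongr
        _ < 1 := by linarith
    have h2 : DifferentiableOn ℂ (fun z => F (r * z) * z ^ m) (Metric.closedBall 0 1) :=
      (hF.comp (by fun_prop) hm).mul (by fun_prop)
    rw [abs_one]
    refine ⟨h2.mono Metric.ball_subset_closedBall, ?_⟩
    rw [closure_ball _ one_ne_zero]
    exact h2.continuousOn
  have h3 := hd.circleAverage
  rw [Real.circleAverage_def] at h3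
  have h4 : coeff (fun z => F (r * z)) (-m) = F (r * 0) * 0 ^ m := by
    rw [← h3, coeff, Complex.real_smul]
    congr 1
    · push_cast
      simp
    · refine intervalIntegral.integral_congr fun θ _ => ?_
      simp only [circleMap, ofReal_one, one_mul, zero_add, Circle.coe_exp, ← Complex.exp_nat_mul]
      congr 2
      push_cast
      ring
  rw [h4, mul_zero, zero_pow_eq]
  split_ifs <;> simp

/-- Let `r` tend to `1` in the coefficients of `F(r ·)`; boundedness of `F` provides the dominating
function, so radial limits suffice and no continuity on the closed disc is required. -/
lemma IsDiscPlus.integral {a : ℝ →ᵇ ℂ} {F : ℂ → ℂ} (h : IsDiscPlus a F) (m : ℕ) :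
    ∫ ξ, (cayDensity ξ / (2 * Real.pi) : ℝ) * (a ξ * (cay ξ : ℂ) ^ m) =
      if m = 0 then F 0 else 0 := by
  obtain ⟨M, hM⟩ := h.bounded
  have hr : ∀ᶠ r : ℝ in 𝓝[<] 1, 0 < r ∧ r < 1 := by
    filter_upwards [Ioo_mem_nhdsLT (zero_lt_one' ℝ)] with r hr using hr
  have hlim : Tendsto (fun r : ℝ => ∫ ξ, (cayDensity ξ / (2 * Real.pi) : ℝ) *
      (F (r * cay ξ) * (cay ξ : ℂ) ^ m)) (𝓝[<] 1)
      (𝓝 (∫ ξ, (cayDensity ξ / (2 * Real.pi) : ℝ) * (a ξ * (cay ξ : ℂ) ^ m))) := by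
    refine tendsto_integral_filter_of_dominated_convergence
      (fun ξ => cayDensity ξ / (2 * Real.pi) * M) ?_ ?_
      ((integrable_cayDensity.div_const _).mul_const _) ?_
    · filter_upwards [hr] with r hr
      have hc : Continuous fun ξ : ℝ => (cay ξ : ℂ) := continuous_subtype_val.comp continuous_cay
      have hF : Continuous fun ξ : ℝ => F (r * cay ξ) :=
        h.diff.continuousOn.comp_continuous (continuous_const.mul hc)
          fun ξ => smul_mem_ball hr.1 hr.2 _
      refine AEStronglyMeasurable.mul ?_ (hF.mul (hc.pow m)).aestronglyMeasurable
      exact Complex.continuous_ofReal.comp_aestronglyMeasurable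
        (integrable_cayDensity.div_const _).aestronglyMeasurable
    · filter_upwards [hr] with r hr
      refine Eventually.of_forall fun ξ => ?_
      have h0 : 0 ≤ cayDensity ξ / (2 * Real.pi) := by
        have := cayDensity_pos ξ
        positivity
      rw [norm_mul, norm_mul, norm_pow, Circle.norm_coe, one_pow, mul_one, Complex.norm_real,
        Real.norm_of_nonneg h0]
      exact mul_le_mul_of_nonneg_left (hM _ (smul_mem_ball hr.1 hr.2 _)) h0
    · exact Eventually.of_forall fun ξ => ((h.tendsto ξ).mul_const _).const_mul _
  refine tendsto_nhds_unique hlim ?_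
  refine tendsto_const_nhds.congr' ?_
  filter_upwards [hr] with r hr
  rw [← coeff_neg_of_differentiableOn h.diff hr.1 hr.2 m, coeff_eq_integral, ← integral_const_mul]
  refine integral_congr_ae (Eventually.of_forall fun ξ => ?_)
  simp only [Complex.real_smul, neg_neg, zpow_natCast]
  push_cast
  ring

lemma IsDiscPlus.inner_eq_zero {a : ℝ →ᵇ ℂ} {F : ℂ → ℂ} (h : IsDiscPlus a F) {j k : ℤ}
    (hjk : j < k) : ⟪mobVec j, mulOp a (mobVec k)⟫_ℂ = 0 := by
  obtain ⟨m, hm⟩ : ∃ m : ℕ, k - j = m := ⟨(k - j).toNat, by omega⟩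
  have h1 := h.integral m
  rw [if_neg (by omega)] at h1
  rw [inner_mobVec_mulOp, hm]
  simpa only [zpow_natCast] using h1

lemma IsDiscPlus.inner_self {a : ℝ →ᵇ ℂ} {F : ℂ → ℂ} (h : IsDiscPlus a F) (k : ℤ) :
    ⟪mobVec k, mulOp a (mobVec k)⟫_ℂ = F 0 := by
  have h1 := h.integral 0
  rw [if_pos rfl] at h1
  rw [inner_mobVec_mulOp, sub_self, ← h1]
  simp

lemma IsDiscPlus.hank_eq_zero {a : ℝ →ᵇ ℂ} {F : ℂ → ℂ} (h : IsDiscPlus a F) :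
    hank circIncl circProj reflOp (mulOp (reflFun a)) = 0 := by
  refine hasMatrix_ext (a := fun _ _ => 0) (fun j k => ?_) (fun j k => by simp)
  rw [inner_hank, inner_mobVec_reflFun]
  exact h.inner_eq_zero (by omega)

/-- A bounded analytic function whose reflection has the same property is constant. -/
lemma IsDiscPlus.eq_const {a : ℝ →ᵇ ℂ} {F G : ℂ → ℂ} (h : IsDiscPlus a F)
    (h' : IsDiscPlus (reflFun a) G) (ξ : ℝ) : a ξ = F 0 := by
  -- Negative coefficients vanish because `a` is analytic inside the disc, positive ones because its
  -- reflection is.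
  have h1 : mulOp a (mobVec 0) = F 0 • mobVec 0 := by
    rw [← sub_eq_zero]
    refine eq_zero_of_inner_mobVec fun k => ?_
    rw [inner_sub_right, inner_smul_right, inner_mobVec_mobVec]
    rcases lt_trichotomy k 0 with hk | hk | hk
    · rw [h.inner_eq_zero hk, if_neg hk.ne, mul_zero, sub_zero]
    · subst hk
      rw [h.inner_self, if_pos rfl, mul_one, sub_self]
    · have h2 := h'.inner_eq_zero (j := -k - 1) (k := -0 - 1) (by omega)
      rw [← inner_mobVec_reflFun] at h2
      have h3 : reflFun (reflFun a) = a := by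
        ext x
        rw [reflFun_apply, reflFun_apply, neg_neg]
      rw [h3] at h2
      rw [h2, if_neg hk.ne', mul_zero, sub_zero]
  have h2 : (fun ξ => a ξ * mobFun 0 ξ) =ᵐ[volume] fun ξ => F 0 * mobFun 0 ξ := by
    have e := congrArg (fun g : LR => (g : ℝ → ℂ)) h1
    filter_upwards [coeFn_mulOp a (mobVec 0), coeFn_mobVec 0, Lp.coeFn_smul (F 0) (mobVec 0)]
      with x e1 e2 e3
    rw [← e2, ← e1]
    exact (congrFun e x).trans (by rw [e3, Pi.smul_apply, smul_eq_mul, e2])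
  have h3 := (Continuous.ae_eq_iff_eq volume (a.continuous.mul (continuous_mobFun 0))
    (continuous_const.mul (continuous_mobFun 0))).1 h2
  have h4 := congrFun h3 ξ
  refine mul_right_cancel₀ ?_ h4
  rw [mobFun, zpow_zero, mul_one]
  refine div_ne_zero ?_ (one_sub_I_mul_ne_zero _)
  exact ofReal_ne_zero.2 (by positivity)

end Disc

/-! ### Finite sections of operators on ℓ². -/

section FiniteSections

lemma coe_mem_closedBall (z : Circle) : (z : ℂ) ∈ Metric.closedBall (0 : ℂ) 1 := by
  rw [mem_closedBall_zero_iff, Circle.norm_coe]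

lemma det_comp_clm {E : Type*} [NormedAddCommGroup E] [NormedSpace ℂ E] (A B : E →L[ℂ] E) :
    LinearMap.det ((A ∘L B : E →L[ℂ] E) : E →ₗ[ℂ] E) =
      LinearMap.det (A : E →ₗ[ℂ] E) * LinearMap.det (B : E →ₗ[ℂ] E) :=
  LinearMap.det_comp _ _

/-- The inclusion of `ℂⁿ` in `ℓ²(ℤ₊)`. -/
def finIncl (n : ℕ) : EuclideanSpace ℂ (Fin n) →L[ℂ] Ell2 :=
  ∑ k : Fin n, (EuclideanSpace.proj k : EuclideanSpace ℂ (Fin n) →L[ℂ] ℂ).smulRight (stdVec k)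

/-- The adjoint of the inclusion of `ℂⁿ` in `ℓ²(ℤ₊)`. -/
def finProj (n : ℕ) : Ell2 →L[ℂ] EuclideanSpace ℂ (Fin n) :=
  ContinuousLinearMap.adjoint (finIncl n)

lemma finIncl_apply (n : ℕ) (x : EuclideanSpace ℂ (Fin n)) :
    finIncl n x = ∑ k : Fin n, x k • stdVec k := by
  simp [finIncl]

lemma finIncl_single (n : ℕ) (k : Fin n) :
    finIncl n (EuclideanSpace.single k 1) = stdVec k := by
  rw [finIncl_apply, Finset.sum_eq_single k]
  · simp
  · intro j _ hj
    simp [hj]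
  · simp

lemma finProj_apply (n : ℕ) (x : Ell2) (k : Fin n) : finProj n x k = ⟪stdVec k, x⟫_ℂ := by
  rw [← finIncl_single, ← ContinuousLinearMap.adjoint_inner_right, ← finProj,
    EuclideanSpace.inner_single_left]
  simp

lemma finProj_stdVec (n : ℕ) (k : Fin n) :
    finProj n (stdVec k) = EuclideanSpace.single k 1 := by
  ext j
  rw [finProj_apply, inner_stdVec]
  simp [Fin.ext_iff]

lemma finProj_stdVec_of_le {n k : ℕ} (hk : n ≤ k) : finProj n (stdVec k) = 0 := by
  ext j
  rw [finProj_apply, inner_stdVec, if_neg (by omega)]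
  rfl

lemma ext_stdVec {F : Type*} [NormedAddCommGroup F] [NormedSpace ℂ F] {A B : Ell2 →L[ℂ] F}
    (h : ∀ k, A (stdVec k) = B (stdVec k)) : A = B := by
  ext x : 1
  have h2 := A.hasSum (stdBasis.hasSum_repr x)
  have h3 := B.hasSum (stdBasis.hasSum_repr x)
  simp only [map_smul, stdBasis_apply, h] at h2 h3
  exact h2.unique h3

lemma ext_single {n : ℕ} {F : Type*} [NormedAddCommGroup F] [NormedSpace ℂ F]
    {A B : EuclideanSpace ℂ (Fin n) →L[ℂ] F}
    (h : ∀ k, A (EuclideanSpace.single k 1) = B (EuclideanSpace.single k 1)) : A = B := by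
  have : (A : EuclideanSpace ℂ (Fin n) →ₗ[ℂ] F) = B := by
    refine (EuclideanSpace.basisFun (Fin n) ℂ).toBasis.ext fun k => ?_
    simpa using h k
  exact ContinuousLinearMap.coe_injective this

lemma finProj_finIncl (n : ℕ) : finProj n ∘L finIncl n = 1 := by
  refine ext_single fun k => ?_
  rw [ContinuousLinearMap.comp_apply, finIncl_single, finProj_stdVec]
  rfl

lemma finIncl_finProj_stdVec {n k : ℕ} (hk : k < n) :
    finIncl n (finProj n (stdVec k)) = stdVec k := by
  have := finProj_stdVec n ⟨k, hk⟩
  simp only at this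
  rw [this, finIncl_single]

lemma inner_finIncl_finProj (n j : ℕ) (x : Ell2) :
    ⟪stdVec j, finIncl n (finProj n x)⟫_ℂ = if j < n then ⟪stdVec j, x⟫_ℂ else 0 := by
  rw [← ContinuousLinearMap.adjoint_inner_left, ← finProj]
  split_ifs with h
  · have := finProj_stdVec n ⟨j, h⟩
    simp only at this
    rw [this, EuclideanSpace.inner_single_left, finProj_apply]
    simp
  · rw [finProj_stdVec_of_le (by omega), inner_zero_left]

lemma one_sub_finIncl_finProj (n : ℕ) : 1 - finIncl n ∘L finProj n = Q n := by
  rw [Q]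
  congr 1
  ext x : 1
  have : FiniteDimensional ℂ (Submodule.span ℂ (Set.range fun j : Fin n => stdVec j)) :=
    FiniteDimensional.span_of_finite ℂ (Set.finite_range _)
  refine (Submodule.eq_starProjection_of_mem_of_inner_eq_zero ?_ ?_).symm
  · rw [ContinuousLinearMap.comp_apply, finIncl_apply]
    exact Submodule.sum_mem _ fun k _ =>
      Submodule.smul_mem _ _ (Submodule.subset_span (mem_range_self k))
  · intro w hw
    induction hw using Submodule.span_induction with
    | mem w hw =>
      obtain ⟨k, rfl⟩ := hw
      simp only
      rw [inner_eq_zero_symm, inner_sub_right, ← finProj_apply, ← finProj_apply, ← ContinuousLinearMap.comp_apply,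
        ← ContinuousLinearMap.comp_assoc, finProj_finIncl]
      exact sub_self _
    | zero => exact inner_zero_right _
    | add u v _ _ hu hv => rw [inner_add_right, hu, hv, add_zero]
    | smul c u _ hu => rw [inner_smul_right, hu, mul_zero]

lemma det_compress (n : ℕ) (A : Ell2 →L[ℂ] Ell2) :
    LinearMap.det ((finProj n ∘L A ∘L finIncl n : EuclideanSpace ℂ (Fin n) →L[ℂ] _) :
      EuclideanSpace ℂ (Fin n) →ₗ[ℂ] EuclideanSpace ℂ (Fin n)) =
      (Matrix.of fun j k : Fin n => ⟪stdVec j, A (stdVec k)⟫_ℂ).det := by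
  rw [← LinearMap.det_toMatrix (EuclideanSpace.basisFun (Fin n) ℂ).toBasis]
  congr 1
  ext j k
  rw [LinearMap.toMatrix_apply]
  simp [finIncl_single, finProj_apply]

end FiniteSections

/-! ### The determinant identity on the circle for a given factorization. -/

section CircleFactor

open scoped BoundedContinuousFunction

lemma reflFun_circFun (φ : C(Circle, ℂ)) :
    reflFun (circFun φ) = circFun (φ.comp ⟨fun z => z⁻¹, continuous_inv⟩) := by
  ext ξ
  simp [reflFun_apply, cay_neg]

lemma circFun_mul (φ ψ : C(Circle, ℂ)) : circFun (φ * ψ) = circFun φ * circFun ψ := rfl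

lemma circFun_one : circFun 1 = 1 := rfl

lemma isDiscPlus_circFun {F : ℂ → ℂ} (hF : DiffContOnCl ℂ F (Metric.ball 0 1))
    {φ : C(Circle, ℂ)} (hφ : ∀ z : Circle, φ z = F z) : IsDiscPlus (circFun φ) F where
  diff := hF.differentiableOn
  bounded := by
    have hc := hF.continuousOn
    rw [closure_ball _ one_ne_zero] at hc
    obtain ⟨M, hM⟩ := (isCompact_closedBall (0 : ℂ) 1).exists_bound_of_continuousOn hc
    exact ⟨M, fun z hz => hM z (Metric.ball_subset_closedBall hz)⟩
  tendsto ξ := by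
    have hc := hF.continuousOn
    rw [closure_ball _ one_ne_zero] at hc
    have h1 : (cay ξ : ℂ) ∈ Metric.closedBall (0 : ℂ) 1 := coe_mem_closedBall _
    rw [circFun_apply, hφ]
    refine (hc _ h1).tendsto.comp (tendsto_nhdsWithin_iff.2 ⟨?_, ?_⟩)
    · have : Tendsto (fun r : ℝ => (r * cay ξ : ℂ)) (𝓝 1) (𝓝 ((1 : ℝ) * cay ξ)) :=
        ((Complex.continuous_ofReal.mul continuous_const).tendsto 1)
      rw [ofReal_one, one_mul] at this
      exact this.mono_left nhdsWithin_le_nhds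
    · filter_upwards [Ioo_mem_nhdsLT (zero_lt_one' ℝ)] with r hr
      exact Metric.ball_subset_closedBall (smul_mem_ball hr.1 hr.2 _)

namespace IsCircleFactorization

variable {φ : Circle → ℂ} {φp φm : ℂ → ℂ}

lemma continuousOn (h : IsCircleFactorization φ φp φm) :
    ContinuousOn φp (Metric.closedBall 0 1) := by
  have hc := h.analytic.continuousOn
  rwa [closure_ball _ one_ne_zero] at hc

lemma coe_ne_zero (h : IsCircleFactorization φ φp φm) (z : Circle) : φp z ≠ 0 :=
  h.ne_zero z (coe_mem_closedBall z)

lemma continuous_coe (h : IsCircleFactorization φ φp φm) :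
    Continuous fun z : Circle => φp z :=
  h.continuousOn.comp_continuous continuous_subtype_val coe_mem_closedBall

/-- The plus factor on the circle. -/
def plus (h : IsCircleFactorization φ φp φm) : C(Circle, ℂ) := ⟨fun z => φp z, h.continuous_coe⟩

/-- The inverse of the plus factor on the circle. -/
def plusInv (h : IsCircleFactorization φ φp φm) : C(Circle, ℂ) :=
  ⟨fun z => (φp z)⁻¹, h.continuous_coe.inv₀ h.coe_ne_zero⟩

/-- The minus factor on the circle. -/
def minus (h : IsCircleFactorization φ φp φm) : C(Circle, ℂ) :=
  h.plus.comp ⟨fun z => z⁻¹, continuous_inv⟩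

/-- The inverse of the minus factor on the circle. -/
def minusInv (h : IsCircleFactorization φ φp φm) : C(Circle, ℂ) :=
  h.plusInv.comp ⟨fun z => z⁻¹, continuous_inv⟩

lemma minus_apply (h : IsCircleFactorization φ φp φm) (z : Circle) : h.minus z = φm z := by
  rw [h.symm z (Circle.norm_coe z).ge, ← Circle.coe_inv]
  rfl

lemma symbol_eq (h : IsCircleFactorization φ φp φm) : φ = (h.plus * h.minus : C(Circle, ℂ)) := by
  funext z
  rw [h.mul_eq, ContinuousMap.mul_apply, minus_apply]
  rfl

lemma symbol_inv_eq (h : IsCircleFactorization φ φp φm) :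
    φ⁻¹ = (h.plusInv * h.minusInv : C(Circle, ℂ)) := by
  funext z
  refine (congrArg Inv.inv (congrFun h.symbol_eq z)).trans ?_
  rw [ContinuousMap.mul_apply, ContinuousMap.mul_apply, mul_inv]
  rfl

lemma ratio_eq (h : IsCircleFactorization φ φp φm) :
    (fun z : Circle => φm z / φp z) = (h.minus * h.plusInv : C(Circle, ℂ)) := by
  funext z
  rw [ContinuousMap.mul_apply, minus_apply, div_eq_mul_inv]
  rfl

lemma isDiscPlus_plus (h : IsCircleFactorization φ φp φm) : IsDiscPlus (circFun h.plus) φp :=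
  isDiscPlus_circFun h.analytic fun _ => rfl

lemma isDiscPlus_plusInv (h : IsCircleFactorization φ φp φm) :
    IsDiscPlus (circFun h.plusInv) (φp⁻¹) :=
  isDiscPlus_circFun (h.analytic.inv fun z hz => h.ne_zero z (by
    rwa [closure_ball _ one_ne_zero] at hz)) fun _ => rfl

lemma plus_mul_plusInv (h : IsCircleFactorization φ φp φm) : h.plus * h.plusInv = 1 := by
  ext z
  exact mul_inv_cancel₀ (h.coe_ne_zero z)

lemma hardyFactor (h : IsCircleFactorization φ φp φm) :
    HardyFactor circIncl circProj reflOp (mulOp (circFun h.plus)) (mulOp (circFun h.minus))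
      (mulOp (circFun h.plusInv)) (mulOp (circFun h.minusInv)) where
  setup := circSetup
  refl_p := by rw [reflOp_mulOp, reflFun_circFun]; rfl
  refl_q := by rw [reflOp_mulOp, reflFun_circFun]; rfl
  mul_inv := by rw [← mulOp_mul, ← circFun_mul, h.plus_mul_plusInv, circFun_one, mulOp_one]
  inv_mul := by
    rw [← mulOp_mul, ← circFun_mul, mul_comm, h.plus_mul_plusInv, circFun_one, mulOp_one]
  comm := by rw [← mulOp_mul, ← mulOp_mul, mul_comm]
  hank_p := by
    have := h.isDiscPlus_plus.hank_eq_zero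
    rwa [reflFun_circFun] at this
  hank_q := by
    have := h.isDiscPlus_plusInv.hank_eq_zero
    rwa [reflFun_circFun] at this

lemma isBoundedMatrix_toeplitz (h : IsCircleFactorization φ φp φm) :
    IsBoundedMatrix (toeplitzMatrix φ) := by
  rw [h.symbol_eq]
  exact ⟨_, hasMatrix_toep _⟩

lemma isBoundedMatrix_toeplitz_inv (h : IsCircleFactorization φ φp φm) :
    IsBoundedMatrix (toeplitzMatrix φ⁻¹) := by
  rw [h.symbol_inv_eq]
  exact ⟨_, hasMatrix_toep _⟩

lemma isBoundedMatrix_hankel (h : IsCircleFactorization φ φp φm) :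
    IsBoundedMatrix (hankelMatrix φ) := by
  rw [h.symbol_eq]
  exact ⟨_, hasMatrix_hank _⟩

lemma isBoundedMatrix_ratio (h : IsCircleFactorization φ φp φm) :
    IsBoundedMatrix (hankelMatrix fun z => φm z / φp z) := by
  rw [h.ratio_eq]
  exact ⟨_, hasMatrix_hank _⟩

lemma T_eq (h : IsCircleFactorization φ φp φm) :
    T φ = toep circIncl circProj (mulOp (circFun h.plus) * mulOp (circFun h.minus)) := by
  rw [← mulOp_mul, ← circFun_mul, ← BorodinOkounkov.T_eq, ← h.symbol_eq]

lemma H_eq (h : IsCircleFactorization φ φp φm) :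
    H φ = hank circIncl circProj reflOp (mulOp (circFun h.plus) * mulOp (circFun h.minus)) := by
  rw [← mulOp_mul, ← circFun_mul, ← BorodinOkounkov.H_eq, ← h.symbol_eq]

lemma T_inv_eq (h : IsCircleFactorization φ φp φm) :
    T φ⁻¹ = toep circIncl circProj (mulOp (circFun h.plusInv) * mulOp (circFun h.minusInv)) := by
  rw [← mulOp_mul, ← circFun_mul, ← BorodinOkounkov.T_eq, ← h.symbol_inv_eq]

lemma H_ratio_eq (h : IsCircleFactorization φ φp φm) :
    H (fun z => φm z / φp z) =
      hank circIncl circProj reflOp (mulOp (circFun h.minus) * mulOp (circFun h.plusInv)) := by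
  rw [← mulOp_mul, ← circFun_mul, ← BorodinOkounkov.H_eq, ← h.ratio_eq]

lemma product_eq (h : IsCircleFactorization φ φp φm) : T φ⁻¹ * (T φ + H φ) =
    toep circIncl circProj (mulOp (circFun h.plusInv) * mulOp (circFun h.minusInv)) *
      HardyFactor.sumOp circIncl circProj reflOp
        (mulOp (circFun h.plus) * mulOp (circFun h.minus)) := by
  rw [HardyFactor.sumOp, ← h.T_eq, ← h.H_eq, ← h.T_inv_eq]

lemma inner_plus (h : IsCircleFactorization φ φp φm) {j k : ℕ} (hjk : j < k) :
    ⟪stdVec j, toep circIncl circProj (mulOp (circFun h.plus)) (stdVec k)⟫_ℂ = 0 := by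
  rw [inner_toep]
  exact h.isDiscPlus_plus.inner_eq_zero (by exact_mod_cast hjk)

lemma inner_plus_self (h : IsCircleFactorization φ φp φm) (k : ℕ) :
    ⟪stdVec k, toep circIncl circProj (mulOp (circFun h.plus)) (stdVec k)⟫_ℂ = φp 0 := by
  rw [inner_toep]
  exact h.isDiscPlus_plus.inner_self _

lemma inner_minus (h : IsCircleFactorization φ φp φm) {j k : ℕ} (hjk : k < j) :
    ⟪stdVec j, toep circIncl circProj (mulOp (circFun h.minus)) (stdVec k)⟫_ℂ = 0 := by
  rw [inner_toep, minus, ← reflFun_circFun, inner_mobVec_reflFun]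
  exact h.isDiscPlus_plus.inner_eq_zero (by omega)

lemma inner_minus_self (h : IsCircleFactorization φ φp φm) (k : ℕ) :
    ⟪stdVec k, toep circIncl circProj (mulOp (circFun h.minus)) (stdVec k)⟫_ℂ = φp 0 := by
  rw [inner_toep, minus, ← reflFun_circFun, inner_mobVec_reflFun]
  exact h.isDiscPlus_plus.inner_self _

/-- The finite section of the plus factor is a triangular matrix whose diagonal entries are all the
value at the origin. -/
lemma det_plus (h : IsCircleFactorization φ φp φm) (n : ℕ) :
    LinearMap.det ((finProj n ∘L toep circIncl circProj (mulOp (circFun h.plus)) ∘L finIncl n :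
      EuclideanSpace ℂ (Fin n) →L[ℂ] _) :
      EuclideanSpace ℂ (Fin n) →ₗ[ℂ] EuclideanSpace ℂ (Fin n)) = φp 0 ^ n := by
  rw [det_compress, Matrix.det_of_lowerTriangular]
  · simp [inner_plus_self]
  · intro j k hjk
    exact h.inner_plus hjk

lemma det_minus (h : IsCircleFactorization φ φp φm) (n : ℕ) :
    LinearMap.det ((finProj n ∘L toep circIncl circProj (mulOp (circFun h.minus)) ∘L finIncl n :
      EuclideanSpace ℂ (Fin n) →L[ℂ] _) :
      EuclideanSpace ℂ (Fin n) →ₗ[ℂ] EuclideanSpace ℂ (Fin n)) = φp 0 ^ n := by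
  rw [det_compress, Matrix.det_of_upperTriangular]
  · simp [inner_minus_self]
  · intro j k hjk
    exact h.inner_minus hjk

/-- In finite dimension the determinants of the two triangular outer factors can be taken
separately. Each contributes `φp 0 ^ n`, and the general compression theorem supplies the middle
factor. -/
theorem det_finiteTH (h : IsCircleFactorization φ φp φm) (ht : TC (H φ)) (n : ℕ) :
    TC (H fun z => φm z / φp z) ∧
    (finiteTH φ n).det = (φp 0 ^ 2) ^ n * fredholmDet (T φ⁻¹ * (T φ + H φ)) *
      fredholmDet (1 + Q n * H (fun z => φm z / φp z) * Q n) := by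
  rw [h.H_eq] at ht
  -- Multiplication by the plus factor does not lower the index, so vectors of index at least `n` do
  -- not reach the first `n` coordinates.
  have hs : finProj n ∘L toep circIncl circProj (mulOp (circFun h.plus)) =
      finProj n ∘L toep circIncl circProj (mulOp (circFun h.plus)) ∘L finIncl n ∘L finProj n := by
    refine ext_stdVec fun k => ?_
    simp only [ContinuousLinearMap.comp_apply]
    rcases lt_or_ge k n with hk | hk
    · rw [finIncl_finProj_stdVec hk]
    · rw [finProj_stdVec_of_le hk, map_zero, map_zero, map_zero]
      ext j
      rw [finProj_apply, h.inner_plus (by omega)]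
      rfl
  have hj : toep circIncl circProj (mulOp (circFun h.minus)) ∘L finIncl n =
      finIncl n ∘L finProj n ∘L toep circIncl circProj (mulOp (circFun h.minus)) ∘L
        finIncl n := by
    refine ext_single fun k => ?_
    simp only [ContinuousLinearMap.comp_apply, finIncl_single]
    refine eq_of_inner_stdVec fun j => ?_
    rcases lt_or_ge j n with hj | hj
    · rw [inner_finIncl_finProj, if_pos hj]
    · rw [h.inner_minus (by omega), inner_finIncl_finProj, if_neg (by omega)]
  obtain ⟨h1, h2, h3⟩ := h.hardyFactor.compression_det ht (finProj_finIncl n) hs hj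
  refine ⟨by rwa [h.H_ratio_eq], ?_⟩
  have h4 : (finiteTH φ n).det = LinearMap.det ((finProj n ∘L
      HardyFactor.sumOp circIncl circProj reflOp
        (mulOp (circFun h.plus) * mulOp (circFun h.minus)) ∘L finIncl n :
      EuclideanSpace ℂ (Fin n) →L[ℂ] _) :
      EuclideanSpace ℂ (Fin n) →ₗ[ℂ] EuclideanSpace ℂ (Fin n)) := by
    rw [det_compress, finiteTH, HardyFactor.sumOp, ← mulOp_mul, ← circFun_mul]
    congr 1
    ext j k
    simp only [Matrix.of_apply, ContinuousLinearMap.add_apply, inner_add_right]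
    rw [hasMatrix_toep, hasMatrix_hank, ← h.symbol_eq]
  rw [h4, h2, ContinuousLinearMap.mul_def, ContinuousLinearMap.mul_def]
  rw [det_comp_clm, det_comp_clm, h.det_plus, h.det_minus, ← fredholmDet_eq_det, h3, ← h.product_eq,
    ← h.H_ratio_eq, one_sub_finIncl_finProj]
  ring

end IsCircleFactorization

end CircleFactor

/-! ### Decay of Fourier coefficients and trace class Hankel matrices. -/

section CoeffDecay

/-- The `k`-th Fourier coefficient of a function on `[0, 2π]`. -/
def angleCoeff (g : ℝ → ℂ) (k : ℤ) : ℂ := fourierCoeffOn Real.two_pi_pos g k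

lemma coeff_eq_angleCoeff (φ : Circle → ℂ) (k : ℤ) :
    coeff φ k = angleCoeff (fun θ => φ (Circle.exp θ)) k := by
  rw [angleCoeff, fourierCoeffOn_eq_integral, coeff, sub_zero, Complex.real_smul]
  congr 1
  · push_cast
    rfl
  · refine intervalIntegral.integral_congr fun θ _ => ?_
    rw [fourier_coe_apply, smul_eq_mul, mul_comm]
    congr 2
    have : (Real.pi : ℂ) ≠ 0 := ofReal_ne_zero.2 Real.pi_ne_zero
    push_cast
    field_simp

/-- Integration by parts; periodicity removes the boundary term, and `k = 0` is trivial. -/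
lemma norm_angleCoeff_deriv {g : ℝ → ℂ} (hg : ContDiff ℝ 1 g)
    (hp : Function.Periodic g (2 * Real.pi)) (k : ℤ) :
    |(k : ℝ)| * ‖angleCoeff g k‖ ≤ ‖angleCoeff (deriv g) k‖ := by
  rcases eq_or_ne k 0 with rfl | hk
  · simp
  have h1 := fourierCoeffOn_of_hasDerivAt Real.two_pi_pos hk
    (fun x _ => (hg.differentiable one_ne_zero x).hasDerivAt)
    ((hg.continuous_deriv le_rfl).intervalIntegrable _ _)
  have h2 : g (2 * Real.pi) = g 0 := by simpa using hp 0
  have hk' : (k : ℂ) ≠ 0 := Int.cast_ne_zero.2 hk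
  have h3 : angleCoeff g k = (I * k)⁻¹ * angleCoeff (deriv g) k := by
    rw [angleCoeff, angleCoeff, h1, h2]
    have : (Real.pi : ℂ) ≠ 0 := ofReal_ne_zero.2 Real.pi_ne_zero
    have hI := I_ne_zero
    push_cast
    field_simp
    ring
  rw [h3, norm_mul, norm_inv, norm_mul, norm_I, one_mul, Complex.norm_intCast, ← mul_assoc,
    mul_inv_cancel₀ (abs_ne_zero.2 (Int.cast_ne_zero.2 hk)), one_mul]

lemma summable_sq_angleCoeff {g : ℝ → ℂ} (hg : Continuous g) :
    Summable fun k : ℤ => ‖angleCoeff g k‖ ^ 2 := by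
  refine (hasSum_sq_fourierCoeffOn Real.two_pi_pos ?_).summable
  rw [memLp_two_iff_integrable_sq_norm hg.aestronglyMeasurable]
  exact ((hg.norm.pow 2).integrableOn_Icc).mono_set Ioc_subset_Icc_self

/-- Two integrations by parts bound the term by `|c_k| / |k|`, where the `c_k` are the square
summable coefficients of the second derivative. The arithmetic–geometric mean inequality finishes.
-/
lemma summable_abs_mul_coeff {φ : Circle → ℂ}
    (h : ContDiff ℝ 2 fun θ : ℝ => φ (Circle.exp θ)) :
    Summable fun k : ℤ => |(k : ℝ)| * ‖coeff φ k‖ := by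
  set g : ℝ → ℂ := fun θ => φ (Circle.exp θ) with hg
  have hp : Function.Periodic g (2 * Real.pi) := fun θ => by
    simp only [hg, Circle.exp_add, Circle.exp_two_pi, mul_one]
  have hp' : Function.Periodic (deriv g) (2 * Real.pi) := fun θ => by
    rw [← deriv_comp_add_const]
    congr 1
    exact funext hp
  have hd : ContDiff ℝ 1 (deriv g) := by
    have h2 : ContDiff ℝ (1 + 1) g := by
      rw [one_add_one_eq_two]
      exact h
    exact (contDiff_succ_iff_deriv.1 h2).2.2
  have hs := summable_sq_angleCoeff (hd.continuous_deriv le_rfl)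
  have hz : Summable fun k : ℤ => 1 / |(k : ℝ)| ^ 2 := by
    simpa using Real.summable_one_div_int_pow.2 one_lt_two
  refine Summable.of_nonneg_of_le (fun k => by positivity) (fun k => ?_) ((hs.add hz).div_const 2)
  rw [coeff_eq_angleCoeff, ← hg]
  rcases eq_or_ne k 0 with rfl | hk
  · simp
    positivity
  have hk' : 0 < |(k : ℝ)| := abs_pos.2 (Int.cast_ne_zero.2 hk)
  have e1 := norm_angleCoeff_deriv (h.of_le one_le_two) hp k
  have e2 := norm_angleCoeff_deriv hd hp' k
  set x := ‖angleCoeff (deriv (deriv g)) k‖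
  set y := ‖angleCoeff (deriv g) k‖
  have e3 : y ≤ x * (1 / |(k : ℝ)|) := by
    rw [mul_one_div, le_div_iff₀ hk', mul_comm]
    exact e2
  have e4 : (1 / |(k : ℝ)|) ^ 2 = 1 / |(k : ℝ)| ^ 2 := by rw [div_pow, one_pow]
  rw [← e4]
  nlinarith [sq_nonneg (x - 1 / |(k : ℝ)|)]

lemma summable_norm_coeff {φ : Circle → ℂ}
    (h : ContDiff ℝ 2 fun θ : ℝ => φ (Circle.exp θ)) :
    Summable fun k : ℤ => ‖coeff φ k‖ := by
  refine ((summable_abs_mul_coeff h).add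
    (summable_of_finite_support (f := fun k : ℤ => if k = 0 then ‖coeff φ 0‖ else 0) ?_)).of_nonneg_of_le
    (fun k => norm_nonneg _) (fun k => ?_)
  · refine (Set.finite_singleton (0 : ℤ)).subset fun k hk => ?_
    by_contra h0
    exact hk (if_neg h0)
  · split_ifs with hk
    · rw [hk]
      simp
    · rw [add_zero]
      refine le_mul_of_one_le_left (norm_nonneg _) ?_
      exact_mod_cast Int.one_le_abs hk

/-- The antidiagonal of total `n` has `n + 1` elements, which accounts for the weight. -/
lemma summable_antidiagonal {f : ℕ → ℝ} (h0 : ∀ n, 0 ≤ f n)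
    (hf : Summable fun n : ℕ => ((n : ℝ) + 1) * f n) :
    Summable fun p : ℕ × ℕ => f (p.1 + p.2) := by
  rw [← Finset.HasAntidiagonal.sigmaAntidiagonalEquivProd.summable_iff]
  refine (summable_sigma_of_nonneg fun _ => h0 _).2 ⟨fun n => Summable.of_finite, ?_⟩
  refine hf.congr fun n => ?_
  rw [tsum_fintype]
  have : ∀ c : Finset.HasAntidiagonal.antidiagonal n, ((fun p : ℕ × ℕ => f (p.1 + p.2)) ∘
      Finset.HasAntidiagonal.sigmaAntidiagonalEquivProd) ⟨n, c⟩ = f n := by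
    rintro ⟨c, hc⟩
    simp only [Function.comp, Finset.HasAntidiagonal.sigmaAntidiagonalEquivProd_apply]
    rw [Finset.HasAntidiagonal.mem_antidiagonal.1 hc]
  refine Eq.trans ?_ (Finset.sum_congr rfl fun c _ => (this c).symm)
  simp

lemma summable_hankel {φ : Circle → ℂ}
    (h : ContDiff ℝ 2 fun θ : ℝ => φ (Circle.exp θ)) :
    Summable fun p : ℕ × ℕ => ‖hankelMatrix φ p.1 p.2‖ := by
  have h1 := (summable_abs_mul_coeff h).comp_injective
    (i := fun n : ℕ => (n : ℤ) + 1) fun a b hab => by simpa using hab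
  have := summable_antidiagonal (f := fun n => ‖coeff φ ((n : ℤ) + 1)‖) (fun n => norm_nonneg _)
    (h1.congr fun n => by
      simp only [Function.comp]
      rw [abs_of_nonneg (by positivity)]
      push_cast
      rfl)
  refine this.congr fun p => ?_
  rw [hankelMatrix]
  push_cast
  rfl

/-- Expand `A x` in the standard basis: the left vectors are the rows `A* e_j`, with norm at most
the sum of the moduli of their entries. -/
lemma tc_of_summable_matrix {A : Ell2 →L[ℂ] Ell2} {a : ℕ → ℕ → ℂ} (hA : HasMatrix A a)
    (hs : Summable fun p : ℕ × ℕ => ‖a p.1 p.2‖) : TC A := by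
  rw [← isTraceClass_iff_tc]
  refine ⟨fun j => ContinuousLinearMap.adjoint A (stdVec j), stdVec, ?_, fun x => ?_⟩
  · refine hs.prod.of_nonneg_of_le (fun j => by positivity) fun j => ?_
    have hv : ∀ j, ‖stdVec j‖ = 1 := fun j => by
      rw [← stdBasis_apply]
      exact stdBasis.orthonormal.1 j
    rw [hv, mul_one]
    refine (stdBasis.hasSum_repr (ContinuousLinearMap.adjoint A (stdVec j))).norm_le_of_bounded
      (hs.prod_factor j).hasSum fun k => ?_
    rw [stdBasis.repr_apply_apply, norm_smul, stdBasis_apply, hv, mul_one,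
      ContinuousLinearMap.adjoint_inner_right, ← hA j k, norm_inner_symm]
  · have := stdBasis.hasSum_repr (A x)
    simp only [stdBasis.repr_apply_apply, stdBasis_apply] at this
    simpa only [ContinuousLinearMap.adjoint_inner_left] using this

lemma tc_H {φ : C(Circle, ℂ)} (h : ContDiff ℝ 2 fun θ : ℝ => φ (Circle.exp θ)) : TC (H φ) := by
  rw [H_eq]
  exact tc_of_summable_matrix (hasMatrix_hank φ) (summable_hankel h)

end CoeffDecay

/-! ### The canonical factorization on the circle and the constant `G`. -/

section CircleLog

lemma coeff_neg {φ : Circle → ℂ} (h : ∀ z, φ z⁻¹ = φ z) (k : ℤ) : coeff φ (-k) = coeff φ k := by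
  rw [coeff_eq_integral, coeff_eq_integral]
  congr 1
  rw [← integral_neg_eq_self]
  refine integral_congr_ae (Eventually.of_forall fun ξ => ?_)
  simp only [cay_neg, h, neg_neg]
  congr 1
  · simp [cayDensity]
  · rw [Circle.coe_inv, inv_zpow, zpow_neg]

lemma hasSum_coeff {b : Circle → ℂ} (h : ContDiff ℝ 2 fun θ : ℝ => b (Circle.exp θ)) (z : Circle) :
    HasSum (fun k : ℤ => coeff b k * (z : ℂ) ^ k) (b z) := by
  have : Fact (0 < 2 * Real.pi) := ⟨Real.two_pi_pos⟩
  have hp : Function.Periodic (fun θ : ℝ => b (Circle.exp θ)) (2 * Real.pi) := fun θ => by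
    simp only [Circle.exp_add, Circle.exp_two_pi, mul_one]
  set f : C(AddCircle (2 * Real.pi), ℂ) := ⟨hp.lift, continuous_quot_lift _ h.continuous⟩ with hf
  have hc : ∀ k, fourierCoeff f k = coeff b k := by
    intro k
    rw [coeff_eq_angleCoeff, angleCoeff, fourierCoeff_eq_intervalIntegral f k 0,
      fourierCoeffOn_eq_integral, sub_zero, zero_add]
    rfl
  have hs : Summable (fourierCoeff f) := by
    have := (summable_norm_coeff h).of_norm
    exact this.congr fun k => (hc k).symm
  have h1 := has_pointwise_sum_fourier_series_of_summable hs
    ((Complex.arg z : ℝ) : AddCircle (2 * Real.pi))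
  have h2 : f ((Complex.arg z : ℝ) : AddCircle (2 * Real.pi)) = b z := by
    change b (Circle.exp (Complex.arg z)) = b z
    rw [Circle.exp_arg]
  rw [h2] at h1
  refine h1.congr_fun fun k => ?_
  rw [hc, fourier_coe_apply, smul_eq_mul]
  congr 1
  conv_lhs => rw [← Circle.exp_arg z]
  rw [Circle.coe_exp, ← Complex.exp_int_mul]
  congr 1
  have : (Real.pi : ℂ) ≠ 0 := ofReal_ne_zero.2 Real.pi_ne_zero
  push_cast
  field_simp

/-- The analytic part of `b` in the disc. -/
def discPlus (b : Circle → ℂ) (z : ℂ) : ℂ :=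
  coeff b 0 / 2 + ∑' k : ℕ, coeff b (k + 1) * z ^ (k + 1)

lemma discPlus_zero (b : Circle → ℂ) : discPlus b 0 = coeff b 0 / 2 := by
  simp [discPlus]

lemma norm_discPlus_term_le (b : Circle → ℂ) (k : ℕ) {z : ℂ} (hz : ‖z‖ ≤ 1) :
    ‖coeff b (k + 1) * z ^ (k + 1)‖ ≤ ‖coeff b (k + 1)‖ := by
  rw [norm_mul, norm_pow]
  exact mul_le_of_le_one_right (norm_nonneg _) (pow_le_one₀ (norm_nonneg _) hz)

lemma summable_coeff_succ {b : Circle → ℂ} (h : ContDiff ℝ 2 fun θ : ℝ => b (Circle.exp θ)) :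
    Summable fun k : ℕ => ‖coeff b (k + 1)‖ :=
  (summable_norm_coeff h).comp_injective (i := fun n : ℕ => (n : ℤ) + 1)
    fun a b hab => by simpa using hab

lemma diffContOnCl_discPlus {b : Circle → ℂ} (h : ContDiff ℝ 2 fun θ : ℝ => b (Circle.exp θ)) :
    DiffContOnCl ℂ (discPlus b) (Metric.ball 0 1) := by
  refine ⟨(differentiableOn_const _).add (differentiableOn_tsum_of_summable_norm
    (summable_coeff_succ h) (fun k => by fun_prop) Metric.isOpen_ball fun k z hz =>
      norm_discPlus_term_le b k (mem_ball_zero_iff.1 hz).le), ?_⟩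
  rw [closure_ball _ one_ne_zero]
  exact continuousOn_const.add (continuousOn_tsum (fun k => by fun_prop) (summable_coeff_succ h)
    fun k z hz => norm_discPlus_term_le b k (mem_closedBall_zero_iff.1 hz))

/-- For an even function the coefficients of `zᵏ` and `z⁻ᵏ` agree, so the Fourier series splits
symmetrically; the constant term is shared equally, whence the halved coefficient in `discPlus`. -/
lemma discPlus_add {b : Circle → ℂ} (h : ContDiff ℝ 2 fun θ : ℝ => b (Circle.exp θ))
    (he : ∀ z, b z⁻¹ = b z) (z : Circle) :
    discPlus b z + discPlus b (z : ℂ)⁻¹ = b z := by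
  have hs : ∀ w : ℂ, ‖w‖ ≤ 1 → Summable fun k : ℕ => coeff b (k + 1) * w ^ (k + 1) := fun w hw =>
    Summable.of_norm_bounded (summable_coeff_succ h) fun k => norm_discPlus_term_le b k hw
  have h1 := (hs z (Circle.norm_coe z).le).hasSum
  have h2 := (hs (z : ℂ)⁻¹ (by rw [norm_inv, Circle.norm_coe, inv_one])).hasSum
  have h3 : HasSum (fun k : ℤ => coeff b k * (z : ℂ) ^ k)
      ((∑' k : ℕ, coeff b (k + 1) * (z : ℂ) ^ (k + 1)) + coeff b 0 * (z : ℂ) ^ (0 : ℤ) +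
        ∑' k : ℕ, coeff b (k + 1) * (z : ℂ)⁻¹ ^ (k + 1)) := by
    refine HasSum.of_add_one_of_neg_add_one (f := fun k : ℤ => coeff b k * (z : ℂ) ^ k)
      (h1.congr_fun fun k => ?_) (h2.congr_fun fun k => ?_)
    · rw [← zpow_natCast]
      push_cast
      rfl
    · rw [coeff_neg he, zpow_neg, inv_pow, ← zpow_natCast]
      push_cast
      rfl
  rw [(hasSum_coeff h z).unique h3, discPlus, discPlus, zpow_zero]
  ring

lemma IsCircleSymbol.even_log {φ b : Circle → ℂ} (h : IsCircleSymbol φ b) (z : Circle) :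
    b z⁻¹ = b z := by
  have hc := h.smooth.continuous
  have h1 := eq_zero_of_exp_eq_one (d := fun θ => b (Circle.exp (-θ)) - b (Circle.exp θ))
    ((hc.comp continuous_neg).sub hc) (fun θ => by
      rw [Complex.exp_sub, ← h.exp_eq, ← h.exp_eq, Circle.exp_neg, h.even, div_self]
      rw [h.exp_eq]
      exact Complex.exp_ne_zero _) (by simp) (Complex.arg z)
  rwa [Circle.exp_neg, Circle.exp_arg, sub_eq_zero] at h1

lemma IsCircleSymbol.isCircleFactorization {φ b : Circle → ℂ} (h : IsCircleSymbol φ b) :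
    IsCircleFactorization φ (fun z => Complex.exp (discPlus b z))
      (fun z => Complex.exp (discPlus b z⁻¹)) where
  analytic := ⟨(diffContOnCl_discPlus h.smooth).1.cexp, (diffContOnCl_discPlus h.smooth).2.cexp⟩
  ne_zero z _ := Complex.exp_ne_zero _
  symm z _ := rfl
  mul_eq z := by rw [← Complex.exp_add, discPlus_add h.smooth h.even_log, h.exp_eq]

lemma IsCircleSymbol.contDiff {φ b : Circle → ℂ} (h : IsCircleSymbol φ b) :
    ContDiff ℝ 2 fun θ : ℝ => φ (Circle.exp θ) := by
  simp only [h.exp_eq]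
  exact h.smooth.cexp

lemma exp_discPlus_zero_sq (b : Circle → ℂ) : Complex.exp (discPlus b 0) ^ 2 = circleG b := by
  rw [← Complex.exp_nat_mul, discPlus_zero, circleG, coeff]
  congr 1
  simp only [Int.cast_zero, mul_zero, zero_mul, Complex.exp_zero, mul_one]
  push_cast
  ring

/-- The quotient of two plus factors is analytic, and its reflection, being the inverse quotient, is
analytic too, so the quotient is constant. At the point `1`, fixed by inversion, the constant equals
its own inverse. It is thus a sign, which the square does not see. -/
lemma IsCircleFactorization.sq_eq {φ : Circle → ℂ} {φp φm ψp ψm : ℂ → ℂ}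
    (h : IsCircleFactorization φ φp φm) (h0 : IsCircleFactorization φ ψp ψm) :
    φp 0 ^ 2 = ψp 0 ^ 2 := by
  have hb : ∀ z ∈ closure (Metric.ball (0 : ℂ) 1), z ∈ Metric.closedBall (0 : ℂ) 1 := fun z hz => by
    rwa [closure_ball _ one_ne_zero] at hz
  have d1 : IsDiscPlus (circFun (h.plus * h0.plusInv)) (φp • ψp⁻¹) :=
    isDiscPlus_circFun (h.analytic.smul (h0.analytic.inv fun z hz => h0.ne_zero z (hb z hz)))
      fun _ => rfl
  have d2 : IsDiscPlus (circFun (h0.plus * h.plusInv)) (ψp • φp⁻¹) :=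
    isDiscPlus_circFun (h0.analytic.smul (h.analytic.inv fun z hz => h.ne_zero z (hb z hz)))
      fun _ => rfl
  have e : reflFun (circFun (h.plus * h0.plusInv)) = circFun (h0.plus * h.plusInv) := by
    rw [reflFun_circFun]
    congr 1
    ext z
    have e1 : h.plus z * h.minus z = h0.plus z * h0.minus z := by
      rw [← ContinuousMap.mul_apply, ← ContinuousMap.mul_apply, ← h.symbol_eq, ← h0.symbol_eq]
    change h.minus z * (h0.minus z)⁻¹ = h0.plus z * (h.plus z)⁻¹
    have n1 : h.plus z ≠ 0 := h.coe_ne_zero z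
    have n2 : h0.minus z ≠ 0 := h0.coe_ne_zero z⁻¹
    field_simp
    linear_combination e1
  rw [← e] at d2
  have e1 := d1.eq_const d2 0
  have e2 := congrArg (fun a => a (0 : ℝ)) e
  simp only [reflFun_apply, neg_zero, e1] at e2
  change φp 0 * (ψp 0)⁻¹ = ψp (cay 0) * (φp (cay 0))⁻¹ at e2
  change φp (cay 0) * (ψp (cay 0))⁻¹ = φp 0 * (ψp 0)⁻¹ at e1
  have n1 := h.coe_ne_zero (cay 0)
  have n2 := h0.coe_ne_zero (cay 0)
  have n3 := h0.ne_zero 0 (by simp)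
  have e3 : (φp 0 * (ψp 0)⁻¹) * (φp 0 * (ψp 0)⁻¹) = 1 := by
    nth_rewrite 1 [← e1]
    rw [e2]
    field_simp
  field_simp at e3
  exact e3

theorem IsCircleSymbol.det_finiteTH {φ b : Circle → ℂ} (hs : IsCircleSymbol φ b)
    {φp φm : ℂ → ℂ} (h : IsCircleFactorization φ φp φm) (n : ℕ) :
    TC (H fun z => φm z / φp z) ∧
    (finiteTH φ n).det = circleG b ^ n * fredholmDet (T φ⁻¹ * (T φ + H φ)) *
      fredholmDet (1 + Q n * H (fun z => φm z / φp z) * Q n) := by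
  have ht : TC (H φ) := by
    have hd := hs.contDiff
    rw [h.symbol_eq] at hd ⊢
    exact tc_H hd
  rw [← exp_discPlus_zero_sq, ← h.sq_eq hs.isCircleFactorization]
  exact h.det_finiteTH ht n

lemma IsCircleSymbol.tc_first {φ b : Circle → ℂ} (hs : IsCircleSymbol φ b) :
    TC (T φ⁻¹ * (T φ + H φ) - 1) := by
  have h := hs.isCircleFactorization
  have ht : TC (H φ) := by
    have hd := hs.contDiff
    rw [h.symbol_eq] at hd ⊢
    exact tc_H hd
  rw [h.product_eq]
  refine h.hardyFactor.tc_first ?_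
  rwa [← h.H_eq]

end CircleLog

/-! ### Uniqueness of the factorization on the line up to a constant. -/

section LineUniqueness

open scoped BoundedContinuousFunction

/-- The inverse of the Cayley transform. -/
def cayInv (z : ℂ) : ℂ := I * (1 - z) / (1 + z)

lemma one_add_ne_zero {z : ℂ} (hz : z ∈ Metric.ball (0 : ℂ) 1) : 1 + z ≠ 0 := by
  intro h
  have : z = -1 := by linear_combination h
  rw [this, mem_ball_zero_iff, norm_neg, norm_one] at hz
  exact lt_irrefl _ hz

lemma cayInv_im_pos {z : ℂ} (hz : z ∈ Metric.ball (0 : ℂ) 1) : 0 < (cayInv z).im := by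
  have h0 : 0 < Complex.normSq (1 + z) := Complex.normSq_pos.2 (one_add_ne_zero hz)
  have h1 : Complex.normSq z < 1 := by
    rw [Complex.normSq_eq_norm_sq]
    rw [mem_ball_zero_iff] at hz
    exact pow_lt_one₀ (norm_nonneg _) hz two_ne_zero
  have h2 : (cayInv z).im = (1 - Complex.normSq z) / Complex.normSq (1 + z) := by
    rw [cayInv, Complex.div_im, Complex.normSq_apply z]
    simp
    ring
  rw [h2]
  exact div_pos (by linarith) h0

lemma one_add_cay_ne_zero (ξ : ℝ) : 1 + (cay ξ : ℂ) ≠ 0 := by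
  have h0 := one_sub_I_mul_ne_zero (2 * Real.pi * ξ)
  have h1 : 1 + (cay ξ : ℂ) = 2 / (1 - I * (2 * Real.pi * ξ : ℝ)) := by
    rw [cay, coe_cayley]
    field_simp
    ring
  rw [h1]
  exact div_ne_zero two_ne_zero h0

lemma cayInv_cay (ξ : ℝ) : cayInv (cay ξ) = (2 * Real.pi * ξ : ℝ) := by
  have h0 := one_sub_I_mul_ne_zero (2 * Real.pi * ξ)
  rw [cayInv, div_eq_iff (one_add_cay_ne_zero ξ), cay, coe_cayley]
  field_simp
  linear_combination (-2 * ((2 * Real.pi * ξ : ℝ) : ℂ)) * I_sq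

/-- The inverse Cayley transform carries the disc to the upper half-plane and is continuous at every
boundary point `cay ξ`. The point `-1` corresponds to infinity, where no limit is known; this is why
`IsDiscPlus` asks only for boundedness and radial limits. -/
lemma isDiscPlus_halfPlane {g : ℂ → ℂ} (hg : DiffContOnCl ℂ g {ζ : ℂ | 0 < ζ.im})
    (hb : ∃ M, ∀ ζ : ℂ, 0 ≤ ζ.im → ‖g ζ‖ ≤ M) {a : ℝ →ᵇ ℂ}
    (ha : ∀ ξ : ℝ, a ξ = g (2 * Real.pi * ξ : ℝ)) : IsDiscPlus a (g ∘ cayInv) where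
  diff := by
    refine hg.differentiableOn.comp ?_ fun z hz => cayInv_im_pos hz
    exact DifferentiableOn.div (by fun_prop) (by fun_prop) fun z hz => one_add_ne_zero hz
  bounded := by
    obtain ⟨M, hM⟩ := hb
    exact ⟨M, fun z hz => hM _ (cayInv_im_pos hz).le⟩
  tendsto ξ := by
    have hc := hg.continuousOn
    rw [closure_setOfPred_lt_im] at hc
    rw [ha, ← cayInv_cay]
    have h1 : cayInv (cay ξ) ∈ {ζ : ℂ | 0 ≤ ζ.im} := by
      rw [cayInv_cay, mem_setOf_eq, Complex.ofReal_im]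
    refine (hc _ h1).tendsto.comp (tendsto_nhdsWithin_iff.2 ⟨?_, ?_⟩)
    · have h2 : ContinuousAt (fun r : ℝ => cayInv (r * cay ξ)) 1 := by
        refine ContinuousAt.div (by fun_prop) (by fun_prop) ?_
        rw [ofReal_one, one_mul]
        exact one_add_cay_ne_zero ξ
      have h3 := h2.tendsto
      rw [ofReal_one, one_mul] at h3
      exact h3.mono_left nhdsWithin_le_nhds
    · filter_upwards [Ioo_mem_nhdsLT (zero_lt_one' ℝ)] with r hr
      exact (cayInv_im_pos (smul_mem_ball hr.1 hr.2 _)).le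

namespace IsLineFactorization

variable {σ : ℝ → ℂ} {σp σm ψp ψm : ℂ → ℂ}

lemma ne_zero (h : IsLineFactorization σ σp σm) {ζ : ℂ} (hζ : 0 ≤ ζ.im) : σp ζ ≠ 0 := by
  obtain ⟨m, M, hm, hM⟩ := h.bounded
  exact norm_pos_iff.1 (hm.trans_le (hM ζ hζ).1)

lemma diff_div (h : IsLineFactorization σ σp σm) (h0 : IsLineFactorization σ ψp ψm) :
    DiffContOnCl ℂ (σp • ψp⁻¹) {ζ : ℂ | 0 < ζ.im} :=
  h.analytic.smul (h0.analytic.inv fun ζ hζ => h0.ne_zero (by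
    rw [closure_setOfPred_lt_im] at hζ
    exact hζ))

lemma exists_bound_div (h : IsLineFactorization σ σp σm) (h0 : IsLineFactorization σ ψp ψm) :
    ∃ M, ∀ ζ : ℂ, 0 ≤ ζ.im → ‖(σp • ψp⁻¹) ζ‖ ≤ M := by
  obtain ⟨m, M, hm, hM⟩ := h.bounded
  obtain ⟨m', M', hm', hM'⟩ := h0.bounded
  refine ⟨M * m'⁻¹, fun ζ hζ => ?_⟩
  rw [Pi.smul_apply', smul_eq_mul, norm_mul, Pi.inv_apply, norm_inv]
  exact mul_le_mul (hM ζ hζ).2 (inv_anti₀ hm' (hM' ζ hζ).1) (by positivity)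
    ((norm_nonneg _).trans (hM ζ hζ).2)

/-- The quotient of the plus factors of two factorizations on the real line. -/
lemma exists_quotient (h : IsLineFactorization σ σp σm) (h0 : IsLineFactorization σ ψp ψm) :
    ∃ a : ℝ →ᵇ ℂ, ∀ ξ : ℝ, a ξ = (σp • ψp⁻¹) (2 * Real.pi * ξ : ℝ) := by
  obtain ⟨M, hM⟩ := h.exists_bound_div h0
  have hc := (h.diff_div h0).continuousOn
  rw [closure_setOfPred_lt_im] at hc
  refine ⟨BoundedContinuousFunction.ofNormedAddCommGroup
    (fun ξ : ℝ => (σp • ψp⁻¹) (2 * Real.pi * ξ : ℝ)) ?_ M fun ξ => hM _ (by simp), fun ξ => rfl⟩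
  exact hc.comp_continuous (by fun_prop) fun ξ => by simp

/-- As on the circle, the quotient of plus factors and its reflection are both bounded and analytic,
hence constant. The value of the constant does not matter because it cancels in `σ₋/σ₊`. -/
lemma eq_const_mul (h : IsLineFactorization σ σp σm) (h0 : IsLineFactorization σ ψp ψm) :
    ∃ c : ℂ, ∀ x : ℝ, σp x = c * ψp x := by
  obtain ⟨a, ha⟩ := h.exists_quotient h0
  obtain ⟨a', ha'⟩ := h0.exists_quotient h
  have e : reflFun a = a' := by
    ext ξ
    rw [reflFun_apply, ha, ha']
    set x := 2 * Real.pi * ξ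
    have e1 : ((2 * Real.pi * -ξ : ℝ) : ℂ) = -(x : ℂ) := by
      simp only [x]
      push_cast
      ring
    have e2 := (h.mul_eq x).symm.trans (h0.mul_eq x)
    rw [h.symm x (by simp), h0.symm x (by simp)] at e2
    rw [e1]
    change σp (-x) * (ψp (-x))⁻¹ = ψp x * (σp x)⁻¹
    have n1 := h.ne_zero (ζ := x) (by simp)
    have n2 := h0.ne_zero (ζ := -x) (by simp)
    field_simp
    linear_combination e2
  have d1 := isDiscPlus_halfPlane (h.diff_div h0) (h.exists_bound_div h0) ha
  have d2 := isDiscPlus_halfPlane (h0.diff_div h) (h0.exists_bound_div h) ha'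
  rw [← e] at d2
  refine ⟨((σp • ψp⁻¹) ∘ cayInv) 0, fun x => ?_⟩
  have e3 := d1.eq_const d2 (x / (2 * Real.pi))
  rw [ha, mul_div_cancel₀ _ (by positivity)] at e3
  change σp x * (ψp x)⁻¹ = _ at e3
  rw [← e3, mul_assoc, inv_mul_cancel₀ (h0.ne_zero (by simp)), mul_one]

/-- Reduces an arbitrary factorization to the exponential one, for which the determinant identity is
available. -/
lemma ratio_eq {f : ℝ → ℂ} (h : IsLineFactorization σ σp σm) (hs : IsLineSymbol σ f) (ξ : ℝ) :
    σm (2 * Real.pi * ξ : ℝ) / σp (2 * Real.pi * ξ : ℝ) =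
      Complex.exp (hs.isSmoothL1.lineB (-ξ) - hs.isSmoothL1.lineB ξ) := by
  obtain ⟨c, hc⟩ := h.eq_const_mul (hs.isSmoothL1.isLineFactorization hs.even_log hs.exp_eq)
  set x := 2 * Real.pi * ξ with hx
  have e1 : ((2 * Real.pi * -ξ : ℝ) : ℂ) = ((-x : ℝ) : ℂ) := by
    rw [hx, mul_neg]
  have n1 := h.ne_zero (ζ := x) (by simp)
  rw [h.symm x (by simp), ← ofReal_neg, IsSmoothL1.lineB_apply, IsSmoothL1.lineB_apply, e1, ← hx,
    Complex.exp_sub, hc, hc]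
  have n2 : c ≠ 0 := by
    rintro rfl
    rw [hc, zero_mul] at n1
    exact n1 rfl
  rw [mul_div_mul_left _ _ n2]

end IsLineFactorization

end LineUniqueness

/-! ### The two Hardy spaces coincide: comparison of the discrete and continuous operators. -/

section Transfer

open scoped BoundedContinuousFunction

/-- The function `1 / (1 - 2πiξ)`. -/
def poleFun : ℝ →ᵇ ℂ :=
  BoundedContinuousFunction.ofNormedAddCommGroup
    (fun ξ : ℝ => (1 - I * (2 * Real.pi * ξ : ℝ))⁻¹)
    (Continuous.inv₀ (by fun_prop) fun ξ => one_sub_I_mul_ne_zero _) 1 fun ξ => by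
      rw [norm_inv]
      refine inv_le_one_of_one_le₀ ?_
      have := Complex.abs_re_le_norm (1 - I * (2 * Real.pi * ξ : ℝ))
      simpa using this

lemma poleFun_apply (ξ : ℝ) : poleFun ξ = (1 - I * (2 * Real.pi * ξ : ℝ))⁻¹ := rfl

/-- The function is the inverse Fourier transform of `e^(-x)` on `(0,∞)`, by the Laplace integral.
-/
lemma isPlus_poleFun : IsPlus poleFun ((Ioi 0).indicator fun x : ℝ => Complex.exp (-x)) := by
  have hi : Integrable ((Ioi 0).indicator fun x : ℝ => Complex.exp (-x)) := by
    rw [integrable_indicator_iff measurableSet_Ioi]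
    simpa using integrableOn_exp_mul_complex_Ioi (a := -1) (by simp) 0
  refine isPlus_of_fourierInv hi ?_ (fun ξ => ?_) fun x hx => indicator_of_notMem (by
    simpa using hx.le) _
  · rw [memLp_two_iff_integrable_sq_norm hi.1]
    refine hi.norm.mono' (hi.1.norm.pow 2) (Eventually.of_forall fun x => ?_)
    rw [Real.norm_of_nonneg (by positivity), pow_two]
    refine mul_le_of_le_one_left (norm_nonneg _) ?_
    by_cases hx : x ∈ Ioi 0
    · rw [indicator_of_mem hx, Complex.norm_exp]
      simpa using (mem_Ioi.1 hx).le
    · rw [indicator_of_notMem hx, norm_zero]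
      exact zero_le_one
  · have ha : (-(1 - I * (2 * Real.pi * ξ : ℝ)) : ℂ).re < 0 := by simp
    have h1 := integral_exp_mul_complex_Ioi ha 0
    rw [ofReal_zero, mul_zero, Complex.exp_zero, neg_div_neg_eq, one_div] at h1
    rw [poleFun_apply, ← h1, ← integral_indicator measurableSet_Ioi, Real.fourierInv_eq']
    refine integral_congr_ae (Eventually.of_forall fun x => ?_)
    by_cases hx : x ∈ Ioi 0
    · simp only [indicator_of_mem hx, smul_eq_mul]
      rw [← Complex.exp_add]
      congr 1
      simp
      ring
    · simp only [indicator_of_notMem hx, smul_zero]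

lemma lineIncl_lineProj_mobVec_zero : lineIncl (lineProj (mobVec 0)) = mobVec 0 := by
  have h := isPlus_poleFun
  have e : mobVec 0 = (Real.sqrt 2 : ℂ) • h.memLp.toLp poleFun := by
    ext
    filter_upwards [coeFn_mobVec 0, h.memLp.coeFn_toLp,
      Lp.coeFn_smul (Real.sqrt 2 : ℂ) (h.memLp.toLp poleFun)] with x h1 h2 h3
    rw [h1, h3, Pi.smul_apply, h2, mobFun, poleFun_apply, zpow_zero, mul_one, smul_eq_mul,
      div_eq_mul_inv]
  have e2 : lineIncl (lineProj (h.memLp.toLp poleFun)) = h.memLp.toLp poleFun := by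
    change fourInvL (extH (restH (fourL (h.memLp.toLp poleFun)))) = _
    rw [extH_restH, fourInvL_fourL]
    filter_upwards [h.fourier] with x hx h0
    rw [fourL_apply, ← hx, h.support x h0]
  rw [e, map_smul, map_smul, e2]

/-- Since `z = 2/(1 - 2πiξ) - 1`, each step from `k` to `k + 1` only uses multiplication by
`poleFun`, which preserves the Hardy space of the half-line. -/
lemma lineIncl_lineProj_mobVec (k : ℕ) : lineIncl (lineProj (mobVec k)) = mobVec k := by
  induction k with
  | zero => exact lineIncl_lineProj_mobVec_zero
  | succ k ih =>
    have h1 : mobVec ((k + 1 : ℕ) : ℤ) = (2 : ℂ) • mulOp poleFun (mobVec k) - mobVec k := by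
      ext
      filter_upwards [coeFn_mobVec ((k + 1 : ℕ) : ℤ), coeFn_mobVec k,
        coeFn_mulOp poleFun (mobVec k), Lp.coeFn_smul (2 : ℂ) (mulOp poleFun (mobVec k)),
        Lp.coeFn_sub ((2 : ℂ) • mulOp poleFun (mobVec k)) (mobVec k)] with x e1 e2 e3 e4 e5
      rw [e1, e5, Pi.sub_apply, e4, Pi.smul_apply, e3, e2, smul_eq_mul, poleFun_apply, mobFun,
        mobFun, Nat.cast_succ, zpow_add_one₀ (Circle.coe_ne_zero _)]
      have h0 := one_sub_I_mul_ne_zero (2 * Real.pi * x)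
      have h2 : (cay x : ℂ) = 2 * (1 - I * (2 * Real.pi * x : ℝ))⁻¹ - 1 := by
        rw [cay, coe_cayley]
        field_simp
        ring
      generalize (cay x : ℂ) ^ (k : ℤ) = w
      rw [h2]
      ring
    have h2 : lineIncl (lineProj (mulOp poleFun (mobVec k))) = mulOp poleFun (mobVec k) := by
      have e := congrArg (fun A : Lp ℂ 2 halfLine →L[ℂ] LR => A (lineProj (mobVec k)))
        isPlus_poleFun.mulOp_lineIncl
      simp only [ContinuousLinearMap.comp_apply, ih] at e
      rw [e, lineSetup.apply_retract]
    rw [h1, map_sub, map_sub, map_smul, map_smul, h2, ih]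

/-- Two Hardy spaces of the same involution coincide if one contains the other. -/
lemma HardySetup.proj_eq {E E' L : Type*} [NormedAddCommGroup E] [InnerProductSpace ℂ E]
    [NormedAddCommGroup E'] [InnerProductSpace ℂ E']
    [NormedAddCommGroup L] [InnerProductSpace ℂ L] {i : E →L[ℂ] L} {r : L →L[ℂ] E}
    {i' : E' →L[ℂ] L} {r' : L →L[ℂ] E'} {J : L →L[ℂ] L} (h : HardySetup i r J)
    (h' : HardySetup i' r' J) (hi : (i' ∘L r') ∘L i = i) : i' ∘L r' = i ∘L r := by
  set P := i ∘L r with hP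
  set P' := i' ∘L r' with hP'
  have h1 : P' * P = P := by
    change P' ∘L i ∘L r = i ∘L r
    rw [← ContinuousLinearMap.comp_assoc, hi]
  -- Conjugation by `J` exchanges each projection with its complement, so `P' P = P` also yields `(1
  -- - P')(1 - P) = 1 - P`; together these force `P' = P`.
  have h2 : J * P * J = 1 - P := eq_sub_of_add_eq' h.decomp
  have h3 : J * P' * J = 1 - P' := eq_sub_of_add_eq' h'.decomp
  have h4 : (J * P' * J) * (J * P * J) = J * P * J := by
    calc _ = J * P' * (J * J) * P * J := by noncomm_ring
      _ = J * (P' * P) * J := by rw [h.invol]; noncomm_ring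
      _ = _ := by rw [h1]
  rw [h2, h3, sub_mul, one_mul, mul_sub, mul_one, h1] at h4
  exact sub_eq_zero.1 (sub_eq_self.1 h4)

/-- One inclusion comes from the basis vectors; the other is automatic because both spaces are
complementary to their reflections under the same involution. -/
lemma circ_proj_eq : circIncl ∘L circProj = lineIncl ∘L lineProj := by
  refine (circSetup.proj_eq lineSetup ?_).symm
  refine ext_stdVec fun k => ?_
  simp only [ContinuousLinearMap.comp_apply, circIncl_stdVec]
  exact lineIncl_lineProj_mobVec k

section Equivalent

variable {E E' L : Type*} [NormedAddCommGroup E] [InnerProductSpace ℂ E]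
  [NormedAddCommGroup E'] [InnerProductSpace ℂ E']
  [NormedAddCommGroup L] [InnerProductSpace ℂ L] {i : E →L[ℂ] L} {r : L →L[ℂ] E}
  {i' : E' →L[ℂ] L} {r' : L →L[ℂ] E'} {J : L →L[ℂ] L}

lemma HardySetup.incl_eq (h' : HardySetup i' r' J) (hP : i ∘L r = i' ∘L r') (x : E') :
    i (r (i' x)) = i' x := by
  have := congrArg (fun A : L →L[ℂ] L => A (i' x)) hP
  simp only [ContinuousLinearMap.comp_apply, h'.apply_retract] at this
  exact this

lemma HardySetup.proj_incl (h : HardySetup i r J) (hP : i ∘L r = i' ∘L r') (x : L) :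
    r (i' (r' x)) = r x := by
  have := congrArg (fun A : L →L[ℂ] L => r (A x)) hP
  simp only [ContinuousLinearMap.comp_apply, h.apply_retract] at this
  exact this.symm

lemma HardySetup.toep_conj (h' : HardySetup i' r' J)
    (hP : i ∘L r = i' ∘L r') (m : L →L[ℂ] L) :
    toep i' r' m = (r' ∘L i) ∘L toep i r m ∘L (r ∘L i') := by
  ext x
  simp only [toep, ContinuousLinearMap.comp_apply, h'.incl_eq hP, h'.proj_incl hP.symm]

lemma HardySetup.hank_conj (h' : HardySetup i' r' J)
    (hP : i ∘L r = i' ∘L r') (m : L →L[ℂ] L) :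
    hank i' r' J m = (r' ∘L i) ∘L hank i r J m ∘L (r ∘L i') := by
  ext x
  simp only [hank, ContinuousLinearMap.comp_apply, h'.incl_eq hP, h'.proj_incl hP.symm]

lemma HardySetup.transfer_inv (h : HardySetup i r J) (hP : i ∘L r = i' ∘L r') :
    (r ∘L i') ∘L (r' ∘L i) = 1 := by
  ext x
  simp only [ContinuousLinearMap.comp_apply, h.proj_incl hP, h.apply_retract]
  rfl

/-- The operators of the identity in two realizations of the same Hardy space. -/
theorem HardySetup.fredholmDet_eq [CompleteSpace E] [CompleteSpace E']
    (h : HardySetup i r J) (h' : HardySetup i' r' J)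
    (hP : i ∘L r = i' ∘L r') (m n : L →L[ℂ] L)
    (ht : TC (toep i r n * HardyFactor.sumOp i r J m - 1)) :
    fredholmDet (toep i' r' n * HardyFactor.sumOp i' r' J m) =
      fredholmDet (toep i r n * HardyFactor.sumOp i r J m) := by
  set U := r' ∘L i
  set V := r ∘L i'
  have hVU : V ∘L U = 1 := h.transfer_inv hP
  have hUV : U ∘L V = 1 := h'.transfer_inv hP.symm
  have hs : HardyFactor.sumOp i' r' J m = U ∘L HardyFactor.sumOp i r J m ∘L V := by
    rw [HardyFactor.sumOp, h'.toep_conj hP, h'.hank_conj hP, HardyFactor.sumOp,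
      ContinuousLinearMap.add_comp, ContinuousLinearMap.comp_add]
  rw [hs, h'.toep_conj hP n]
  have e : (U ∘L toep i r n ∘L V) * (U ∘L HardyFactor.sumOp i r J m ∘L V) =
      1 + U ∘L (toep i r n * HardyFactor.sumOp i r J m - 1) ∘L V := by
    have hc : ∀ x, V (U x) = x := fun x => congrArg (fun A : E →L[ℂ] E => A x) hVU
    have hc' : ∀ x, U (V x) = x := fun x => congrArg (fun A : E' →L[ℂ] E' => A x) hUV
    ext x
    simp only [ContinuousLinearMap.mul_def, ContinuousLinearMap.comp_apply,
      ContinuousLinearMap.add_apply, ContinuousLinearMap.sub_apply,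
      ContinuousLinearMap.one_apply, hc, map_sub, hc']
    abel
  rw [e, fredholmDet_conj ht U V hVU, add_sub_cancel]

end Equivalent

/-- The first factors agree for symbols which correspond under the Cayley transform. -/
theorem fredholmDet_line_eq_circle {φ b : Circle → ℂ} {σ f : ℝ → ℂ} {c : ℂ}
    (hφ : IsCircleSymbol φ b) (hσ : IsLineSymbol σ f) (h : ∀ ξ, σ ξ = c * φ (cayley ξ)) :
    fredholmDet (W σ⁻¹ * (W σ + HL σ)) = fredholmDet (T φ⁻¹ * (T φ + H φ)) := by
  have h0 := hφ.isCircleFactorization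
  have hl := hσ.isLogFactor
  have hc : c ≠ 0 := by
    rintro rfl
    have := h 0
    rw [zero_mul, hσ.exp_eq] at this
    exact Complex.exp_ne_zero _ this
  set ψ : C(Circle, ℂ) := h0.plus * h0.minus with hψ
  set ψ' : C(Circle, ℂ) := h0.plusInv * h0.minusInv with hψ'
  have e1 : φ = ψ := h0.symbol_eq
  have e2 : φ⁻¹ = ψ' := h0.symbol_inv_eq
  -- On L²(ℝ) the multiplier of `σ` is `c` times that of `φ`, and the multiplier of `σ⁻¹` is `c⁻¹`
  -- times that of `φ⁻¹`. The scalars cancel in the product.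
  have d1 : IsDilated (c • circFun ψ) σ := ⟨fun ξ => by
    rw [h, e1]
    rfl, hl.isDilated.memLp⟩
  have d2 : IsDilated (c⁻¹ • circFun ψ') σ⁻¹ := ⟨fun ξ => by
    rw [Pi.inv_apply, h, mul_inv, ← Pi.inv_apply φ, e2]
    rfl, hl.isDilated_inv.memLp⟩
  have t := hφ.tc_first
  have eT : T φ⁻¹ * (T φ + H φ) = toep circIncl circProj (mulOp (circFun ψ')) *
      HardyFactor.sumOp circIncl circProj reflOp (mulOp (circFun ψ)) := by
    rw [HardyFactor.sumOp, e2, e1, T_eq, T_eq, H_eq]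
  rw [eT] at t
  rw [eT, d2.W_eq, d1.W_eq, d1.HL_eq, ← circSetup.fredholmDet_eq lineSetup circ_proj_eq _ _ t]
  congr 1
  rw [mulOp_smul, mulOp_smul, HardyFactor.sumOp]
  ext1 x
  simp only [toep, hank, ContinuousLinearMap.mul_def, ContinuousLinearMap.comp_apply,
    ContinuousLinearMap.add_apply, ContinuousLinearMap.smul_apply, map_smul, map_add,
    smul_smul, mul_inv_cancel₀ hc, one_smul]

end Transfer

end BorodinOkounkov

end

open BorodinOkounkov in
theorem mainTheorem2 :
    -- the Toeplitz + Hankel identity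
    (∀ φ b : Circle → ℂ, IsCircleSymbol φ b →
      (∃ φp φm : ℂ → ℂ, IsCircleFactorization φ φp φm) ∧
      IsBoundedMatrix (toeplitzMatrix φ) ∧ IsBoundedMatrix (toeplitzMatrix (φ⁻¹)) ∧
      IsBoundedMatrix (hankelMatrix φ) ∧
      IsTraceClass (T (φ⁻¹) * (T φ + H φ) - 1) ∧
      ∀ φp φm : ℂ → ℂ, IsCircleFactorization φ φp φm →
        IsBoundedMatrix (hankelMatrix fun z => φm z / φp z) ∧
        ∀ n : ℕ,
          IsTraceClass (Q n * H (fun z => φm z / φp z) * Q n) ∧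
          (finiteTH φ n).det =
            circleG b ^ n * fredholmDet (T (φ⁻¹) * (T φ + H φ)) *
              fredholmDet (1 + Q n * H (fun z => φm z / φp z) * Q n)) ∧
    -- the Wiener-Hopf + Hankel identity
    (∀ σ f : ℝ → ℂ, IsLineSymbol σ f →
      (∃ σp σm : ℂ → ℂ, IsLineFactorization σ σp σm) ∧
      Integrable (fun ξ => σ ξ - 1) ∧ Integrable (fun ξ => (σ ξ)⁻¹ - 1) ∧
      IsBoundedKernel halfLine (diffKernel σ) ∧ IsBoundedKernel halfLine (diffKernel (σ⁻¹)) ∧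
      IsBoundedKernel halfLine (sumKernel σ) ∧
      IsTraceClass (W (σ⁻¹) * (W σ + HL σ) - 1) ∧
      ∀ σp σm : ℂ → ℂ, IsLineFactorization σ σp σm →
        MemLp (fun ξ : ℝ => σm ξ / σp ξ - 1) 2 ∧
        IsBoundedKernel halfLine (sumKernel fun ξ => σm ξ / σp ξ) ∧
        ∀ R : ℝ, 0 < R →
          IsBoundedKernel (interval R) (diffKernel σ) ∧
          IsBoundedKernel (interval R) (sumKernel σ) ∧
          IsTraceClass (truncWH σ R - 1) ∧
          IsTraceClass (QL R * HL (fun ξ => σm ξ / σp ξ) * QL R) ∧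
          fredholmDet (truncWH σ R) =
            lineGPow f R * fredholmDet (W (σ⁻¹) * (W σ + HL σ)) *
              fredholmDet (1 + QL R * HL (fun ξ => σm ξ / σp ξ) * QL R)) ∧
    -- equality of the first factors and the ratio formula for corresponding symbols
    (∀ (φ b : Circle → ℂ) (σ f : ℝ → ℂ) (c : ℂ), IsCircleSymbol φ b → IsLineSymbol σ f →
      (∀ ξ : ℝ, σ ξ = c * φ (cayley ξ)) →
      fredholmDet (W (σ⁻¹) * (W σ + HL σ)) = fredholmDet (T (φ⁻¹) * (T φ + H φ)) ∧
      ∀ φp φm σp σm : ℂ → ℂ, IsCircleFactorization φ φp φm → IsLineFactorization σ σp σm →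
        ∀ (n : ℕ) (R : ℝ), 0 < R → (finiteTH φ n).det ≠ 0 →
          fredholmDet (1 + Q n * H (fun z => φm z / φp z) * Q n) ≠ 0 ∧
          fredholmDet (truncWH σ R) / (finiteTH φ n).det =
            lineGPow f R / circleG b ^ n *
              (fredholmDet (1 + QL R * HL (fun ξ => σm ξ / σp ξ) * QL R) /
                fredholmDet (1 + Q n * H (fun z => φm z / φp z) * Q n))) := by
  have circle : ∀ (φ b : Circle → ℂ) (n : ℕ), IsCircleSymbol φ b →
      ∀ φp φm : ℂ → ℂ, IsCircleFactorization φ φp φm →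
      (finiteTH φ n).det = circleG b ^ n * fredholmDet (T (φ⁻¹) * (T φ + H φ)) *
        fredholmDet (1 + Q n * H (fun z => φm z / φp z) * Q n) :=
    fun φ b n hs φp φm h => (hs.det_finiteTH h n).2
  refine ⟨fun φ b hs => ?_, fun σ f hs => ?_, fun φ b σ f c hφ hσ hc => ?_⟩
  · have h0 := hs.isCircleFactorization
    refine ⟨⟨_, _, h0⟩, h0.isBoundedMatrix_toeplitz, h0.isBoundedMatrix_toeplitz_inv,
      h0.isBoundedMatrix_hankel, isTraceClass_iff_tc.2 hs.tc_first, fun φp φm h =>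
      ⟨h.isBoundedMatrix_ratio, fun n => ⟨?_, circle φ b n hs φp φm h⟩⟩⟩
    exact isTraceClass_iff_tc.2 (((hs.det_finiteTH h n).1.mul_left (Q n)).mul_right (Q n))
  · have hl := hs.isLogFactor
    refine ⟨⟨_, _, hs.isSmoothL1.isLineFactorization hs.even_log hs.exp_eq⟩,
      hs.sub_one.integrable_self, hs.inv_sub_one.integrable_self,
      ⟨_, hl.isDilated.isIntegralOp_diff⟩, ⟨_, hl.isDilated_inv.isIntegralOp_diff⟩,
      ⟨_, hl.isDilated.isIntegralOp_sum⟩, isTraceClass_iff_tc.2 hl.tc_first, fun σp σm h => ?_⟩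
    have hr := hl.isDilated_ratio (a := fun ξ => σm ξ / σp ξ) (h.ratio_eq hs)
    refine ⟨hr.memLp, ⟨_, hr.isIntegralOp_sum⟩, fun R hR => ?_⟩
    obtain ⟨h1, h2⟩ := hl.det_truncWH (a := fun ξ => σm ξ / σp ξ) (h.ratio_eq hs) hR
    exact ⟨⟨_, hl.isDilated.isIntegralOp_diff.compress R⟩,
      ⟨_, hl.isDilated.isIntegralOp_sum.compress R⟩, isTraceClass_iff_tc.2 (hl.tc_truncWH hR),
      isTraceClass_iff_tc.2 ((h1.mul_left _).mul_right _), h2⟩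
  · have hd := fredholmDet_line_eq_circle hφ hσ hc
    refine ⟨hd, fun φp φm σp σm h h' n R hR hn => ?_⟩
    have h1 := circle φ b n hφ φp φm h
    obtain ⟨-, h2⟩ := hσ.isLogFactor.det_truncWH (a := fun ξ => σm ξ / σp ξ) (h'.ratio_eq hσ) hR
    rw [h1] at hn ⊢
    rw [h2, hd]
    -- The finite determinant is the product of three factors, so its nonvanishing gives that of
    -- each; in particular the common first factor can be cancelled in the quotient.
    have n1 := right_ne_zero_of_mul hn
    have n2 := right_ne_zero_of_mul (left_ne_zero_of_mul hn)
    have n3 := left_ne_zero_of_mul (left_ne_zero_of_mul hn)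
    exact ⟨n1, by field_simp⟩
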